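/- Let $p\ge 5$ be a prime, $\pi\in\overline{\mathbb Q}_p$ with $\pi^{p-1}=-p$, $\Omega=\mathbb Q_p(\pi)$, and $q=p^a$ with $a\ge 1$. Normalize $\mathrm{ord}_p$ by $\mathrm{ord}_p\,p=1$. *The $L$-function.* Fix a nontrivial additive character $\psi:\mathbb F_q\to\Omega^*$. For $\bar t\in\overline{\mathbb F}_q^*$ put $\deg\bar t=[\mathbb F_q(\bar t):\mathbb F_q]$, $q_{\bar t}=q^{\deg\bar t}$ and $$Kl_{\bar t,m}=\sum_{x\in\mathbb F_{q_{\bar t}^m}^*}\psi\Bigl(\mathrm{Tr}_{\mathbb F_{q_{\bar t}^m}/\mathbb F_q}\bigl(x+\tfrac{\bar t}{x}\bigr)\Bigr),\qquad m\ge 1 .$$ Then $\exp\bigl(\sum_{m\ge1}Kl_{\bar t,m}T^m/m\bigr)=(1-\pi_0(\bar t)T)(1-\pi_1(\bar t)T)$ for a unique pair $\pi_0(\bar t),\pi_1(\bar t)\in\Omega$ with $|1-\pi_0(\bar t)|_p<1$. For $\kappa\in\mathbb Z_p$ let $$L(\mathrm{Sym}^{\infty,\kappa}Kl,T)=\prod_{\bar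 t\in|\mathbb G_m/\mathbb F_q|}\ \prod_{m\ge0}\frac1{1-\pi_0(\bar t)^{\kappa-m}\pi_1(\bar t)^mT^{\deg\bar t}}\in\Omega[[T]],$$ the product running over the closed points of $\mathbb G_m$ over $\mathbb F_q$; it converges coefficientwise. *The relative Frobenius.* Let $b,b'$ be real numbers with $\frac{p-1}p-\frac1{p-1}\ge b>\frac1{p-1}$ and $b\ge b'>0$, and let $\varepsilon=b-\frac1{p-1}$. Let $L(b'/q)$ be the ring of $\sum_{n\ge0}A(n)t^n\in\Omega[[t]]$ for which $\mathrm{ord}_pA(n)-2b'n/q$ is bounded below, and $K_q(b'/q,b)$ the space of series $\sum_{n\ge0,\,u\in\mathbb Z}A(n,u)\,t^{n+q\max(-u,0)}x^u$ over $\Omega$ for which $\mathrm{ord}_pA(n,u)-2b'n/q-b|u|$ is bounded below. Put $D_{t^q}=x\frac{\partial}{\partial x}+\pi\bigl(x-\frac{t^q}x\bigr)$, $\theta(z)=\exp\pi(z-z^p)$, $F_a(t,x)=\prod_{i=0}^{a-1}\theta(x^{p^i})\theta(t^{p^i}/x^{p^i})$, $\psi_x\sum_uA_ux^u=\sum_uA_{pu}x^u$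 and $\alpha_a=\psi_x^a\circ F_a(t,x)$. The quotient $K_q(b'/q,b)/D_{t^q}K_q(b'/q,b)$ is free over $L(b'/q)$ with basis $1,\pi t^q/x$; the classes of $\alpha_a(1)$ and $\alpha_a(\pi t/x)$ in it are therefore $A_1+A_3\frac{\pi t^q}x$ and $A_2+A_4\frac{\pi t^q}x$ for unique $A_i\in L(b'/q)$. One has $A_1(0)=1$. *The operator $\beta_\kappa$.* Let $\kappa^{\underline m}=\prod_{0\le i<m,\ i\ne\kappa}(\kappa-i)$ and $w^{(m)}=\kappa^{\underline m}w^m$, and let $S(b',\varepsilon)$ be the space of $\sum_{n,m\ge0}A(n,m)t^nw^{(m)}\in\Omega[[t,w]]$ for which $\mathrm{ord}_pA(n,m)-2b'n-\varepsilon m$ is bounded below. Define $[\bar\alpha_a]_\kappa:S(b',\varepsilon)\to S(b'/q,\varepsilon)$ by $$[\bar\alpha_a]_\kappa\Bigl(\sum_m\xi_m(t)w^{(m)}\Bigr)=\sum_m\xi_m(t)\,\kappa^{\underline m}(A_1+A_3w)^{\kappa-m}(A_2+A_4w)^m$$ (powers with exponent in $\mathbb Z_p$ are given by the binomial series), $\psi_t^a:S(b'/q,\varepsilon)\to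 S(b',\varepsilon)$ by $\sum A(n,m)t^nw^{(m)}\mapsto\sum A(qn,m)t^nw^{(m)}$, and $\beta_\kappa=\psi_t^a\circ[\bar\alpha_a]_\kappa$. **Theorem.** For every $\kappa\in\mathbb Z_p$ all these objects are well defined, $\beta_\kappa$ is a completely continuous operator on $S(b',\varepsilon)$, and its Fredholm determinant $g(T)=\det(1-\beta_\kappa T\mid S(b',\varepsilon))$, whose coefficient of $T^k$ is $(-1)^k$ times the convergent sum of the $k\times k$ principal minors of the matrix of $\beta_\kappa$ with respect to the $t^nw^{(m)}$, satisfies $$L(\mathrm{Sym}^{\infty,\kappa}Kl,T)=\frac{g(T)}{g(qT)}\qquad\text{in }\Omega[[T]].$$ -/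

import Mathlib

open scoped PowerSeries PowerSeries.WithPiTopology IntermediateField

noncomputable section

namespace KloostermanSym

/-! ### The coefficient field `Ω = ℚ_p(π)` -/

/-- `Ω = ℚ_p(π)` inside the algebraic closure of `ℚ_p`, with the norm `‖x‖ = p ^ (-ord_p x)`
(so `‖p‖ = 1 / p`). -/
abbrev Omega (p : ℕ) [Fact p.Prime] (π : PadicAlgCl p) : Type :=
  ↥(ℚ_[p]⟮π⟯)

/-- `π` as an element of `Ω`. -/
abbrev piOmega (p : ℕ) [Fact p.Prime] (π : PadicAlgCl p) : Omega p π :=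
  IntermediateField.AdjoinSimple.gen ℚ_[p] π

/-! ### Kloosterman sums and the infinite symmetric power `L`-function -/

section Kloosterman

variable (F : Type*) [Field F] [Finite F]

/-- `deg t = [𝔽_q(t) : 𝔽_q]`. -/
def deg (t : (AlgebraicClosure F)ˣ) : ℕ :=
  Module.finrank F F⟮(t : AlgebraicClosure F)⟯

/-- The field with `q ^ n` elements inside the algebraic closure of `F = 𝔽_q`. -/
def subExt (n : ℕ) : IntermediateField F (AlgebraicClosure F) :=
  IntermediateField.adjoin F {x | x ^ (Nat.card F ^ n) = x}

theorem mem_subExt (t : (AlgebraicClosure F)ˣ) (m : ℕ) :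
    (t : AlgebraicClosure F) ∈ subExt F (deg F t * m) := by
  apply IntermediateField.subset_adjoin
  have hint : IsIntegral F (t : AlgebraicClosure F) := Algebra.IsIntegral.isIntegral _
  have : FiniteDimensional F F⟮(t : AlgebraicClosure F)⟯ :=
    IntermediateField.adjoin.finiteDimensional hint
  have : Finite F⟮(t : AlgebraicClosure F)⟯ := Module.finite_of_finite F
  have := Fintype.ofFinite F⟮(t : AlgebraicClosure F)⟯
  have hcard : Fintype.card F⟮(t : AlgebraicClosure F)⟯ = Nat.card F ^ deg F t := by
    rw [← Nat.card_eq_fintype_card]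
    exact Module.natCard_eq_pow_finrank
  have h := FiniteField.pow_card_pow m
    (IntermediateField.AdjoinSimple.gen F (t : AlgebraicClosure F))
  rw [hcard, ← pow_mul] at h
  have h' := congrArg (algebraMap F⟮(t : AlgebraicClosure F)⟯ (AlgebraicClosure F)) h
  rwa [map_pow, IntermediateField.AdjoinSimple.algebraMap_gen] at h'

/-- The closed points of `𝔾_m` over `F`: conjugacy classes over `F` of nonzero elements of the
algebraic closure. -/
abbrev ClosedPoint : Type _ :=
  Quotient (Setoid.ker fun t : (AlgebraicClosure F)ˣ => minpoly F (t : AlgebraicClosure F))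

variable {F} {Ω : Type*} [NormedField Ω]

/-- `Kl_{t,m}`: the sum of `ψ (Tr (x + t / x))` over the nonzero `x` in the extension of degree `m`
of `𝔽_q(t)`; the trace goes down to `𝔽_q`. -/
def klSum (ψ : AddChar F Ω) (t : (AlgebraicClosure F)ˣ) (m : ℕ) : Ω :=
  ∑ᶠ x : (subExt F (deg F t * m))ˣ,
    ψ (Algebra.trace F (subExt F (deg F t * m))
      (x + ⟨t, mem_subExt F t m⟩ / x))

/-- `L(Kl_t, T) = exp (∑_{m ≥ 1} Kl_{t,m} T^m / m)`. -/
def klL [CharZero Ω] (ψ : AddChar F Ω) (t : (AlgebraicClosure F)ˣ) : Ω⟦X⟧ :=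
  (PowerSeries.exp Ω).subst
    (PowerSeries.mk fun m => if m = 0 then 0 else klSum ψ t m / (m : Ω))

/-- `r = (π₀, π₁)` with `L(Kl_t, T) = (1 - π₀ T) (1 - π₁ T)` and `π₀` a `1`-unit. -/
def IsKlRoots [CharZero Ω] (ψ : AddChar F Ω) (t : (AlgebraicClosure F)ˣ) (r : Ω × Ω) : Prop :=
  klL ψ t = (1 - PowerSeries.C r.1 * PowerSeries.X) * (1 - PowerSeries.C r.2 * PowerSeries.X) ∧
    ‖1 - r.1‖ < 1

/-- The pair `(π₀(t), π₁(t))`. -/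
def klRoots [CharZero Ω] (ψ : AddChar F Ω) (t : (AlgebraicClosure F)ˣ) : Ω × Ω :=
  Classical.epsilon (IsKlRoots ψ t)

variable (p : ℕ) [Fact p.Prime] [NormedAlgebra ℚ_[p] Ω]

/-- The binomial coefficient `binom(τ, k)`, for `τ ∈ ℤ_p`, in `Ω`. -/
def binom (Ω : Type*) [NormedField Ω] [NormedAlgebra ℚ_[p] Ω] (τ : ℤ_[p]) (k : ℕ) : Ω :=
  algebraMap ℚ_[p] Ω (Ring.choose τ k : ℤ_[p])

/-- `u ^ τ` for a `1`-unit `u ∈ Ω` and `τ ∈ ℤ_p`, by the binomial series. -/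
def unitPow (u : Ω) (τ : ℤ_[p]) : Ω :=
  ∑' k : ℕ, binom p Ω τ k * (u - 1) ^ k

/-- The Euler factor `1 / (1 - π₀(t)^(κ - m) π₁(t)^m T^(deg t))`, at the closed point of `t` and
the index `m`. -/
def eulerFactor [CharZero Ω] (ψ : AddChar F Ω) (κ : ℤ_[p]) (i : ClosedPoint F × ℕ) : Ω⟦X⟧ :=
  (1 - PowerSeries.C
      (unitPow p (klRoots ψ i.1.out).1 (κ - (i.2 : ℤ_[p])) * (klRoots ψ i.1.out).2 ^ i.2) *
    PowerSeries.X ^ deg F i.1.out)⁻¹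

/-- `L(Sym^{∞,κ} Kl, T)`, the product converging coefficientwise in `Ω[[T]]`. -/
def symL [CharZero Ω] (ψ : AddChar F Ω) (κ : ℤ_[p]) : Ω⟦X⟧ :=
  ∏' i : ClosedPoint F × ℕ, eulerFactor p ψ κ i

end Kloosterman

/-! ### Relative Bessel cohomology and the relative Frobenius

A series `∑ A(N, u) t^N x^u`, with `N ≥ 0` and `u ∈ ℤ`, is given by its coefficients `A N u`. -/

section Relative

variable {Ω : Type*} [NormedField Ω]

/-- `ord_p x ≥ r`. -/
def OrdGE (p : ℕ) (x : Ω) (r : ℝ) : Prop := ‖x‖ ≤ (p : ℝ) ^ (-r)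

/-- `L(b')`: power series in `t` with `ord_p A(n) ≥ 2 b' n + ρ` for some real `ρ`. -/
def MemL (p : ℕ) (b' : ℝ) (A : Ω⟦X⟧) : Prop :=
  ∃ ρ : ℝ, ∀ n : ℕ, OrdGE p (PowerSeries.coeff n A) (2 * b' * n + ρ)

/-- `K_q(b', b)`: series `∑ A(n, u) t^n t^(q m(u)) x^u`, where `m(u) = max(-u, 0)`, with
`ord_p A(n, u) ≥ 2 b' n + b |u| + ρ` for some real `ρ`. -/
def MemK (p q : ℕ) (b' b : ℝ) (A : ℕ → ℤ → Ω) : Prop :=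
  (∀ (N : ℕ) (u : ℤ), N < q * (-u).toNat → A N u = 0) ∧
    ∃ ρ : ℝ, ∀ (n : ℕ) (u : ℤ),
      OrdGE p (A (n + q * (-u).toNat) u) (2 * b' * n + b * |(u : ℝ)| + ρ)

/-- `D_{t^q} = x ∂/∂x + π (x - t^q / x)`. -/
def bdry (q : ℕ) (π : Ω) (A : ℕ → ℤ → Ω) : ℕ → ℤ → Ω := fun N u =>
  (u : Ω) * A N u + π * (A N (u - 1) - if q ≤ N then A (N - q) (u + 1) else 0)

/-- The product of two series in which every monomial `t^N x^u` has `u ≥ -N`, that is, of two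
series in `x` and `t / x`; each coefficient is then a finite sum. -/
def serMul (A B : ℕ → ℤ → Ω) : ℕ → ℤ → Ω := fun N u =>
  ∑ i ∈ Finset.HasAntidiagonal.antidiagonal N, ∑ v ∈ Finset.Icc (-(i.1 : ℤ)) (u + (i.2 : ℤ)),
    A i.1 v * B i.2 (u - v)

/-- The series `1`. -/
def serOne : ℕ → ℤ → Ω := fun N u => if N = 0 ∧ u = 0 then 1 else 0

/-- The series `π t / x`. -/
def serPiTX (π : Ω) : ℕ → ℤ → Ω := fun N u => if N = 1 ∧ u = -1 then π else 0

/-- The series `A + B π t^q / x`, with `A, B ∈ Ω[[t]]` and `c = (A, B)`. -/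
def serV (q : ℕ) (π : Ω) (c : Ω⟦X⟧ × Ω⟦X⟧) : ℕ → ℤ → Ω := fun N u =>
  if u = 0 then PowerSeries.coeff N c.1
  else if u = -1 ∧ q ≤ N then PowerSeries.coeff (N - q) c.2 * π
  else 0

/-- The substitution `(t, x) ↦ (t^k, x^k)`. -/
def serPow (k : ℕ) (A : ℕ → ℤ → Ω) : ℕ → ℤ → Ω := fun N u =>
  if k ∣ N ∧ (k : ℤ) ∣ u then A (N / k) (u / k) else 0

/-- `ψ_x : ∑ A_u x^u ↦ ∑ A_{pu} x^u`. -/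
def psiX (p : ℕ) (A : ℕ → ℤ → Ω) : ℕ → ℤ → Ω := fun N u => A N (p * u)

variable [CharZero Ω]

/-- Dwork's splitting function `θ(z) = exp (π (z - z^p))`. -/
def theta (p : ℕ) (π : Ω) : Ω⟦X⟧ :=
  (PowerSeries.exp Ω).subst
    (PowerSeries.C π * (PowerSeries.X - PowerSeries.X ^ p) : Ω⟦X⟧)

/-- The series `θ(x)`. -/
def thetaX (p : ℕ) (π : Ω) : ℕ → ℤ → Ω := fun N u =>
  if N = 0 ∧ 0 ≤ u then PowerSeries.coeff u.toNat (theta p π) else 0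

/-- The series `θ(t / x)`. -/
def thetaTX (p : ℕ) (π : Ω) : ℕ → ℤ → Ω := fun N u =>
  if u = -(N : ℤ) then PowerSeries.coeff N (theta p π) else 0

/-- `F(t, x) = θ(x) θ(t / x)`. -/
def serF (p : ℕ) (π : Ω) : ℕ → ℤ → Ω := serMul (thetaX p π) (thetaTX p π)

/-- `F_m(t, x) = ∏_{i < m} F(t^(p^i), x^(p^i))`. -/
def serFm (p : ℕ) (π : Ω) : ℕ → ℕ → ℤ → Ω
  | 0 => serOne
  | m + 1 => serMul (serFm p π m) (serPow (p ^ m) (serF p π))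

/-- Dwork's Frobenius `α_a = ψ_x^a ∘ F_a(t, x)`. -/
def alpha (p a : ℕ) (π : Ω) (A : ℕ → ℤ → Ω) : ℕ → ℤ → Ω :=
  (psiX p)^[a] (serMul (serFm p π a) A)

/-- With `q = p^a`: the class of `α_a(ξ)` in `H¹_{t^q}(b'/q, b) = K_q(b'/q, b) / D_{t^q} K_q(b'/q, b)`
is that of `c.1 + c.2 π t^q / x`, where `c.1, c.2 ∈ L(b'/q)`. -/
def IsFrobCoords (p a : ℕ) (b' b : ℝ) (π : Ω) (ξ : ℕ → ℤ → Ω) (c : Ω⟦X⟧ × Ω⟦X⟧) : Prop :=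
  MemL p (b' / (p : ℝ) ^ a) c.1 ∧ MemL p (b' / (p : ℝ) ^ a) c.2 ∧
    ∃ η : ℕ → ℤ → Ω, MemK p (p ^ a) (b' / (p : ℝ) ^ a) b η ∧
      alpha p a π ξ = serV (p ^ a) π c + bdry (p ^ a) π η

/-- The coordinates of `ᾱ_a(ξ)` in the basis `1, π t^q / x` of `H¹_{t^q}(b'/q, b)`. -/
def frobCoords (p a : ℕ) (b' b : ℝ) (π : Ω) (ξ : ℕ → ℤ → Ω) : Ω⟦X⟧ × Ω⟦X⟧ :=
  Classical.epsilon (IsFrobCoords p a b' b π ξ)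

/-- `Υ_q(ᾱ_a(ξ)) ∈ Ω[[t]][[w]]`, where `Υ_q(A + B π t^q / x) = A + B w`. -/
def upsFrob (p a : ℕ) (b' b : ℝ) (π : Ω) (ξ : ℕ → ℤ → Ω) : Ω⟦X⟧⟦X⟧ :=
  PowerSeries.C (frobCoords p a b' b π ξ).1 +
    PowerSeries.C (frobCoords p a b' b π ξ).2 * PowerSeries.X

end Relative

/-! ### The infinite symmetric power -/

section Symmetric

variable (p : ℕ) [Fact p.Prime] {Ω : Type*} [NormedField Ω]

/-- The coefficient arrays `A(n, m)` of the elements `∑ A(n, m) t^n w^(m)` of `S(b', ε; ρ)`. -/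
def MemSρ (b' ε ρ : ℝ) (A : ℕ × ℕ → Ω) : Prop :=
  ∀ i : ℕ × ℕ, OrdGE p (A i) (2 * b' * i.1 + ε * i.2 + ρ)

theorem exists_memSρ_iff (b' ε : ℝ) (A : ℕ × ℕ → Ω) :
    (∃ ρ, MemSρ p b' ε ρ A) ↔
      ∃ C : ℝ, ∀ i : ℕ × ℕ, ‖A i‖ ≤ C * (p : ℝ) ^ (-(2 * b' * i.1 + ε * i.2)) := by
  have hp1 : (1 : ℝ) < p := by exact_mod_cast (Fact.out : p.Prime).one_lt
  have hp0 : (0 : ℝ) < p := by linarith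
  constructor
  · rintro ⟨ρ, h⟩
    refine ⟨(p : ℝ) ^ (-ρ), fun i => (h i).trans (le_of_eq ?_)⟩
    rw [← Real.rpow_add hp0]
    congr 1
    ring
  · rintro ⟨C, h⟩
    refine ⟨-Real.logb p (max C 1), fun i => (h i).trans ?_⟩
    have hC : (0 : ℝ) < max C 1 := lt_max_of_lt_right one_pos
    have e : (p : ℝ) ^ (-(2 * b' * i.1 + ε * i.2 + -Real.logb p (max C 1))) =
        max C 1 * (p : ℝ) ^ (-(2 * b' * i.1 + ε * i.2)) := by
      rw [show -(2 * b' * i.1 + ε * i.2 + -Real.logb p (max C 1)) =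
        Real.logb p (max C 1) + -(2 * b' * i.1 + ε * i.2) by ring, Real.rpow_add hp0,
        Real.rpow_logb hp0 hp1.ne' hC]
    rw [e]
    gcongr
    exact le_max_left _ _

variable (Ω) in
/-- The space `S(b', ε)`, the union of the `S(b', ε; ρ)` over all real `ρ`; the series
`∑ A(n, m) t^n w^(m)` is given by its coefficients `A (n, m)`. -/
def S (b' ε : ℝ) : Submodule Ω (ℕ × ℕ → Ω) where
  carrier := {A | ∃ ρ, MemSρ p b' ε ρ A}
  zero_mem' := by
    refine ⟨0, fun i => ?_⟩
    simp only [OrdGE, Pi.zero_apply, norm_zero]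
    positivity
  add_mem' := by
    intro A B hA hB
    simp only [Set.mem_ofPred_eq, exists_memSρ_iff] at hA hB ⊢
    obtain ⟨C, hC⟩ := hA
    obtain ⟨C', hC'⟩ := hB
    refine ⟨C + C', fun i => (norm_add_le _ _).trans ?_⟩
    rw [add_mul]
    exact add_le_add (hC i) (hC' i)
  smul_mem' := by
    intro c A hA
    simp only [Set.mem_ofPred_eq, exists_memSρ_iff] at hA ⊢
    obtain ⟨C, hC⟩ := hA
    refine ⟨‖c‖ * C, fun i => ?_⟩
    rw [Pi.smul_apply, smul_eq_mul, norm_mul, mul_assoc]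
    exact mul_le_mul_of_nonneg_left (hC i) (norm_nonneg c)

/-- The element `t^n w^(m)` of `S(b', ε)`, where `i = (n, m)`. -/
def basisVec (b' ε : ℝ) (i : ℕ × ℕ) : S p Ω b' ε :=
  ⟨Pi.single i 1, -(2 * b' * i.1 + ε * i.2), fun j => by
    by_cases h : j = i
    · subst h
      simp [OrdGE]
    · simp only [OrdGE, Pi.single_eq_of_ne h, norm_zero]
      positivity⟩

/-- `ψ_t^a : S(b'/p^a, ε) → S(b', ε)`, `∑ A(n, m) t^n w^(m) ↦ ∑ A(p^a n, m) t^n w^(m)`. -/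
def psiT (a : ℕ) (b' ε : ℝ) : S p Ω (b' / (p : ℝ) ^ a) ε →ₗ[Ω] S p Ω b' ε where
  toFun A := ⟨fun i => A.1 (p ^ a * i.1, i.2), by
    obtain ⟨A, ρ, h⟩ := A
    refine ⟨ρ, fun i => ?_⟩
    have h1 := h (p ^ a * i.1, i.2)
    have hp0 : (p : ℝ) ^ a ≠ 0 := pow_ne_zero _ (by exact_mod_cast (Fact.out : p.Prime).ne_zero)
    have e : 2 * (b' / (p : ℝ) ^ a) * ((p ^ a * i.1 : ℕ) : ℝ) = 2 * b' * i.1 := by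
      push_cast
      field_simp
    simp only [e] at h1
    exact h1⟩
  map_add' _ _ := rfl
  map_smul' _ _ := rfl

/-- The Fredholm determinant `det(1 - u T | S(b', ε))`, through the matrix of `u` with respect to
the `t^n w^(m)`: the coefficient of `T^k` is `(-1)^k` times the sum of the principal minors of
size `k`. -/
def fredholmDet {b' ε : ℝ} (u : S p Ω b' ε →ₗ[Ω] S p Ω b' ε) : Ω⟦X⟧ :=
  PowerSeries.mk fun k =>
    (-1) ^ k * ∑' I : {I : Finset (ℕ × ℕ) // I.card = k},
      (Matrix.of fun i j : I.1 => (u (basisVec p b' ε j)).1 i).det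

/-- Convergence of the sums of principal minors. -/
def HasFredholmDet {b' ε : ℝ} (u : S p Ω b' ε →ₗ[Ω] S p Ω b' ε) : Prop :=
  ∀ k : ℕ, Summable fun I : {I : Finset (ℕ × ℕ) // I.card = k} =>
    (Matrix.of fun i j : I.1 => (u (basisVec p b' ε j)).1 i).det

/-- Completely continuous: a limit, in the operator norm, of bounded operators of finite rank.
(`S(b', ε)` has the norm with balls `S(b', ε; ρ)`.) -/
def IsCompletelyContinuous {b' ε : ℝ} (u : S p Ω b' ε →ₗ[Ω] S p Ω b' ε) : Prop :=
  ∀ c : ℝ, ∃ v : S p Ω b' ε →ₗ[Ω] S p Ω b' ε,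
    FiniteDimensional Ω (LinearMap.range v) ∧
    (∃ c₀ : ℝ, ∀ (ρ : ℝ) (ξ : S p Ω b' ε), MemSρ p b' ε ρ ξ.1 → MemSρ p b' ε (ρ + c₀) (v ξ).1) ∧
    ∀ (ρ : ℝ) (ξ : S p Ω b' ε), MemSρ p b' ε ρ ξ.1 → MemSρ p b' ε (ρ + c) (u ξ - v ξ).1

variable [NormedAlgebra ℚ_[p] Ω]

open scoped Classical in
/-- The falling factorial `κ (κ - 1) ⋯ (κ - m + 1)` with a factor `0` left out, so that
`w^(m)` is this number times `w^m`. -/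
def fall (Ω : Type*) [NormedField Ω] [NormedAlgebra ℚ_[p] Ω] (κ : ℤ_[p]) (m : ℕ) : Ω :=
  algebraMap ℚ_[p] Ω
    (∏ i ∈ Finset.range m, if κ - (i : ℤ_[p]) = 0 then 1 else κ - (i : ℤ_[p]) : ℤ_[p])

/-- `G ^ τ = ∑_k binom(τ, k) (G - 1)^k` for `G ∈ Ω[[t]][[w]]` with constant term `1` and `τ ∈ ℤ_p`.
As `(G - 1)^k` has no terms of total degree less than `k`, only `k ≤ n + j` contribute to
the coefficient of `t^n w^j`. -/
def serUnitPow (G : Ω⟦X⟧⟦X⟧) (τ : ℤ_[p]) : Ω⟦X⟧⟦X⟧ :=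
  PowerSeries.mk fun j => PowerSeries.mk fun n =>
    ∑ k ∈ Finset.range (n + j + 1),
      binom p Ω τ k * PowerSeries.coeff n (PowerSeries.coeff j ((G - 1) ^ k))

variable [CharZero Ω]

/-- `[ᾱ_a]_κ(w^(m)) = κ^(m) (Υ_q ᾱ_a(1))^(κ - m) (Υ_q ᾱ_a(π t / x))^m` in `Ω[[t]][[w]]`, where
`κ^(m)` is the falling factorial. -/
def symFrobBasis (a : ℕ) (b' b : ℝ) (π : Ω) (κ : ℤ_[p]) (m : ℕ) : Ω⟦X⟧⟦X⟧ :=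
  PowerSeries.C (PowerSeries.C (fall p Ω κ m)) *
    serUnitPow p (upsFrob p a b' b π serOne) (κ - (m : ℤ_[p])) *
    upsFrob p a b' b π (serPiTX π) ^ m

/-- The coefficient of `t^n w^(j)` in `[ᾱ_a]_κ(w^(m))`. -/
def symFrobCoeff (a : ℕ) (b' b : ℝ) (π : Ω) (κ : ℤ_[p]) (n m j : ℕ) : Ω :=
  PowerSeries.coeff n (PowerSeries.coeff j (symFrobBasis p a b' b π κ m)) / fall p Ω κ j

/-- `A` is the operator `[ᾱ_a]_κ : S(b', ε) → S(b'/p^a, ε)`: the extension of the above, linear over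
power series in `t`, that sends `∑_m ξ_m(t) w^(m)` to the (coefficientwise convergent) sum
`∑_m ξ_m(t) [ᾱ_a]_κ(w^(m))`. -/
def IsSymFrob (a : ℕ) (b' b ε : ℝ) (π : Ω) (κ : ℤ_[p])
    (A : S p Ω b' ε →ₗ[Ω] S p Ω (b' / (p : ℝ) ^ a) ε) : Prop :=
  ∀ (ξ : S p Ω b' ε) (N j : ℕ),
    HasSum
      (fun m : ℕ => ∑ i ∈ Finset.HasAntidiagonal.antidiagonal N, ξ.1 (i.1, m) * symFrobCoeff p a b' b π κ i.2 m j)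
      ((A ξ).1 (N, j))

end Symmetric

end KloostermanSym

end

open scoped PowerSeries PowerSeries.WithPiTopology IntermediateField

noncomputable section

namespace KloostermanSym

open PowerSeries Finset.HasAntidiagonal

set_option linter.unusedSectionVars false

/-! ### Exponentials of power series -/

section Exponential

variable {K : Type*} [Field K] [CharZero K]

/-! Dwork's method is applied twice. Along x it turns every Kloosterman sum into the trace of a
Frobenius on a cohomology space of rank two. Along t it turns the sum over all fibres of the traces
of the infinite symmetric power into the trace of one nuclear operator.

Along x. The series Θ_e(z) = exp π(z - z^(p^e)), a product of the θ(z^(p^i)), converges beyond the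
unit disc (`norm_coeff_bigTheta_le`, through the Artin–Hasse exponential), and at Teichmüller points
it takes the values of a nontrivial additive character (`dworkChar_add`, `dworkAddChar_ne_one`).
Every nontrivial ψ is x ↦ χ(cx) for this χ, which moves the parameter t to c²t. Put D_s = x d/dx +
π(x - s/x). Modulo its image, powers of x are reduced by a three-term recursion (`besselR`). Over
power series in t, with s = t^q, this yields existence, uniqueness and size of A_1, ..., A_4
(`exists_reduction`, `reduction_unique`); the gain of a factor p^(-b) in A_3 and A_4 drives
everything later. On a fibre |t| = 1 let X be the matrix of ψ_x^e ∘ Θ_e(x)Θ_e(t/x) and M its action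
on cohomology. When t^(p^e) = t, the relation X D = p^e D X and an explicit R with R D = 1 and D R =
1 - (projection to cohomology) give tr M = (1 - p^e) tr X (`fibreM_trace`). Expanding the
Kloosterman sum over Teichmüller points then gives Kl = -tr M (`sum_dworkChar_eq_neg_trace`). The
matrix M is the value at t of the relative Frobenius (`fibreM_eq_ev`) and satisfies M_{e+e'}(t) =
M_{e'}(t^(p^e)) M_e(t) (`fibreM_add`). It reduces to a matrix with rows (1, *) and (0, 0), which
produces the unit root π_0 and a root π_1 with |π_1| < 1.

Along t. With respect to t^n w^m the matrix of β_κ is dominated by a rank one matrix of finite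
trace, uniformly in κ (`FrobBound.nuclear_symMatrix`); hence the traces of its powers are continuous
in κ. For a natural number κ = k the span of the w^m with m ≤ k is stable and carries Sym^k, while
the other diagonal entries contribute O(p^(-b(k+1))) (`FrobBound.norm_matTr_sub_le`). Orthogonality
on Teichmüller points identifies q^n - 1 times the trace of the n-th power on Sym^k with a sum over
the points of 𝔾_m over the extension of degree n of sums of π_0^(k-m) π_1^m, suitably raised to
powers. Natural numbers k that tend to κ p-adically and to infinity in size give in the limit the
trace formula for β_κ (`KlData.matTr_symMatrix`).

Newton's identities, passed to the limit from finite blocks, give g(T) = exp(-∑ tr(β^n) T^n / n).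
The logarithm of the Euler product is ∑ (q^n - 1) tr(β^n) T^n / n by the trace formula, which is log
g(T) - log g(qT). -/

theorem ode_unique {f h g : K⟦X⟧} (hf : derivative K f = f * g) (hh : derivative K h = h * g)
    (h0 : constantCoeff f = constantCoeff h) : f = h := by
  ext n
  induction n using Nat.strong_induction_on with
  | _ n ih =>
    cases n with
    | zero => simpa using h0
    | succ n =>
      have h1 := congrArg (coeff n) hf
      have h2 := congrArg (coeff n) hh
      rw [coeff_derivative, coeff_mul] at h1 h2
      have : ∑ x ∈ antidiagonal n, coeff x.1 f * coeff x.2 g =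
          ∑ x ∈ antidiagonal n, coeff x.1 h * coeff x.2 g := by
        refine Finset.sum_congr rfl fun x hx => ?_
        rw [ih x.1 (by have := mem_antidiagonal.1 hx; omega)]
      rw [this, ← h2] at h1
      exact mul_right_cancel₀ (by exact_mod_cast Nat.succ_ne_zero n) h1

theorem constantCoeff_exp_subst {g : K⟦X⟧} (hg : constantCoeff g = 0) :
    constantCoeff ((exp K).subst g) = 1 := by
  have hs : HasSubst g := HasSubst.of_constantCoeff_zero' hg
  rw [← coeff_zero_eq_constantCoeff_apply, coeff_subst' hs, finsum_eq_single _ 0]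
  · simp
  · intro n hn
    simp [hg, hn]

theorem derivative_exp_subst {g : K⟦X⟧} (hg : constantCoeff g = 0) :
    derivative K ((exp K).subst g) = (exp K).subst g * derivative K g := by
  rw [derivative_subst (HasSubst.of_constantCoeff_zero' hg), derivative_exp]

/-- All exponential identities below are obtained from this characterisation by the logarithmic
derivative, so that no composition of formal series has to be expanded. -/
theorem eq_exp_subst {f g : K⟦X⟧} (hg : constantCoeff g = 0) (hf : constantCoeff f = 1)
    (h : derivative K f = f * derivative K g) : f = (exp K).subst g :=
  ode_unique h (derivative_exp_subst hg) (by rw [hf, constantCoeff_exp_subst hg])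

theorem exp_subst_add {g h : K⟦X⟧} (hg : constantCoeff g = 0) (hh : constantCoeff h = 0) :
    (exp K).subst (g + h) = (exp K).subst g * (exp K).subst h := by
  symm
  apply eq_exp_subst
  · simp [hg, hh]
  · simp [constantCoeff_exp_subst, hg, hh]
  · rw [Derivation.leibniz, derivative_exp_subst hg, derivative_exp_subst hh, map_add]
    simp only [smul_eq_mul]
    ring

theorem exp_subst_zero : (exp K).subst (0 : K⟦X⟧) = 1 :=
  (eq_exp_subst (by simp) (by simp) (by simp)).symm

theorem exp_subst_nsmul {g : K⟦X⟧} (hg : constantCoeff g = 0) (n : ℕ) :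
    (exp K).subst (n • g) = (exp K).subst g ^ n := by
  induction n with
  | zero => simpa using exp_subst_zero
  | succ n ih => rw [succ_nsmul, exp_subst_add (by simp [hg]) hg, ih, pow_succ]

theorem expand_exp_subst {g : K⟦X⟧} (hg : constantCoeff g = 0) {k : ℕ} (hk : k ≠ 0) :
    expand k hk ((exp K).subst g) = (exp K).subst (expand k hk g) := by
  have hs : HasSubst g := HasSubst.of_constantCoeff_zero' hg
  have hX : HasSubst (X ^ k : K⟦X⟧) := HasSubst.X_pow hk
  rw [expand_apply, expand_apply, subst_comp_subst_apply hs hX]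

theorem rescale_exp_subst {g : K⟦X⟧} (hg : constantCoeff g = 0) (c : K) :
    rescale c ((exp K).subst g) = (exp K).subst (rescale c g) := by
  have key : ∀ f : K⟦X⟧, derivative K (rescale c f) = C c * rescale c (derivative K f) := by
    intro f
    ext n
    simp [coeff_derivative, coeff_rescale, pow_succ]
    ring
  apply eq_exp_subst
  · rw [← coeff_zero_eq_constantCoeff_apply, coeff_rescale]; simp [hg]
  · rw [← coeff_zero_eq_constantCoeff_apply, coeff_rescale]; simp [constantCoeff_exp_subst hg]
  · rw [key, key, derivative_exp_subst hg, map_mul]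
    ring

theorem map_exp_subst {L : Type*} [Field L] [CharZero L] (φ : K →+* L) {g : K⟦X⟧}
    (hg : constantCoeff g = 0) :
    PowerSeries.map φ ((exp K).subst g) = (exp L).subst (PowerSeries.map φ g) := by
  have key : ∀ f : K⟦X⟧, derivative L (PowerSeries.map φ f) =
      PowerSeries.map φ (derivative K f) := by
    intro f
    ext n
    simp [coeff_derivative]
  apply eq_exp_subst
  · rw [← coeff_zero_eq_constantCoeff_apply, coeff_map]; simp [hg]
  · rw [← coeff_zero_eq_constantCoeff_apply, coeff_map]; simp [constantCoeff_exp_subst hg]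
  · rw [key, key, derivative_exp_subst hg, map_mul]

end Exponential

/-! ### Norms of coefficients -/

section Ultrametric

variable {K : Type*} [NormedField K] [IsUltrametricDist K]

theorem norm_sum_le_of_le {ι : Type*} (s : Finset ι) (f : ι → K) {c : ℝ} (hc : 0 ≤ c)
    (h : ∀ i ∈ s, ‖f i‖ ≤ c) : ‖∑ i ∈ s, f i‖ ≤ c :=
  IsUltrametricDist.norm_sum_le_of_forall_le_of_nonneg hc h

theorem norm_add_le_of_le {x y : K} {c : ℝ} (hx : ‖x‖ ≤ c) (hy : ‖y‖ ≤ c) : ‖x + y‖ ≤ c :=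
  (IsUltrametricDist.norm_add_le_max x y).trans (max_le hx hy)

theorem norm_sub_le_of_le {x y : K} {c : ℝ} (hx : ‖x‖ ≤ c) (hy : ‖y‖ ≤ c) : ‖x - y‖ ≤ c := by
  rw [sub_eq_add_neg]
  exact norm_add_le_of_le hx (by rwa [norm_neg])

/-- Bounds of the form c ρ^n with a fixed ρ are Gauss norm bounds on the disc of radius 1/ρ, and the
Gauss norm is submultiplicative. -/
theorem norm_coeff_mul_le {f g : K⟦X⟧} {c d ρ : ℝ} (hc : 0 ≤ c) (hd : 0 ≤ d) (hρ : 0 ≤ ρ)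
    (hf : ∀ n, ‖coeff n f‖ ≤ c * ρ ^ n) (hg : ∀ n, ‖coeff n g‖ ≤ d * ρ ^ n) (n : ℕ) :
    ‖coeff n (f * g)‖ ≤ c * d * ρ ^ n := by
  rw [coeff_mul]
  refine norm_sum_le_of_le _ _ (by positivity) fun i hi => ?_
  rw [norm_mul, ← mem_antidiagonal.1 hi, pow_add]
  calc ‖coeff i.1 f‖ * ‖coeff i.2 g‖ ≤ (c * ρ ^ i.1) * (d * ρ ^ i.2) :=
        mul_le_mul (hf _) (hg _) (norm_nonneg _) (by positivity)
    _ = _ := by ring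

theorem norm_coeff_one_le {ρ : ℝ} (hρ : 0 ≤ ρ) (n : ℕ) : ‖coeff n (1 : K⟦X⟧)‖ ≤ 1 * ρ ^ n := by
  rw [coeff_one]
  split_ifs with h
  · simp [h]
  · simp only [norm_zero]; positivity

theorem norm_coeff_pow_le {f : K⟦X⟧} {c ρ : ℝ} (hc : 0 ≤ c) (hρ : 0 ≤ ρ)
    (hf : ∀ n, ‖coeff n f‖ ≤ c * ρ ^ n) (d n : ℕ) :
    ‖coeff n (f ^ d)‖ ≤ c ^ d * ρ ^ n := by
  induction d generalizing n with
  | zero => simpa using norm_coeff_one_le hρ n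
  | succ d ih =>
    rw [pow_succ, pow_succ]
    exact norm_coeff_mul_le (by positivity) hc hρ ih hf n

end Ultrametric

/-! ### Norms of π and of factorials; convergence of the exponential -/

section PadicNorms

variable (p : ℕ) [hp : Fact p.Prime]

/-- `‖π‖ = p ^ (-1 / (p - 1))`. -/
def radius (p : ℕ) : ℝ := (p : ℝ) ^ (-(1 / ((p : ℝ) - 1)))

theorem one_lt_cast : (1 : ℝ) < p := by exact_mod_cast hp.out.one_lt

theorem radius_pos : 0 < radius p := Real.rpow_pos_of_pos (by linarith [one_lt_cast p]) _

theorem radius_lt_one : radius p < 1 :=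
  Real.rpow_lt_one_of_one_lt_of_neg (one_lt_cast p) (by
    have := one_lt_cast p
    have : 0 < 1 / ((p : ℝ) - 1) := by apply one_div_pos.2; linarith
    linarith)

variable {K : Type*} [NormedField K] [NormedAlgebra ℚ_[p] K]

theorem norm_padicNat (n : ℕ) : ‖(n : K)‖ = ‖(n : ℚ_[p])‖ := by
  rw [← map_natCast (algebraMap ℚ_[p] K) n, norm_algebraMap']

theorem norm_natCast_le_one (p : ℕ) [Fact p.Prime] {K : Type*} [NormedField K]
    [NormedAlgebra ℚ_[p] K] (n : ℕ) : ‖(n : K)‖ ≤ 1 := by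
  rw [norm_padicNat p]
  exact_mod_cast Padic.norm_int_le_one (n : ℤ)

theorem norm_cast_prime : ‖(p : K)‖ = (p : ℝ)⁻¹ := by
  rw [norm_padicNat p]; exact Padic.norm_p

theorem norm_pi {π : K} (hπ : π ^ (p - 1) = -(p : K)) : ‖π‖ = radius p := by
  have h1 := congrArg norm hπ
  rw [norm_pow, norm_neg, norm_cast_prime p] at h1
  have hp1 : 0 < p - 1 := by have := hp.out.one_lt; omega
  have hcast : ((p - 1 : ℕ) : ℝ) = (p : ℝ) - 1 := by
    rw [Nat.cast_sub hp.out.one_le]; simp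
  have h2 : radius p ^ (p - 1) = (p : ℝ)⁻¹ := by
    have h0 : (p : ℝ) - 1 ≠ 0 := by have := one_lt_cast p; linarith
    rw [radius, ← Real.rpow_natCast, ← Real.rpow_mul (by positivity), hcast,
      show -(1 / ((p : ℝ) - 1)) * ((p : ℝ) - 1) = -1 by field_simp, Real.rpow_neg_one]
  exact pow_left_injective₀ (norm_nonneg _) (radius_pos p).le hp1.ne' (h1.trans h2.symm)
where pow_left_injective₀ {x y : ℝ} (hx : 0 ≤ x) (hy : 0 ≤ y) {n : ℕ} (hn : n ≠ 0)
    (h : x ^ n = y ^ n) : x = y := (pow_left_inj₀ hx hy hn).1 h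

theorem norm_factorial_eq (n : ℕ) :
    ‖((n.factorial : ℕ) : K)‖ = (p : ℝ) ^ (-(padicValNat p n.factorial : ℤ)) := by
  rw [norm_padicNat p, Padic.norm_eq_zpow_neg_valuation
    (by exact_mod_cast n.factorial_ne_zero), Padic.valuation_natCast]

theorem padicValNat_factorial_real_le (n : ℕ) :
    (padicValNat p n.factorial : ℝ) ≤ n * (1 / ((p : ℝ) - 1)) := by
  have h := sub_one_mul_padicValNat_factorial (p := p) n
  have h1 : (p - 1) * padicValNat p n.factorial ≤ n := by rw [h]; exact Nat.sub_le _ _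
  have h2 : (((p - 1 : ℕ) : ℝ)) * padicValNat p n.factorial ≤ n := by exact_mod_cast h1
  rw [Nat.cast_sub hp.out.one_le] at h2
  have h0 : 0 < (p : ℝ) - 1 := by have := one_lt_cast p; linarith
  rw [mul_one_div, le_div_iff₀ h0]
  simpa [mul_comm] using h2

theorem radius_pow_le_norm_factorial (n : ℕ) :
    radius p ^ n ≤ ‖((n.factorial : ℕ) : K)‖ := by
  have hp0 : (0 : ℝ) < p := by linarith [one_lt_cast p]
  rw [norm_factorial_eq p, radius, ← Real.rpow_natCast, ← Real.rpow_mul hp0.le,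
    ← Real.rpow_intCast]
  apply Real.rpow_le_rpow_of_exponent_le (one_lt_cast p).le
  have := padicValNat_factorial_real_le p n
  rw [Int.cast_neg, Int.cast_natCast]
  linarith

theorem norm_inv_factorial_mul_le (n : ℕ) :
    ‖((n.factorial : ℕ) : K)‖⁻¹ * radius p ^ n ≤ 1 := by
  have h1 := radius_pow_le_norm_factorial p (K := K) n
  have h2 := pow_pos (radius_pos p) n
  rw [inv_mul_le_iff₀ (by linarith)]
  linarith

/-- The d-th power of g brings `radius p ^ d`, and Legendre's formula makes this at most |d!|, so
that the denominators of the exponential cost nothing. -/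
theorem norm_coeff_exp_subst_le [CharZero K] [IsUltrametricDist K] {g : K⟦X⟧} {ρ : ℝ}
    (hρ : 0 ≤ ρ) (hg0 : constantCoeff g = 0) (hg : ∀ n, ‖coeff n g‖ ≤ radius p * ρ ^ n) (n : ℕ) :
    ‖coeff n ((exp K).subst g)‖ ≤ ρ ^ n := by
  rw [coeff_subst' (HasSubst.of_constantCoeff_zero' hg0)]
  have hfin := coeff_subst_finite' (HasSubst.of_constantCoeff_zero' hg0) (exp K) n
  rw [finsum_eq_sum _ hfin]
  refine norm_sum_le_of_le _ _ (by positivity) fun d _ => ?_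
  rw [smul_eq_mul, norm_mul, coeff_exp]
  have h1 := norm_coeff_pow_le (radius_pos p).le hρ hg d n
  have h2 : ‖(algebraMap ℚ K) (1 / (d.factorial : ℚ))‖ = ‖((d.factorial : ℕ) : K)‖⁻¹ := by
    rw [map_div₀, map_one, map_natCast, norm_div, norm_one, one_div]
  rw [h2]
  calc _ ≤ ‖((d.factorial : ℕ) : K)‖⁻¹ * (radius p ^ d * ρ ^ n) := by gcongr
    _ = (‖((d.factorial : ℕ) : K)‖⁻¹ * radius p ^ d) * ρ ^ n := by ring
    _ ≤ 1 * ρ ^ n := by gcongr; exact norm_inv_factorial_mul_le p d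
    _ = _ := one_mul _

end PadicNorms

/-! ### The Artin–Hasse exponential -/

section ArtinHasse

variable (p : ℕ) [hp : Fact p.Prime]

/-- Over 𝔽_p the Frobenius is a ring homomorphism fixing the coefficients: g^p = g(X^p) modulo p. -/
theorem norm_coeff_pow_sub_expand_le (g : Polynomial ℤ_[p]) (n : ℕ) :
    ‖(g ^ p - Polynomial.expand _ p g).coeff n‖ ≤ (p : ℝ)⁻¹ := by
  have h : Polynomial.map (PadicInt.toZMod (p := p)) (g ^ p - Polynomial.expand _ p g) = 0 := by
    rw [Polynomial.map_sub, Polynomial.map_pow, Polynomial.map_expand, ZMod.expand_card, sub_self]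
  have h1 := congrArg (fun f => Polynomial.coeff f n) h
  simp only [Polynomial.coeff_map, Polynomial.coeff_zero] at h1
  have h2 : (g ^ p - Polynomial.expand _ p g).coeff n ∈ RingHom.ker (PadicInt.toZMod (p := p)) := h1
  rw [PadicInt.ker_toZMod, PadicInt.maximalIdeal_eq_span_p, Ideal.mem_span_singleton] at h2
  obtain ⟨c, hc⟩ := h2
  rw [hc, norm_mul, PadicInt.norm_p]
  exact mul_le_of_le_one_right (by positivity) (PadicInt.norm_le_one c)

/-- Dwork's lemma. -/
theorem norm_coeff_le_one_of_pow_eq {f h : ℚ_[p]⟦X⟧} (hf : constantCoeff f = 1)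
    (hh : constantCoeff h = 1) (hhn : ∀ n, n ≠ 0 → ‖coeff n h‖ ≤ (p : ℝ)⁻¹)
    (H : f ^ p = expand p hp.out.ne_zero f * h) (n : ℕ) : ‖coeff n f‖ ≤ 1 := by
  have hp0 : (0 : ℝ) < p := by linarith [one_lt_cast p]
  induction n using Nat.strong_induction_on with
  | _ n ih =>
  rcases Nat.eq_zero_or_pos n with rfl | hn
  · simp [hf]
  classical
  -- By the induction hypothesis the coefficients below degree n are integral. They are assembled
  -- into a polynomial over ℤ_p so that the congruence modulo p applies; the default 0 only occurs
  -- for k ≥ n, where `z` is not used.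
  let z : ℕ → ℤ_[p] := fun k =>
    if hk : ‖coeff k f‖ ≤ 1 then (⟨coeff k f, hk⟩ : ℤ_[p]) else (0 : ℤ_[p])
  have hz : ∀ k, k < n → ((z k : ℤ_[p]) : ℚ_[p]) = coeff k f := by
    intro k hk
    simp [z, ih k hk]
  let g : Polynomial ℤ_[p] := ∑ k ∈ Finset.range n, Polynomial.monomial k (z k)
  have hg : ∀ k, ((g.coeff k : ℤ_[p]) : ℚ_[p]) = if k < n then coeff k f else 0 := by
    intro k
    simp only [g, Polynomial.finsetSum_coeff, Polynomial.coeff_monomial, Finset.sum_ite_eq',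
      Finset.mem_range]
    split_ifs with hk
    · exact hz k hk
    · simp
  let G : ℚ_[p]⟦X⟧ := PowerSeries.map (PadicInt.Coe.ringHom (p := p)) (g : ℤ_[p]⟦X⟧)
  have hG : ∀ k, coeff k G = if k < n then coeff k f else 0 := by
    intro k
    simp only [G, coeff_map, Polynomial.coeff_coe]
    exact hg k
  have hdvd : (X : ℚ_[p]⟦X⟧) ^ n ∣ f - G := by
    rw [X_pow_dvd_iff]
    intro m hm
    simp [hG, hm]
  obtain ⟨r, hr⟩ := hdvd
  have hr0 : constantCoeff r = coeff n f := by
    have := congrArg (coeff n) hr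
    rw [map_sub, hG, coeff_X_pow_mul'] at this
    simpa using this.symm
  have hG0 : constantCoeff G = 1 := by
    rw [← coeff_zero_eq_constantCoeff_apply, hG]; simp [hn, hf]
  -- Since f = G + X^n r, the terms of f^p beyond the linear one lie in degree at least 2n, hence
  -- f^p and G^p differ at degree n by exactly p times the coefficient of f.
  obtain ⟨k, hk⟩ := Polynomial.powAddExpansion G (X ^ n * r) p
  rw [← hr, add_sub_cancel, hr] at hk
  have hcoef : coeff n (f ^ p) = coeff n (G ^ p) + p * coeff n f := by
    rw [hk, map_add, map_add]
    have e1 : coeff n ((p : ℚ_[p]⟦X⟧) * G ^ (p - 1) * (X ^ n * r)) = p * coeff n f := by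
      rw [show (p : ℚ_[p]⟦X⟧) * G ^ (p - 1) * (X ^ n * r) =
        X ^ n * ((p : ℚ_[p]⟦X⟧) * G ^ (p - 1) * r) by ring, coeff_X_pow_mul']
      simp [hG0, hr0]
    have e2 : coeff n (k * (X ^ n * r) ^ 2) = 0 := by
      rw [show k * (X ^ n * r) ^ 2 = X ^ (2 * n) * (k * r ^ 2) by ring, coeff_X_pow_mul']
      simp; omega
    rw [e1, e2, add_zero]
  have hGp : ‖coeff n (G ^ p) - coeff n (expand p hp.out.ne_zero G)‖ ≤ (p : ℝ)⁻¹ := by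
    have h1 := norm_coeff_pow_sub_expand_le p g n
    have e : coeff n (G ^ p) - coeff n (expand p hp.out.ne_zero G) =
        (((g ^ p - Polynomial.expand _ p g).coeff n : ℤ_[p]) : ℚ_[p]) := by
      rw [Polynomial.coeff_sub, PadicInt.coe_sub]
      congr 1
      · simp only [G]
        rw [← map_pow, coeff_map, ← Polynomial.coe_pow, Polynomial.coeff_coe]
        rfl
      · rw [coeff_expand, Polynomial.coeff_expand hp.out.pos]
        split_ifs
        · simp only [G, coeff_map, Polynomial.coeff_coe]
          rfl
        · simp
    rw [e, ← PadicInt.norm_def]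
    exact h1
  have hexp : coeff n (expand p hp.out.ne_zero G) = coeff n (expand p hp.out.ne_zero f) := by
    rw [coeff_expand, coeff_expand]
    split_ifs with hd
    · rw [hG, if_pos (Nat.div_lt_self hn hp.out.one_lt)]
    · rfl
  have hprod : ‖coeff n (expand p hp.out.ne_zero f * h) - coeff n (expand p hp.out.ne_zero f)‖ ≤
      (p : ℝ)⁻¹ := by
    rw [← map_sub, show expand p hp.out.ne_zero f * h - expand p hp.out.ne_zero f =
      expand p hp.out.ne_zero f * (h - 1) by ring, coeff_mul]
    refine norm_sum_le_of_le _ _ (by positivity) fun i hi => ?_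
    have hi := mem_antidiagonal.1 hi
    rw [norm_mul]
    by_cases h2 : i.2 = 0
    · simp only [h2, coeff_zero_eq_constantCoeff, map_sub, hh, map_one, sub_self, norm_zero,
        mul_zero]
      positivity
    · have b1 : ‖coeff i.2 (h - 1)‖ ≤ (p : ℝ)⁻¹ := by
        rw [map_sub, coeff_one, if_neg h2, sub_zero]; exact hhn _ h2
      have b2 : ‖coeff i.1 (expand p hp.out.ne_zero f)‖ ≤ 1 := by
        rw [coeff_expand]
        split_ifs
        · exact ih _ (lt_of_le_of_lt (Nat.div_le_self _ _) (by omega))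
        · simp
      calc _ ≤ 1 * (p : ℝ)⁻¹ := mul_le_mul b2 b1 (norm_nonneg _) zero_le_one
        _ = _ := one_mul _
  -- As f(X^p) and G(X^p) have the same coefficient at n, p times the unknown coefficient is a
  -- difference of two quantities divisible by p.
  have key : (p : ℚ_[p]) * coeff n f =
      (coeff n (expand p hp.out.ne_zero f * h) - coeff n (expand p hp.out.ne_zero f)) -
      (coeff n (G ^ p) - coeff n (expand p hp.out.ne_zero G)) := by
    rw [hexp, ← H, hcoef]; ring
  have := norm_sub_le_of_le hprod hGp
  rw [← key, norm_mul, Padic.norm_p] at this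
  have h3 : (p : ℝ)⁻¹ * ‖coeff n f‖ ≤ (p : ℝ)⁻¹ := this
  exact le_of_mul_le_mul_left (by simpa using h3) (inv_pos.2 hp0)

open scoped Classical in
/-- `∑ z^(p^i) / p^i`. -/
def artinHasseLog (K : Type*) [Field K] : K⟦X⟧ :=
  mk fun n => if ∃ i, n = p ^ i then (n : K)⁻¹ else 0

theorem constantCoeff_artinHasseLog (K : Type*) [Field K] :
    constantCoeff (artinHasseLog p K) = 0 := by
  rw [← coeff_zero_eq_constantCoeff_apply, artinHasseLog, coeff_mk]
  split_ifs <;> simp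

/-- After exponentiation this reads E(z)^p = E(z^p) exp(pz), the functional equation to which
Dwork's lemma applies. -/
theorem nsmul_artinHasseLog (K : Type*) [Field K] [CharZero K] :
    p • artinHasseLog p K = expand p hp.out.ne_zero (artinHasseLog p K) + C (p : K) * X := by
  classical
  have hp1 := hp.out.one_lt
  have hpK : (p : K) ≠ 0 := by exact_mod_cast hp.out.ne_zero
  ext n
  rw [map_nsmul, map_add, coeff_expand, coeff_C_mul, coeff_X, artinHasseLog, coeff_mk,
    coeff_mk, nsmul_eq_mul]
  by_cases h1 : n = 1
  · subst h1
    rw [if_pos ⟨0, by simp⟩, if_neg (by rw [Nat.dvd_one]; omega)]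
    simp
  · rw [if_neg h1, mul_zero, add_zero]
    by_cases h : ∃ i, n = p ^ i
    · obtain ⟨i, rfl⟩ := h
      cases i with
      | zero => simp at h1
      | succ i =>
        have e : p ^ (i + 1) / p = p ^ i := by rw [pow_succ]; exact Nat.mul_div_cancel _ hp.out.pos
        rw [if_pos ⟨_, rfl⟩, if_pos (dvd_pow_self p (Nat.succ_ne_zero i)), e, if_pos ⟨_, rfl⟩]
        push_cast
        rw [pow_succ]
        field_simp
    · rw [if_neg h, mul_zero]
      split_ifs with h2 h3
      · exfalso
        obtain ⟨i, hi⟩ := h3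
        apply h
        exact ⟨i + 1, by rw [pow_succ, ← hi, Nat.div_mul_cancel h2]⟩
      · rfl
      · rfl

/-- By Legendre (p - 1) v(n!) = n - s(n), where the digit sum s(n) is positive; therefore v(n!) < n,
and one factor p is left over. -/
theorem norm_pow_div_factorial_le {n : ℕ} (hn : n ≠ 0) :
    ‖(p : ℚ_[p]) ^ n / (n.factorial : ℚ_[p])‖ ≤ (p : ℝ)⁻¹ := by
  have hv : padicValNat p n.factorial < n := by
    have h := sub_one_mul_padicValNat_factorial (p := p) n
    have hd : 0 < (p.digits n).sum := Nat.pos_of_ne_zero fun h0 => hn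
      (by
        have := Nat.modEq_digits_sum
        by_contra hne
        have h1 := List.sum_eq_zero_iff.1 h0
        have h2 := Nat.getLast_digit_ne_zero p hne
        exact h2 (h1 _ (List.getLast_mem _)))
    have hp1 : 1 ≤ p - 1 := by have := hp.out.one_lt; omega
    calc padicValNat p n.factorial ≤ (p - 1) * padicValNat p n.factorial :=
          Nat.le_mul_of_pos_left _ hp1
      _ = n - (p.digits n).sum := h
      _ < n := by omega
  rw [norm_div, norm_pow, norm_cast_prime p, norm_factorial_eq p, inv_pow, ← zpow_natCast,
    ← zpow_neg, ← zpow_sub₀ (by exact_mod_cast hp.out.ne_zero), ← zpow_neg_one]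
  apply zpow_le_zpow_right₀ (one_lt_cast p).le
  omega

theorem norm_coeff_artinHasse_le_one (n : ℕ) :
    ‖coeff n ((exp ℚ_[p]).subst (artinHasseLog p ℚ_[p]))‖ ≤ 1 := by
  have h0 := constantCoeff_artinHasseLog p ℚ_[p]
  have hX : constantCoeff (C (p : ℚ_[p]) * X) = 0 := by simp
  apply norm_coeff_le_one_of_pow_eq p (h := (exp ℚ_[p]).subst (C (p : ℚ_[p]) * X))
  · exact constantCoeff_exp_subst h0
  · exact constantCoeff_exp_subst hX
  · intro n hn
    have e : (exp ℚ_[p]).subst (C (p : ℚ_[p]) * X) = rescale (p : ℚ_[p]) (exp ℚ_[p]) := by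
      symm
      rw [rescale_eq_subst, smul_eq_C_mul]
    rw [e, coeff_rescale, coeff_exp]
    simpa [div_eq_mul_inv] using norm_pow_div_factorial_le p hn
  · rw [← exp_subst_nsmul h0, nsmul_artinHasseLog, exp_subst_add _ hX, expand_exp_subst h0]
    rw [← coeff_zero_eq_constantCoeff_apply, coeff_expand]
    simp [h0]

end ArtinHasse

/-! ### Coefficients extended by zero to negative indices -/

section IntegerIndexed

variable {K : Type*} [NormedField K]

/-- Coefficients indexed by the integers. -/
def zcoeff (f : K⟦X⟧) (n : ℤ) : K := if 0 ≤ n then coeff n.toNat f else 0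

theorem zcoeff_natCast (f : K⟦X⟧) (n : ℕ) : zcoeff f n = coeff n f := by simp [zcoeff]

theorem zcoeff_of_neg (f : K⟦X⟧) {n : ℤ} (hn : n < 0) : zcoeff f n = 0 := by
  simp [zcoeff, not_le.2 hn]

theorem zcoeff_X_pow_mul (f : K⟦X⟧) (k : ℕ) (n : ℤ) : zcoeff (X ^ k * f) n = zcoeff f (n - k) := by
  rcases lt_or_ge n 0 with hn | hn
  · rw [zcoeff_of_neg _ hn, zcoeff_of_neg _ (by omega)]
  · lift n to ℕ using hn
    rw [zcoeff_natCast, coeff_X_pow_mul']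
    split_ifs with h
    · rw [← Nat.cast_sub h, zcoeff_natCast]
    · rw [zcoeff_of_neg _ (by omega)]

theorem norm_zcoeff_le {f : K⟦X⟧} {ρ : ℝ} (hρ : 0 < ρ) (hf : ∀ n, ‖coeff n f‖ ≤ ρ ^ n) (n : ℤ) :
    ‖zcoeff f n‖ ≤ ρ ^ n := by
  rcases lt_or_ge n 0 with hn | hn
  · rw [zcoeff_of_neg _ hn, norm_zero]; positivity
  · lift n to ℕ using hn
    rw [zcoeff_natCast, zpow_natCast]
    exact hf n

end IntegerIndexed

/-! ### Dwork's splitting functions -/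

section SplittingFunction

variable (p : ℕ) [hp : Fact p.Prime]

/-- The rate of decay `p ^ (-(p - 1) / p^(e + 1))` of the coefficients of `exp π (z - z^(p^e))`. -/
def rate (p e : ℕ) : ℝ := (p : ℝ) ^ (-(((p : ℝ) - 1) / p / (p : ℝ) ^ e))

theorem rate_pos (e : ℕ) : 0 < rate p e := Real.rpow_pos_of_pos (by linarith [one_lt_cast p]) _

theorem rate_lt_one (e : ℕ) : rate p e < 1 := by
  have h := one_lt_cast p
  refine Real.rpow_lt_one_of_one_lt_of_neg h (neg_neg_of_pos ?_)
  have : 0 < (p : ℝ) - 1 := by linarith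
  positivity

theorem rate_mono {e e' : ℕ} (h : e ≤ e') : rate p e ≤ rate p e' := by
  have h1 := one_lt_cast p
  have : 0 < (p : ℝ) - 1 := by linarith
  apply Real.rpow_le_rpow_of_exponent_le h1.le
  apply neg_le_neg
  gcongr
  exact h1.le

theorem rate_pow (e i : ℕ) : rate p (e + i) ^ (p ^ i) = rate p e := by
  have h0 : (0 : ℝ) < p := by linarith [one_lt_cast p]
  rw [rate, rate, ← Real.rpow_natCast, ← Real.rpow_mul h0.le]
  congr 1
  push_cast
  rw [pow_add]
  field_simp

theorem rate_zero_pow (e n : ℕ) : rate p e ^ (p ^ e * n) = rate p 0 ^ n := by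
  rw [pow_mul]
  have := rate_pow p 0 e
  rw [zero_add] at this
  rw [this]

variable {K : Type*} [NormedField K] [NormedAlgebra ℚ_[p] K] [CharZero K] [IsUltrametricDist K]
variable {π : K}

/-- This is the inequality of exponents needed to compare the term π^n / n of the Artin–Hasse
logarithm, n = p^(k+2), with |π| times the target rate to the power n. -/
theorem geometric_bound (k : ℕ) :
    ((p : ℝ) - 1) * ((k + 2 : ℕ) + (p : ℝ) ^ k * ((p : ℝ) - 1)) ≤ (p : ℝ) ^ (k + 2) - 1 := by
  have h := one_lt_cast p
  have hp2 : (2 : ℝ) ≤ p := by exact_mod_cast hp.out.two_le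
  induction k with
  | zero => push_cast; nlinarith
  | succ k ih =>
    have h1 := mul_le_mul_of_nonneg_left ih (by linarith : (0 : ℝ) ≤ p)
    push_cast at h1 ⊢
    have e : (p : ℝ) ^ (k + 1) = p * p ^ k := by ring
    have e2 : (p : ℝ) ^ (k + 1 + 2) = p * p ^ (k + 2) := by ring
    have hk : (0 : ℝ) ≤ k := Nat.cast_nonneg k
    rw [e, e2]
    have h3 : 0 ≤ ((p : ℝ) - 1) * (p - 1) * (k + 1) := by
      apply mul_nonneg (mul_nonneg _ _) <;> linarith
    nlinarith

theorem radius_pow_prime_pow_le (k : ℕ) :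
    radius p ^ (p ^ (k + 2)) * (p : ℝ) ^ (k + 2) ≤ radius p * rate p 1 ^ (p ^ (k + 2)) := by
  have h := one_lt_cast p
  have h0 : (0 : ℝ) < p := by linarith
  have h1 : (0 : ℝ) < (p : ℝ) - 1 := by linarith
  rw [radius, rate, ← Real.rpow_natCast, ← Real.rpow_mul h0.le, ← Real.rpow_natCast _ (k + 2),
    ← Real.rpow_natCast (_ ^ _) (p ^ (k + 2)), ← Real.rpow_mul h0.le, ← Real.rpow_add h0,
    ← Real.rpow_add h0]
  apply Real.rpow_le_rpow_of_exponent_le h.le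
  have hb := geometric_bound p k
  have e1 : ((p : ℝ) - 1) / p / (p : ℝ) ^ 1 * ((p ^ (k + 2) : ℕ) : ℝ) = (p : ℝ) ^ k * (p - 1) := by
    push_cast
    field_simp
    ring
  have e2 : ((k + 2 : ℕ) : ℝ) + (p : ℝ) ^ k * (p - 1) ≤
      ((p : ℝ) ^ (k + 2) - 1) * (1 / ((p : ℝ) - 1)) := by
    rw [mul_one_div, le_div_iff₀ h1]
    linarith
  rw [neg_mul, neg_mul, e1]
  push_cast at e2 ⊢
  nlinarith

theorem radius_le_rate_one : radius p ≤ rate p 1 := by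
  have h := one_lt_cast p
  have h1 : (0 : ℝ) < (p : ℝ) - 1 := by linarith
  apply Real.rpow_le_rpow_of_exponent_le h.le
  apply neg_le_neg
  rw [pow_one, div_div, div_le_div_iff₀ (by positivity) h1]
  nlinarith

theorem map_artinHasseLog :
    PowerSeries.map (algebraMap ℚ_[p] K) (artinHasseLog p ℚ_[p]) = artinHasseLog p K := by
  ext n
  rw [coeff_map, artinHasseLog, artinHasseLog, coeff_mk, coeff_mk]
  split_ifs <;> simp

/-- Because π^p = -pπ, the terms of degree 1 and p in ∑ (πz)^(p^i) / p^i are precisely πz - πz^p.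
Thus θ(z) = E(πz) exp(h) with E the Artin–Hasse exponential, integral over ℤ_p, and with h supported
in the degrees p^i, i ≥ 2, where π^n / n is small enough for the exponential to keep the rate. -/
theorem norm_coeff_theta_le (hπ : π ^ (p - 1) = -(p : K)) (n : ℕ) :
    ‖coeff n (theta p π)‖ ≤ rate p 1 ^ n := by
  classical
  have hp1 := hp.out.one_lt
  have hpp : π ^ p = -(p : K) * π := by
    rw [← hπ, ← pow_succ, Nat.sub_add_cancel hp.out.one_le]
  have hpK : (p : K) ≠ 0 := by exact_mod_cast hp.out.ne_zero
  set g := rescale π (artinHasseLog p K) with hg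
  set h := C π * (X - X ^ p) - g with hh
  have hg0 : constantCoeff g = 0 := by
    rw [hg, ← coeff_zero_eq_constantCoeff_apply, coeff_rescale]
    simp [constantCoeff_artinHasseLog]
  have hh0 : constantCoeff h = 0 := by
    rw [hh, map_sub, hg0]
    simp [hp.out.ne_zero]
  have hcoef : ∀ n, coeff n h = π * ((if n = 1 then 1 else 0) - if n = p then 1 else 0) -
      π ^ n * if ∃ i, n = p ^ i then (n : K)⁻¹ else 0 := by
    intro n
    rw [hh, map_sub, hg, coeff_rescale, coeff_C_mul, map_sub, coeff_X, coeff_X_pow, artinHasseLog,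
      coeff_mk]
  have hbound : ∀ n, ‖coeff n h‖ ≤ radius p * rate p 1 ^ n := by
    intro n
    have hr := radius_pos p
    have hr1 := rate_pos p 1
    rw [hcoef]
    by_cases hn : ∃ i, n = p ^ i
    · obtain ⟨i, rfl⟩ := hn
      have hex : ∃ k, p ^ i = p ^ k := ⟨i, rfl⟩
      rw [if_pos hex]
      clear hex
      match i with
      | 0 =>
        have h1 : ¬ (1 = p) := by omega
        simp only [pow_zero, if_true, h1, if_false, sub_zero, mul_one, pow_one, Nat.cast_one,
          inv_one, sub_self, norm_zero]
        positivity
      | 1 =>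
        have h1 : ¬ (p = 1) := by omega
        simp only [pow_one, if_true, h1, if_false, hpp]
        have : π * (0 - 1) - -(p : K) * π * (p : K)⁻¹ = 0 := by field_simp; ring
        rw [this, norm_zero]
        positivity
      | k + 2 =>
        have h1 : p < p ^ (k + 2) := by
          calc p = p ^ 1 := (pow_one p).symm
            _ < p ^ (k + 2) := Nat.pow_lt_pow_right hp1 (by omega)
        have h2 : ¬ (p ^ (k + 2) = p) := by omega
        have h3 : ¬ (p ^ (k + 2) = 1) := by omega
        rw [if_neg h3, if_neg h2, sub_zero, mul_zero, zero_sub, norm_neg, norm_mul,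
          norm_pow, norm_pi p hπ, norm_inv, Nat.cast_pow, norm_pow, norm_cast_prime p, inv_pow,
          inv_inv]
        exact radius_pow_prime_pow_le p k
    · rw [if_neg hn, if_neg fun h => hn ⟨0, by simpa using h⟩,
        if_neg fun h => hn ⟨1, by simpa using h⟩]
      simp
      positivity
  have e : theta p π = (exp K).subst g * (exp K).subst h := by
    rw [← exp_subst_add hg0 hh0, theta, hh, add_sub_cancel]
  have hE : ∀ n, ‖coeff n ((exp K).subst g)‖ ≤ 1 * rate p 1 ^ n := by
    intro n
    rw [hg, ← rescale_exp_subst (constantCoeff_artinHasseLog p K), ← map_artinHasseLog p,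
      ← map_exp_subst _ (constantCoeff_artinHasseLog p _), coeff_rescale, coeff_map, norm_mul,
      norm_algebraMap', norm_pow, norm_pi p hπ, one_mul]
    calc _ ≤ radius p ^ n * 1 := by
          gcongr
          · exact (pow_pos (radius_pos p) n).le
          · exact norm_coeff_artinHasse_le_one p n
      _ ≤ _ := by
          rw [mul_one]
          exact pow_le_pow_left₀ (radius_pos p).le (radius_le_rate_one p) n
  rw [e]
  have := norm_coeff_mul_le zero_le_one zero_le_one (rate_pos p 1).le hE
    (fun n => (norm_coeff_exp_subst_le p (rate_pos p 1).le hh0 hbound n).trans_eq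
      (one_mul _).symm) n
  simpa using this

/-- `exp π (z - z^(p^e))`. -/
def bigTheta (p e : ℕ) (π : K) : K⟦X⟧ := (exp K).subst (C π * (X - X ^ (p ^ e)))

theorem constantCoeff_bigTheta_log (e : ℕ) :
    constantCoeff (C π * (X - X ^ (p ^ e)) : K⟦X⟧) = 0 := by
  simp [hp.out.ne_zero]

theorem constantCoeff_bigTheta (e : ℕ) : constantCoeff (bigTheta p e π) = 1 :=
  constantCoeff_exp_subst (constantCoeff_bigTheta_log p e)

theorem bigTheta_zero : bigTheta p 0 π = 1 := by
  rw [bigTheta, pow_zero, pow_one, sub_self, mul_zero, exp_subst_zero]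

theorem bigTheta_one : bigTheta p 1 π = theta p π := by
  rw [bigTheta, pow_one, theta]

/-- The logarithms telescope: z - z^(p^(e+e')) is the sum of z - z^(p^e) and of z - z^(p^e') taken
at z^(p^e). With e' = 1 this turns the product of the θ(z^(p^i)) into a single exponential. -/
theorem bigTheta_add (e e' : ℕ) :
    bigTheta p (e + e') π =
      bigTheta p e π * expand (p ^ e) (pow_ne_zero e hp.out.ne_zero) (bigTheta p e' π) := by
  have h1 := constantCoeff_bigTheta_log p (π := π) e
  have h2 := constantCoeff_bigTheta_log p (π := π) e'
  have h3 : expand (p ^ e) (pow_ne_zero e hp.out.ne_zero) (C π * (X - X ^ (p ^ e')) : K⟦X⟧) =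
      C π * (X ^ (p ^ e) - X ^ (p ^ (e + e'))) := by
    simp only [map_mul, map_sub, map_pow, expand_C, expand_X]
    rw [← pow_mul, ← pow_add]
  rw [bigTheta, bigTheta, bigTheta, expand_exp_subst h2, h3, ← exp_subst_add h1]
  · congr 1; ring
  · simp [hp.out.ne_zero]

theorem norm_coeff_expand_le {f : K⟦X⟧} {ρ σ : ℝ} (hσ : 0 ≤ σ) {k : ℕ} (hk : k ≠ 0)
    (h : σ ^ k = ρ) (hf : ∀ n, ‖coeff n f‖ ≤ ρ ^ n) (n : ℕ) :
    ‖coeff n (expand k hk f)‖ ≤ σ ^ n := by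
  rw [coeff_expand]
  split_ifs with hd
  · obtain ⟨m, rfl⟩ := hd
    rw [Nat.mul_div_cancel_left _ (Nat.pos_of_ne_zero hk), pow_mul, h]
    exact hf m
  · simp only [norm_zero]; positivity

theorem norm_coeff_bigTheta_le (hπ : π ^ (p - 1) = -(p : K)) (e n : ℕ) :
    ‖coeff n (bigTheta p e π)‖ ≤ rate p e ^ n := by
  induction e generalizing n with
  | zero => rw [bigTheta_zero]; simpa using norm_coeff_one_le (rate_pos p 0).le n
  | succ e ih =>
    rw [bigTheta_add]
    have h1 : ∀ n, ‖coeff n (bigTheta p e π)‖ ≤ 1 * rate p (e + 1) ^ n := fun n => by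
      rw [one_mul]
      exact (ih n).trans (pow_le_pow_left₀ (rate_pos p e).le (rate_mono p (Nat.le_succ e)) n)
    have h2 := norm_coeff_expand_le (f := bigTheta p 1 π) (rate_pos p (e + 1)).le
      (pow_ne_zero e hp.out.ne_zero)
      (show rate p (e + 1) ^ p ^ e = rate p 1 by rw [add_comm e 1]; exact rate_pow p 1 e)
      (fun n => by rw [bigTheta_one]; exact norm_coeff_theta_le p hπ n)
    have := norm_coeff_mul_le zero_le_one zero_le_one (rate_pos p (e + 1)).le h1
      (fun n => (h2 n).trans_eq (one_mul _).symm) n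
    simpa using this

theorem bigTheta_ode (e : ℕ) :
    X * derivative K (bigTheta p e π) =
      C π * (X * bigTheta p e π - C ((p : K) ^ e) * (X ^ (p ^ e) * bigTheta p e π)) := by
  have hne : p ^ e ≠ 0 := pow_ne_zero e hp.out.ne_zero
  rw [bigTheta, derivative_exp_subst (constantCoeff_bigTheta_log p e), Derivation.leibniz,
    map_sub, derivative_pow, derivative_X, derivative_C]
  obtain ⟨m, hm⟩ := Nat.exists_eq_succ_of_ne_zero hne
  have hC : ((p ^ e : ℕ) : K⟦X⟧) = C ((p : K) ^ e) := by simp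
  rw [hC, hm]
  simp only [smul_eq_mul, Nat.succ_sub_one, Nat.succ_eq_add_one]
  ring

/-- This is z d/dz log Θ = π(z - p^e z^(p^e)), coefficient by coefficient. It is the only source of
the commutation of Frobenius with the Bessel operator. -/
theorem zcoeff_bigTheta_ode (e : ℕ) (n : ℤ) :
    (n : K) * zcoeff (bigTheta p e π) n = π * (zcoeff (bigTheta p e π) (n - 1) -
      (p : K) ^ e * zcoeff (bigTheta p e π) (n - (p ^ e : ℕ))) := by
  rcases lt_or_ge n 0 with hn | hn
  · rw [zcoeff_of_neg _ hn, zcoeff_of_neg _ (by omega), zcoeff_of_neg _ (by omega)]; simp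
  · lift n to ℕ using hn
    have h := congrArg (coeff n) (bigTheta_ode p (π := π) e)
    rw [coeff_C_mul, map_sub, coeff_C_mul] at h
    have e1 := zcoeff_X_pow_mul (bigTheta p e π) 1 n
    rw [zcoeff_natCast, pow_one] at e1
    have e2 := zcoeff_X_pow_mul (bigTheta p e π) (p ^ e) n
    rw [zcoeff_natCast] at e2
    rw [e1, e2] at h
    rw [zcoeff_natCast]
    have e3 : coeff n (X * derivative K (bigTheta p e π)) = (n : K) * coeff n (bigTheta p e π) := by
      cases n with
      | zero => simp
      | succ n => rw [coeff_succ_X_mul, coeff_derivative]; push_cast; ring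
    rw [e3] at h
    exact_mod_cast h

end SplittingFunction

/-! ### Series in `x` and `t / x` of product form -/

section ProductSeries

variable {K : Type*} [NormedField K]

/-- The coefficients of `f(x) g(t / x)`. -/
def prodSer (f g : K⟦X⟧) : ℕ → ℤ → K := fun N u => zcoeff f (N + u) * coeff N g

/-- Writing t^N x^u as x^(N+u) (t/x)^N separates the variables x and t/x, in which the product is
formed independently. The inner range of `serMul` is exactly the set of exponents of x where both
factors can be nonzero. -/
theorem serMul_prodSer (f g f' g' : K⟦X⟧) :
    serMul (prodSer f g) (prodSer f' g') = prodSer (f * f') (g * g') := by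
  funext N u
  simp only [serMul, prodSer]
  rcases lt_or_ge ((N : ℤ) + u) 0 with h | h
  · rw [zcoeff_of_neg _ h, zero_mul]
    refine Finset.sum_eq_zero fun i hi => ?_
    have hi := mem_antidiagonal.1 hi
    rw [Finset.Icc_eq_empty (by omega), Finset.sum_empty]
  · obtain ⟨n, hn⟩ := Int.eq_ofNat_of_zero_le h
    rw [hn, zcoeff_natCast, coeff_mul, coeff_mul, Finset.mul_sum]
    refine Finset.sum_congr rfl fun i hi => ?_
    have hi := mem_antidiagonal.1 hi
    rw [Finset.sum_mul]
    refine Finset.sum_nbij' (fun v => ((i.1 + v).toNat, (i.2 + (u - v)).toNat))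
      (fun k => (k.1 : ℤ) - i.1) ?_ ?_ ?_ ?_ ?_
    · intro v hv
      rw [Finset.mem_Icc] at hv
      rw [mem_antidiagonal]
      dsimp only
      omega
    · intro k hk
      have hk := mem_antidiagonal.1 hk
      rw [Finset.mem_Icc]
      omega
    · intro v hv
      rw [Finset.mem_Icc] at hv
      dsimp only
      omega
    · intro k hk
      have hk := mem_antidiagonal.1 hk
      ext
      · dsimp only; omega
      · dsimp only; omega
    · intro v hv
      rw [Finset.mem_Icc] at hv
      rw [zcoeff, zcoeff, if_pos (by omega), if_pos (by omega)]
      ring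

theorem serPow_prodSer (f g : K⟦X⟧) {k : ℕ} (hk : k ≠ 0) :
    serPow k (prodSer f g) = prodSer (expand k hk f) (expand k hk g) := by
  have hz : ∀ (f : K⟦X⟧) (n : ℤ), zcoeff (expand k hk f) n =
      if (k : ℤ) ∣ n then zcoeff f (n / k) else 0 := by
    intro f n
    have hk' : (0 : ℤ) < k := by exact_mod_cast Nat.pos_of_ne_zero hk
    rcases lt_or_ge n 0 with hn | hn
    · rw [zcoeff_of_neg _ hn]
      split_ifs
      · rw [zcoeff_of_neg _ (Int.ediv_neg_of_neg_of_pos hn hk')]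
      · rfl
    · lift n to ℕ using hn
      rw [zcoeff_natCast, coeff_expand]
      simp only [Int.natCast_dvd_natCast]
      split_ifs
      · rw [← Int.natCast_div, zcoeff_natCast]
      · rfl
  funext N u
  simp only [serPow, prodSer, hz, coeff_expand]
  by_cases h1 : k ∣ N
  · have h1' : (k : ℤ) ∣ N := Int.natCast_dvd_natCast.2 h1
    rw [if_pos h1]
    by_cases h2 : (k : ℤ) ∣ u
    · rw [if_pos ⟨h1, h2⟩, if_pos (dvd_add h1' h2), Int.add_ediv_of_dvd_left h1', Int.natCast_div]
    · rw [if_neg (fun h => h2 h.2), if_neg (fun h => h2 ((dvd_add_right h1').1 h)), zero_mul]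
  · rw [if_neg h1, if_neg (fun h => h1 h.1), mul_zero]

theorem serOne_eq : (serOne : ℕ → ℤ → K) = prodSer 1 1 := by
  funext N u
  simp only [serOne, prodSer, coeff_one]
  rcases Nat.eq_zero_or_pos N with rfl | hN
  · rcases lt_or_ge u 0 with hu | hu
    · rw [zcoeff_of_neg _ (by simpa using hu)]
      simp [hu.ne]
    · lift u to ℕ using hu
      rw [Nat.cast_zero, zero_add, zcoeff_natCast, coeff_one]
      simp
  · simp [hN.ne']

theorem zcoeff_one (n : ℤ) : zcoeff (1 : K⟦X⟧) n = if n = 0 then 1 else 0 := by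
  rcases lt_or_ge n 0 with hu | hu
  · rw [zcoeff_of_neg _ hu, if_neg hu.ne]
  · lift n to ℕ using hu
    rw [zcoeff_natCast, coeff_one]
    simp

theorem serPiTX_eq (π : K) : serPiTX π = prodSer 1 (C π * X) := by
  funext N u
  simp only [serPiTX, prodSer, zcoeff_one, coeff_C_mul, coeff_X]
  by_cases hN : N = 1
  · subst hN
    by_cases hu : u = -1
    · subst hu; simp
    · rw [if_neg (fun h => hu h.2), if_neg (by push_cast; omega)]; simp
  · simp [hN]

variable [CharZero K]

theorem serF_eq (p : ℕ) (π : K) : serF p π = prodSer (theta p π) (theta p π) := by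
  have h1 : thetaX p π = prodSer (theta p π) 1 := by
    funext N u
    simp only [thetaX, prodSer, coeff_one]
    by_cases hN : N = 0
    · subst hN
      simp [zcoeff]
    · simp [hN]
  have h2 : thetaTX p π = prodSer 1 (theta p π) := by
    funext N u
    simp only [thetaTX, prodSer, zcoeff_one]
    by_cases hN : u = -(N : ℤ)
    · rw [if_pos hN, if_pos (by omega), one_mul]
    · rw [if_neg hN, if_neg (by omega), zero_mul]
  rw [serF, h1, h2, serMul_prodSer, mul_one, one_mul]

variable [IsUltrametricDist K]

theorem serFm_eq (p : ℕ) [hp : Fact p.Prime] [NormedAlgebra ℚ_[p] K] (π : K) (m : ℕ) :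
    serFm p π m = prodSer (bigTheta p m π) (bigTheta p m π) := by
  induction m with
  | zero => rw [serFm, bigTheta_zero, serOne_eq]
  | succ m ih =>
    rw [serFm, ih, serF_eq, serPow_prodSer _ _ (pow_ne_zero m hp.out.ne_zero), serMul_prodSer,
      bigTheta_add, bigTheta_one]

theorem psiX_iterate (p a : ℕ) (A : ℕ → ℤ → K) (N : ℕ) (u : ℤ) :
    (psiX p)^[a] A N u = A N ((p : ℤ) ^ a * u) := by
  induction a generalizing A with
  | zero => simp
  | succ a ih =>
    rw [Function.iterate_succ_apply, ih, psiX, pow_succ]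
    congr 1
    ring

theorem alpha_prodSer (p : ℕ) [hp : Fact p.Prime] [NormedAlgebra ℚ_[p] K] (a : ℕ) (π : K) (f g : K⟦X⟧) (N : ℕ) (u : ℤ) :
    alpha p a π (prodSer f g) N u = zcoeff (bigTheta p a π * f) (N + (p : ℤ) ^ a * u) *
      coeff N (bigTheta p a π * g) := by
  rw [alpha, psiX_iterate, serFm_eq, serMul_prodSer, prodSer]

end ProductSeries

/-! ### The recursion that reduces modulo the image of `x ∂/∂x + π (x - s / x)` -/

section BesselRecursion

variable {R : Type*} [CommRing R]

/-- The coefficient of `x^v` in the polynomial `ρ_n` for which `x^n - (x ∂/∂x + π (x - s / x)) ρ_n`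
is a combination of `1` and `s / x`; here `ϖ = 1 / π`. -/
def besselR (ϖ s : R) (v : ℕ) : ℕ → R
  | 0 => 0
  | 1 => if v = 0 then ϖ else 0
  | n + 2 => (if v = n + 1 then ϖ else 0) - ((n + 1 : ℕ) : R) * ϖ * besselR ϖ s v (n + 1) +
      s * besselR ϖ s v n

variable {π ϖ : R} (s : R)

theorem besselR_zero (v : ℕ) : besselR ϖ s v 0 = 0 := rfl

theorem besselR_one (v : ℕ) : besselR ϖ s v 1 = if v = 0 then ϖ else 0 := rfl

theorem besselR_add_two (v n : ℕ) : besselR ϖ s v (n + 2) = (if v = n + 1 then ϖ else 0) -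
    ((n + 1 : ℕ) : R) * ϖ * besselR ϖ s v (n + 1) + s * besselR ϖ s v n := rfl

theorem besselR_eq_zero {v n : ℕ} (hn : n ≤ v) : besselR ϖ s v n = 0 := by
  induction n using Nat.strong_induction_on with
  | _ n ih =>
    match n with
    | 0 => rfl
    | 1 => rw [besselR_one, if_neg (by omega)]
    | n + 2 =>
      rw [besselR_add_two, ih (n + 1) (by omega) (by omega), ih n (by omega) (by omega),
        if_neg (by omega)]
      ring

theorem besselR_column (h : π * ϖ = 1) (v n : ℕ) :
    ((n + 1 : ℕ) : R) * besselR ϖ s v (n + 1) + π * besselR ϖ s v (n + 2) -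
      π * s * besselR ϖ s v n = if v = n + 1 then 1 else 0 := by
  have e : (if v = n + 1 then (1 : R) else 0) = π * if v = n + 1 then ϖ else 0 := by
    split_ifs <;> simp [h]
  rw [besselR_add_two, e]
  linear_combination (-(((n + 1 : ℕ) : R) * besselR ϖ s v (n + 1))) * h

/-- Whereas `besselR_column` restates the recursion in n, this is the differential equation in x:
the coefficient of x^(v+1) in D ρ_n is that of x^n. The induction works because the Bessel operator
applied to the inhomogeneous term of the recursion reproduces the same three terms. -/
theorem besselR_row (h : π * ϖ = 1) (v n : ℕ) :
    ((v + 1 : ℕ) : R) * besselR ϖ s (v + 1) n + π * besselR ϖ s v n -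
      π * s * besselR ϖ s (v + 2) n = if v + 1 = n then 1 else 0 := by
  induction n using Nat.strong_induction_on with
  | _ n ih =>
    match n with
    | 0 => simp [besselR_zero]
    | 1 =>
      simp only [besselR_one]
      by_cases hv : v = 0
      · subst hv; simp [h]
      · simp [hv]
    | n + 2 =>
      have h1 := ih (n + 1) (by omega)
      have h2 := ih n (by omega)
      rw [besselR_add_two, besselR_add_two, besselR_add_two]
      have e1 : (if v = n + 1 then (1 : R) else 0) = π * if v = n + 1 then ϖ else 0 := by
        split_ifs <;> simp [h]
      have e2 : (if v + 1 = n then (1 : R) else 0) = π * if v + 2 = n + 1 then ϖ else 0 := by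
        have : (v + 2 = n + 1) ↔ v + 1 = n := by omega
        simp only [this]
        split_ifs <;> simp [h]
      have e3 : (if v + 1 = n + 2 then (1 : R) else 0) = if v = n + 1 then (1 : R) else 0 := by
        have : (v + 1 = n + 2) ↔ v = n + 1 := by omega
        simp only [this]
      have e4 : ((v + 1 : ℕ) : R) * (if v + 1 = n + 1 then ϖ else 0) =
          ((n + 1 : ℕ) : R) * ϖ * if v + 1 = n + 1 then 1 else 0 := by
        split_ifs with hh
        · rw [hh]; ring
        · simp
      rw [e3, e1]
      linear_combination e4 - ((n + 1 : ℕ) : R) * ϖ * h1 + s * h2 + s * e2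

/-- The coordinates of `x^n`, for `i = 0` along `1`, for `i = 1` along `π s / x`. -/
def besselY (π ϖ s : R) (i : Fin 2) (n : ℕ) : R :=
  if i = 0 then (if n = 0 then 1 else 0) + π * s * besselR ϖ s 1 n else besselR ϖ s 0 n

theorem besselY_zero (n : ℕ) :
    besselY π ϖ s 0 n = (if n = 0 then 1 else 0) + π * s * besselR ϖ s 1 n := rfl

theorem besselY_one (n : ℕ) : besselY π ϖ s 1 n = besselR ϖ s 0 n := rfl

/-- The left side is the value of the coordinate functional on D(x^(n+1)) = (n+1) x^(n+1) + π
x^(n+2) - π s x^n; coordinates in cohomology must kill it. -/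
theorem besselY_rec (h : π * ϖ = 1) (i : Fin 2) (n : ℕ) :
    ((n + 1 : ℕ) : R) * besselY π ϖ s i (n + 1) + π * besselY π ϖ s i (n + 2) -
      π * s * besselY π ϖ s i n = 0 := by
  fin_cases i
  · have h1 := besselR_column s h 1 n
    change ((n + 1 : ℕ) : R) * besselY π ϖ s 0 (n + 1) + π * besselY π ϖ s 0 (n + 2) -
      π * s * besselY π ϖ s 0 n = 0
    rw [besselY_zero, besselY_zero, besselY_zero, if_neg (by omega), if_neg (by omega)]
    have e : (if 1 = n + 1 then (1 : R) else 0) = if n = 0 then 1 else 0 := by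
      have : (1 = n + 1) ↔ n = 0 := by omega
      simp only [this]
    rw [e] at h1
    linear_combination (π * s) * h1
  · have h1 := besselR_column s h 0 n
    rw [if_neg (by omega)] at h1
    exact h1

variable [TopologicalSpace R] [IsTopologicalRing R] [T2Space R]

/-- Summation by parts: once the shifts are moved from f to y the recursion makes every term vanish,
and only the contributions at the boundary index remain. -/
theorem hasSum_functional {y f : ℕ → R}
    (hy : ∀ n, ((n + 1 : ℕ) : R) * y (n + 1) + π * y (n + 2) - π * s * y n = 0)
    (h1 : Summable fun n => ((n + 1 : ℕ) : R) * (y (n + 1) * f (n + 1)))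
    (h2 : Summable fun n => y (n + 1) * f n) (h3 : Summable fun n => y n * f (n + 1)) :
    HasSum (fun n => y (n + 1) * (((n + 1 : ℕ) : R) * f (n + 1) + π * f n - π * s * f (n + 2)))
      (π * y 1 * f 0 + π * s * y 0 * f 1) := by
  have s2 := (hasSum_nat_add_iff' 1).2 h2.hasSum
  have s3 := (hasSum_nat_add_iff' 1).2 h3.hasSum
  simp only [Finset.range_one, Finset.sum_singleton] at s2 s3
  have total : HasSum (fun n => y (n + 1) * (((n + 1 : ℕ) : R) * f (n + 1) + π * f n -
      π * s * f (n + 2))) ((∑' n, ((n + 1 : ℕ) : R) * (y (n + 1) * f (n + 1))) +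
      π * (∑' n, y (n + 1) * f n) - π * s * ((∑' n, y n * f (n + 1)) - y 0 * f (0 + 1))) := by
    have := (h1.hasSum.add (h2.hasSum.mul_left π)).sub (s3.mul_left (π * s))
    refine this.congr_fun fun n => ?_
    ring
  have zero : HasSum (fun _ : ℕ => (0 : R))
      ((∑' n, ((n + 1 : ℕ) : R) * (y (n + 1) * f (n + 1))) +
      π * ((∑' n, y (n + 1) * f n) - y (0 + 1) * f 0) - π * s * (∑' n, y n * f (n + 1))) := by
    have := (h1.hasSum.add (s2.mul_left π)).sub (h3.hasSum.mul_left (π * s))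
    refine this.congr_fun fun n => ?_
    linear_combination (-f (n + 1)) * hy n
  have z := zero.unique hasSum_zero
  convert total using 1
  simp only [zero_add] at z ⊢
  linear_combination -z

end BesselRecursion

/-! ### Relative cohomology -/

section RelativeCohomology

variable {K : Type*} [NormedField K] [IsUltrametricDist K]

theorem norm_tsum_le_of_le {ι : Type*} {f : ι → K} {c : ℝ} (hc : 0 ≤ c) (h : ∀ i, ‖f i‖ ≤ c) :
    ‖∑' i, f i‖ ≤ c :=
  (IsUltrametricDist.norm_tsum_le f).trans (Real.iSup_le h hc)

theorem coeff_tsum {ι : Type*} {f : ι → K⟦X⟧} (hf : Summable f) (d : ℕ) :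
    coeff d (∑' i, f i) = ∑' i, coeff d (f i) :=
  ((WithPiTopology.hasSum_iff_hasSum_coeff K).1 hf.hasSum d).tsum_eq.symm

theorem norm_coeff_tsum_le {ι : Type*} {f : ι → K⟦X⟧} (hf : Summable f) {c : ℝ} (d : ℕ)
    (hc : 0 ≤ c) (h : ∀ i, ‖coeff d (f i)‖ ≤ c) : ‖coeff d (∑' i, f i)‖ ≤ c := by
  rw [coeff_tsum hf]
  exact norm_tsum_le_of_le hc h

/-- A step of the recursion either multiplies by an integer times ϖ, which costs at most β, or skips
two degrees at the price of t^q. The hypothesis `hσβ` says that two factors β outweigh the loss of q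
powers of σ. -/
theorem norm_coeff_besselR_le {ϖ : K} {q : ℕ} {σ β : ℝ} (hσ : 0 < σ) (hβ : ‖ϖ‖ ≤ β)
    (hσβ : 1 ≤ σ ^ q * β ^ 2) (hnat : ∀ n : ℕ, ‖(n : K)‖ ≤ 1) (v n d : ℕ) :
    ‖coeff d (besselR (C ϖ) (X ^ q) v (v + 1 + n))‖ ≤ ‖ϖ‖ * β ^ n * σ ^ d := by
  have hβ0 : 0 ≤ β := (norm_nonneg _).trans hβ
  have hC : ∀ d, ‖coeff d (C ϖ : K⟦X⟧)‖ ≤ ‖ϖ‖ * σ ^ d := by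
    intro d
    rw [coeff_C]
    split_ifs with h
    · simp [h]
    · rw [norm_zero]; positivity
  induction n using Nat.strong_induction_on generalizing d with
  | _ n ih =>
  match n with
  | 0 =>
    rw [add_zero, pow_zero, mul_one]
    cases v with
    | zero =>
      rw [zero_add, besselR_one, if_pos rfl]; exact hC d
    | succ v =>
      rw [besselR_add_two, if_pos rfl, besselR_eq_zero _ le_rfl, besselR_eq_zero _ (by omega)]
      simpa using hC d
  | n + 1 =>
    rw [show v + 1 + (n + 1) = v + n + 2 by ring, besselR_add_two, if_neg (by omega), zero_sub,
      map_add, map_neg]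
    apply norm_add_le_of_le
    · rw [norm_neg, mul_assoc, show ((v + n + 1 : ℕ) : K⟦X⟧) = C ((v + n + 1 : ℕ) : K) by simp,
        coeff_C_mul, coeff_C_mul, norm_mul, norm_mul]
      have h1 := ih n (by omega) d
      rw [show v + 1 + n = v + n + 1 by ring] at h1
      calc _ ≤ 1 * (β * (‖ϖ‖ * β ^ n * σ ^ d)) := by
            gcongr
            exact hnat _
        _ = _ := by ring
    · rw [coeff_X_pow_mul']
      split_ifs with hd
      · match n with
        | 0 => rw [besselR_eq_zero _ (by omega), map_zero, norm_zero]; positivity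
        | n + 1 =>
          have h1 := ih n (by omega) (d - q)
          rw [show v + 1 + n = v + (n + 1) by ring] at h1
          refine h1.trans ?_
          obtain ⟨e, rfl⟩ := Nat.exists_eq_add_of_le hd
          rw [Nat.add_sub_cancel_left, pow_add]
          calc ‖ϖ‖ * β ^ n * σ ^ e = ‖ϖ‖ * β ^ n * σ ^ e * 1 := by ring
            _ ≤ ‖ϖ‖ * β ^ n * σ ^ e * (σ ^ q * β ^ 2) := by gcongr
            _ = _ := by ring
      · rw [norm_zero]; positivity

/-- The coefficient of `x^n`. -/
def plusPart (A : ℕ → ℤ → K) (n : ℕ) : K⟦X⟧ := mk fun N => A N n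

/-- The coefficient of `(t^q / x)^n`. -/
def minusPart (q : ℕ) (A : ℕ → ℤ → K) (n : ℕ) : K⟦X⟧ := mk fun N => A (N + q * n) (-n)

theorem minusPart_zero (q : ℕ) (A : ℕ → ℤ → K) : minusPart q A 0 = plusPart A 0 := by
  ext N; simp [minusPart, plusPart]

theorem ser_ext {q : ℕ} {A B : ℕ → ℤ → K}
    (hA : ∀ (N : ℕ) (u : ℤ), N < q * (-u).toNat → A N u = 0)
    (hB : ∀ (N : ℕ) (u : ℤ), N < q * (-u).toNat → B N u = 0)
    (hp : ∀ n, plusPart A n = plusPart B n)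
    (hm : ∀ n, minusPart q A (n + 1) = minusPart q B (n + 1)) : A = B := by
  funext N u
  rcases lt_or_ge u 0 with hu | hu
  · obtain ⟨n, hn⟩ : ∃ n : ℕ, u = -((n + 1 : ℕ) : ℤ) := ⟨(-u).toNat - 1, by omega⟩
    rcases lt_or_ge N (q * (-u).toNat) with hN | hN
    · rw [hA _ _ hN, hB _ _ hN]
    · have h1 : (-u).toNat = n + 1 := by omega
      rw [h1] at hN
      have := congrArg (coeff (N - q * (n + 1))) (hm n)
      simp only [minusPart, coeff_mk] at this
      rwa [Nat.sub_add_cancel hN, ← hn] at this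
  · lift u to ℕ using hu
    have := congrArg (coeff N) (hp u)
    simpa [plusPart] using this

variable {q : ℕ} {π : K}

theorem plusPart_add (A B : ℕ → ℤ → K) (n : ℕ) :
    plusPart (A + B) n = plusPart A n + plusPart B n := by
  ext N; simp [plusPart]

theorem minusPart_add (A B : ℕ → ℤ → K) (n : ℕ) :
    minusPart q (A + B) n = minusPart q A n + minusPart q B n := by
  ext N; simp [minusPart]

theorem plusPart_bdry_succ (A : ℕ → ℤ → K) (n : ℕ) :
    plusPart (bdry q π A) (n + 1) = ((n + 1 : ℕ) : K⟦X⟧) * plusPart A (n + 1) +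
      C π * plusPart A n - C π * X ^ q * plusPart A (n + 2) := by
  ext N
  rw [show ((n + 1 : ℕ) : K⟦X⟧) = C ((n + 1 : ℕ) : K) by simp, map_sub, map_add, mul_assoc,
    coeff_C_mul, coeff_C_mul, coeff_C_mul, coeff_X_pow_mul']
  simp only [plusPart, coeff_mk, bdry]
  rw [show ((n + 1 : ℕ) : ℤ) - 1 = n by push_cast; ring,
    show ((n + 1 : ℕ) : ℤ) + 1 = (n + 2 : ℕ) by push_cast; ring]
  push_cast
  ring

theorem plusPart_bdry_zero {A : ℕ → ℤ → K}
    (hA : ∀ (N : ℕ) (u : ℤ), N < q * (-u).toNat → A N u = 0) :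
    plusPart (bdry q π A) 0 = C π * X ^ q * (minusPart q A 1 - plusPart A 1) := by
  ext N
  rw [mul_assoc, coeff_C_mul, coeff_X_pow_mul']
  simp only [plusPart, minusPart, coeff_mk, bdry, map_sub]
  split_ifs with h
  · rw [mul_one, Nat.sub_add_cancel h]
    simp
  · have h1 := hA N (-1) (by simp; omega)
    simp [h1]

/-- The substitution x ↦ t^q / x changes the sign of D. Both halves of a Laurent series are
therefore reduced by the same polynomials, with opposite signs. -/
theorem minusPart_bdry_succ {A : ℕ → ℤ → K}
    (hA : ∀ (N : ℕ) (u : ℤ), N < q * (-u).toNat → A N u = 0) (n : ℕ) :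
    minusPart q (bdry q π A) (n + 1) = -(((n + 1 : ℕ) : K⟦X⟧) * minusPart q A (n + 1) +
      C π * minusPart q A n - C π * X ^ q * minusPart q A (n + 2)) := by
  ext N
  rw [show ((n + 1 : ℕ) : K⟦X⟧) = C ((n + 1 : ℕ) : K) by simp, map_neg, map_sub, map_add, mul_assoc,
    coeff_C_mul, coeff_C_mul, coeff_C_mul, coeff_X_pow_mul']
  simp only [minusPart, coeff_mk, bdry]
  have e1 : -((n + 1 : ℕ) : ℤ) - 1 = -((n + 2 : ℕ) : ℤ) := by push_cast; ring
  have e2 : -((n + 1 : ℕ) : ℤ) + 1 = -(n : ℤ) := by push_cast; ring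
  have e3 : N + q * (n + 1) - q = N + q * n := by rw [mul_add, mul_one]; omega
  rw [e1, e2, if_pos (by nlinarith), e3]
  split_ifs with h
  · rw [show N - q + q * (n + 2) = N + q * (n + 1) by
      rw [mul_add, mul_add]; omega]
    push_cast
    ring
  · rw [hA (N + q * (n + 1)) (-((n + 2 : ℕ) : ℤ)) (by
      have : (- -((n + 2 : ℕ) : ℤ)).toNat = n + 2 := by omega
      rw [this, mul_add, mul_add]; omega)]
    push_cast
    ring

theorem plusPart_serV_zero (c : K⟦X⟧ × K⟦X⟧) : plusPart (serV q π c) 0 = c.1 := by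
  ext N; simp [plusPart, serV]

theorem plusPart_serV_succ (c : K⟦X⟧ × K⟦X⟧) (n : ℕ) : plusPart (serV q π c) (n + 1) = 0 := by
  ext N
  simp only [plusPart, serV, coeff_mk, map_zero]
  rw [if_neg (by omega), if_neg (by omega)]

theorem minusPart_serV_one (c : K⟦X⟧ × K⟦X⟧) : minusPart q (serV q π c) 1 = C π * c.2 := by
  ext N; simp [minusPart, serV, mul_comm]

theorem minusPart_serV_add_two (c : K⟦X⟧ × K⟦X⟧) (n : ℕ) :
    minusPart q (serV q π c) (n + 2) = 0 := by
  ext N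
  simp only [minusPart, serV, coeff_mk, map_zero]
  rw [if_neg (by omega), if_neg (by omega)]

theorem serV_support (c : K⟦X⟧ × K⟦X⟧) (N : ℕ) (u : ℤ) (h : N < q * (-u).toNat) :
    serV q π c N u = 0 := by
  simp only [serV]
  rw [if_neg, if_neg]
  · rintro ⟨rfl, h2⟩
    simp at h
    omega
  · rintro rfl
    simp at h

theorem bdry_support {A : ℕ → ℤ → K}
    (hA : ∀ (N : ℕ) (u : ℤ), N < q * (-u).toNat → A N u = 0) (N : ℕ) (u : ℤ)
    (h : N < q * (-u).toNat) : bdry q π A N u = 0 := by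
  simp only [bdry]
  rw [hA N u h, hA N (u - 1) (lt_of_lt_of_le h (Nat.mul_le_mul_left q (by omega)))]
  split_ifs with hq
  · have hu : (-u).toNat = (-(u + 1)).toNat + 1 := by
      rcases Nat.eq_zero_or_pos (-u).toNat with h0 | h0
      · rw [h0] at h; simp at h
      · omega
    rw [hA (N - q) (u + 1) (by rw [hu, mul_add] at h; omega)]
    simp
  · simp

/-! #### Reduction -/

/-- The coefficient of `x^v` in the reducing series of `∑ f(n) x^n`. -/
def besselSum (π : K) (q : ℕ) (f : ℕ → K⟦X⟧) (v : ℕ) : K⟦X⟧ :=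
  ∑' n, besselR (C π⁻¹) (X ^ q) v n * f n

/-- Here σ is the rate of decay in t, while γ and β are the inverse rates in x of the series to be
reduced and of its primitive. Reduction loses one factor 1/|π| per degree, whence `mul_le`; `one_le`
balances t^q against two powers of x. -/
structure ReductionBounds (π : K) (q : ℕ) (σ β γ : ℝ) : Prop where
  σ_pos : 0 < σ
  one_lt : 1 < ‖π⁻¹‖
  le : ‖π⁻¹‖ ≤ β
  one_le : 1 ≤ σ ^ q * β ^ 2
  mul_le : β * ‖π⁻¹‖ ≤ γ
  natCast : ∀ n : ℕ, ‖(n : K)‖ ≤ 1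

variable {σ β γ : ℝ} {f : ℕ → K⟦X⟧}

theorem ReductionBounds.beta_pos (H : ReductionBounds π q σ β γ) : 0 < β := by
  linarith [H.one_lt, H.le]

theorem ReductionBounds.beta_lt (H : ReductionBounds π q σ β γ) : β < γ := by
  nlinarith [H.one_lt, H.mul_le, H.beta_pos]

theorem ReductionBounds.ne_zero (H : ReductionBounds π q σ β γ) : π ≠ 0 := by
  rintro rfl
  have := H.one_lt
  simp at this
  linarith

theorem norm_coeff_besselR_mul_le (H : ReductionBounds π q σ β γ)
    (hf : ∀ n d, ‖coeff d (f n)‖ ≤ (γ⁻¹) ^ n * σ ^ d) (v n d : ℕ) :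
    ‖coeff d (besselR (C π⁻¹) (X ^ q) v (v + 1 + n) * f (v + 1 + n))‖ ≤
      ‖π⁻¹‖ * β ^ n * (γ⁻¹) ^ (v + 1 + n) * σ ^ d := by
  have hβ := H.beta_pos
  have hγ := hβ.trans H.beta_lt
  exact norm_coeff_mul_le (by positivity) (by positivity) H.σ_pos.le
    (norm_coeff_besselR_le H.σ_pos H.le H.one_le H.natCast v n) (hf _) d

theorem summable_besselR_mul [CompleteSpace K] (H : ReductionBounds π q σ β γ)
    (hf : ∀ n d, ‖coeff d (f n)‖ ≤ (γ⁻¹) ^ n * σ ^ d) (v : ℕ) :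
    Summable fun n => besselR (C π⁻¹) (X ^ q) v n * f n := by
  have hβ := H.beta_pos
  have hγ := hβ.trans H.beta_lt
  rw [WithPiTopology.summable_iff_summable_coeff]
  intro d
  rw [← summable_nat_add_iff (v + 1)]
  refine Summable.of_norm_bounded (g := fun n => ‖π⁻¹‖ * (γ⁻¹) ^ (v + 1) * σ ^ d * (β / γ) ^ n)
    ((summable_geometric_of_lt_one (by positivity) ((div_lt_one hγ).2 H.beta_lt)).mul_left _) ?_
  intro n
  rw [add_comm n]
  refine (norm_coeff_besselR_mul_le H hf v n d).trans_eq ?_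
  rw [pow_add, div_eq_mul_inv, mul_pow]
  ring

theorem norm_coeff_besselSum_le [CompleteSpace K] (H : ReductionBounds π q σ β γ)
    (hf : ∀ n d, ‖coeff d (f n)‖ ≤ (γ⁻¹) ^ n * σ ^ d) (v d : ℕ) :
    ‖coeff d (besselSum π q f v)‖ ≤ (β⁻¹) ^ (v + 1) * σ ^ d := by
  have hβ := H.beta_pos
  have hγ := hβ.trans H.beta_lt
  have hσ := H.σ_pos
  refine norm_coeff_tsum_le (summable_besselR_mul H hf v) d (by positivity) fun n => ?_
  rcases le_or_gt n v with hn | hn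
  · rw [besselR_eq_zero _ hn, zero_mul, map_zero, norm_zero]
    positivity
  · obtain ⟨m, rfl⟩ := Nat.exists_eq_add_of_le (show v + 1 ≤ n from hn)
    refine (norm_coeff_besselR_mul_le H hf v m d).trans ?_
    gcongr
    rw [inv_pow, inv_pow, ← div_eq_mul_inv, div_le_iff₀ (by positivity),
      inv_mul_eq_div, le_div_iff₀ (by positivity)]
    -- The single factor 1/|π| > 1 is raised to the full degree, so that β/|π| ≤ γ can be used
    -- degree by degree.
    calc ‖π⁻¹‖ * β ^ m * β ^ (v + 1) = β ^ (v + 1 + m) * ‖π⁻¹‖ ^ 1 := by ring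
      _ ≤ β ^ (v + 1 + m) * ‖π⁻¹‖ ^ (v + 1 + m) := by
          gcongr
          · exact H.one_lt.le
          · omega
      _ = (β * ‖π⁻¹‖) ^ (v + 1 + m) := by rw [mul_pow]
      _ ≤ _ := by
          gcongr
          exact H.mul_le

theorem besselSum_row [CompleteSpace K] (H : ReductionBounds π q σ β γ)
    (hf : ∀ n d, ‖coeff d (f n)‖ ≤ (γ⁻¹) ^ n * σ ^ d) (v : ℕ) :
    ((v + 1 : ℕ) : K⟦X⟧) * besselSum π q f (v + 1) + C π * besselSum π q f v -
      C π * X ^ q * besselSum π q f (v + 2) = f (v + 1) := by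
  have hC : (C π : K⟦X⟧) * C π⁻¹ = 1 := by
    rw [← map_mul, mul_inv_cancel₀ H.ne_zero, map_one]
  have hs := fun v => (summable_besselR_mul H hf v).hasSum
  have h1 := (((hs (v + 1)).mul_left (((v + 1 : ℕ) : K⟦X⟧))).add ((hs v).mul_left (C π))).sub
    ((hs (v + 2)).mul_left (C π * X ^ q))
  have h2 : HasSum (fun n => if n = v + 1 then f (v + 1) else 0) (f (v + 1)) := hasSum_ite_eq _ _
  refine h1.unique (h2.congr_fun fun n => ?_)
  have h3 := besselR_row (X ^ q : K⟦X⟧) hC v n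
  have e : (if n = v + 1 then f (v + 1) else 0) = (if v + 1 = n then 1 else 0) * f n := by
    by_cases h : n = v + 1
    · subst h; simp
    · rw [if_neg h, if_neg (Ne.symm h), zero_mul]
  rw [e, ← h3]
  ring

/-- The positive half is reduced by P = ∑ A_n ρ_n, and the negative half by the analogous M, which
enters η with a minus sign because D changes sign under x ↦ t^q / x. Only the terms at x^0 and at
t^q / x are left over. The correction to the constant coordinate is divisible by t^q, hence the
value at t = 0 is not affected. -/
theorem exists_reduction [CompleteSpace K] (H : ReductionBounds π q σ β γ) (hq : q ≠ 0)
    {A : ℕ → ℤ → K} (hA : ∀ (N : ℕ) (u : ℤ), N < q * (-u).toNat → A N u = 0)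
    (hp : ∀ n d, ‖coeff d (plusPart A n)‖ ≤ (γ⁻¹) ^ n * σ ^ d)
    (hm : ∀ n d, ‖coeff d (minusPart q A n)‖ ≤ (γ⁻¹) ^ n * σ ^ d) :
    ∃ (c : K⟦X⟧ × K⟦X⟧) (η : ℕ → ℤ → K), A = serV q π c + bdry q π η ∧
      (∀ (N : ℕ) (u : ℤ), N < q * (-u).toNat → η N u = 0) ∧
      (∀ n d, ‖coeff d (plusPart η n)‖ ≤ (β⁻¹) ^ (n + 1) * σ ^ d) ∧
      (∀ n d, ‖coeff d (minusPart q η (n + 1))‖ ≤ (β⁻¹) ^ (n + 2) * σ ^ d) ∧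
      (∀ d, ‖coeff d c.1‖ ≤ σ ^ d) ∧ (∀ d, ‖coeff d c.2‖ ≤ β⁻¹ * σ ^ d) ∧
      constantCoeff c.1 = A 0 0 := by
  have hβ := H.beta_pos
  have hσ := H.σ_pos
  set P := besselSum π q (plusPart A) with hP
  set M := besselSum π q (minusPart q A) with hM
  have bP := norm_coeff_besselSum_le H hp
  have bM := norm_coeff_besselSum_le H hm
  rw [← hP] at bP
  rw [← hM] at bM
  let η : ℕ → ℤ → K := fun N u =>
    if 0 ≤ u then coeff N (P u.toNat)
    else if q * (-u).toNat ≤ N then -coeff (N - q * (-u).toNat) (M (-u).toNat) else 0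
  have hη : ∀ (N : ℕ) (u : ℤ), N < q * (-u).toNat → η N u = 0 := by
    intro N u h
    have : ¬ (0 ≤ u) := by
      intro h0
      rw [show (-u).toNat = 0 by omega] at h
      simp at h
    simp [η, this, not_le.2 h]
  have ηp : ∀ n, plusPart η n = P n := by
    intro n; ext N; simp [plusPart, η]
  have ηm : ∀ n, minusPart q η (n + 1) = -M (n + 1) := by
    intro n
    ext N
    have h1 : (- -((n + 1 : ℕ) : ℤ)).toNat = n + 1 := by omega
    simp only [minusPart, coeff_mk, η, map_neg, h1]
    rw [if_neg (by omega), if_pos (by omega), Nat.add_sub_cancel]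
  -- These are the defects of D η at x^0 and, divided by π, at t^q / x; the positive and negative
  -- halves meet in both.
  let c : K⟦X⟧ × K⟦X⟧ := (plusPart A 0 + C π * X ^ q * (P 1 + M 1), P 0 + M 0)
  refine ⟨c, η, ?_, hη, fun n d => ?_, fun n d => ?_, fun d => ?_, fun d => ?_, ?_⟩
  · refine ser_ext hA (fun N u h => ?_) (fun n => ?_) (fun n => ?_)
    · rw [Pi.add_apply, Pi.add_apply, serV_support c N u h, bdry_support hη N u h, add_zero]
    · rw [plusPart_add]
      cases n with
      | zero =>
        rw [plusPart_serV_zero, plusPart_bdry_zero hη, ηm 0, ηp]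
        simp only [c]
        ring
      | succ n =>
        rw [plusPart_serV_succ, plusPart_bdry_succ, ηp, ηp, ηp, zero_add, hP,
          besselSum_row H hp]
    · rw [minusPart_add, minusPart_bdry_succ hη]
      cases n with
      | zero =>
        rw [zero_add, minusPart_serV_one, ηm 0, ηm 1, minusPart_zero, ηp]
        have h1 := besselSum_row H hm 0
        rw [← hM] at h1
        simp only [zero_add] at h1 ⊢
        rw [← h1]
        simp only [c]
        ring
      | succ n =>
        rw [minusPart_serV_add_two, ηm, ηm, ηm]
        have h1 := besselSum_row H hm (n + 1)
        rw [← hM] at h1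
        rw [← h1]
        ring
  · rw [ηp]; exact bP n d
  · rw [ηm, map_neg, norm_neg]; exact bM (n + 1) d
  · simp only [c]
    rw [map_add]
    apply norm_add_le_of_le
    · simpa using hp 0 d
    · rw [mul_assoc, coeff_C_mul, coeff_X_pow_mul']
      split_ifs with h
      · rw [norm_mul, map_add]
        have h1 : ‖coeff (d - q) (P 1) + coeff (d - q) (M 1)‖ ≤ (β⁻¹) ^ 2 * σ ^ (d - q) :=
          norm_add_le_of_le (bP 1 _) (bM 1 _)
        have h2 : ‖π‖ ≤ 1 := by
          have := H.one_lt
          rw [norm_inv] at this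
          exact (one_lt_inv_iff₀.1 this).2.le
        have h3 : (β⁻¹) ^ 2 ≤ σ ^ q := by
          rw [inv_pow, inv_le_iff_one_le_mul₀ (by positivity)]
          exact H.one_le
        calc _ ≤ 1 * (σ ^ q * σ ^ (d - q)) := by
              gcongr
              exact h1.trans (by gcongr)
          _ = _ := by rw [one_mul, ← pow_add, Nat.add_sub_cancel' h]
      · rw [mul_zero, norm_zero]; positivity
  · simp only [c]
    rw [map_add]
    have := norm_add_le_of_le (bP 0 d) (bM 0 d)
    simpa using this
  · simp only [c, map_add, map_mul, map_pow, constantCoeff_X, zero_pow hq]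
    simp [plusPart]

end RelativeCohomology

/-! ### Uniqueness of coordinates in relative cohomology -/

section FrobeniusCoordinates

theorem hasSum_of_eq {ι α : Type*} [AddCommMonoid α] [TopologicalSpace α] {f g : ι → α} {x y : α}
    (h : HasSum f x) (hf : ∀ i, g i = f i) (hx : y = x) : HasSum g y := by
  rw [funext hf, hx]
  exact h

variable {K : Type*} [NormedField K] [IsUltrametricDist K]

theorem norm_coeff_besselY_le {π : K} {q : ℕ} (h1 : 1 < ‖π⁻¹‖)
    (hnat : ∀ n : ℕ, ‖(n : K)‖ ≤ 1) (i : Fin 2) (n d : ℕ) :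
    ‖coeff d (besselY (C π) (C π⁻¹) (X ^ q) i n)‖ ≤ ‖π⁻¹‖ ^ n := by
  have hR : ∀ v m d, ‖coeff d (besselR (C π⁻¹) (X ^ q) v (v + 1 + m))‖ ≤ ‖π⁻¹‖ ^ (m + 1) := by
    intro v m d
    have := norm_coeff_besselR_le (σ := 1) (β := ‖π⁻¹‖) (q := q) one_pos le_rfl
      (by rw [one_pow, one_mul]; exact one_le_pow₀ h1.le) hnat v m d
    rw [one_pow, mul_one] at this
    rwa [pow_succ, mul_comm]
  fin_cases i
  · change ‖coeff d (besselY (C π) (C π⁻¹) (X ^ q) 0 n)‖ ≤ ‖π⁻¹‖ ^ n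
    rw [besselY_zero, map_add]
    apply norm_add_le_of_le
    · split_ifs with h
      · subst h
        have := norm_coeff_one_le (K := K) zero_le_one d
        simpa using this
      · simp
    · rw [mul_assoc, coeff_C_mul, coeff_X_pow_mul']
      have hπ : ‖π‖ ≤ 1 := by
        rw [norm_inv] at h1
        exact (one_lt_inv_iff₀.1 h1).2.le
      split_ifs with hd
      · rcases le_or_gt n 1 with hn | hn
        · rw [besselR_eq_zero _ hn, map_zero, mul_zero, norm_zero]; positivity
        · obtain ⟨m, rfl⟩ := Nat.exists_eq_add_of_le (show 1 + 1 ≤ n from hn)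
          rw [norm_mul]
          calc _ ≤ 1 * ‖π⁻¹‖ ^ (m + 1) := by
                gcongr
                exact hR 1 m _
            _ ≤ _ := by
                rw [one_mul]
                exact pow_le_pow_right₀ h1.le (by omega)
      · simp
  · change ‖coeff d (besselY (C π) (C π⁻¹) (X ^ q) 1 n)‖ ≤ ‖π⁻¹‖ ^ n
    rw [besselY_one]
    cases n with
    | zero => rw [besselR_zero]; simp
    | succ m =>
      have := hR 0 m d
      rwa [zero_add, add_comm 1 m] at this

theorem summable_mul_of_geometric [CompleteSpace K] {y f : ℕ → K⟦X⟧} {A B c d : ℝ} (hA : 0 ≤ A)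
    (hB : 0 ≤ B) (hAB : A * B < 1) (hc : 0 ≤ c) (hd : 0 ≤ d)
    (hy : ∀ n e, ‖coeff e (y n)‖ ≤ c * A ^ n) (hf : ∀ n e, ‖coeff e (f n)‖ ≤ d * B ^ n) :
    Summable fun n => y n * f n := by
  rw [WithPiTopology.summable_iff_summable_coeff]
  intro e
  refine Summable.of_norm_bounded (g := fun n => c * d * (A * B) ^ n)
    ((summable_geometric_of_lt_one (by positivity) hAB).mul_left _) fun n => ?_
  have := norm_coeff_mul_le (c := c * A ^ n) (d := d * B ^ n) (by positivity) (by positivity)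
    zero_le_one (by simpa using hy n) (by simpa using hf n) e
  refine this.trans_eq ?_
  rw [one_pow, mul_pow]
  ring

variable {π : K} {q : ℕ}

/-- The boundary terms of the two halves are subtracted: the contribution of the common constant
coefficient cancels, and what remains is minus the pairing at x^0. In total the functional vanishes
on the image of D. Convergence uses β > 1/|π|, since the functional grows like |π|^(-n). -/
theorem hasSum_besselY_mul_bdry [CompleteSpace K] (h1 : 1 < ‖π⁻¹‖)
    (hnat : ∀ n : ℕ, ‖(n : K)‖ ≤ 1) {A : ℕ → ℤ → K}
    (hA : ∀ (N : ℕ) (u : ℤ), N < q * (-u).toNat → A N u = 0) {c β : ℝ} (hβ : ‖π⁻¹‖ < β)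
    (hp : ∀ n d, ‖coeff d (plusPart A n)‖ ≤ c * (β⁻¹) ^ n)
    (hm : ∀ n d, ‖coeff d (minusPart q A n)‖ ≤ c * (β⁻¹) ^ n) (i : Fin 2) :
    HasSum (fun n => besselY (C π) (C π⁻¹) (X ^ q) i (n + 1) *
      (plusPart (bdry q π A) (n + 1) + minusPart q (bdry q π A) (n + 1)))
      (-(besselY (C π) (C π⁻¹) (X ^ q) i 0 * plusPart (bdry q π A) 0)) := by
  set y := besselY (C π) (C π⁻¹) (X ^ q) i with hy
  have hC : (C π : K⟦X⟧) * C π⁻¹ = 1 := by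
    rw [← map_mul, mul_inv_cancel₀, map_one]
    rintro rfl
    simp at h1
    linarith
  have hβ0 : 0 < β := by linarith
  have hc : 0 ≤ c := by
    have := (norm_nonneg _).trans (hp 0 0)
    simpa using this
  have key : ∀ f : ℕ → K⟦X⟧, (∀ n d, ‖coeff d (f n)‖ ≤ c * (β⁻¹) ^ n) →
      HasSum (fun n => y (n + 1) * (((n + 1 : ℕ) : K⟦X⟧) * f (n + 1) + C π * f n -
        C π * X ^ q * f (n + 2))) (C π * y 1 * f 0 + C π * X ^ q * y 0 * f 1) := by
    intro f hf
    have by' := norm_coeff_besselY_le (q := q) h1 hnat i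
    rw [← hy] at by'
    have hlt : ‖π⁻¹‖ * β⁻¹ < 1 := by
      rw [← div_eq_mul_inv]; exact (div_lt_one hβ0).2 hβ
    have by1 : ∀ n e, ‖coeff e (y (n + 1))‖ ≤ ‖π⁻¹‖ * ‖π⁻¹‖ ^ n := fun n e => by
      rw [← pow_succ']; exact by' _ _
    have bf1 : ∀ n e, ‖coeff e (f (n + 1))‖ ≤ c * β⁻¹ * (β⁻¹) ^ n := fun n e => by
      rw [mul_assoc, ← pow_succ']; exact hf _ _
    refine hasSum_functional (X ^ q) (besselY_rec _ hC i) ?_ ?_ ?_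
    · have := summable_mul_of_geometric (y := fun n => ((n + 1 : ℕ) : K⟦X⟧) * y (n + 1))
        (f := fun n => f (n + 1)) (norm_nonneg _) (by positivity) hlt (by positivity)
        (by positivity) (c := ‖π⁻¹‖) (d := c * β⁻¹) (fun n e => ?_) bf1
      · simpa only [mul_assoc] using this
      · rw [show ((n + 1 : ℕ) : K⟦X⟧) = C ((n + 1 : ℕ) : K) by simp, coeff_C_mul, norm_mul]
        calc _ ≤ 1 * (‖π⁻¹‖ * ‖π⁻¹‖ ^ n) := by
              gcongr
              · exact hnat _
              · exact by1 n e
          _ = _ := one_mul _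
    · exact summable_mul_of_geometric (norm_nonneg _) (by positivity) hlt (by positivity) hc by1 hf
    · exact summable_mul_of_geometric (norm_nonneg _) (by positivity) hlt zero_le_one
        (by positivity) (by simpa using by') bf1
  have kp := key (plusPart A) hp
  have km := key (minusPart q A) hm
  refine hasSum_of_eq (kp.sub km) (fun n => ?_) ?_
  · rw [plusPart_bdry_succ, minusPart_bdry_succ hA]
    ring
  · rw [plusPart_bdry_zero hA, minusPart_zero]
    ring

/-- The two coordinate functionals converge on the series allowed here, kill exact series and
separate 1 from π t^q / x. -/
theorem reduction_unique [CompleteSpace K] (h1 : 1 < ‖π⁻¹‖)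
    (hnat : ∀ n : ℕ, ‖(n : K)‖ ≤ 1) {η η' : ℕ → ℤ → K} {c c' : K⟦X⟧ × K⟦X⟧}
    (hη : ∀ (N : ℕ) (u : ℤ), N < q * (-u).toNat → η N u = 0)
    (hη' : ∀ (N : ℕ) (u : ℤ), N < q * (-u).toNat → η' N u = 0) {r r' β : ℝ} (hβ : ‖π⁻¹‖ < β)
    (hp : ∀ n d, ‖coeff d (plusPart η n)‖ ≤ r * (β⁻¹) ^ n)
    (hm : ∀ n d, ‖coeff d (minusPart q η n)‖ ≤ r * (β⁻¹) ^ n)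
    (hp' : ∀ n d, ‖coeff d (plusPart η' n)‖ ≤ r' * (β⁻¹) ^ n)
    (hm' : ∀ n d, ‖coeff d (minusPart q η' n)‖ ≤ r' * (β⁻¹) ^ n)
    (h : serV q π c + bdry q π η = serV q π c' + bdry q π η') : c = c' := by
  have hC : (C π : K⟦X⟧) * C π⁻¹ = 1 := by
    rw [← map_mul, mul_inv_cancel₀, map_one]
    rintro rfl
    simp at h1
    linarith
  have key : ∀ (c : K⟦X⟧ × K⟦X⟧) (η : ℕ → ℤ → K) (r : ℝ)
      (_ : ∀ (N : ℕ) (u : ℤ), N < q * (-u).toNat → η N u = 0)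
      (_ : ∀ n d, ‖coeff d (plusPart η n)‖ ≤ r * (β⁻¹) ^ n)
      (_ : ∀ n d, ‖coeff d (minusPart q η n)‖ ≤ r * (β⁻¹) ^ n) (i : Fin 2),
      HasSum (fun n => besselY (C π) (C π⁻¹) (X ^ q) i (n + 1) *
        (plusPart (serV q π c + bdry q π η) (n + 1) + minusPart q (serV q π c + bdry q π η) (n + 1)))
      (besselY (C π) (C π⁻¹) (X ^ q) i 0 * c.1 + besselY (C π) (C π⁻¹) (X ^ q) i 1 * (C π * c.2)
        - besselY (C π) (C π⁻¹) (X ^ q) i 0 * plusPart (serV q π c + bdry q π η) 0) := by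
    intro c η r hη hp hm i
    have k1 := hasSum_besselY_mul_bdry h1 hnat hη hβ hp hm i
    have k2 : HasSum (fun n => besselY (C π) (C π⁻¹) (X ^ q) i (n + 1) *
        (plusPart (serV q π c) (n + 1) + minusPart q (serV q π c) (n + 1)))
        (besselY (C π) (C π⁻¹) (X ^ q) i (0 + 1) *
        (plusPart (serV q π c) (0 + 1) + minusPart q (serV q π c) (0 + 1))) := by
      apply hasSum_single
      intro n hn
      obtain ⟨m, rfl⟩ := Nat.exists_eq_succ_of_ne_zero hn
      rw [plusPart_serV_succ, minusPart_serV_add_two]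
      ring
    rw [plusPart_serV_succ, zero_add, zero_add, minusPart_serV_one] at k2
    refine hasSum_of_eq (k2.add k1) (fun n => ?_) ?_
    · rw [plusPart_add, minusPart_add]
      ring
    · rw [plusPart_add, plusPart_serV_zero]
      ring
  have e : ∀ i, besselY (C π) (C π⁻¹) (X ^ q) i 0 * c.1 +
      besselY (C π) (C π⁻¹) (X ^ q) i 1 * (C π * c.2) =
      besselY (C π) (C π⁻¹) (X ^ q) i 0 * c'.1 +
      besselY (C π) (C π⁻¹) (X ^ q) i 1 * (C π * c'.2) := by
    intro i
    have k1 := key c η r hη hp hm i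
    have k2 := key c' η' r' hη' hp' hm' i
    rw [h] at k1
    exact sub_left_injective (k1.unique k2)
  have e0 := e 0
  have e1 := e 1
  simp only [besselY_zero, besselY_one, besselR_zero, besselR_one, if_true, one_ne_zero, if_false,
    mul_zero, add_zero, zero_add, zero_mul, one_mul] at e0 e1
  ext1
  · exact e0
  · have := e1
    rwa [← mul_assoc, ← mul_assoc, mul_comm (C π⁻¹), hC, one_mul, one_mul] at this

end FrobeniusCoordinates

/-! ### The relative Frobenius -/

/-- The hypotheses on the parameters. -/
structure Params (p a : ℕ) [Fact p.Prime] {K : Type*} [NormedField K] (π : K) (b b' : ℝ) :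
    Prop where
  five_le : 5 ≤ p
  pi_pow : π ^ (p - 1) = -(p : K)
  a_ne : a ≠ 0
  lt_b : 1 / ((p : ℝ) - 1) < b
  b_le : b ≤ ((p : ℝ) - 1) / p - 1 / ((p : ℝ) - 1)
  b'_pos : 0 < b'
  b'_le : b' ≤ b

section RelativeFrobenius

variable {p a : ℕ} [hp : Fact p.Prime] {K : Type*} [NormedField K] [NormedAlgebra ℚ_[p] K]
  [CharZero K] [IsUltrametricDist K] [CompleteSpace K] {π : K} {b b' : ℝ}

/-- `p ^ (-2 b' / p^a)`. -/
def decay (p a : ℕ) (b' : ℝ) : ℝ := (p : ℝ) ^ (-(2 * (b' / (p : ℝ) ^ a)))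

theorem decay_pos : 0 < decay p a b' := Real.rpow_pos_of_pos (by linarith [one_lt_cast p]) _

theorem decay_lt_one (H : Params p a π b b') : decay p a b' < 1 := by
  have h := one_lt_cast p
  have := H.b'_pos
  refine Real.rpow_lt_one_of_one_lt_of_neg h (neg_neg_of_pos ?_)
  positivity

theorem decay_pow (n : ℕ) : decay p a b' ^ n = (p : ℝ) ^ (-(2 * (b' / (p : ℝ) ^ a) * n)) := by
  rw [decay, ← Real.rpow_natCast, ← Real.rpow_mul (by positivity)]
  congr 1
  ring

theorem norm_inv_pi (hπ : π ^ (p - 1) = -(p : K)) :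
    ‖π⁻¹‖ = (p : ℝ) ^ (1 / ((p : ℝ) - 1)) := by
  rw [norm_inv, norm_pi p hπ, radius, Real.rpow_neg (by positivity), inv_inv]

theorem rate_zero_inv : (rate p 0)⁻¹ = (p : ℝ) ^ (((p : ℝ) - 1) / p) := by
  rw [rate, Real.rpow_neg (by positivity), inv_inv, pow_zero, div_one]

/-- With σ = p^(-2b'/q), β = p^b and γ = p^((p-1)/p) the conditions become 1/(p-1) ≤ b, b' ≤ b and b
+ 1/(p-1) ≤ (p-1)/p, which is what the hypotheses on b and b' provide. -/
theorem Params.reductionBounds (H : Params p a π b b') :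
    ReductionBounds π (p ^ a) (decay p a b') ((p : ℝ) ^ b) (rate p 0)⁻¹ where
  σ_pos := decay_pos
  one_lt := by
    rw [norm_inv_pi H.pi_pow]
    have h := one_lt_cast p
    apply Real.one_lt_rpow h
    apply one_div_pos.2
    linarith
  le := by
    rw [norm_inv_pi H.pi_pow]
    exact Real.rpow_le_rpow_of_exponent_le (one_lt_cast p).le H.lt_b.le
  one_le := by
    have h := one_lt_cast p
    have h0 : (0 : ℝ) < p := by linarith
    rw [decay_pow, ← Real.rpow_natCast ((p : ℝ) ^ b), ← Real.rpow_mul h0.le, ← Real.rpow_add h0]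
    apply Real.one_le_rpow h.le
    push_cast
    have : 2 * (b' / (p : ℝ) ^ a) * (p : ℝ) ^ a = 2 * b' := by field_simp
    rw [this]
    linarith [H.b'_le]
  mul_le := by
    have h := one_lt_cast p
    have h0 : (0 : ℝ) < p := by linarith
    rw [norm_inv_pi H.pi_pow, rate_zero_inv, ← Real.rpow_add h0]
    apply Real.rpow_le_rpow_of_exponent_le h.le
    linarith [H.b_le]
  natCast := norm_natCast_le_one p

/-- A power t^d in Θ(x)Θ(t/x) is paid for twice, once by each factor; this is why the weight of t is
2b'/q. -/
theorem rate_sq_le_decay (H : Params p a π b b') : rate p a ^ 2 ≤ decay p a b' := by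
  have h := one_lt_cast p
  have h0 : (0 : ℝ) < p := by linarith
  rw [rate, decay, ← Real.rpow_natCast, ← Real.rpow_mul h0.le]
  apply Real.rpow_le_rpow_of_exponent_le h.le
  have h1 : b' ≤ ((p : ℝ) - 1) / p := by
    have : 0 < 1 / ((p : ℝ) - 1) := one_div_pos.2 (by linarith)
    linarith [H.b'_le, H.b_le]
  have h2 : b' / (p : ℝ) ^ a ≤ ((p : ℝ) - 1) / p / (p : ℝ) ^ a := by gcongr
  push_cast
  linarith

theorem alpha_support (a : ℕ) (π : K) (f g : K⟦X⟧) (N : ℕ) (u : ℤ)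
    (h : N < p ^ a * (-u).toNat) : alpha p a π (prodSer f g) N u = 0 := by
  rw [alpha_prodSer, zcoeff_of_neg, zero_mul]
  rcases lt_or_ge u 0 with hu | hu
  · have h1 : ((-u).toNat : ℤ) = -u := Int.toNat_of_nonneg (by omega)
    have h2 : (N : ℤ) < (p : ℤ) ^ a * (-u) := by
      rw [← h1]; exact_mod_cast h
    linarith
  · rw [show (-u).toNat = 0 by omega] at h
    simp at h

theorem memK_bounds {η : ℕ → ℤ → K} {q : ℕ} (hη : MemK p q (b' / (p : ℝ) ^ a) b η) :
    ∃ r : ℝ, (∀ n d, ‖coeff d (plusPart η n)‖ ≤ r * (((p : ℝ) ^ b)⁻¹) ^ n * decay p a b' ^ d) ∧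
      ∀ n d, ‖coeff d (minusPart q η n)‖ ≤ r * (((p : ℝ) ^ b)⁻¹) ^ n * decay p a b' ^ d := by
  have h := one_lt_cast p
  have h0 : (0 : ℝ) < p := by linarith
  obtain ⟨-, ρ, hρ⟩ := hη
  have key : ∀ n d : ℕ, (p : ℝ) ^ (-(2 * (b' / (p : ℝ) ^ a) * d + b * n + ρ)) =
      (p : ℝ) ^ (-ρ) * (((p : ℝ) ^ b)⁻¹) ^ n * decay p a b' ^ d := by
    intro n d
    rw [← Real.rpow_neg h0.le, ← Real.rpow_natCast (_ ^ _) n, ← Real.rpow_mul h0.le, decay_pow,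
      ← Real.rpow_add h0, ← Real.rpow_add h0]
    congr 1
    ring
  refine ⟨(p : ℝ) ^ (-ρ), fun n d => ?_, fun n d => ?_⟩
  · have := hρ d n
    simp only [OrdGE] at this
    have e : (-(n : ℤ)).toNat = 0 := by omega
    rw [e, mul_zero, add_zero] at this
    simp only [plusPart, coeff_mk]
    rw [← key]
    simpa using this
  · have := hρ d (-n)
    simp only [OrdGE] at this
    simp only [minusPart, coeff_mk]
    rw [← key]
    simpa using this

/-- Existence and size of the coordinates of the relative Frobenius. -/
theorem exists_isFrobCoords (H : Params p a π b b') {g : K⟦X⟧}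
    (hg : ∀ d, ‖coeff d (bigTheta p a π * g)‖ ≤ rate p a ^ d) :
    ∃ c, IsFrobCoords p a b' b π (prodSer 1 g) c ∧
      (∀ d, ‖coeff d c.1‖ ≤ decay p a b' ^ d) ∧
      (∀ d, ‖coeff d c.2‖ ≤ ((p : ℝ) ^ b)⁻¹ * decay p a b' ^ d) ∧
      constantCoeff c.1 = constantCoeff g := by
  have h := one_lt_cast p
  have h0 : (0 : ℝ) < p := by linarith
  have hr := rate_pos p a
  have hθ := norm_zcoeff_le hr (norm_coeff_bigTheta_le p H.pi_pow a)
  -- After ψ_x^a the coefficient of x^n comes from degree d + p^a n of Θ(x), and rate(a)^(p^a) =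
  -- rate(0) = 1/γ gives the decay in x needed by the reduction.
  have hbound : ∀ n d : ℕ, rate p a ^ (d + p ^ a * n) * rate p a ^ d ≤
      ((rate p 0)⁻¹⁻¹) ^ n * decay p a b' ^ d := by
    intro n d
    rw [inv_inv, pow_add, rate_zero_pow, show rate p a ^ d * rate p 0 ^ n * rate p a ^ d =
      rate p 0 ^ n * (rate p a ^ 2) ^ d by ring]
    have := rate_pos p 0
    gcongr
    exact rate_sq_le_decay H
  obtain ⟨c, η, hA, hη, bp, bm, b1, b2, b3⟩ := exists_reduction H.reductionBounds
    (pow_ne_zero a hp.out.ne_zero) (A := alpha p a π (prodSer 1 g)) (alpha_support a π 1 g) (by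
      intro n d
      simp only [plusPart, coeff_mk]
      rw [alpha_prodSer, norm_mul, mul_one]
      refine le_trans (mul_le_mul ?_ (hg d) (norm_nonneg _) (by positivity)) (hbound n d)
      have := hθ (d + (p : ℤ) ^ a * n)
      rw [show (d : ℤ) + (p : ℤ) ^ a * n = ((d + p ^ a * n : ℕ) : ℤ) by push_cast; ring,
        zpow_natCast] at this
      exact_mod_cast this) (by
      intro n d
      simp only [minusPart, coeff_mk]
      rw [alpha_prodSer, norm_mul, mul_one, mul_comm]
      refine le_trans (mul_le_mul (hg _) ?_ (norm_nonneg _) (by positivity)) (hbound n d)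
      have := hθ (d : ℤ)
      rw [zpow_natCast] at this
      rwa [show ((d + p ^ a * n : ℕ) : ℤ) + (p : ℤ) ^ a * -(n : ℤ) = d by push_cast; ring])
  have hbpos : (0 : ℝ) < (p : ℝ) ^ b := Real.rpow_pos_of_pos h0 _
  have hb1 : ((p : ℝ) ^ b)⁻¹ ≤ 1 := by
    apply inv_le_one_of_one_le₀
    apply Real.one_le_rpow h.le
    have : 0 < 1 / ((p : ℝ) - 1) := one_div_pos.2 (by linarith)
    linarith [H.lt_b]
  have hdec := decay_pos (p := p) (a := a) (b' := b')
  refine ⟨c, ⟨⟨0, fun n => ?_⟩, ⟨b, fun n => ?_⟩, η, ⟨hη, 0, fun n u => ?_⟩, hA⟩, b1, b2, ?_⟩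
  · have := b1 n
    rw [decay_pow] at this
    rw [OrdGE, add_zero]
    exact this
  · have := b2 n
    rw [decay_pow, ← Real.rpow_neg h0.le, ← Real.rpow_add h0] at this
    rw [OrdGE]
    convert this using 2
    ring
  · have key : ∀ m : ℕ, (((p : ℝ) ^ b)⁻¹) ^ m * decay p a b' ^ n =
        (p : ℝ) ^ (-(2 * (b' / (p : ℝ) ^ a) * n + b * m + 0)) := by
      intro m
      rw [← Real.rpow_neg h0.le, ← Real.rpow_natCast (_ ^ _) m, ← Real.rpow_mul h0.le, decay_pow,
        ← Real.rpow_add h0]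
      congr 1
      ring
    rw [OrdGE]
    rcases lt_or_ge u 0 with hu | hu
    · obtain ⟨m, rfl⟩ : ∃ m : ℕ, u = -((m + 1 : ℕ) : ℤ) := ⟨(-u).toNat - 1, by omega⟩
      have h1 := bm m n
      have e : (- -((m + 1 : ℕ) : ℤ)).toNat = m + 1 := by omega
      rw [e]
      simp only [minusPart, coeff_mk] at h1
      refine h1.trans ?_
      have h2 := key (m + 1)
      rw [show |((-((m + 1 : ℕ) : ℤ) : ℤ) : ℝ)| = ((m + 1 : ℕ) : ℝ) by
        rw [Int.cast_neg, abs_neg, Int.cast_natCast]; exact abs_of_nonneg (Nat.cast_nonneg _)]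
      rw [← h2]
      gcongr 1
      exact pow_le_pow_of_le_one (by positivity) hb1 (by omega)
    · lift u to ℕ using hu
      have h1 := bp u n
      have e : (-(u : ℤ)).toNat = 0 := by omega
      rw [e, mul_zero, add_zero]
      simp only [plusPart, coeff_mk] at h1
      refine h1.trans ?_
      have h2 := key u
      rw [show |((u : ℤ) : ℝ)| = (u : ℝ) by
        rw [Int.cast_natCast]; exact abs_of_nonneg (Nat.cast_nonneg _)]
      rw [← h2]
      gcongr 1
      exact pow_le_pow_of_le_one (by positivity) hb1 (by omega)
  · rw [b3, alpha_prodSer]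
    have e : ((0 : ℕ) : ℤ) + (p : ℤ) ^ a * 0 = ((0 : ℕ) : ℤ) := by simp
    rw [e, zcoeff_natCast]
    simp [constantCoeff_bigTheta]

theorem isFrobCoords_unique (H : Params p a π b b') {ξ : ℕ → ℤ → K} {c c' : K⟦X⟧ × K⟦X⟧}
    (h : IsFrobCoords p a b' b π ξ c) (h' : IsFrobCoords p a b' b π ξ c') : c = c' := by
  obtain ⟨-, -, η, hη, e⟩ := h
  obtain ⟨-, -, η', hη', e'⟩ := h'
  obtain ⟨r, hp, hm⟩ := memK_bounds hη
  obtain ⟨r', hp', hm'⟩ := memK_bounds hη'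
  have hβ : ‖π⁻¹‖ < (p : ℝ) ^ b := by
    rw [norm_inv_pi H.pi_pow]
    exact Real.rpow_lt_rpow_of_exponent_lt (one_lt_cast p) H.lt_b
  have hd0 := decay_pos (p := p) (a := a) (b' := b')
  have hd1 := (decay_lt_one H).le
  have weak : ∀ {r : ℝ} {f : ℕ → K⟦X⟧},
      (∀ n d, ‖coeff d (f n)‖ ≤ r * (((p : ℝ) ^ b)⁻¹) ^ n * decay p a b' ^ d) →
      ∀ n d, ‖coeff d (f n)‖ ≤ r * (((p : ℝ) ^ b)⁻¹) ^ n := by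
    intro r f hf n d
    have h0 : 0 ≤ r * (((p : ℝ) ^ b)⁻¹) ^ n := by
      have := (norm_nonneg _).trans (hf n 0)
      simpa using this
    exact (hf n d).trans (mul_le_of_le_one_right h0 (pow_le_one₀ hd0.le hd1))
  exact reduction_unique H.reductionBounds.one_lt H.reductionBounds.natCast hη.1 hη'.1 hβ (weak hp)
    (weak hm) (weak hp') (weak hm') (e.symm.trans e')

/-- The coordinates of the relative Frobenius applied to `1` (`i = 0`) and to `π t / x`
(`i = 1`). -/
def frobColumn (p a : ℕ) (b' b : ℝ) (π : K) (i : Fin 2) : K⟦X⟧ × K⟦X⟧ :=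
  frobCoords p a b' b π (prodSer 1 (if i = 0 then 1 else C π * X))

/-- For the second column the shift by t is compensated by |π| ≤ `rate p a`, so both columns obey
the same bounds. -/
theorem frobColumn_spec (H : Params p a π b b') (i : Fin 2) :
    IsFrobCoords p a b' b π (prodSer 1 (if i = 0 then 1 else C π * X)) (frobColumn p a b' b π i) ∧
      (∀ d, ‖coeff d (frobColumn p a b' b π i).1‖ ≤ decay p a b' ^ d) ∧
      (∀ d, ‖coeff d (frobColumn p a b' b π i).2‖ ≤ ((p : ℝ) ^ b)⁻¹ * decay p a b' ^ d) ∧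
      constantCoeff (frobColumn p a b' b π i).1 = if i = 0 then 1 else 0 := by
  have hg : ∀ d, ‖coeff d (bigTheta p a π * (if i = 0 then 1 else C π * X))‖ ≤ rate p a ^ d := by
    intro d
    have hθ := norm_coeff_bigTheta_le p H.pi_pow a
    split_ifs
    · rw [mul_one]; exact hθ d
    · rw [show bigTheta p a π * (C π * X) = C π * (bigTheta p a π * X) by ring, coeff_C_mul,
        norm_mul, norm_pi p H.pi_pow]
      cases d with
      | zero => simp
      | succ d =>
        rw [coeff_succ_mul_X, pow_succ']
        have h1 := (radius_le_rate_one p).trans (rate_mono p (Nat.one_le_iff_ne_zero.2 H.a_ne))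
        exact mul_le_mul h1 (hθ d) (norm_nonneg _) (rate_pos p a).le
  obtain ⟨c, hc, h1, h2, h3⟩ := exists_isFrobCoords H hg
  have he : frobColumn p a b' b π i = c :=
    isFrobCoords_unique H (Classical.epsilon_spec ⟨c, hc⟩) hc
  rw [he]
  refine ⟨hc, h1, h2, h3.trans ?_⟩
  split_ifs <;> simp

end RelativeFrobenius

/-! ### Families indexed by the integers -/

section IntegerSums

theorem summable_pow_natAbs {r : ℝ} (h0 : 0 ≤ r) (h1 : r < 1) :
    Summable fun n : ℤ => r ^ n.natAbs := by
  apply Summable.of_nat_of_neg <;> simpa using summable_geometric_of_lt_one h0 h1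

theorem pow_natAbs_add_le {A : ℝ} (hA : 1 ≤ A) (u k : ℤ) :
    A ^ (u + k).natAbs ≤ A ^ k.natAbs * A ^ u.natAbs := by
  rw [← pow_add]
  exact pow_le_pow_right₀ hA (by omega)

theorem inv_pow_natAbs_add_le {A : ℝ} (hA : 1 ≤ A) (u k : ℤ) :
    (A⁻¹) ^ (u + k).natAbs ≤ A ^ k.natAbs * (A⁻¹) ^ u.natAbs := by
  have hA0 : 0 < A := by linarith
  rw [inv_pow, inv_pow, ← div_eq_mul_inv, le_div_iff₀ (by positivity),
    inv_mul_le_iff₀ (by positivity), ← pow_add]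
  exact pow_le_pow_right₀ hA (by omega)

end IntegerSums

/-! ### The fibre: reduction modulo the image of `x d/dx + π (x - s / x)` -/

section FibreReduction

variable {L : Type*} [NormedField L] [IsUltrametricDist L]

theorem norm_besselR_le {ϖ s : L} (hϖ : 1 ≤ ‖ϖ‖) (hs : ‖s‖ ≤ 1)
    (hnat : ∀ n : ℕ, ‖(n : L)‖ ≤ 1) (v n : ℕ) :
    ‖besselR ϖ s v n‖ ≤ ‖ϖ‖ ^ n * (‖ϖ‖⁻¹) ^ v := by
  have hϖ0 : 0 < ‖ϖ‖ := by linarith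
  induction n using Nat.strong_induction_on with
  | _ n ih =>
    match n with
    | 0 => rw [besselR_zero, norm_zero]; positivity
    | 1 =>
      rw [besselR_one]
      split_ifs with h
      · simp [h]
      · rw [norm_zero]; positivity
    | n + 2 =>
      rw [besselR_add_two]
      refine norm_add_le_of_le (norm_sub_le_of_le ?_ ?_) ?_
      · split_ifs with h
        · subst h
          rw [inv_pow, ← div_eq_mul_inv, le_div_iff₀ (by positivity)]
          exact le_of_eq (by ring)
        · rw [norm_zero]; positivity
      · rw [norm_mul, norm_mul]
        calc _ ≤ 1 * ‖ϖ‖ * (‖ϖ‖ ^ (n + 1) * (‖ϖ‖⁻¹) ^ v) := by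
              gcongr
              · exact hnat _
              · exact ih (n + 1) (by omega)
          _ = _ := by ring
      · rw [norm_mul]
        calc _ ≤ 1 * (‖ϖ‖ ^ n * (‖ϖ‖⁻¹) ^ v) := by
              gcongr
              exact ih n (by omega)
          _ ≤ ‖ϖ‖ ^ (n + 2) * (‖ϖ‖⁻¹) ^ v := by
              rw [one_mul]
              gcongr 1
              exact pow_le_pow_right₀ hϖ (by omega)

/-- The functionals on Laurent series that vanish on the image of `x d/dx + π (x - s / x)`. -/
def fibreC (π s : L) (i : Fin 2) (u : ℤ) : L :=
  besselY π π⁻¹ s i u.natAbs * if 0 ≤ u then 1 else s ^ u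

/-- The matrix of the left inverse of `x d/dx + π (x - s / x)`. -/
def fibreR (π s : L) (v u : ℤ) : L :=
  if 0 ≤ u then (if 0 ≤ v then besselR π⁻¹ s v.natAbs u.natAbs else 0)
  else if 0 ≤ v then 0 else -(besselR π⁻¹ s v.natAbs u.natAbs * s ^ (u - v))

variable {π s : L}

theorem fibreC_natCast (i : Fin 2) (n : ℕ) : fibreC π s i n = besselY π π⁻¹ s i n := by
  simp [fibreC]

theorem fibreC_neg (i : Fin 2) (n : ℕ) :
    fibreC π s i (-(n : ℤ)) = besselY π π⁻¹ s i n * s ^ (-(n : ℤ)) := by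
  rcases Nat.eq_zero_or_pos n with rfl | hn
  · simp [fibreC]
  · rw [fibreC, if_neg (by omega), Int.natAbs_neg, Int.natAbs_natCast]

theorem int_trichotomy (u : ℤ) : u = 0 ∨ (∃ n : ℕ, u = (n + 1 : ℕ)) ∨ ∃ n : ℕ, u = -((n + 1 : ℕ) : ℤ) := by
  rcases lt_trichotomy u 0 with h | h | h
  · exact Or.inr (Or.inr ⟨(-u).toNat - 1, by omega⟩)
  · exact Or.inl h
  · exact Or.inr (Or.inl ⟨u.toNat - 1, by omega⟩)

theorem besselY_at_one (hπ : π ≠ 0) (i : Fin 2) : π * besselY π π⁻¹ s i 1 = if i = 0 then 0 else 1 := by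
  fin_cases i
  · simp [besselY, besselR_one]
  · simp [besselY, besselR_one, hπ]

theorem fibreC_rec (hπ : π ≠ 0) (hs : s ≠ 0) (i : Fin 2) (u : ℤ) :
    (u : L) * fibreC π s i u + π * fibreC π s i (u + 1) - π * s * fibreC π s i (u - 1) = 0 := by
  have hrec := besselY_rec s (mul_inv_cancel₀ hπ) i
  rcases int_trichotomy u with rfl | ⟨n, rfl⟩ | ⟨n, rfl⟩
  · rw [zero_add, zero_sub, show (1 : ℤ) = ((1 : ℕ) : ℤ) by rfl, fibreC_natCast, fibreC_neg]
    simp only [Int.cast_zero, zero_mul, zero_add, Nat.cast_one, zpow_neg_one]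
    field_simp
    ring
  · rw [show ((n + 1 : ℕ) : ℤ) + 1 = ((n + 2 : ℕ) : ℤ) by push_cast; ring,
      show ((n + 1 : ℕ) : ℤ) - 1 = (n : ℤ) by push_cast; ring, fibreC_natCast, fibreC_natCast,
      fibreC_natCast, Int.cast_natCast]
    exact hrec n
  · rw [show -((n + 1 : ℕ) : ℤ) + 1 = -(n : ℤ) by push_cast; ring,
      show -((n + 1 : ℕ) : ℤ) - 1 = -((n + 2 : ℕ) : ℤ) by push_cast; ring, fibreC_neg, fibreC_neg,
      fibreC_neg]
    have e1 : s ^ (-(n : ℤ)) = s * s ^ (-((n + 1 : ℕ) : ℤ)) := by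
      rw [← zpow_one_add₀ hs]; congr 1; push_cast; ring
    have e2 : s * s ^ (-((n + 2 : ℕ) : ℤ)) = s ^ (-((n + 1 : ℕ) : ℤ)) := by
      rw [← zpow_one_add₀ hs, show 1 + -((n + 2 : ℕ) : ℤ) = -((n + 1 : ℕ) : ℤ) by omega]
    have := hrec n
    rw [e1]
    push_cast at this ⊢
    push_cast at e2
    linear_combination (-s ^ (-((n : ℤ) + 1))) * this - π * besselY π π⁻¹ s i (n + 2) * e2

/-- The extreme coefficients π and πs of the recurrence are invertible, so a solution is determined
in both directions by its values at 0 and -1. -/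
theorem rec_eq_fibreC (hπ : π ≠ 0) (hs : s ≠ 0) {f : ℤ → L}
    (hf : ∀ u : ℤ, (u : L) * f u + π * f (u + 1) - π * s * f (u - 1) = 0) (u : ℤ) :
    f u = f 0 * fibreC π s 0 u + π * s * f (-1) * fibreC π s 1 u := by
  set d : ℤ → L := fun u => f u - (f 0 * fibreC π s 0 u + π * s * f (-1) * fibreC π s 1 u) with hd
  have hrec : ∀ u : ℤ, (u : L) * d u + π * d (u + 1) - π * s * d (u - 1) = 0 := by
    intro u
    have h0 := fibreC_rec hπ hs 0 u
    have h1 := fibreC_rec hπ hs 1 u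
    simp only [hd]
    linear_combination hf u - f 0 * h0 - π * s * f (-1) * h1
  have b0 : π * besselY π π⁻¹ s 0 1 = 0 := by rw [besselY_at_one hπ]; simp
  have b1 : π * besselY π π⁻¹ s 1 1 = 1 := by rw [besselY_at_one hπ]; simp
  have d0 : d 0 = 0 := by
    have e0 : fibreC π s 0 0 = 1 := by simp [fibreC, besselY, besselR_zero]
    have e1 : fibreC π s 1 0 = 0 := by simp [fibreC, besselY, besselR_zero]
    simp [hd, e0, e1]
  have dm : d (-1) = 0 := by
    have e0 : fibreC π s 0 (-1) = 0 := by
      have := fibreC_neg (π := π) (s := s) 0 1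
      rw [(mul_eq_zero.1 b0).resolve_left hπ, zero_mul] at this
      exact_mod_cast this
    have e1 : π * s * fibreC π s 1 (-1) = 1 := by
      have := fibreC_neg (π := π) (s := s) 1 1
      rw [Nat.cast_one] at this
      rw [this, zpow_neg_one, show π * s * (besselY π π⁻¹ s 1 1 * s⁻¹) =
        (π * besselY π π⁻¹ s 1 1) * (s * s⁻¹) by ring, b1, mul_inv_cancel₀ hs, one_mul]
    simp only [hd, e0]
    linear_combination (-f (-1)) * e1
  have up : ∀ n : ℕ, d n = 0 ∧ d ((n : ℤ) - 1) = 0 := by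
    intro n
    induction n with
    | zero => simpa using ⟨d0, dm⟩
    | succ n ih =>
      have := hrec n
      rw [ih.1, ih.2] at this
      refine ⟨?_, ?_⟩
      · push_cast
        simpa [hπ] using this
      · rw [show ((n + 1 : ℕ) : ℤ) - 1 = n by push_cast; ring]; exact ih.1
  have down : ∀ n : ℕ, d (-(n : ℤ)) = 0 ∧ d (-(n : ℤ) - 1) = 0 := by
    intro n
    induction n with
    | zero => simpa using ⟨d0, dm⟩
    | succ n ih =>
      have e : -((n + 1 : ℕ) : ℤ) = -(n : ℤ) - 1 := by push_cast; ring
      have := hrec (-(n : ℤ) - 1)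
      rw [sub_add_cancel, ih.1, ih.2] at this
      refine ⟨by rw [e]; exact ih.2, ?_⟩
      rw [e]
      simpa [hπ, hs] using this
  have : d u = 0 := by
    rcases Int.eq_nat_or_neg u with ⟨n, rfl | rfl⟩
    · exact (up n).1
    · exact (down n).1
  simpa [hd, sub_eq_zero] using this

theorem norm_fibreC_le (hπ : 1 ≤ ‖π⁻¹‖) (hs : ‖s‖ = 1) (hnat : ∀ n : ℕ, ‖(n : L)‖ ≤ 1)
    (i : Fin 2) (u : ℤ) : ‖fibreC π s i u‖ ≤ ‖π⁻¹‖ ^ u.natAbs := by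
  have hπ0 : 0 < ‖π⁻¹‖ := by linarith
  have h1 : ‖if 0 ≤ u then (1 : L) else s ^ u‖ = 1 := by
    split_ifs
    · simp
    · rw [norm_zpow, hs, one_zpow]
  rw [fibreC, norm_mul, h1, mul_one]
  have hR := norm_besselR_le hπ hs.le hnat
  fin_cases i
  · change ‖(if u.natAbs = 0 then 1 else 0) + π * s * besselR π⁻¹ s 1 u.natAbs‖ ≤ _
    apply norm_add_le_of_le
    · split_ifs with h
      · simp [h]
      · rw [norm_zero]; positivity
    · rw [norm_mul, norm_mul, hs, mul_one]
      calc ‖π‖ * ‖besselR π⁻¹ s 1 u.natAbs‖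
          ≤ ‖π‖ * (‖π⁻¹‖ ^ u.natAbs * (‖π⁻¹‖⁻¹) ^ 1) := by
            gcongr
            exact hR 1 _
        _ ≤ 1 * (‖π⁻¹‖ ^ u.natAbs * 1) := by
            have e : ‖π‖ ≤ 1 := by
              rw [norm_inv] at hπ
              exact (one_le_inv_iff₀.1 hπ).2
            gcongr
            rw [pow_one]
            exact inv_le_one_of_one_le₀ hπ
        _ = _ := by ring
  · have := hR 0 u.natAbs
    rw [pow_zero, mul_one] at this
    exact this

theorem norm_fibreR_le (hπ : 1 ≤ ‖π⁻¹‖) (hs : ‖s‖ = 1) (hnat : ∀ n : ℕ, ‖(n : L)‖ ≤ 1)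
    (v u : ℤ) : ‖fibreR π s v u‖ ≤ ‖π⁻¹‖ ^ u.natAbs * (‖π⁻¹‖⁻¹) ^ v.natAbs := by
  have hπ0 : 0 < ‖π⁻¹‖ := by linarith
  have hR := norm_besselR_le hπ hs.le hnat
  rw [fibreR]
  split_ifs
  · exact hR _ _
  · rw [norm_zero]; positivity
  · rw [norm_zero]; positivity
  · rw [norm_neg, norm_mul, norm_zpow, hs, one_zpow, mul_one]; exact hR _ _

theorem fibreR_nat_nat (v u : ℕ) : fibreR π s v u = besselR π⁻¹ s v u := by
  simp [fibreR]

theorem fibreR_neg_nat (v u : ℕ) : fibreR π s (-((v + 1 : ℕ) : ℤ)) u = 0 := by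
  rw [fibreR, if_pos (by omega), if_neg (by omega)]

theorem fibreR_nat_neg (v u : ℕ) : fibreR π s v (-((u + 1 : ℕ) : ℤ)) = 0 := by
  rw [fibreR, if_neg (by omega), if_pos (by omega)]

theorem fibreR_neg_neg (v u : ℕ) : fibreR π s (-((v + 1 : ℕ) : ℤ)) (-((u + 1 : ℕ) : ℤ)) =
    -(besselR π⁻¹ s (v + 1) (u + 1) * s ^ ((v : ℤ) - u)) := by
  rw [fibreR, if_neg (by omega), if_neg (by omega)]
  simp only [Int.natAbs_neg, Int.natAbs_natCast]
  congr 3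
  push_cast
  ring

/-- As matrices this says R D = 1: D is injective, and the complex has no cohomology in degree zero.
-/
theorem fibreR_column (hπ : π ≠ 0) (hs : s ≠ 0) (v u : ℤ) :
    (u : L) * fibreR π s v u + π * fibreR π s v (u + 1) - π * s * fibreR π s v (u - 1) =
      if v = u then 1 else 0 := by
  have hcol := besselR_column s (mul_inv_cancel₀ hπ)
  have e0 : (0 : ℤ) = ((0 : ℕ) : ℤ) := rfl
  have nat_case : ∀ (v : ℕ) (u : ℤ), (u : L) * fibreR π s v u + π * fibreR π s v (u + 1) -
      π * s * fibreR π s v (u - 1) = if (v : ℤ) = u then 1 else 0 := by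
    intro v u
    rcases int_trichotomy u with rfl | ⟨n, rfl⟩ | ⟨n, rfl⟩
    · rw [show (0 : ℤ) + 1 = ((1 : ℕ) : ℤ) by rfl,
        show (0 : ℤ) - 1 = -((0 + 1 : ℕ) : ℤ) by rfl, fibreR_nat_neg, fibreR_nat_nat, besselR_one]
      by_cases hv : v = 0
      · subst hv; simp [hπ]
      · simp [hv]
    · rw [show ((n + 1 : ℕ) : ℤ) + 1 = ((n + 2 : ℕ) : ℤ) by push_cast; ring,
        show ((n + 1 : ℕ) : ℤ) - 1 = (n : ℤ) by push_cast; ring, fibreR_nat_nat, fibreR_nat_nat,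
        fibreR_nat_nat, Int.cast_natCast, hcol v n]
      simp only [Nat.cast_inj]
    · rw [if_neg (by omega), show -((n + 1 : ℕ) : ℤ) - 1 = -((n + 1 + 1 : ℕ) : ℤ) by
        push_cast; ring, fibreR_nat_neg, fibreR_nat_neg]
      cases n with
      | zero =>
        rw [show -((0 + 1 : ℕ) : ℤ) + 1 = ((0 : ℕ) : ℤ) by rfl, fibreR_nat_nat, besselR_zero]
        ring
      | succ n =>
        rw [show -((n + 1 + 1 : ℕ) : ℤ) + 1 = -((n + 1 : ℕ) : ℤ) by push_cast; ring,
          fibreR_nat_neg]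
        ring
  rcases int_trichotomy v with rfl | ⟨m, rfl⟩ | ⟨m, rfl⟩
  · exact_mod_cast nat_case 0 u
  · exact nat_case (m + 1) u
  · rcases int_trichotomy u with rfl | ⟨n, rfl⟩ | ⟨n, rfl⟩
    · rw [if_neg (by omega), show (0 : ℤ) + 1 = ((1 : ℕ) : ℤ) by rfl,
        show (0 : ℤ) - 1 = -((0 + 1 : ℕ) : ℤ) by rfl, fibreR_neg_neg, fibreR_neg_nat,
        besselR_eq_zero _ (by omega)]
      simp
    · rw [if_neg (by omega), show ((n + 1 : ℕ) : ℤ) + 1 = ((n + 2 : ℕ) : ℤ) by push_cast; ring,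
        show ((n + 1 : ℕ) : ℤ) - 1 = (n : ℤ) by push_cast; ring, fibreR_neg_nat, fibreR_neg_nat,
        fibreR_neg_nat]
      ring
    · rw [show -((n + 1 : ℕ) : ℤ) - 1 = -((n + 1 + 1 : ℕ) : ℤ) by push_cast; ring,
        fibreR_neg_neg, fibreR_neg_neg]
      have e1 : fibreR π s (-((m + 1 : ℕ) : ℤ)) (-((n + 1 : ℕ) : ℤ) + 1) =
          -(besselR π⁻¹ s (m + 1) n * s ^ ((m : ℤ) - n + 1)) := by
        cases n with
        | zero =>
          rw [show -((0 + 1 : ℕ) : ℤ) + 1 = ((0 : ℕ) : ℤ) by rfl, fibreR_neg_nat, besselR_zero]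
          ring
        | succ n =>
          rw [show -((n + 1 + 1 : ℕ) : ℤ) + 1 = -((n + 1 : ℕ) : ℤ) by push_cast; ring,
            fibreR_neg_neg]
          congr 3
          push_cast
          ring
      have e2 : s ^ ((m : ℤ) - n + 1) = s * s ^ ((m : ℤ) - n) := by
        rw [zpow_add_one₀ hs, mul_comm]
      have e3 : s * s ^ ((m : ℤ) - (n + 1 : ℕ)) = s ^ ((m : ℤ) - n) := by
        rw [← zpow_one_add₀ hs]; congr 1; push_cast; ring
      rw [e1, e2]
      have h1 := hcol (m + 1) n
      have h2 : (if -((m + 1 : ℕ) : ℤ) = -((n + 1 : ℕ) : ℤ) then (1 : L) else 0) =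
          (if m + 1 = n + 1 then 1 else 0) * s ^ ((m : ℤ) - n) := by
        by_cases h : m = n
        · subst h; simp
        · rw [if_neg (by omega), if_neg (by omega), zero_mul]
      rw [h2, ← h1]
      push_cast at e3 ⊢
      linear_combination π * besselR π⁻¹ s (m + 1) (n + 2) * e3

/-- As matrices this says D R = 1 - P, where P projects onto the span of 1 and π s / x along the
image of D. Together with R D = 1 it is all that the trace formula needs from the cohomology. -/
theorem fibreR_row (hπ : π ≠ 0) (hs : s ≠ 0) (v u : ℤ) :
    (v : L) * fibreR π s v u + π * fibreR π s (v - 1) u - π * s * fibreR π s (v + 1) u =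
      (if v = u then 1 else 0) - ((if v = 0 then fibreC π s 0 u else 0) +
        if v = -1 then π * s * fibreC π s 1 u else 0) := by
  have hrow := besselR_row s (mul_inv_cancel₀ hπ)
  rcases int_trichotomy v with rfl | ⟨m, rfl⟩ | ⟨m, rfl⟩
  · rw [if_pos (rfl : (0 : ℤ) = 0), if_neg (by omega : ¬ (0 : ℤ) = -1),
      show (0 : ℤ) - 1 = -((0 + 1 : ℕ) : ℤ) by rfl, show (0 : ℤ) + 1 = ((1 : ℕ) : ℤ) by rfl]
    rcases int_trichotomy u with rfl | ⟨n, rfl⟩ | ⟨n, rfl⟩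
    · have e : fibreR π s ((1 : ℕ) : ℤ) ((0 : ℕ) : ℤ) = 0 := by rw [fibreR_nat_nat, besselR_zero]
      rw [show (0 : ℤ) = ((0 : ℕ) : ℤ) by rfl, fibreR_neg_nat, e, fibreC_natCast,
        besselY_zero, besselR_zero]
      simp
    · rw [fibreR_neg_nat, fibreR_nat_nat, fibreC_natCast, besselY_zero, if_neg (by omega),
        if_neg (by omega)]
      simp
    · rw [fibreR_neg_neg, fibreR_nat_neg, if_neg (by omega), fibreC_neg, besselY_zero,
        if_neg (by omega)]
      have e : s * s ^ (-((n + 1 : ℕ) : ℤ)) = s ^ (((0 : ℕ) : ℤ) - n) := by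
        rw [← zpow_one_add₀ hs]; congr 1; push_cast; ring
      rw [← e]
      simp only [Int.cast_zero]
      ring
  · rw [if_neg (by omega : ¬ ((m + 1 : ℕ) : ℤ) = 0), if_neg (by omega : ¬ ((m + 1 : ℕ) : ℤ) = -1),
      add_zero, sub_zero, show ((m + 1 : ℕ) : ℤ) + 1 = ((m + 2 : ℕ) : ℤ) by push_cast; ring,
      show ((m + 1 : ℕ) : ℤ) - 1 = (m : ℤ) by push_cast; ring]
    rcases Int.eq_nat_or_neg u with ⟨n, rfl | rfl⟩
    · rw [fibreR_nat_nat, fibreR_nat_nat, fibreR_nat_nat, Int.cast_natCast, hrow m n]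
      simp only [Nat.cast_inj]
    · cases n with
      | zero =>
        rw [show -((0 : ℕ) : ℤ) = ((0 : ℕ) : ℤ) by rfl, fibreR_nat_nat, fibreR_nat_nat,
          fibreR_nat_nat, besselR_zero, besselR_zero, besselR_zero, if_neg (by omega)]
        ring
      | succ n =>
        rw [fibreR_nat_neg, fibreR_nat_neg, fibreR_nat_neg, if_neg (by omega)]
        ring
  · rw [if_neg (by omega : ¬ -((m + 1 : ℕ) : ℤ) = 0), zero_add,
      show -((m + 1 : ℕ) : ℤ) - 1 = -((m + 1 + 1 : ℕ) : ℤ) by push_cast; ring]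
    rcases Int.eq_nat_or_neg u with ⟨n, rfl | rfl⟩
    · rw [fibreR_neg_nat, fibreR_neg_nat, if_neg (by omega)]
      cases m with
      | zero =>
        rw [show -((0 + 1 : ℕ) : ℤ) + 1 = ((0 : ℕ) : ℤ) by rfl, fibreR_nat_nat, if_pos (by rfl),
          fibreC_natCast, besselY_one]
        ring
      | succ m =>
        rw [show -((m + 1 + 1 : ℕ) : ℤ) + 1 = -((m + 1 : ℕ) : ℤ) by push_cast; ring,
          fibreR_neg_nat, if_neg (by omega)]
        ring
    · cases n with
      | zero =>
        rw [show -((0 : ℕ) : ℤ) = ((0 : ℕ) : ℤ) by rfl, fibreR_neg_nat, fibreR_neg_nat,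
          if_neg (by omega)]
        cases m with
        | zero =>
          rw [show -((0 + 1 : ℕ) : ℤ) + 1 = ((0 : ℕ) : ℤ) by rfl, fibreR_nat_nat, if_pos (by rfl),
            fibreC_natCast, besselY_one]
          ring
        | succ m =>
          rw [show -((m + 1 + 1 : ℕ) : ℤ) + 1 = -((m + 1 : ℕ) : ℤ) by push_cast; ring,
            fibreR_neg_nat, if_neg (by omega)]
          ring
      | succ n =>
        rw [fibreR_neg_neg, fibreR_neg_neg]
        have h1 := hrow m (n + 1)
        have hδ : (if -((m + 1 : ℕ) : ℤ) = -((n + 1 : ℕ) : ℤ) then (1 : L) else 0) =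
            (if m + 1 = n + 1 then 1 else 0) * s ^ ((m : ℤ) - n) := by
          by_cases h : m = n
          · subst h; simp
          · rw [if_neg (by omega), if_neg (by omega), zero_mul]
        have e3 : s ^ (((m + 1 : ℕ) : ℤ) - n) = s * s ^ ((m : ℤ) - n) := by
          rw [← zpow_one_add₀ hs]; congr 1; push_cast; ring
        rw [hδ, ← h1, e3]
        cases m with
        | zero =>
          have e4 : s * s ^ (-((n + 1 : ℕ) : ℤ)) = s ^ (((0 : ℕ) : ℤ) - n) := by
            rw [← zpow_one_add₀ hs]; congr 1; push_cast; ring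
          rw [show -((0 + 1 : ℕ) : ℤ) + 1 = ((0 : ℕ) : ℤ) by rfl, fibreR_nat_neg, if_pos (by rfl),
            fibreC_neg, besselY_one, ← e4]
          push_cast
          ring
        | succ m =>
          have e4 : s * s ^ ((m : ℤ) - n) = s ^ (((m + 1 : ℕ) : ℤ) - n) := by
            rw [← zpow_one_add₀ hs]; congr 1; push_cast; ring
          rw [show -((m + 1 + 1 : ℕ) : ℤ) + 1 = -((m + 1 : ℕ) : ℤ) by push_cast; ring,
            fibreR_neg_neg, if_neg (by omega), ← e4]
          push_cast
          ring

end FibreReduction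


/-! ### The Frobenius on a fibre -/

section FibreFrobenius

theorem zcoeff_mul_expand {K : Type*} [NormedField K] (f g : K⟦X⟧) {k : ℕ} (hk : k ≠ 0) (n : ℤ) :
    HasSum (fun j : ℤ => zcoeff f (n - k * j) * zcoeff g j) (zcoeff (f * expand k hk g) n) := by
  rcases lt_or_ge n 0 with hn | hn
  · rw [zcoeff_of_neg _ hn]
    convert hasSum_zero using 2 with j
    rcases lt_or_ge j 0 with hj | hj
    · rw [zcoeff_of_neg g hj, mul_zero]
    · rw [zcoeff_of_neg f, zero_mul]
      have : (0 : ℤ) ≤ k * j := by positivity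
      omega
  · lift n to ℕ using hn
    rw [zcoeff_natCast, mul_comm f, coeff_mul, Finset.Nat.sum_antidiagonal_eq_sum_range_succ
      (fun i j => coeff i (expand k hk g) * coeff j f)]
    have h1 : HasSum (fun j : ℕ => if j ≤ n then coeff j (expand k hk g) * coeff (n - j) f else 0)
        (∑ j ∈ Finset.range n.succ, coeff j (expand k hk g) * coeff (n - j) f) := by
      rw [Finset.sum_congr rfl fun j hj => (if_pos (Nat.lt_succ_iff.1 (Finset.mem_range.1 hj))).symm]
      apply hasSum_sum_of_ne_finset_zero
      intro j hj
      rw [if_neg (by simpa [Nat.lt_succ_iff] using hj)]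
    have hinj : Function.Injective fun j : ℕ => k * j := fun i j h => by simpa [hk] using h
    rw [← hinj.hasSum_iff] at h1
    · have hinj' : Function.Injective fun j : ℕ => (j : ℤ) := Nat.cast_injective
      rw [← hinj'.hasSum_iff]
      · refine hasSum_of_eq h1 (fun j => ?_) rfl
        simp only [Function.comp_apply, zcoeff_natCast, coeff_expand, dvd_mul_right, if_true,
          Nat.mul_div_cancel_left j (Nat.pos_of_ne_zero hk)]
        split_ifs with h
        · rw [← Nat.cast_mul, ← Nat.cast_sub h, zcoeff_natCast, mul_comm]
        · rw [← Nat.cast_mul, zcoeff_of_neg f (by omega), zero_mul]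
      · intro j hj
        rw [zcoeff_of_neg g, mul_zero]
        by_contra h
        exact hj ⟨j.toNat, by simp; omega⟩
    · intro j hj
      have hkj : ¬ k ∣ j := by
        rintro ⟨i, rfl⟩
        exact hj ⟨i, rfl⟩
      rw [coeff_expand, if_neg hkj, zero_mul, ite_self]

variable {p : ℕ} [hp : Fact p.Prime] {L : Type*} [NormedField L] [NormedAlgebra ℚ_[p] L]
  [CharZero L] [IsUltrametricDist L] {π t : L}

theorem norm_zcoeff_bigTheta_le (hπ : π ^ (p - 1) = -(p : L)) (e : ℕ) (n : ℤ) :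
    ‖zcoeff (bigTheta p e π) n‖ ≤ rate p e ^ n.natAbs := by
  rcases lt_or_ge n 0 with hn | hn
  · rw [zcoeff_of_neg _ hn, norm_zero]
    exact pow_nonneg (rate_pos p e).le _
  · lift n to ℕ using hn
    rw [zcoeff_natCast]
    exact norm_coeff_bigTheta_le p hπ e n

theorem norm_zcoeff_bigTheta_le_one (hπ : π ^ (p - 1) = -(p : L)) (e : ℕ) (n : ℤ) :
    ‖zcoeff (bigTheta p e π) n‖ ≤ 1 :=
  (norm_zcoeff_bigTheta_le hπ e n).trans (pow_le_one₀ (rate_pos p e).le (rate_lt_one p e).le)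

/-- The terms of the coefficient of `x ^ n` in `Θ(x) Θ(t / x)`, where `Θ = exp π (z - z^(p^e))`. -/
def kernelTerm (p e : ℕ) (π t : L) (n N : ℤ) : L :=
  zcoeff (bigTheta p e π) (N + n) * zcoeff (bigTheta p e π) N * t ^ N

/-- The coefficient of `x ^ n` in `Θ(x) Θ(t / x)`, where `Θ = exp π (z - z^(p^e))`. -/
def kernelG (p e : ℕ) (π t : L) (n : ℤ) : L := ∑' N : ℤ, kernelTerm p e π t n N

theorem norm_kernelTerm_le (hπ : π ^ (p - 1) = -(p : L)) (ht : ‖t‖ = 1) (e : ℕ) (n N : ℤ) :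
    ‖kernelTerm p e π t n N‖ ≤ rate p e ^ N.natAbs := by
  rw [kernelTerm, norm_mul, norm_mul, norm_zpow, ht, one_zpow, mul_one]
  exact (mul_le_mul (norm_zcoeff_bigTheta_le_one hπ e _) (norm_zcoeff_bigTheta_le hπ e N)
    (norm_nonneg _) zero_le_one).trans_eq (one_mul _)

/-- When N and N + n are both nonnegative, one of them is at least |n|; this gives decay in n
uniformly in N. -/
theorem norm_kernelTerm_le' (hπ : π ^ (p - 1) = -(p : L)) (ht : ‖t‖ = 1) (e : ℕ) (n N : ℤ) :
    ‖kernelTerm p e π t n N‖ ≤ rate p e ^ n.natAbs := by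
  rcases le_or_gt n.natAbs N.natAbs with h | h
  · exact (norm_kernelTerm_le hπ ht e n N).trans
      (pow_le_pow_of_le_one (rate_pos p e).le (rate_lt_one p e).le h)
  · rcases lt_or_ge N 0 with hN | hN
    · rw [kernelTerm, zcoeff_of_neg _ hN, mul_zero, zero_mul, norm_zero]
      exact pow_nonneg (rate_pos p e).le _
    rcases lt_or_ge (N + n) 0 with hN' | hN'
    · rw [kernelTerm, zcoeff_of_neg _ hN', zero_mul, zero_mul, norm_zero]
      exact pow_nonneg (rate_pos p e).le _
    rw [kernelTerm, norm_mul, norm_mul, norm_zpow, ht, one_zpow, mul_one]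
    refine (mul_le_mul (norm_zcoeff_bigTheta_le hπ e _) (norm_zcoeff_bigTheta_le_one hπ e N)
      (norm_nonneg _) (pow_nonneg (rate_pos p e).le _)).trans ?_
    rw [mul_one]
    exact pow_le_pow_of_le_one (rate_pos p e).le (rate_lt_one p e).le (by omega)

theorem norm_kernelG_le (hπ : π ^ (p - 1) = -(p : L)) (ht : ‖t‖ = 1) (e : ℕ) (n : ℤ) :
    ‖kernelG p e π t n‖ ≤ rate p e ^ n.natAbs :=
  norm_tsum_le_of_le (pow_nonneg (rate_pos p e).le _) (norm_kernelTerm_le' hπ ht e n)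

variable [CompleteSpace L]

theorem summable_pow_mul_pow {x y : ℝ} (hx0 : 0 ≤ x) (hx : x < 1) (hy0 : 0 ≤ y) (hy : y < 1) :
    Summable fun i : ℤ × ℤ => x ^ i.1.natAbs * y ^ i.2.natAbs :=
  (summable_pow_natAbs hx0 hx).mul_of_nonneg (summable_pow_natAbs hy0 hy)
    (fun _ => pow_nonneg hx0 _) (fun _ => pow_nonneg hy0 _)

theorem hasSum_kernelG (hπ : π ^ (p - 1) = -(p : L)) (ht : ‖t‖ = 1) (e : ℕ) (n : ℤ) :
    HasSum (kernelTerm p e π t n) (kernelG p e π t n) :=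
  (Summable.of_norm_bounded (summable_pow_natAbs (rate_pos p e).le (rate_lt_one p e))
    (norm_kernelTerm_le hπ ht e n)).hasSum

theorem hasSum_kernelG_shift (hπ : π ^ (p - 1) = -(p : L)) (ht : ‖t‖ = 1) (e : ℕ) (n k : ℤ) :
    HasSum (fun N : ℤ => zcoeff (bigTheta p e π) (N + n) * zcoeff (bigTheta p e π) (N - k) * t ^ N)
      (t ^ k * kernelG p e π t (n + k)) := by
  have ht0 : t ≠ 0 := by rintro rfl; simp at ht
  have h := (hasSum_kernelG hπ ht e (n + k)).mul_left (t ^ k)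
  rw [← (Equiv.addRight (-k)).hasSum_iff] at h
  refine hasSum_of_eq h (fun N => ?_) rfl
  simp only [Function.comp_apply, Equiv.coe_addRight, kernelTerm]
  rw [show N + -k + (n + k) = N + n by ring, show N + -k = N - k by ring, zpow_sub₀ ht0]
  field_simp

/-- Apply x d/dx to Θ(x)Θ(t/x): each factor contributes its differential equation, with opposite
signs. -/
theorem kernelG_rec (hπ : π ^ (p - 1) = -(p : L)) (ht : ‖t‖ = 1) (e : ℕ) (n : ℤ) :
    (n : L) * kernelG p e π t n = π * (kernelG p e π t (n - 1) - t * kernelG p e π t (n + 1)) -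
      (p : L) ^ e * π * (kernelG p e π t (n - (p ^ e : ℕ)) -
        t ^ p ^ e * kernelG p e π t (n + (p ^ e : ℕ))) := by
  have h0 := (hasSum_kernelG hπ ht e n).mul_left (n : L)
  have h1 := (hasSum_kernelG hπ ht e (n - 1)).mul_left π
  have h2 := (hasSum_kernelG_shift hπ ht e n 1).mul_left π
  have h3 := (hasSum_kernelG hπ ht e (n - (p ^ e : ℕ))).mul_left ((p : L) ^ e * π)
  have h4 := (hasSum_kernelG_shift hπ ht e n (p ^ e : ℕ)).mul_left ((p : L) ^ e * π)
  rw [zpow_one] at h2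
  rw [zpow_natCast] at h4
  have key := ((h1.sub h2).sub (h3.sub h4))
  rw [mul_sub, mul_sub]
  refine (h0.unique (hasSum_of_eq key (fun N => ?_) rfl))
  simp only [kernelTerm]
  have e1 := zcoeff_bigTheta_ode (π := π) p e (N + n)
  have e2 := zcoeff_bigTheta_ode (π := π) p e N
  rw [show N + (n - 1) = N + n - 1 by ring,
    show N + (n - (p ^ e : ℕ)) = N + n - (p ^ e : ℕ) by ring]
  push_cast at e1 e2 ⊢
  linear_combination (zcoeff (bigTheta p e π) N * t ^ N) * e1 -
    (zcoeff (bigTheta p e π) (N + n) * t ^ N) * e2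

end FibreFrobenius


/-! ### Composition of Frobenius matrices and their commutation with D -/

section FibreFrobenius

variable {p : ℕ} [hp : Fact p.Prime] {L : Type*} [NormedField L] [NormedAlgebra ℚ_[p] L]
  [CharZero L] [IsUltrametricDist L] {π t : L} [CompleteSpace L]

/-- The shear `(w, l, N) ↦ (N + k l, l + w, l)`. -/
def shear (k : ℤ) : ℤ × ℤ × ℤ ≃ ℤ × ℤ × ℤ where
  toFun x := (x.2.2 + k * x.2.1, x.2.1 + x.1, x.2.1)
  invFun x := (x.2.1 - x.2.2, x.2.2, x.1 - k * x.2.2)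
  left_inv x := by ext <;> simp
  right_inv x := by ext <;> simp

set_option maxHeartbeats 1000000 in
-- On coefficients, this is the factorisation of Θ_{e+e'}(x)Θ_{e+e'}(t/x) into the kernel for e and
-- the kernel for e' at (t^(p^e), x^(p^e)). One absolutely convergent triple sum is evaluated in two
-- orders, related by `shear`.
theorem kernelG_add (hπ : π ^ (p - 1) = -(p : L)) (ht : ‖t‖ = 1) (e e' : ℕ) (n : ℤ) :
    HasSum (fun w : ℤ => kernelG p e' π (t ^ p ^ e) w * kernelG p e π t (n - (p ^ e : ℕ) * w))
      (kernelG p (e + e') π t n) := by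
  have ht0 : t ≠ 0 := by rintro rfl; simp at ht
  have hk : p ^ e ≠ 0 := pow_ne_zero _ hp.out.ne_zero
  set Θ := zcoeff (bigTheta p e π) with hΘ
  set Θ' := zcoeff (bigTheta p e' π) with hΘ'
  set f : ℤ × ℤ × ℤ → L := fun x =>
    (Θ' (x.2.1 + x.1) * Θ' x.2.1 * (t ^ p ^ e) ^ x.2.1) *
      (Θ (x.2.2 + (n - (p ^ e : ℕ) * x.1)) * Θ x.2.2 * t ^ x.2.2) with hf
  have ht' : ‖t ^ p ^ e‖ = 1 := by rw [norm_pow, ht, one_pow]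
  set σ := max (rate p e) (rate p e') with hσ
  have hσ0 : 0 < σ := lt_max_of_lt_left (rate_pos p e)
  have hσ1 : σ < 1 := max_lt (rate_lt_one p e) (rate_lt_one p e')
  have le1 : ∀ m : ℤ, ‖Θ m‖ ≤ σ ^ m.natAbs := fun m => (norm_zcoeff_bigTheta_le hπ e m).trans
    (pow_le_pow_left₀ (rate_pos p e).le (le_max_left _ _) _)
  have le2 : ∀ m : ℤ, ‖Θ' m‖ ≤ σ ^ m.natAbs := fun m => (norm_zcoeff_bigTheta_le hπ e' m).trans
    (pow_le_pow_left₀ (rate_pos p e').le (le_max_right _ _) _)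
  have hpos : ∀ n : ℤ, 0 ≤ σ ^ n.natAbs := fun n => pow_nonneg hσ0.le _
  have hbound : ∀ x, ‖f x‖ ≤ (σ⁻¹) ^ n.natAbs * (σ ^ x.1.natAbs * (σ ^ x.2.1.natAbs * σ ^ x.2.2.natAbs)) := by
    rintro ⟨w, l, N⟩
    have hnn : 0 ≤ (σ⁻¹) ^ n.natAbs * (σ ^ w.natAbs * (σ ^ l.natAbs * σ ^ N.natAbs)) := by positivity
    rcases lt_or_ge l 0 with hl | hl
    · simp only [hf, hΘ', zcoeff_of_neg _ hl]; simpa using hnn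
    rcases lt_or_ge N 0 with hN | hN
    · simp only [hf, hΘ, zcoeff_of_neg _ hN]; simpa using hnn
    -- Decay in w comes from the first factor if w ≥ 0 and from the second one if w < 0, where -p^e
    -- w ≥ |w|; the fixed shift n costs at most σ^(-|n|).
    have key : ‖Θ' (l + w)‖ * ‖Θ (N + (n - (p ^ e : ℕ) * w))‖ ≤ (σ⁻¹) ^ n.natAbs * σ ^ w.natAbs := by
      rcases le_or_gt 0 w with hw | hw
      · calc _ ≤ σ ^ (l + w).natAbs * 1 := by
              gcongr
              · exact le2 _
              · exact norm_zcoeff_bigTheta_le_one hπ e _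
          _ ≤ 1 * σ ^ w.natAbs := by
              rw [mul_one, one_mul]
              exact pow_le_pow_of_le_one hσ0.le hσ1.le (by omega)
          _ ≤ _ := by
              gcongr
              exact one_le_pow₀ ((one_le_inv₀ hσ0).2 hσ1.le)
      · calc _ ≤ 1 * σ ^ (N + (n - (p ^ e : ℕ) * w)).natAbs := by
              gcongr
              · exact norm_zcoeff_bigTheta_le_one hπ e' _
              · exact le1 _
          _ ≤ _ := by
              rw [one_mul, inv_pow, ← div_eq_inv_mul, le_div_iff₀ (by positivity), ← pow_add]
              apply pow_le_pow_of_le_one hσ0.le hσ1.le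
              have h1 : (1 : ℤ) ≤ (p ^ e : ℕ) := by exact_mod_cast Nat.one_le_iff_ne_zero.2 hk
              have h2 : -w ≤ -((p ^ e : ℕ) * w) := by nlinarith
              omega
    have hz : ‖f (w, l, N)‖ = (‖Θ' (l + w)‖ * ‖Θ (N + (n - (p ^ e : ℕ) * w))‖) * (‖Θ' l‖ * ‖Θ N‖) := by
      simp only [hf, norm_mul, norm_zpow, ht, ht', one_zpow]
      ring
    rw [hz]
    exact (mul_le_mul key (mul_le_mul (le2 l) (le1 N) (norm_nonneg _) (hpos _))
      (mul_nonneg (norm_nonneg _) (norm_nonneg _)) (by positivity)).trans_eq (by ring)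
  have hsig := summable_pow_natAbs hσ0.le hσ1
  have hsum : Summable f := Summable.of_norm_bounded
    ((hsig.mul_of_nonneg (hsig.mul_of_nonneg hsig hpos hpos) hpos
      (fun x => mul_nonneg (hpos _) (hpos _))).mul_left _) hbound
  have hfib : ∀ w, HasSum (fun y => f (w, y))
      (kernelG p e' π (t ^ p ^ e) w * kernelG p e π t (n - (p ^ e : ℕ) * w)) := by
    intro w
    have h1 := hasSum_kernelG hπ ht' e' w
    have h2 := hasSum_kernelG hπ ht e (n - (p ^ e : ℕ) * w)
    refine hasSum_of_eq (h1.mul h2 ((hsum.prod_factor w).congr fun y => ?_)) (fun y => ?_) rfl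
    · simp only [hf, hΘ, hΘ', kernelTerm]
    · simp only [hf, hΘ, hΘ', kernelTerm]
  have h1 := hsum.hasSum.prod_fiberwise hfib
  have h2 : HasSum (fun x => f ((shear (p ^ e : ℕ)).symm x)) (∑' x, f x) :=
    (shear (p ^ e : ℕ)).symm.hasSum_iff.2 hsum.hasSum
  have h3 : ∀ N : ℤ, HasSum (fun y => f ((shear (p ^ e : ℕ)).symm (N, y)))
      (kernelTerm p (e + e') π t n N) := by
    intro N
    have g1 := zcoeff_mul_expand (bigTheta p e π) (bigTheta p e' π) hk (N + n)
    have g2 := zcoeff_mul_expand (bigTheta p e π) (bigTheta p e' π) hk N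
    rw [← bigTheta_add] at g1 g2
    refine hasSum_of_eq ((g1.mul g2 ?_).mul_right (t ^ N)) (fun y => ?_) rfl
    · have h4 := (h2.summable.prod_factor N).mul_right ((t ^ N)⁻¹)
      refine h4.congr fun y => ?_
      simp only [hf, shear, Equiv.coe_fn_symm_mk, hΘ, hΘ']
      rw [← zpow_natCast t (p ^ e), ← zpow_mul, zpow_sub₀ ht0,
        show N - (p ^ e : ℕ) * y.2 + (n - (p ^ e : ℕ) * (y.1 - y.2)) = N + n - (p ^ e : ℕ) * y.1 by ring,
        show y.2 + (y.1 - y.2) = y.1 by ring]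
      field_simp
    · simp only [hf, shear, Equiv.coe_fn_symm_mk, hΘ, hΘ']
      rw [← zpow_natCast t (p ^ e), ← zpow_mul, zpow_sub₀ ht0,
        show N - (p ^ e : ℕ) * y.2 + (n - (p ^ e : ℕ) * (y.1 - y.2)) = N + n - (p ^ e : ℕ) * y.1 by ring,
        show y.2 + (y.1 - y.2) = y.1 by ring]
      field_simp
  have h5 := h2.prod_fiberwise h3
  rw [h5.unique (hasSum_kernelG hπ ht (e + e') n)] at h1
  exact h1

/-- The matrix of `ψ_x^e ∘ Θ(x) Θ(t / x)` with respect to the powers of `x`. -/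
def fibreX (p e : ℕ) (π t : L) (u v : ℤ) : L := kernelG p e π t ((p ^ e : ℕ) * u - v)

/-- In operator form X_t D_t = p^e D_{t^(p^e)} X_t. The factor p^e appears because ψ_x^e ∘ x d/dx =
p^e (x d/dx) ∘ ψ_x^e. -/
theorem fibreX_comm (hπ : π ^ (p - 1) = -(p : L)) (ht : ‖t‖ = 1) (e : ℕ) (u v : ℤ) :
    (v : L) * fibreX p e π t u v + π * fibreX p e π t u (v + 1) - π * t * fibreX p e π t u (v - 1) =
      (p : L) ^ e * ((u : L) * fibreX p e π t u v + π * fibreX p e π t (u - 1) v -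
        π * t ^ p ^ e * fibreX p e π t (u + 1) v) := by
  have h := kernelG_rec hπ ht e ((p ^ e : ℕ) * u - v)
  simp only [fibreX]
  rw [show ((p ^ e : ℕ) : ℤ) * u - (v + 1) = (p ^ e : ℕ) * u - v - 1 by ring,
    show ((p ^ e : ℕ) : ℤ) * u - (v - 1) = (p ^ e : ℕ) * u - v + 1 by ring,
    show ((p ^ e : ℕ) : ℤ) * (u - 1) - v = (p ^ e : ℕ) * u - v - (p ^ e : ℕ) by ring,
    show ((p ^ e : ℕ) : ℤ) * (u + 1) - v = (p ^ e : ℕ) * u - v + (p ^ e : ℕ) by ring]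
  rw [Int.cast_sub, Int.cast_mul, Int.cast_natCast, Nat.cast_pow] at h
  linear_combination -h

theorem fibreX_add (hπ : π ^ (p - 1) = -(p : L)) (ht : ‖t‖ = 1) (e e' : ℕ) (u v : ℤ) :
    HasSum (fun w : ℤ => fibreX p e' π (t ^ p ^ e) u w * fibreX p e π t w v)
      (fibreX p (e + e') π t u v) := by
  have h := kernelG_add hπ ht e e' ((p ^ (e + e') : ℕ) * u - v)
  rw [← (Equiv.subLeft ((p ^ e' : ℕ) * u : ℤ)).hasSum_iff] at h
  refine hasSum_of_eq h (fun w => ?_) rfl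
  simp only [Function.comp_apply, Equiv.subLeft_apply, fibreX]
  congr 2
  push_cast
  ring

theorem norm_fibreX_le (hπ : π ^ (p - 1) = -(p : L)) (ht : ‖t‖ = 1) (e : ℕ) (u v : ℤ) :
    ‖fibreX p e π t u v‖ ≤ rate p 0 ^ u.natAbs * ((rate p e)⁻¹) ^ v.natAbs := by
  have hr := rate_pos p e
  refine (norm_kernelG_le hπ ht e _).trans ?_
  rw [← rate_zero_pow p e, inv_pow, ← div_eq_mul_inv, le_div_iff₀ (by positivity), ← pow_add]
  apply pow_le_pow_of_le_one hr.le (rate_lt_one p e).le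
  have : p ^ e * u.natAbs = ((p ^ e : ℕ) * u : ℤ).natAbs := by rw [Int.natAbs_mul, Int.natAbs_natCast]
  omega

end FibreFrobenius


/-! ### Frobenius on the cohomology of a fibre: cocycle relation and trace formula -/

section FibreFrobenius

variable {p : ℕ} [hp : Fact p.Prime] {L : Type*} [NormedField L] [NormedAlgebra ℚ_[p] L]
  [CharZero L] [IsUltrametricDist L] {π t : L} [CompleteSpace L]

theorem radius_lt_rate {e : ℕ} (he : e ≠ 0) : radius p < rate p e := by
  refine lt_of_lt_of_le ?_ (rate_mono p (Nat.one_le_iff_ne_zero.2 he))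
  have h := one_lt_cast p
  have h0 : (0 : ℝ) < p := by linarith
  rw [radius, rate]
  apply Real.rpow_lt_rpow_of_exponent_lt h
  have h1 : (0 : ℝ) < p - 1 := by linarith
  rw [neg_lt_neg_iff, pow_one, div_div, div_lt_div_iff₀ (by positivity) h1]
  nlinarith

theorem rate_zero_lt_rate {e : ℕ} (he : e ≠ 0) : rate p 0 < rate p e := by
  have h := rate_zero_pow p e 1
  have h1 : 1 < p ^ e := Nat.one_lt_pow he hp.out.one_lt
  rw [mul_one, pow_one] at h
  rw [← h]
  calc rate p e ^ p ^ e < rate p e ^ 1 :=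
        pow_lt_pow_right_of_lt_one₀ (rate_pos p e) (rate_lt_one p e) h1
    _ = _ := pow_one _

/-- The functionals grow like |π|^(-|u|) and the rows of X decay like rate(0)^|u|; the pairing
converges since (p-1)/p > 1/(p-1). -/
theorem rate_zero_mul_norm_inv_lt (h5 : 5 ≤ p) (hπ : π ^ (p - 1) = -(p : L)) :
    rate p 0 * ‖π⁻¹‖ < 1 := by
  have h := one_lt_cast p
  have h0 : (0 : ℝ) < p := by linarith
  have h5' : (5 : ℝ) ≤ p := by exact_mod_cast h5
  rw [norm_inv_pi hπ, rate, ← Real.rpow_add h0]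
  apply Real.rpow_lt_one_of_one_lt_of_neg h
  rw [pow_zero, div_one, ← sub_eq_neg_add, sub_neg, div_lt_div_iff₀ (by linarith) h0]
  nlinarith

theorem one_le_norm_inv_pi (hπ : π ^ (p - 1) = -(p : L)) : 1 ≤ ‖π⁻¹‖ := by
  rw [norm_inv, norm_pi p hπ]
  exact (one_le_inv₀ (radius_pos p)).2 (radius_lt_one p).le

theorem pi_ne_zero (hπ : π ^ (p - 1) = -(p : L)) : π ≠ 0 := by
  rw [← norm_pos_iff, norm_pi p hπ]
  exact radius_pos p

theorem norm_intCast_le_one (p : ℕ) [Fact p.Prime] {L : Type*} [NormedField L] [NormedAlgebra ℚ_[p] L]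
    (n : ℤ) : ‖(n : L)‖ ≤ 1 := by
  rcases Int.natAbs_eq n with h | h <;> rw [h] <;>
    simpa using norm_natCast_le_one p (K := L) n.natAbs

theorem norm_fibreC_mul_fibreX_le (hπ : π ^ (p - 1) = -(p : L)) (ht : ‖t‖ = 1) (e : ℕ)
    (i : Fin 2) (u v : ℤ) :
    ‖fibreC π (t ^ p ^ e) i u * fibreX p e π t u v‖ ≤
      (rate p 0 * ‖π⁻¹‖) ^ u.natAbs * ((rate p e)⁻¹) ^ v.natAbs := by
  rw [norm_mul, mul_pow, mul_comm (rate p 0 ^ _), mul_assoc]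
  have hC := norm_fibreC_le (one_le_norm_inv_pi hπ) (show ‖t ^ p ^ e‖ = 1 by rw [norm_pow, ht, one_pow])
    (norm_natCast_le_one p) i u
  exact mul_le_mul hC (norm_fibreX_le hπ ht e u v) (norm_nonneg _) (by positivity)

theorem summable_fibreC_mul_fibreX (h5 : 5 ≤ p) (hπ : π ^ (p - 1) = -(p : L)) (ht : ‖t‖ = 1)
    (e : ℕ) (i : Fin 2) (v : ℤ) :
    Summable fun u : ℤ => fibreC π (t ^ p ^ e) i u * fibreX p e π t u v :=
  Summable.of_norm_bounded ((summable_pow_natAbs (by have := rate_pos p 0; positivity)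
    (rate_zero_mul_norm_inv_lt h5 hπ)).mul_right _)
    (fun u => norm_fibreC_mul_fibreX_le hπ ht e i u v)

/-- The matrix of the Frobenius on the fibre cohomology at `t`, with respect to the bases
`1, π t / x` and `1, π t^(p^e) / x`. -/
def fibreM (p e : ℕ) (π t : L) : Matrix (Fin 2) (Fin 2) L := Matrix.of fun i j =>
  if j = 0 then ∑' u : ℤ, fibreC π (t ^ p ^ e) i u * fibreX p e π t u 0
  else π * t * ∑' u : ℤ, fibreC π (t ^ p ^ e) i u * fibreX p e π t u (-1)

/-- Composing a functional at t^(p^e) with X kills the image of D_t, since X D = p^e D X. The result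
therefore satisfies the three-term recurrence at t, and its values at 0 and -1 are the entries of
`fibreM`, up to the normalisation of π t / x. -/
theorem tsum_fibreC_mul_fibreX (h5 : 5 ≤ p) (hπ : π ^ (p - 1) = -(p : L)) (ht : ‖t‖ = 1)
    (e : ℕ) (i : Fin 2) (v : ℤ) :
    ∑' u : ℤ, fibreC π (t ^ p ^ e) i u * fibreX p e π t u v =
      fibreM p e π t i 0 * fibreC π t 0 v + fibreM p e π t i 1 * fibreC π t 1 v := by
  have ht0 : t ≠ 0 := by rintro rfl; simp at ht
  have hs : t ^ p ^ e ≠ 0 := pow_ne_zero _ ht0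
  set c := fibreC π (t ^ p ^ e) i with hc
  have hsum : ∀ v, Summable fun u => c u * fibreX p e π t u v :=
    summable_fibreC_mul_fibreX h5 hπ ht e i
  refine rec_eq_fibreC (pi_ne_zero hπ) ht0 (f := fun v => ∑' u : ℤ, c u * fibreX p e π t u v)
    (fun v => ?_) v
  have h0 := ((((hsum v).hasSum.mul_left (v : L)).add ((hsum (v + 1)).hasSum.mul_left π)).sub
    ((hsum (v - 1)).hasSum.mul_left (π * t)))
  refine h0.unique ?_
  have hS : ∀ k : ℤ, Summable fun u => c (u + k) * fibreX p e π t u v := by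
    intro k
    have hA := one_le_norm_inv_pi hπ
    refine Summable.of_norm_bounded (((summable_pow_natAbs (by have := rate_pos p 0; positivity)
      (rate_zero_mul_norm_inv_lt h5 hπ)).mul_right (((rate p e)⁻¹) ^ v.natAbs)).mul_left
      (‖π⁻¹‖ ^ k.natAbs)) (fun u => ?_)
    have hC := (norm_fibreC_le hA (show ‖t ^ p ^ e‖ = 1 by rw [norm_pow, ht, one_pow])
      (norm_natCast_le_one p) i (u + k)).trans (pow_natAbs_add_le hA u k)
    rw [norm_mul]
    refine (mul_le_mul hC (norm_fibreX_le hπ ht e u v) (norm_nonneg _) (by positivity)).trans_eq ?_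
    rw [mul_pow]
    ring
  have h1 := (hS 1).hasSum
  have h2 := (hS (-1)).hasSum
  rw [← (Equiv.addRight (-1 : ℤ)).hasSum_iff] at h1
  rw [← (Equiv.addRight (1 : ℤ)).hasSum_iff] at h2
  have hu : Summable fun u : ℤ => (u : L) * (c u * fibreX p e π t u v) := by
    refine Summable.of_norm_bounded ((summable_pow_natAbs (by have := rate_pos p 0; positivity)
      (rate_zero_mul_norm_inv_lt h5 hπ)).mul_right (((rate p e)⁻¹) ^ v.natAbs)) (fun u => ?_)
    rw [norm_mul]
    exact (mul_le_mul (norm_intCast_le_one p u) (norm_fibreC_mul_fibreX_le hπ ht e i u v)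
      (norm_nonneg _) zero_le_one).trans_eq (one_mul _)
  have h3 := ((hu.hasSum.add (h1.mul_left π)).sub (h2.mul_left (π * t ^ p ^ e))).mul_left ((p : L) ^ e)
  have h4 := ((hu.hasSum.add ((hS 1).hasSum.mul_left π)).sub
    ((hS (-1)).hasSum.mul_left (π * t ^ p ^ e))).mul_left ((p : L) ^ e)
  have h5 : HasSum (fun _ : ℤ => (0 : L)) _ := hasSum_of_eq h4 (fun u => by
    have := fibreC_rec (pi_ne_zero hπ) hs i u
    rw [← hc, sub_eq_add_neg u 1] at this
    linear_combination (-(p : L) ^ e * fibreX p e π t u v) * this) rfl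
  refine hasSum_of_eq h3 (fun u => ?_) (hasSum_zero.unique h5)
  have := fibreX_comm hπ ht e u v
  simp only [Function.comp_apply, Equiv.coe_addRight, neg_add_cancel_right, add_neg_cancel_right]
  rw [← sub_eq_add_neg]
  linear_combination c u * this

set_option maxHeartbeats 1000000 in
-- The expansion of a functional composed with X is applied to the two factors of `fibreX_add` in
-- turn. Exchanging the two summations requires rate(0) < rate(e'), which is the role of e' ≠ 0.
theorem fibreM_add (h5 : 5 ≤ p) (hπ : π ^ (p - 1) = -(p : L)) (ht : ‖t‖ = 1) (e : ℕ) {e' : ℕ}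
    (he' : e' ≠ 0) : fibreM p (e + e') π t = fibreM p e' π (t ^ p ^ e) * fibreM p e π t := by
  have ht' : ‖t ^ p ^ e‖ = 1 := by rw [norm_pow, ht, one_pow]
  have hpow : t ^ p ^ (e + e') = (t ^ p ^ e) ^ p ^ e' := by rw [← pow_mul, ← pow_add]
  have key : ∀ (i : Fin 2) (v : ℤ),
      ∑' u : ℤ, fibreC π (t ^ p ^ (e + e')) i u * fibreX p (e + e') π t u v =
      fibreM p e' π (t ^ p ^ e) i 0 * (∑' w : ℤ, fibreC π (t ^ p ^ e) 0 w * fibreX p e π t w v) +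
      fibreM p e' π (t ^ p ^ e) i 1 * ∑' w : ℤ, fibreC π (t ^ p ^ e) 1 w * fibreX p e π t w v := by
    intro i v
    set f : ℤ × ℤ → L := fun x => fibreC π (t ^ p ^ (e + e')) i x.1 *
      (fibreX p e' π (t ^ p ^ e) x.1 x.2 * fibreX p e π t x.2 v) with hf
    have hr0 := rate_pos p 0
    have hre := rate_pos p e'
    have hq : rate p 0 * (rate p e')⁻¹ < 1 := by
      rw [← div_eq_mul_inv, div_lt_one hre]
      exact rate_zero_lt_rate he'
    have hsum : Summable f := by
      refine Summable.of_norm_bounded ((summable_pow_mul_pow (by positivity)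
        (rate_zero_mul_norm_inv_lt h5 hπ) (by positivity) hq).mul_right
          (((rate p e)⁻¹) ^ v.natAbs)) (fun x => ?_)
      have h1 := norm_fibreC_mul_fibreX_le hπ ht' e' i x.1 x.2
      have h2 := norm_fibreX_le hπ ht e x.2 v
      simp only [hf]
      rw [← mul_assoc, norm_mul, hpow]
      refine (mul_le_mul h1 h2 (norm_nonneg _) (by positivity)).trans_eq ?_
      rw [mul_pow (rate p 0) (rate p e')⁻¹]
      ring
    have h1 := hsum.hasSum.prod_fiberwise (fun u => (fibreX_add hπ ht e e' u v).mul_left _)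
    have h2 : HasSum (fun x : ℤ × ℤ => f x.swap) (∑' x, f x) :=
      (Equiv.prodComm ℤ ℤ).hasSum_iff.2 hsum.hasSum
    have h3 : ∀ w : ℤ, HasSum (fun u : ℤ => f (Prod.swap (w, u)))
        ((fibreM p e' π (t ^ p ^ e) i 0 * fibreC π (t ^ p ^ e) 0 w +
          fibreM p e' π (t ^ p ^ e) i 1 * fibreC π (t ^ p ^ e) 1 w) * fibreX p e π t w v) := by
      intro w
      rw [← tsum_fibreC_mul_fibreX h5 hπ ht' e' i w]
      refine hasSum_of_eq ((summable_fibreC_mul_fibreX h5 hπ ht' e' i w).hasSum.mul_right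
        (fibreX p e π t w v)) (fun u => ?_) rfl
      simp only [hf, Prod.swap_prod_mk, hpow]
      ring
    have h4 := h2.prod_fiberwise h3
    have h6 := ((summable_fibreC_mul_fibreX h5 hπ ht e 0 v).hasSum.mul_left
      (fibreM p e' π (t ^ p ^ e) i 0)).add ((summable_fibreC_mul_fibreX h5 hπ ht e 1 v).hasSum.mul_left
      (fibreM p e' π (t ^ p ^ e) i 1))
    rw [h1.tsum_eq]
    exact h4.unique (hasSum_of_eq h6 (fun w => by ring) rfl)
  ext i j
  rw [Matrix.mul_apply, Fin.sum_univ_two]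
  have hM : ∀ (e : ℕ) (s : L) (i : Fin 2),
      fibreM p e π s i 0 = ∑' u : ℤ, fibreC π (s ^ p ^ e) i u * fibreX p e π s u 0 := fun e s i => rfl
  have hM' : ∀ (e : ℕ) (s : L) (i : Fin 2), fibreM p e π s i 1 =
      π * s * ∑' u : ℤ, fibreC π (s ^ p ^ e) i u * fibreX p e π s u (-1) := fun e s i => rfl
  fin_cases j
  · exact key i 0
  · change fibreM p (e + e') π t i 1 = _ * fibreM p e π t 0 1 + _ * fibreM p e π t 1 1
    rw [hM' (e + e'), hM' e t 0, hM' e t 1, key i (-1)]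
    ring

set_option maxHeartbeats 1000000 in
-- With P the projection to cohomology, tr M = tr(P X) = tr X - tr(D R X). Cyclicity gives tr(D R X)
-- = tr(R X D), and X D = p^e D X with R D = 1 turns this into p^e tr X. All traces are absolutely
-- convergent double sums, and cyclicity is a reindexing.
theorem fibreM_trace (h5 : 5 ≤ p) (hπ : π ^ (p - 1) = -(p : L)) (ht : ‖t‖ = 1) {e : ℕ} (he : e ≠ 0)
    (hte : t ^ p ^ e = t) :
    HasSum (fun u : ℤ => (1 - (p : L) ^ e) * fibreX p e π t u u) (fibreM p e π t).trace := by
  have ht0 : t ≠ 0 := by rintro rfl; simp at ht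
  have hA := one_le_norm_inv_pi hπ
  have hr0 := rate_pos p 0
  have hre := rate_pos p e
  set A := ‖π⁻¹‖ with hAdef
  have hA0 : 0 < A := by linarith
  have hx := rate_zero_mul_norm_inv_lt h5 hπ
  -- The decay |π|^|v| of the rows of R must beat the growth rate(e)^(-|v|) of the columns of X.
  have hy : A⁻¹ * (rate p e)⁻¹ < 1 := by
    rw [hAdef, norm_inv, inv_inv, norm_pi p hπ, ← div_eq_mul_inv, div_lt_one hre]
    exact radius_lt_rate he
  set R := fibreR π t with hR
  set Y := fibreX p e π t with hY
  have hbound : ∀ (k l v u : ℤ), ‖R v u * Y (u + k) (v + l)‖ ≤ (rate p 0 ^ k.natAbs)⁻¹ * ((rate p e)⁻¹) ^ l.natAbs *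
      ((A⁻¹ * (rate p e)⁻¹) ^ v.natAbs * (rate p 0 * A) ^ u.natAbs) := by
    intro k l v u
    rw [norm_mul]
    have h1 := norm_fibreR_le hA ht (norm_natCast_le_one p) v u
    have h2 := norm_fibreX_le hπ ht e (u + k) (v + l)
    have h3 := pow_natAbs_add_le ((one_le_inv₀ hre).2 (rate_lt_one p e).le) v l
    have h4 := inv_pow_natAbs_add_le ((one_le_inv₀ hr0).2 (rate_lt_one p 0).le) u k
    rw [inv_inv] at h4
    refine (mul_le_mul h1 (h2.trans (mul_le_mul h4 h3 (by positivity) (by positivity)))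
      (norm_nonneg _) (by positivity)).trans_eq ?_
    rw [mul_pow, mul_pow, inv_pow (rate p 0)]
    ring
  have hs0 := summable_pow_mul_pow (x := A⁻¹ * (rate p e)⁻¹) (y := rate p 0 * A) (by positivity) hy
    (by positivity) hx
  have hS : ∀ k l : ℤ, Summable fun x : ℤ × ℤ => R x.1 x.2 * Y (x.2 + k) (x.1 + l) := fun k l =>
    Summable.of_norm_bounded (hs0.mul_left _) (fun x => hbound k l x.1 x.2)
  have hZ : ∀ n : ℤ × ℤ → ℤ, Summable fun x : ℤ × ℤ => (n x : L) * (R x.1 x.2 * Y x.2 x.1) := by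
    intro n
    refine Summable.of_norm_bounded (hs0.mul_left ((rate p 0 ^ (0 : ℤ).natAbs)⁻¹ *
      ((rate p e)⁻¹) ^ (0 : ℤ).natAbs)) (fun x => ?_)
    have := hbound 0 0 x.1 x.2
    rw [add_zero, add_zero] at this
    rw [norm_mul]
    exact (mul_le_mul (norm_intCast_le_one p _) this (norm_nonneg _) zero_le_one).trans_eq (one_mul _)
  have hshift : ∀ k l : ℤ, HasSum (fun x : ℤ × ℤ => R (x.1 - l) (x.2 - k) * Y x.2 x.1)
      (∑' x : ℤ × ℤ, R x.1 x.2 * Y (x.2 + k) (x.1 + l)) := by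
    intro k l
    have := (hS k l).hasSum
    rw [← ((Equiv.addRight (-l)).prodCongr (Equiv.addRight (-k))).hasSum_iff] at this
    refine hasSum_of_eq this (fun x => ?_) rfl
    simp [sub_eq_add_neg]
  have hdiag : Summable fun u : ℤ => Y u u := by
    refine Summable.of_norm_bounded (summable_pow_natAbs (r := rate p 0 * (rate p e)⁻¹) (by positivity) ?_)
      (fun u => ?_)
    · rw [← div_eq_mul_inv, div_lt_one hre]
      exact rate_zero_lt_rate he
    · rw [mul_pow]
      exact norm_fibreX_le hπ ht e u u
  have hD : HasSum (fun x : ℤ × ℤ => (if x.1 = x.2 then 1 else 0) * Y x.2 x.1) (∑' u, Y u u) := by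
    have hinj : Function.Injective fun u : ℤ => (u, u) := fun u v h => (Prod.mk.inj h).1
    rw [← hinj.hasSum_iff]
    · refine hasSum_of_eq hdiag.hasSum (fun u => by simp) rfl
    · rintro ⟨u, v⟩ h
      rw [if_neg (fun h' => h ⟨u, by simp at h'; simp [h']⟩), zero_mul]
  have hline : ∀ (v₀ : ℤ) (c : L) (i : Fin 2), HasSum (fun x : ℤ × ℤ =>
      (if x.1 = v₀ then c * fibreC π t i x.2 else 0) * Y x.2 x.1)
      (c * ∑' u, fibreC π t i u * Y u v₀) := by
    intro v₀ c i
    have hinj : Function.Injective fun u : ℤ => (v₀, u) := fun u v h => (Prod.mk.inj h).2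
    rw [← hinj.hasSum_iff]
    · have := summable_fibreC_mul_fibreX h5 hπ ht e i v₀
      rw [hte] at this
      refine hasSum_of_eq (this.hasSum.mul_left c) (fun u => ?_) rfl
      simp [mul_assoc, hY]
    · rintro ⟨u, v⟩ h
      rw [if_neg (fun h' => h ⟨v, by simp at h'; simp [h']⟩), zero_mul]
  have e1 := (((hZ Prod.fst).hasSum.add ((hshift 0 1).mul_left π)).sub ((hshift 0 (-1)).mul_left (π * t)))
  have e1' := hD.sub ((hline 0 1 0).add (hline (-1) (π * t) 1))
  -- tr(D R X) = tr X - tr(P X).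
  have f1 := e1.unique (hasSum_of_eq e1' (fun x => by
    have := fibreR_row (pi_ne_zero hπ) ht0 x.1 x.2
    rw [← hR] at this
    simp only [sub_zero, sub_neg_eq_add, one_mul]
    linear_combination Y x.2 x.1 * this) rfl)
  have e2 := (((hZ Prod.fst).hasSum.add ((hS 0 1).hasSum.mul_left π)).sub
    ((hS 0 (-1)).hasSum.mul_left (π * t)))
  have e3 := ((((hZ Prod.snd).hasSum.add ((hS (-1) 0).hasSum.mul_left π)).sub
    ((hS 1 0).hasSum.mul_left (π * t)))).mul_left ((p : L) ^ e)
  -- tr(R X D) = p^e tr(R D X); the reindexing in `hshift` identifies the left side with the sum of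
  -- the previous step.
  have f2 := e2.unique (hasSum_of_eq e3 (fun x => by
    have := fibreX_comm hπ ht e x.2 x.1
    rw [← hY, hte] at this
    simp only [add_zero, ← sub_eq_add_neg]
    linear_combination R x.1 x.2 * this) rfl)
  have e4 := (((hZ Prod.snd).hasSum.add ((hshift (-1) 0).mul_left π)).sub
    ((hshift 1 0).mul_left (π * t)))
  -- tr(R D X) = tr X.
  have f3 := e4.unique (hasSum_of_eq hD (fun x => by
    have := fibreR_column (pi_ne_zero hπ) ht0 x.1 x.2
    rw [← hR] at this
    simp only [sub_zero, sub_neg_eq_add]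
    linear_combination Y x.2 x.1 * this) rfl)
  refine hasSum_of_eq (hdiag.hasSum.mul_left (1 - (p : L) ^ e)) (fun u => rfl) ?_
  rw [Matrix.trace_fin_two]
  have hM : fibreM p e π t 0 0 = ∑' u, fibreC π t 0 u * Y u 0 := by
    rw [fibreM, Matrix.of_apply, if_pos rfl, hte]
  have hM' : fibreM p e π t 1 1 = π * t * ∑' u, fibreC π t 1 u * Y u (-1) := by
    rw [fibreM, Matrix.of_apply, if_neg one_ne_zero, hte]
  rw [hM, hM']
  linear_combination f1 - f2 - (p : L) ^ e * f3

end FibreFrobenius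


/-! ### Evaluation of power series on the unit circle -/

section Evaluation

variable {L : Type*} [NormedField L] [CompleteSpace L] {t : L}

/-- The series with absolutely summable coefficients. -/
def Wiener (f : L⟦X⟧) : Prop := Summable fun n => ‖coeff n f‖

/-- The value of a power series at `t`. -/
def ev (t : L) (f : L⟦X⟧) : L := ∑' n, coeff n f * t ^ n

theorem Wiener.summable {f : L⟦X⟧} (hf : Wiener f) (ht : ‖t‖ ≤ 1) :
    Summable fun n => ‖coeff n f * t ^ n‖ := by
  refine hf.of_nonneg_of_le (fun n => norm_nonneg _) (fun n => ?_)
  rw [norm_mul, norm_pow]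
  exact mul_le_of_le_one_right (norm_nonneg _) (pow_le_one₀ (norm_nonneg _) ht)

theorem Wiener.hasSum_ev {f : L⟦X⟧} (hf : Wiener f) (ht : ‖t‖ ≤ 1) :
    HasSum (fun n => coeff n f * t ^ n) (ev t f) := (hf.summable ht).of_norm.hasSum

theorem Wiener.of_le {f : L⟦X⟧} {c ρ : ℝ} (hρ0 : 0 ≤ ρ) (hρ : ρ < 1)
    (h : ∀ n, ‖coeff n f‖ ≤ c * ρ ^ n) : Wiener f :=
  Summable.of_nonneg_of_le (fun _ => norm_nonneg _) h
    ((summable_geometric_of_lt_one hρ0 hρ).mul_left c)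

theorem Wiener.C (c : L) : Wiener (PowerSeries.C c) := by
  refine summable_of_ne_finset_zero (s := {0}) fun n hn => ?_
  rw [coeff_C, if_neg (by simpa using hn), norm_zero]

theorem Wiener.one : Wiener (1 : L⟦X⟧) := by simpa using Wiener.C (1 : L)

theorem Wiener.add {f g : L⟦X⟧} (hf : Wiener f) (hg : Wiener g) : Wiener (f + g) :=
  Summable.of_nonneg_of_le (fun _ => norm_nonneg _)
    (fun n => by rw [map_add]; exact norm_add_le _ _) (Summable.add hf hg)

theorem Wiener.mul {f g : L⟦X⟧} (hf : Wiener f) (hg : Wiener g) : Wiener (f * g) := by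
  have h := summable_norm_sum_mul_antidiagonal_of_summable_norm hf hg
  refine h.congr fun n => ?_
  rw [coeff_mul]

theorem Wiener.pow {f : L⟦X⟧} (hf : Wiener f) (k : ℕ) : Wiener (f ^ k) := by
  induction k with
  | zero => simpa using Wiener.one
  | succ k ih => rw [pow_succ]; exact ih.mul hf

theorem Wiener.sum {ι : Type*} {s : Finset ι} {f : ι → L⟦X⟧} (h : ∀ i ∈ s, Wiener (f i)) :
    Wiener (∑ i ∈ s, f i) := by
  classical
  induction s using Finset.induction_on with
  | empty => simpa using Wiener.C (0 : L)
  | insert i s hi ih =>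
    rw [Finset.sum_insert hi]
    exact (h i (by simp)).add (ih fun j hj => h j (by simp [hj]))

theorem Wiener.expand {f : L⟦X⟧} (hf : Wiener f) {k : ℕ} (hk : k ≠ 0) :
    Wiener (PowerSeries.expand k hk f) := by
  have hinj : Function.Injective fun j : ℕ => k * j := fun i j h => by simpa [hk] using h
  rw [Wiener, ← hinj.summable_iff]
  · refine hf.congr fun n => ?_
    simp [coeff_expand, Nat.pos_of_ne_zero hk]
  · intro j hj
    rw [coeff_expand, if_neg, norm_zero]
    rintro ⟨i, rfl⟩
    exact hj ⟨i, rfl⟩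

theorem ev_add {f g : L⟦X⟧} (hf : Wiener f) (hg : Wiener g) (ht : ‖t‖ ≤ 1) :
    ev t (f + g) = ev t f + ev t g :=
  HasSum.tsum_eq (hasSum_of_eq ((hf.hasSum_ev ht).add (hg.hasSum_ev ht))
    (fun n => by rw [map_add, add_mul]) rfl)

theorem ev_sum {ι : Type*} {s : Finset ι} {f : ι → L⟦X⟧} (h : ∀ i ∈ s, Wiener (f i))
    (ht : ‖t‖ ≤ 1) : ev t (∑ i ∈ s, f i) = ∑ i ∈ s, ev t (f i) :=
  HasSum.tsum_eq (hasSum_of_eq (hasSum_sum fun i hi => (h i hi).hasSum_ev ht)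
    (fun n => by rw [map_sum, Finset.sum_mul]) rfl)

theorem ev_mul {f g : L⟦X⟧} (hf : Wiener f) (hg : Wiener g) (ht : ‖t‖ ≤ 1) :
    ev t (f * g) = ev t f * ev t g := by
  rw [ev, ev, ev, tsum_mul_tsum_eq_tsum_sum_antidiagonal_of_summable_norm (hf.summable ht)
    (hg.summable ht)]
  refine tsum_congr fun n => ?_
  rw [coeff_mul, Finset.sum_mul]
  refine Finset.sum_congr rfl fun i hi => ?_
  rw [← mem_antidiagonal.1 hi, pow_add]
  ring

theorem ev_C (c : L) : ev t (PowerSeries.C c) = c := by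
  rw [ev, tsum_eq_single 0]
  · simp
  · intro n hn
    rw [coeff_C, if_neg hn, zero_mul]

theorem ev_one : ev t (1 : L⟦X⟧) = 1 := by simpa using ev_C (t := t) (1 : L)

theorem ev_pow {f : L⟦X⟧} (hf : Wiener f) (ht : ‖t‖ ≤ 1) (k : ℕ) : ev t (f ^ k) = ev t f ^ k := by
  induction k with
  | zero => simpa using ev_one
  | succ k ih => rw [pow_succ, pow_succ, ev_mul (hf.pow k) hf ht, ih]

theorem ev_expand (f : L⟦X⟧) {k : ℕ} (hk : k ≠ 0) :
    ev t (PowerSeries.expand k hk f) = ev (t ^ k) f := by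
  have hinj : Function.Injective fun j : ℕ => k * j := fun i j h => by simpa [hk] using h
  rw [ev, ev, ← hinj.tsum_eq]
  · refine tsum_congr fun n => ?_
    simp [coeff_expand, Nat.pos_of_ne_zero hk, pow_mul]
  · intro j hj
    by_contra h
    refine hj ?_
    change coeff j (PowerSeries.expand k hk f) * t ^ j = 0
    rw [coeff_expand, if_neg, zero_mul]
    rintro ⟨i, rfl⟩
    exact h ⟨i, rfl⟩

end Evaluation

/-! ### Specialisation of the relative Frobenius to a fibre -/

section FibreComparison

variable {p : ℕ} [hp : Fact p.Prime] {K L : Type*} [NormedField K] [NormedField L]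
  [NormedAlgebra ℚ_[p] K] [NormedAlgebra ℚ_[p] L] [CharZero K] [CharZero L]
  [IsUltrametricDist K] [IsUltrametricDist L] [CompleteSpace K] [CompleteSpace L]
  {a : ℕ} {b b' : ℝ} {π : K} {t : L} (j : K →+* L)

/-- The matrix of the relative Frobenius with respect to `1, π t / x` and `1, π t^q / x`. -/
def frobM (p a : ℕ) (b' b : ℝ) (π : K) : Matrix (Fin 2) (Fin 2) K⟦X⟧ := Matrix.of fun i k =>
  if i = 0 then (frobColumn p a b' b π k).1 else (frobColumn p a b' b π k).2

theorem zcoeff_map (f : K⟦X⟧) (n : ℤ) : zcoeff (PowerSeries.map j f) n = j (zcoeff f n) := by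
  rw [zcoeff, zcoeff]
  split_ifs <;> simp

theorem map_bigTheta (e : ℕ) : PowerSeries.map j (bigTheta p e π) = bigTheta p e (j π) := by
  rw [bigTheta, bigTheta, map_exp_subst]
  · simp
  · simp [hp.out.ne_zero]

theorem hasSum_nat_of_int {f : ℤ → L} {x : L} (h : HasSum f x) (hf : ∀ n, n < 0 → f n = 0) :
    HasSum (fun n : ℕ => f n) x := by
  have hinj' : Function.Injective fun j : ℕ => (j : ℤ) := Nat.cast_injective
  exact (hinj'.hasSum_iff fun n hn => hf n (by
    by_contra h
    exact hn ⟨n.toNat, by simp; omega⟩)).2 h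

theorem hasSum_alpha (hπ : (j π) ^ (p - 1) = -(p : L)) (ht : ‖t‖ = 1) (k : Fin 2) (u : ℤ) :
    HasSum (fun N : ℕ => j (alpha p a π (prodSer 1 (if k = 0 then 1 else C π * X)) N u) * t ^ N)
      (if k = 0 then fibreX p a (j π) t u 0 else j π * t * fibreX p a (j π) t u (-1)) := by
  have hu : ∀ N : ℕ, (N : ℤ) + (p : ℤ) ^ a * u = (N : ℤ) + ((p ^ a : ℕ) * u) := fun N => by push_cast; rfl
  fin_cases k
  · have h := hasSum_kernelG hπ ht a ((p ^ a : ℕ) * u)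
    have h' := hasSum_nat_of_int h fun n hn => by
      rw [kernelTerm, zcoeff_of_neg (bigTheta p a (j π)) hn, mul_zero, zero_mul]
    simp only [Fin.zero_eta, if_true, fibreX, sub_zero]
    refine hasSum_of_eq h' (fun N => ?_) rfl
    rw [alpha_prodSer, mul_one, map_mul, ← zcoeff_map, ← coeff_map, map_bigTheta, kernelTerm,
      zpow_natCast, zcoeff_natCast, hu]
  · have h := (hasSum_kernelG_shift hπ ht a ((p ^ a : ℕ) * u) 1).mul_left (j π)
    have h' := hasSum_nat_of_int h fun n hn => by
      rw [zcoeff_of_neg (bigTheta p a (j π)) (show n - 1 < 0 by omega), mul_zero, zero_mul, mul_zero]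
    simp only [Fin.mk_one, fibreX, sub_neg_eq_add, if_neg (one_ne_zero : (1 : Fin 2) ≠ 0)]
    refine hasSum_of_eq h' (fun N => ?_) (by rw [zpow_one]; ring)
    have e1 := zcoeff_X_pow_mul (bigTheta p a (j π)) 1 N
    rw [zcoeff_natCast, pow_one, Nat.cast_one] at e1
    have e2 : PowerSeries.map j (bigTheta p a π * (C π * X)) =
        C (j π) * (X * bigTheta p a (j π)) := by
      rw [map_mul, map_mul, map_bigTheta, map_C, map_X]
      ring
    rw [alpha_prodSer, mul_one, map_mul, ← zcoeff_map, ← coeff_map, map_bigTheta, e2,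
      zpow_natCast, hu, coeff_C_mul, e1]
    ring

theorem norm_memK_le {η : ℕ → ℤ → K} {q : ℕ} (hη : MemK p q (b' / (p : ℝ) ^ a) b η) :
    ∃ r : ℝ, 0 ≤ r ∧ ∀ N u, ‖η N u‖ ≤ r * (((p : ℝ) ^ b)⁻¹) ^ u.natAbs *
      decay p a b' ^ (N - q * (-u).toNat) := by
  have h := one_lt_cast p
  have h0 : (0 : ℝ) < p := by linarith
  obtain ⟨hz, ρ, hρ⟩ := hη
  have hd : 0 < decay p a b' := decay_pos
  refine ⟨(p : ℝ) ^ (-ρ), by positivity, fun N u => ?_⟩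
  rcases lt_or_ge N (q * (-u).toNat) with hN | hN
  · rw [hz N u hN, norm_zero]
    positivity
  · have := hρ (N - q * (-u).toNat) u
    rw [Nat.sub_add_cancel hN, OrdGE] at this
    refine this.trans_eq ?_
    rw [decay_pow, ← Real.rpow_neg h0.le, ← Real.rpow_natCast ((p : ℝ) ^ (-b)), ← Real.rpow_mul h0.le,
      ← Real.rpow_add h0, ← Real.rpow_add h0]
    congr 1
    rw [show ((u.natAbs : ℕ) : ℝ) = |(u : ℝ)| by rw [Nat.cast_natAbs, Int.cast_abs]]
    ring

theorem hasSum_fibreC_mul_bdry {s : L} {π' : L} {β : ℝ} (hs : ‖s‖ = 1)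
    (hπ' : π' ^ (p - 1) = -(p : L)) (hβ0 : 0 ≤ β) (hβ : β * ‖π'⁻¹‖ < 1) {h : ℤ → L} {r : ℝ}
    (hh : ∀ u, ‖h u‖ ≤ r * β ^ u.natAbs) (i : Fin 2) :
    HasSum (fun u : ℤ => fibreC π' s i u * ((u : L) * h u + π' * (h (u - 1) - s * h (u + 1)))) 0 := by
  have hs0 : s ≠ 0 := by rintro rfl; simp at hs
  set c := fibreC π' s i with hc
  have hA := one_le_norm_inv_pi hπ'
  have hS : ∀ (n : ℤ → ℤ) (k : ℤ), Summable fun u => (n u : L) * (c (u + k) * h u) := by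
    intro n k
    refine Summable.of_norm_bounded ((summable_pow_natAbs (by positivity) hβ).mul_left
      (‖π'⁻¹‖ ^ k.natAbs * r)) (fun u => ?_)
    have hC := (norm_fibreC_le hA hs (norm_natCast_le_one p) i (u + k)).trans
      (pow_natAbs_add_le hA u k)
    rw [norm_mul, norm_mul]
    refine (mul_le_mul (norm_intCast_le_one p _) (mul_le_mul hC (hh u) (norm_nonneg _)
      (by positivity)) (by positivity) zero_le_one).trans_eq ?_
    rw [mul_pow]
    ring
  have h0 := (hS id 0).hasSum
  have h1 := (hS (fun _ => 1) 1).hasSum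
  have h2 := (hS (fun _ => 1) (-1)).hasSum
  have h1' := h1
  have h2' := h2
  rw [← (Equiv.addRight (-1 : ℤ)).hasSum_iff] at h1'
  rw [← (Equiv.addRight (1 : ℤ)).hasSum_iff] at h2'
  have e1 := (h0.add (h1.mul_left π')).sub (h2.mul_left (π' * s))
  have e2 := (h0.add (h1'.mul_left π')).sub (h2'.mul_left (π' * s))
  have e3 : HasSum (fun _ : ℤ => (0 : L)) _ := hasSum_of_eq e1 (fun u => by
    have := fibreC_rec (pi_ne_zero hπ') hs0 i u
    rw [← hc, sub_eq_add_neg u 1] at this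
    simp only [id, Int.cast_one, one_mul, add_zero]
    linear_combination -h u * this) rfl
  refine hasSum_of_eq e2 (fun u => ?_) (hasSum_zero.unique e3)
  simp only [Function.comp_apply, Equiv.coe_addRight, neg_add_cancel_right, add_neg_cancel_right,
    id, Int.cast_one, one_mul, add_zero]
  rw [← sub_eq_add_neg]
  ring

theorem Params.map (H : Params p a π b b') : (j π) ^ (p - 1) = -(p : L) := by
  rw [← map_pow, H.pi_pow, map_neg, map_natCast]

theorem wiener_frobM (hj : ∀ x, ‖j x‖ = ‖x‖) (H : Params p a π b b') (i k : Fin 2) :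
    Wiener (PowerSeries.map j (frobM p a b' b π i k)) := by
  obtain ⟨-, h1, h2, -⟩ := frobColumn_spec H k
  rw [frobM, Matrix.of_apply]
  split_ifs with hi
  · refine Wiener.of_le (c := 1) decay_pos.le (decay_lt_one H) (fun n => ?_)
    rw [coeff_map, hj, one_mul]
    exact h1 n
  · refine Wiener.of_le (c := ((p : ℝ) ^ b)⁻¹) decay_pos.le (decay_lt_one H) (fun n => ?_)
    rw [coeff_map, hj]
    exact h2 n

set_option maxHeartbeats 1000000 in
-- The relation α_a(ξ) = c + D η is specialised at t and paired with the fibre functionals. They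
-- kill the exact term because η decays like p^(-b|u|) and p^b > 1/|π|; on the basis they read off
-- the values of the coordinates.
theorem fibreM_eq_ev (hj : ∀ x, ‖j x‖ = ‖x‖) (H : Params p a π b b') (ht : ‖t‖ = 1) (i k : Fin 2) :
    fibreM p a (j π) t i k = ev t (PowerSeries.map j (frobM p a b' b π i k)) := by
  have ht0 : t ≠ 0 := by rintro rfl; simp at ht
  have hπ := H.map j
  have hs : ‖t ^ p ^ a‖ = 1 := by rw [norm_pow, ht, one_pow]
  have hs0 : t ^ p ^ a ≠ 0 := pow_ne_zero _ ht0
  obtain ⟨⟨-, -, η, hη, hα⟩, -⟩ := frobColumn_spec H k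
  obtain ⟨r, hr, hbound⟩ := norm_memK_le hη
  have hd0 : 0 < decay p a b' := decay_pos
  have hd1 := decay_lt_one H
  have hp0 : (0 : ℝ) < p := by linarith [one_lt_cast p]
  have hηsum : ∀ u : ℤ, Summable fun N : ℕ => j (η N u) * t ^ N := by
    intro u
    rw [← summable_nat_add_iff (p ^ a * (-u).toNat)]
    refine Summable.of_norm_bounded ((summable_geometric_of_lt_one hd0.le hd1).mul_left
      (r * (((p : ℝ) ^ b)⁻¹) ^ u.natAbs)) (fun N => ?_)
    rw [norm_mul, hj, norm_pow, ht, one_pow, mul_one]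
    refine (hbound _ u).trans_eq ?_
    rw [Nat.add_sub_cancel]
  set h : ℤ → L := fun u => ∑' N : ℕ, j (η N u) * t ^ N with hh
  have hhb : ∀ u, ‖h u‖ ≤ r * (((p : ℝ) ^ b)⁻¹) ^ u.natAbs := by
    intro u
    refine norm_tsum_le_of_le (by positivity) (fun N => ?_)
    rw [norm_mul, hj, norm_pow, ht, one_pow, mul_one]
    refine (hbound _ u).trans (mul_le_of_le_one_right (by positivity) (pow_le_one₀ hd0.le hd1.le))
  have hβ : ((p : ℝ) ^ b)⁻¹ * ‖(j π)⁻¹‖ < 1 := by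
    rw [norm_inv_pi hπ, inv_mul_lt_iff₀ (by positivity), mul_one]
    exact Real.rpow_lt_rpow_of_exponent_lt (one_lt_cast p) H.lt_b
  have hker := hasSum_fibreC_mul_bdry hs hπ (by positivity) hβ hhb i
  set c := frobColumn p a b' b π k with hc
  have hw := fun i => (wiener_frobM j hj H i k).hasSum_ev ht.le
  have hw0 : HasSum (fun N => coeff N (PowerSeries.map j c.1) * t ^ N)
    (ev t (PowerSeries.map j c.1)) := hw 0
  have hw1 : HasSum (fun N => coeff N (PowerSeries.map j c.2) * t ^ N)
    (ev t (PowerSeries.map j c.2)) := hw 1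
  have hshift : ∀ {f : ℕ → L} {x : L}, HasSum (fun N => f N * t ^ N) x →
      HasSum (fun N => (if p ^ a ≤ N then f (N - p ^ a) else 0) * t ^ N) (t ^ p ^ a * x) := by
    intro f x hx
    have := (hasSum_nat_add_iff' (f := fun N => (if p ^ a ≤ N then f (N - p ^ a) else 0) * t ^ N)
      (g := t ^ p ^ a * x) (p ^ a)).1
    refine this (hasSum_of_eq (hx.mul_left (t ^ p ^ a)) (fun N => ?_) ?_)
    · rw [if_pos (Nat.le_add_left _ _), Nat.add_sub_cancel, pow_add]
      ring
    · rw [Finset.sum_eq_zero, sub_zero]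
      intro N hN
      rw [if_neg (by simpa using hN), zero_mul]
  -- This is the specialised relation at x^u: the fibre Frobenius on the left, the two basis
  -- elements and the boundary on the right.
  have hfib : ∀ u : ℤ, (if k = 0 then fibreX p a (j π) t u 0 else j π * t * fibreX p a (j π) t u (-1)) =
      (if u = 0 then ev t (PowerSeries.map j c.1) else if u = -1 then
        t ^ p ^ a * (ev t (PowerSeries.map j c.2) * j π) else 0) +
      ((u : L) * h u + j π * (h (u - 1) - t ^ p ^ a * h (u + 1))) := by
    intro u
    refine (hasSum_alpha j hπ ht k u).unique ?_
    rw [hα]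
    have hb := (((hηsum u).hasSum.mul_left (u : L)).add
      (((hηsum (u - 1)).hasSum.sub (hshift (hηsum (u + 1)).hasSum)).mul_left (j π)))
    have hv : HasSum (fun N : ℕ => j (serV (p ^ a) π c N u) * t ^ N)
        (if u = 0 then ev t (PowerSeries.map j c.1) else if u = -1 then
        t ^ p ^ a * (ev t (PowerSeries.map j c.2) * j π) else 0) := by
      simp only [serV]
      by_cases hu : u = 0
      · simp only [hu, if_true]
        exact hasSum_of_eq hw0 (fun N => by rw [coeff_map]) rfl
      by_cases hu' : u = -1
      · simp only [hu', if_true, true_and]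
        refine hasSum_of_eq (hshift (f := fun N => j (coeff N c.2) * j π)
          (hasSum_of_eq (hw1.mul_right (j π)) (fun N => by rw [coeff_map]; ring) rfl)) (fun N => ?_) ?_
        · simp only [show ¬ (-1 : ℤ) = 0 by decide, if_false]
          split_ifs <;> simp
        · simp
      · simp only [if_neg hu, hu', false_and, if_false, map_zero, zero_mul]
        exact hasSum_zero
    refine hasSum_of_eq (hv.add hb) (fun N => ?_) rfl
    simp only [Pi.add_apply, map_add, bdry, map_mul, map_sub, map_intCast]
    split_ifs
    · ring
    · rw [map_zero]
      ring
  have hpair : HasSum (fun u : ℤ => fibreC (j π) (t ^ p ^ a) i u * (if u = 0 then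
      ev t (PowerSeries.map j c.1) else if u = -1 then
        t ^ p ^ a * (ev t (PowerSeries.map j c.2) * j π) else 0))
      (if i = 0 then ev t (PowerSeries.map j c.1) else ev t (PowerSeries.map j c.2)) := by
    have := hasSum_sum_of_ne_finset_zero (L := .unconditional ℤ) (f := fun u : ℤ => fibreC (j π) (t ^ p ^ a) i u * (if u = 0 then
      ev t (PowerSeries.map j c.1) else if u = -1 then
        t ^ p ^ a * (ev t (PowerSeries.map j c.2) * j π) else 0)) (s := {0, -1}) (fun u hu => by
        simp only [Finset.mem_insert, Finset.mem_singleton, not_or] at hu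
        rw [if_neg hu.1, if_neg hu.2, mul_zero])
    refine hasSum_of_eq this (fun u => rfl) ?_
    rw [Finset.sum_pair (by decide), if_pos (rfl : (0 : ℤ) = 0),
      if_neg (show ¬ (-1 : ℤ) = 0 by decide), if_pos (rfl : (-1 : ℤ) = -1)]
    have e0 := fibreC_natCast (π := j π) (s := t ^ p ^ a) i 0
    have e1 := fibreC_neg (π := j π) (s := t ^ p ^ a) i 1
    have e2 := besselY_at_one (s := t ^ p ^ a) (pi_ne_zero hπ) i
    rw [Nat.cast_zero] at e0
    rw [Nat.cast_one] at e1
    rw [e0, e1, zpow_neg_one]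
    have e3 : besselY (j π) (j π)⁻¹ (t ^ p ^ a) i 0 = if i = 0 then 1 else 0 := by
      fin_cases i <;> simp [besselY, besselR_zero]
    have e4 : besselY (j π) (j π)⁻¹ (t ^ p ^ a) i 1 * (t ^ p ^ a)⁻¹ *
        (t ^ p ^ a * (ev t (PowerSeries.map j c.2) * j π)) =
        (j π * besselY (j π) (j π)⁻¹ (t ^ p ^ a) i 1) * ev t (PowerSeries.map j c.2) := by
      field_simp
    rw [e3, e4, e2]
    split_ifs <;> simp
  have hfinal := hasSum_of_eq (g := fun u => fibreC (j π) (t ^ p ^ a) i u * (if k = 0 then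
      fibreX p a (j π) t u 0 else j π * t * fibreX p a (j π) t u (-1)))
    (hpair.add hker) (fun u => by rw [hfib u, mul_add]) (add_zero _).symm
  rw [frobM, Matrix.of_apply, fibreM, Matrix.of_apply]
  have hev : ev t (PowerSeries.map j (if i = 0 then c.1 else c.2)) =
      if i = 0 then ev t (PowerSeries.map j c.1) else ev t (PowerSeries.map j c.2) := by
    split_ifs <;> rfl
  rw [← hc, hev, ← hfinal.tsum_eq]
  split_ifs with hk
  · rfl
  · rw [← tsum_mul_left]
    refine tsum_congr fun u => by ring

end FibreComparison


/-! ### Teichmüller representatives -/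

section Teichmuller

variable (L : Type*) [NormedField L] [IsUltrametricDist L]

/-- The ring of integers of an ultrametric normed field. -/
abbrev integerRing : ValuationSubring L := (NormedField.valuation (K := L)).valuationSubring

variable {L}

theorem mem_integerRing {x : L} : x ∈ integerRing L ↔ ‖x‖ ≤ 1 := by
  rw [Valuation.mem_valuationSubring_iff, NormedField.valuation_apply, ← NNReal.coe_le_coe]
  rfl

theorem residue_eq_zero_iff (x : integerRing L) :
    IsLocalRing.residue (integerRing L) x = 0 ↔ ‖(x : L)‖ < 1 := by
  rw [IsLocalRing.residue_eq_zero_iff, IsLocalRing.mem_maximalIdeal, mem_nonunits_iff, not_iff_comm,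
    not_lt]
  constructor
  · intro h
    have hx : (x : L) ≠ 0 := by
      intro h0
      rw [h0, norm_zero] at h
      linarith
    refine IsUnit.of_mul_eq_one ⟨(x : L)⁻¹, mem_integerRing.2 ?_⟩ (Subtype.ext ?_)
    · rw [norm_inv]
      exact inv_le_one_of_one_le₀ h
    · simp [hx]
  · rintro ⟨u, rfl⟩
    have h1 := mem_integerRing.1 (u⁻¹).1.2
    have h2 : ((u : integerRing L) : L) * ((u⁻¹ : (integerRing L)ˣ) : integerRing L) = 1 := by
      rw [← MulMemClass.coe_mul, Units.mul_inv]
      rfl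
    have h3 := congrArg norm h2
    rw [norm_mul, norm_one] at h3
    nlinarith [norm_nonneg ((u : integerRing L) : L)]

theorem residue_eq_iff (x y : integerRing L) :
    IsLocalRing.residue (integerRing L) x = IsLocalRing.residue (integerRing L) y ↔
      ‖(x : L) - y‖ < 1 := by
  rw [← sub_eq_zero, ← map_sub, residue_eq_zero_iff]
  rfl

/-- A monic lift of the polynomial has a root in L; it is integral, hence lies in the valuation
ring, and reduces to the required root. -/
theorem isAlgClosed_residueField [IsAlgClosed L] :
    IsAlgClosed (IsLocalRing.ResidueField (integerRing L)) := by
  refine IsAlgClosed.of_exists_root _ fun f hf hirr => ?_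
  obtain ⟨g, hg, hdeg, hmonic⟩ := Polynomial.lifts_and_natDegree_eq_and_monic
    (f := IsLocalRing.residue (integerRing L)) (p := f) (by
      rw [Polynomial.lifts_iff_coeff_lifts]
      exact fun n => IsLocalRing.residue_surjective _) hf
  have hd : (g.map (algebraMap (integerRing L) L)).degree ≠ 0 := by
    rw [hmonic.degree_map, Polynomial.degree_eq_natDegree hmonic.ne_zero, hdeg]
    exact_mod_cast hirr.natDegree_pos.ne'
  obtain ⟨r, hr⟩ := IsAlgClosed.exists_root _ hd
  have hint : IsIntegral (integerRing L) r := ⟨g, hmonic, by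
    rwa [Polynomial.IsRoot, Polynomial.eval_map] at hr⟩
  obtain ⟨y, hy⟩ := IsIntegrallyClosed.isIntegral_iff.1 hint
  refine ⟨IsLocalRing.residue _ y, ?_⟩
  rw [← hg, Polynomial.eval_map, Polynomial.eval₂_at_apply]
  rw [Polynomial.IsRoot, Polynomial.eval_map, ← hy, Polynomial.eval₂_at_apply] at hr
  rw [(FaithfulSMul.algebraMap_injective (integerRing L) L) (hr.trans (map_zero _).symm), map_zero]

/-- If y ≠ y', cancelling y - y' in y^Q - y'^Q = y - y' gives a sum of Q monomials equal to 1. When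
the reductions agree this sum reduces to Q y^(Q-1) = 0. -/
theorem eq_of_pow_eq_self {p Q : ℕ} [Fact p.Prime] [NormedAlgebra ℚ_[p] L] (hQ : ‖(Q : L)‖ < 1)
    {y y' : integerRing L} (hy : y ^ Q = y) (hy' : y' ^ Q = y')
    (h : IsLocalRing.residue (integerRing L) y = IsLocalRing.residue (integerRing L) y') : y = y' := by
  by_contra hne
  have h1 : (∑ i ∈ Finset.range Q, y ^ i * y' ^ (Q - 1 - i)) * (y - y') = y - y' := by
    rw [Commute.geom_sum₂_mul (Commute.all y y'), hy, hy']
  have h2 : ∑ i ∈ Finset.range Q, y ^ i * y' ^ (Q - 1 - i) = 1 := by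
    refine mul_right_cancel₀ (sub_ne_zero.2 hne) ?_
    rw [h1, one_mul]
  have h3 := congrArg (IsLocalRing.residue (integerRing L)) h2
  have h4 : IsLocalRing.residue (integerRing L) (Q : integerRing L) = 0 := by
    rw [residue_eq_zero_iff]
    simpa using hQ
  rw [map_sum, map_one] at h3
  simp only [map_mul, map_pow, h] at h3
  rw [map_natCast] at h4
  have h5 : ∀ i ∈ Finset.range Q, IsLocalRing.residue (integerRing L) y' ^ i *
      IsLocalRing.residue (integerRing L) y' ^ (Q - 1 - i) =
      IsLocalRing.residue (integerRing L) y' ^ (Q - 1) := by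
    intro i hi
    rw [← pow_add]
    congr 1
    have := Finset.mem_range.1 hi
    omega
  rw [Finset.sum_congr rfl h5, Finset.sum_const, Finset.card_range, nsmul_eq_mul, h4, zero_mul] at h3
  exact zero_ne_one h3

theorem exists_pow_eq_self [IsAlgClosed L] {Q : ℕ} (hQ : 1 < Q)
    (z : IsLocalRing.ResidueField (integerRing L)) (hz : z ^ Q = z) :
    ∃ y : integerRing L, y ^ Q = y ∧ IsLocalRing.residue (integerRing L) y = z := by
  obtain ⟨x, rfl⟩ := IsLocalRing.residue_surjective z
  set f : Polynomial L := Polynomial.X ^ Q - Polynomial.X with hf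
  have hmonic : f.Monic := Polynomial.monic_X_pow_sub (by rw [Polynomial.degree_X]; exact_mod_cast hQ)
  have hprod : (f.roots.map fun r => (x : L) - r).prod = (x : L) ^ Q - x := by
    have h := (IsAlgClosed.splits f).eq_prod_roots_of_monic hmonic
    have h' := congrArg (Polynomial.eval (x : L)) h
    rw [Polynomial.eval_multiset_prod, Multiset.map_map] at h'
    simp only [hf, Polynomial.eval_sub, Polynomial.eval_pow, Polynomial.eval_X, Polynomial.eval_C,
      Function.comp_def] at h'
    rw [h', hf]
  have hroot : ∀ r ∈ f.roots, r ^ Q = r := by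
    intro r hr
    have := (Polynomial.mem_roots hmonic.ne_zero).1 hr
    simpa [hf, Polynomial.IsRoot, sub_eq_zero] using this
  have hle : ∀ r ∈ f.roots, ‖r‖ ≤ 1 := by
    intro r hr
    by_contra hlt
    rw [not_le] at hlt
    have h1 := congrArg norm (hroot r hr)
    rw [norm_pow] at h1
    have h2 := pow_lt_pow_right₀ hlt hQ
    rw [pow_one, h1] at h2
    exact lt_irrefl _ h2
  have hlt : ‖(x : L) ^ Q - x‖ < 1 := by
    rw [← map_pow, residue_eq_iff] at hz
    simpa using hz
  -- The product of the differences with all roots is x^Q - x, which is small; hence one difference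
  -- is small.
  have hex : ∃ r ∈ f.roots, ‖(x : L) - r‖ < 1 := by
    by_contra hcon
    push Not at hcon
    have h1 : ∀ s : Multiset L, (∀ r ∈ s, 1 ≤ ‖(x : L) - r‖) →
        1 ≤ ‖(s.map fun r => (x : L) - r).prod‖ := by
      intro s
      induction s using Multiset.induction_on with
      | empty => simp
      | cons r s ih =>
        intro h
        rw [Multiset.map_cons, Multiset.prod_cons, norm_mul]
        exact one_le_mul_of_one_le_of_one_le (h r (by simp)) (ih fun r' hr' => h r' (by simp [hr']))
    have := h1 f.roots hcon
    rw [hprod] at this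
    linarith
  obtain ⟨r, hr, hxr⟩ := hex
  refine ⟨⟨r, mem_integerRing.2 (hle r hr)⟩, Subtype.ext (hroot r hr), ?_⟩
  rw [residue_eq_iff, norm_sub_rev]
  exact hxr

/-- A multiplicative section of the reduction, defined on an algebraic extension of `𝔽_p`. -/
structure IsTeichmuller {k : Type*} [Field k] (τ : k →* L) : Prop where
  map_zero : τ 0 = 0
  norm_eq_one : ∀ x, x ≠ 0 → ‖τ x‖ = 1
  norm_add_sub : ∀ x y, ‖τ (x + y) - (τ x + τ y)‖ < 1

/-- The field k is algebraic over 𝔽_p and embeds in the algebraically closed residue field. Each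
element has exactly one lift satisfying y^(p^m) = y for some m ≠ 0, and uniqueness forces
multiplicativity. -/
theorem exists_isTeichmuller [IsAlgClosed L] {p : ℕ} [hp : Fact p.Prime] [NormedAlgebra ℚ_[p] L]
    {k : Type*} [Field k] [CharP k p] (hk : ∀ x : k, ∃ m : ℕ, m ≠ 0 ∧ x ^ p ^ m = x) :
    ∃ τ : k →* L, IsTeichmuller τ := by
  set O := integerRing L
  set res := IsLocalRing.residue O
  have hpow : ∀ {m : ℕ}, m ≠ 0 → ‖((p ^ m : ℕ) : L)‖ < 1 := by
    intro m hm
    rw [Nat.cast_pow, norm_pow, norm_cast_prime p]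
    exact pow_lt_one₀ (by positivity) (inv_lt_one_of_one_lt₀ (one_lt_cast p)) hm
  have hchar : CharP (IsLocalRing.ResidueField O) p := by
    have : ((p : ℕ) : IsLocalRing.ResidueField O) = 0 := by
      rw [← map_natCast res, residue_eq_zero_iff]
      simpa using hpow one_ne_zero
    exact ringChar.of_eq (CharP.ringChar_of_prime_eq_zero hp.out this)
  have hclosed : IsAlgClosed (IsLocalRing.ResidueField O) := isAlgClosed_residueField
  let _ : Algebra (ZMod p) (IsLocalRing.ResidueField O) := ZMod.algebra _ p
  let _ : Algebra (ZMod p) k := ZMod.algebra _ p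
  have halg : Algebra.IsAlgebraic (ZMod p) k := by
    refine ⟨fun x => ?_⟩
    obtain ⟨m, hm, hx⟩ := hk x
    refine ⟨Polynomial.X ^ p ^ m - Polynomial.X, ?_, by simp [hx]⟩
    exact FiniteField.X_pow_card_pow_sub_X_ne_zero (ZMod p) hm hp.out.one_lt
  set σ : k →+* IsLocalRing.ResidueField O :=
    (IsAlgClosed.lift : k →ₐ[ZMod p] IsLocalRing.ResidueField O).toRingHom
  have hpow_mul : ∀ {R : Type _} [Monoid R] {y : R} {m : ℕ} (n : ℕ), y ^ p ^ m = y → y ^ p ^ (m * n) = y := by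
    intro R _ y m n hy
    induction n with
    | zero => simp
    | succ n ih => rw [Nat.mul_succ, pow_add, pow_mul, ih, hy]
  have hex : ∀ x : k, ∃ y : O, (∃ m : ℕ, m ≠ 0 ∧ y ^ p ^ m = y) ∧ res y = σ x := by
    intro x
    obtain ⟨m, hm, hx⟩ := hk x
    obtain ⟨y, hy, hyx⟩ := exists_pow_eq_self (Nat.one_lt_pow hm hp.out.one_lt) (σ x)
      (by rw [← map_pow, hx])
    exact ⟨y, ⟨m, hm, hy⟩, hyx⟩
  choose T hT hres using hex
  have huniq : ∀ {y y' : O}, (∃ m : ℕ, m ≠ 0 ∧ y ^ p ^ m = y) → (∃ m : ℕ, m ≠ 0 ∧ y' ^ p ^ m = y') →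
      res y = res y' → y = y' := by
    rintro y y' ⟨m, hm, hy⟩ ⟨m', hm', hy'⟩ h
    exact eq_of_pow_eq_self (p := p) (hpow (mul_ne_zero hm hm')) (hpow_mul m' hy)
      (by rw [mul_comm]; exact hpow_mul m hy') h
  have hT1 : T 1 = 1 := huniq (hT 1) ⟨1, one_ne_zero, one_pow _⟩ (by rw [hres, map_one, map_one])
  have hT0 : T 0 = 0 := huniq (hT 0) ⟨1, one_ne_zero, by rw [pow_one, zero_pow hp.out.ne_zero]⟩
    (by rw [hres, map_zero, map_zero])
  have hTmul : ∀ x y, T (x * y) = T x * T y := by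
    intro x y
    refine huniq (hT _) ?_ (by rw [hres, map_mul, map_mul, hres, hres])
    obtain ⟨m, hm, hx⟩ := hT x
    obtain ⟨m', hm', hy⟩ := hT y
    refine ⟨m * m', mul_ne_zero hm hm', ?_⟩
    rw [mul_pow, hpow_mul m' hx, mul_comm m m', hpow_mul m hy]
  refine ⟨⟨⟨fun x => (T x : L), by rw [hT1]; rfl⟩, fun x y => by
    change ((T (x * y) : O) : L) = T x * T y
    rw [hTmul]
    rfl⟩, ?_, ?_, ?_⟩
  · change ((T 0 : O) : L) = 0
    rw [hT0]
    rfl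
  · intro x hx
    change ‖((T x : O) : L)‖ = 1
    refine le_antisymm (mem_integerRing.1 (T x).2) ?_
    by_contra hlt
    rw [not_le, ← residue_eq_zero_iff] at hlt
    have := (hres x).symm.trans hlt
    exact hx ((map_eq_zero σ).1 this)
  · intro x y
    have := (residue_eq_iff (T (x + y)) (T x + T y)).1 (by
      rw [map_add]
      exact (hres _).trans (by rw [map_add, ← hres, ← hres]))
    simpa using this

section Properties

variable {k : Type*} [Field k] {τ : k →* L}

theorem IsTeichmuller.norm_le_one (h : IsTeichmuller τ) (x : k) : ‖τ x‖ ≤ 1 := by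
  by_cases hx : x = 0
  · rw [hx, h.map_zero, norm_zero]
    exact zero_le_one
  · exact (h.norm_eq_one x hx).le

theorem IsTeichmuller.ne_zero (h : IsTeichmuller τ) {x : k} (hx : x ≠ 0) : τ x ≠ 0 := by
  rw [← norm_ne_zero_iff, h.norm_eq_one x hx]
  exact one_ne_zero

theorem IsTeichmuller.norm_sum_sub (h : IsTeichmuller τ) {ι : Type*} (s : Finset ι) (f : ι → k) :
    ‖τ (∑ i ∈ s, f i) - ∑ i ∈ s, τ (f i)‖ < 1 := by
  classical
  induction s using Finset.induction_on with
  | empty => simp [h.map_zero]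
  | insert i s hi ih =>
    rw [Finset.sum_insert hi, Finset.sum_insert hi]
    have h1 := h.norm_add_sub (f i) (∑ i ∈ s, f i)
    rw [show τ (f i + ∑ i ∈ s, f i) - (τ (f i) + ∑ i ∈ s, τ (f i)) =
      (τ (f i + ∑ i ∈ s, f i) - (τ (f i) + τ (∑ i ∈ s, f i))) +
        (τ (∑ i ∈ s, f i) - ∑ i ∈ s, τ (f i)) by ring]
    exact (IsUltrametricDist.norm_add_le_max _ _).trans_lt (max_lt h1 ih)

theorem IsTeichmuller.injective (h : IsTeichmuller τ) : Function.Injective τ := by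
  intro x y hxy
  by_contra hne
  have hy : x - y ≠ 0 := sub_ne_zero.2 hne
  have h1 := h.norm_add_sub (x - y) y
  rw [sub_add_cancel, hxy, sub_add_cancel_right, norm_neg, h.norm_eq_one _ hy] at h1
  exact lt_irrefl _ h1

end Properties

end Teichmuller


/-! ### Dwork's additive characters -/

section DworkCharacter

variable {p : ℕ} [hp : Fact p.Prime] {L : Type*} [NormedField L] [NormedAlgebra ℚ_[p] L]
  [CharZero L] [IsUltrametricDist L] {π z : L}

/-- With d = ζ - 1 the expansion of (1 + d)^p = 1 expresses pd through d^p and the middle binomial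
terms. If 0 < |d| < |π| all of these are strictly smaller than |pd|. -/
theorem eq_one_of_pow_prime_eq_one {ζ : L} (h : ζ ^ p = 1) (hζ : ‖ζ - 1‖ < radius p) : ζ = 1 := by
  by_contra hne
  set d := ζ - 1 with hd
  have hd0 : 0 < ‖d‖ := norm_pos_iff.2 (sub_ne_zero.2 hne)
  have hp2 := hp.out.two_le
  have hr1 := radius_lt_one p
  have h1 : (d + 1) ^ p = ∑ k ∈ Finset.range (p + 1), d ^ k * (p.choose k : L) := by
    rw [add_pow]
    simp
  obtain ⟨m, hm⟩ : ∃ m, p = m + 2 := ⟨p - 2, by omega⟩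
  have h2 : ∑ k ∈ Finset.range (p + 1), d ^ k * (p.choose k : L) =
      ∑ k ∈ Finset.range m, d ^ (k + 2) * (p.choose (k + 2) : L) + d * p + 1 + d ^ p := by
    rw [Finset.sum_range_succ, Nat.choose_self, Nat.cast_one, mul_one]
    congr 1
    rw [show Finset.range p = Finset.range (m + 2) by rw [← hm], Finset.sum_range_succ',
      Finset.sum_range_succ']
    simp
  rw [h2, hd, sub_add_cancel, ← hd, h] at h1
  have h3 : d * p = -(∑ k ∈ Finset.range m, d ^ (k + 2) * (p.choose (k + 2) : L) + d ^ p) := by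
    linear_combination -h1
  have hp0 : (0 : ℝ) < (p : ℝ)⁻¹ := inv_pos.2 (by linarith [one_lt_cast p])
  have hd1 : ‖d‖ < 1 := hζ.trans hr1
  have hrad : radius p ^ (p - 1) = (p : ℝ)⁻¹ := by
    have hcast : ((p - 1 : ℕ) : ℝ) = (p : ℝ) - 1 := by rw [Nat.cast_sub hp.out.one_le]; simp
    rw [radius, ← Real.rpow_natCast, ← Real.rpow_mul (by positivity), hcast, neg_mul,
      one_div_mul_cancel (by linarith [one_lt_cast p]), Real.rpow_neg_one]
  have h4 : ‖d ^ p‖ < ‖d‖ * (p : ℝ)⁻¹ := by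
    have e : ‖d‖ ^ p = ‖d‖ * ‖d‖ ^ (p - 1) := by rw [← pow_succ', Nat.sub_add_cancel hp.out.one_le]
    rw [norm_pow, e, ← hrad]
    apply mul_lt_mul_of_pos_left _ hd0
    exact pow_lt_pow_left₀ hζ (norm_nonneg _) (by omega)
  have h5 : ‖∑ k ∈ Finset.range m, d ^ (k + 2) * (p.choose (k + 2) : L)‖ < ‖d‖ * (p : ℝ)⁻¹ := by
    refine lt_of_le_of_lt (b := ‖d‖ ^ 2 * (p : ℝ)⁻¹) ?_ (by nlinarith [mul_pos hd0 hp0])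
    refine IsUltrametricDist.norm_sum_le_of_forall_le_of_nonneg (by positivity) fun k hk => ?_
    obtain ⟨c, hc⟩ := hp.out.dvd_choose_self (k := k + 2) (by omega)
      (by have := Finset.mem_range.1 hk; omega)
    rw [hc, Nat.cast_mul, norm_mul, norm_mul, norm_cast_prime p, norm_pow]
    have := norm_natCast_le_one p (K := L) c
    calc ‖d‖ ^ (k + 2) * ((p : ℝ)⁻¹ * ‖(c : L)‖) ≤ ‖d‖ ^ 2 * ((p : ℝ)⁻¹ * 1) := by
          gcongr ?_ * (_ * ?_)
          exact pow_le_pow_of_le_one hd0.le hd1.le (by omega)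
      _ = _ := by rw [mul_one]
  have h6 := congrArg norm h3
  rw [norm_mul, norm_cast_prime p, norm_neg] at h6
  exact lt_irrefl _ (h6.trans_lt ((IsUltrametricDist.norm_add_le_max _ _).trans_lt (max_lt h5 h4)))

theorem eq_of_pow_prime_eq_one {ζ ζ' : L} (h : ζ ^ p = 1) (h' : ζ' ^ p = 1)
    (hζ : ‖ζ - ζ'‖ < radius p) : ζ = ζ' := by
  have hn : ‖ζ'‖ = 1 := by
    have := congrArg norm h'
    rw [norm_pow, norm_one] at this
    exact (pow_eq_one_iff_of_nonneg (norm_nonneg _) hp.out.ne_zero).1 this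
  have h0 : ζ' ≠ 0 := by
    rw [← norm_ne_zero_iff, hn]
    exact one_ne_zero
  have := eq_one_of_pow_prime_eq_one (p := p) (ζ := ζ / ζ') (by rw [div_pow, h, h', div_one]) (by
    rw [div_sub_one h0, norm_div, hn, div_one]
    exact hζ)
  exact (div_eq_one_iff_eq h0).1 this

variable [CompleteSpace L]

theorem wiener_bigTheta (hπ : π ^ (p - 1) = -(p : L)) (e : ℕ) : Wiener (bigTheta p e π) :=
  Wiener.of_le (c := 1) (rate_pos p e).le (rate_lt_one p e)
    (fun n => by rw [one_mul]; exact norm_coeff_bigTheta_le p hπ e n)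

theorem wiener_exp_linear {c : L} (hc : ‖c‖ < radius p) : Wiener ((exp L).subst (C c * X : L⟦X⟧)) := by
  have hr := radius_pos p
  refine Wiener.of_le (c := 1) (ρ := ‖c‖ / radius p) (by positivity) ((div_lt_one hr).2 hc) (fun n => ?_)
  rw [one_mul]
  refine norm_coeff_exp_subst_le p (by positivity) (by simp) (fun n => ?_) n
  rw [coeff_C_mul, coeff_X]
  split_ifs with h
  · rw [h, mul_one, pow_one, mul_div_cancel₀ _ hr.ne']
  · rw [mul_zero, norm_zero]
    positivity

/-- Formally Θ_e(z)^p is exp(pπz) / exp(pπz^(p^e)). Unlike exp(πz), these series converge on the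
closed unit disc, and at a fixed point of z ↦ z^(p^e) they have the same value. -/
theorem ev_bigTheta_pow (hπ : π ^ (p - 1) = -(p : L)) (hz : ‖z‖ ≤ 1) {e : ℕ} (hze : z ^ p ^ e = z) :
    ev z (bigTheta p e π) ^ p = 1 := by
  have hQ : p ^ e ≠ 0 := pow_ne_zero _ hp.out.ne_zero
  set E := (exp L).subst (C (p * π) * X : L⟦X⟧) with hE
  set E' := (exp L).subst (C (-(p * π)) * X : L⟦X⟧) with hE'
  have hc : ‖(p : L) * π‖ < radius p := by
    rw [norm_mul, norm_cast_prime p, norm_pi p hπ]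
    exact mul_lt_of_lt_one_left (radius_pos p) (inv_lt_one_of_one_lt₀ (one_lt_cast p))
  have hw : Wiener E := wiener_exp_linear hc
  have hw' : Wiener E' := wiener_exp_linear (by rwa [norm_neg])
  have hone : E * E' = 1 := by
    rw [hE, hE', ← exp_subst_add (by simp) (by simp), map_neg, neg_mul, add_neg_cancel, exp_subst_zero]
  have hmul : bigTheta p e π ^ p * expand (p ^ e) hQ E = E := by
    have h0 := constantCoeff_bigTheta_log p (π := π) e
    rw [bigTheta, ← exp_subst_nsmul h0, hE, expand_exp_subst (by simp), ← exp_subst_add (by simp [h0])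
      (by simp [hp.out.ne_zero])]
    congr 1
    rw [map_mul, expand_C, expand_X, nsmul_eq_mul, map_mul, ← map_natCast (C (R := L))]
    ring
  have h1 := congrArg (ev z) hone
  have h2 := congrArg (ev z) hmul
  rw [ev_mul hw hw' hz, ev_one] at h1
  rw [ev_mul ((wiener_bigTheta hπ e).pow p) (hw.expand hQ) hz, ev_expand, hze,
    ev_pow (wiener_bigTheta hπ e) hz] at h2
  have h3 : ev z E ≠ 0 := left_ne_zero_of_mul_eq_one h1
  exact mul_right_cancel₀ h3 (h2.trans (one_mul _).symm)

/-- This amounts to 2(p-1)² > p², which fails for p = 3: here p ≥ 5 makes the terms of degree at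
least 2 of θ negligible modulo π. -/
theorem rate_one_sq_lt (h5 : 5 ≤ p) : rate p 1 ^ 2 < radius p := by
  have h := one_lt_cast p
  have h0 : (0 : ℝ) < p := by linarith
  have h5' : (5 : ℝ) ≤ p := by exact_mod_cast h5
  rw [radius, rate, ← Real.rpow_natCast, ← Real.rpow_mul h0.le]
  apply Real.rpow_lt_rpow_of_exponent_lt h
  rw [neg_mul, neg_lt_neg_iff, pow_one, div_div, Nat.cast_ofNat, div_mul_eq_mul_div,
    div_lt_div_iff₀ (by linarith) (by positivity)]
  nlinarith

theorem norm_ev_theta_sub (h5 : 5 ≤ p) (hπ : π ^ (p - 1) = -(p : L)) (hz : ‖z‖ ≤ 1) :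
    ‖ev z (bigTheta p 1 π) - (1 + π * z)‖ < radius p := by
  refine lt_of_le_of_lt ?_ (rate_one_sq_lt h5)
  have hs := ((wiener_bigTheta hπ 1).hasSum_ev hz).summable
  have h1 : coeff 1 (bigTheta p 1 π) = π := by
    have := zcoeff_bigTheta_ode (π := π) p 1 1
    rw [zcoeff_of_neg _ (show (1 : ℤ) - (p ^ 1 : ℕ) < 0 by
      have := hp.out.one_lt
      rw [pow_one]
      omega), mul_zero, sub_zero, sub_self] at this
    have e1 := zcoeff_natCast (bigTheta p 1 π) 1
    have e0 := zcoeff_natCast (bigTheta p 1 π) 0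
    rw [Nat.cast_one] at e1
    rw [Nat.cast_zero, coeff_zero_eq_constantCoeff_apply, constantCoeff_bigTheta] at e0
    rw [e1, e0] at this
    simpa using this
  have h2 := hs.sum_add_tsum_nat_add 2
  rw [Finset.sum_range_succ, Finset.sum_range_one, h1, coeff_zero_eq_constantCoeff_apply,
    constantCoeff_bigTheta, pow_zero, pow_one, mul_one] at h2
  rw [ev, ← h2, add_sub_cancel_left]
  refine norm_tsum_le_of_le (by have := rate_pos p 1; positivity) (fun n => ?_)
  rw [norm_mul, norm_pow]
  refine (mul_le_mul (norm_coeff_bigTheta_le p hπ 1 _) (pow_le_one₀ (norm_nonneg _) hz)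
    (by positivity) (by have := rate_pos p 1; positivity)).trans ?_
  rw [mul_one]
  exact pow_le_pow_of_le_one (rate_pos p 1).le (rate_lt_one p 1).le (by omega)

theorem norm_ev_bigTheta_sub (h5 : 5 ≤ p) (hπ : π ^ (p - 1) = -(p : L)) (hz : ‖z‖ ≤ 1) (e : ℕ) :
    ‖ev z (bigTheta p e π) - (1 + π * ∑ i ∈ Finset.range e, z ^ p ^ i)‖ < radius p := by
  have hr := radius_pos p
  have hr1 := radius_lt_one p
  induction e with
  | zero =>
    rw [bigTheta_zero, ev_one]
    simpa using hr
  | succ e ih =>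
    have hQ : p ^ e ≠ 0 := pow_ne_zero _ hp.out.ne_zero
    have hz' : ‖z ^ p ^ e‖ ≤ 1 := by
      rw [norm_pow]
      exact pow_le_one₀ (norm_nonneg _) hz
    have h1 := norm_ev_theta_sub h5 hπ hz'
    rw [bigTheta_add, ev_mul (wiener_bigTheta hπ e) ((wiener_bigTheta hπ 1).expand hQ) hz, ev_expand,
      Finset.sum_range_succ]
    set x := ev z (bigTheta p e π)
    set y := ev (z ^ p ^ e) (bigTheta p 1 π)
    set s := ∑ i ∈ Finset.range e, z ^ p ^ i with hs
    set w := z ^ p ^ e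
    have hs1 : ‖s‖ ≤ 1 := IsUltrametricDist.norm_sum_le_of_forall_le_of_nonneg zero_le_one fun i _ => by
      rw [norm_pow]
      exact pow_le_one₀ (norm_nonneg _) hz
    have hπ' := norm_pi p hπ
    have ha : ∀ v : L, ‖v‖ ≤ 1 → ‖1 + π * v‖ ≤ 1 := by
      intro v hv
      refine norm_add_le_of_le (by rw [norm_one]) ?_
      rw [norm_mul, hπ']
      exact mul_le_one₀ hr1.le (norm_nonneg _) hv
    have hy : ‖y‖ ≤ 1 := by
      rw [show y = (y - (1 + π * w)) + (1 + π * w) by ring]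
      exact norm_add_le_of_le (h1.le.trans hr1.le) (ha w hz')
    rw [show x * y - (1 + π * (s + w)) = (x - (1 + π * s)) * y +
      ((1 + π * s) * (y - (1 + π * w)) + π * s * (π * w)) by ring]
    refine (IsUltrametricDist.norm_add_le_max _ _).trans_lt (max_lt ?_
      ((IsUltrametricDist.norm_add_le_max _ _).trans_lt (max_lt ?_ ?_)))
    · rw [norm_mul]
      exact (mul_le_of_le_one_right (norm_nonneg _) hy).trans_lt ih
    · rw [norm_mul]
      exact (mul_le_of_le_one_left (norm_nonneg _) (ha s hs1)).trans_lt h1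
    · rw [norm_mul, norm_mul, norm_mul, hπ']
      calc radius p * ‖s‖ * (radius p * ‖w‖) ≤ radius p * 1 * (radius p * 1) := by gcongr
        _ < radius p := by nlinarith

end DworkCharacter


/-! ### Dwork's character and the classification of additive characters -/

section DworkCharacter

theorem norm_sub_le_max' {L : Type*} [NormedField L] [IsUltrametricDist L] (x y : L) :
    ‖x - y‖ ≤ max ‖x‖ ‖y‖ := by
  rw [sub_eq_add_neg, ← norm_neg y]
  exact IsUltrametricDist.norm_add_le_max _ _

variable {p : ℕ} [hp : Fact p.Prime] {L : Type*} [NormedField L] [NormedAlgebra ℚ_[p] L]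
  [CharZero L] [IsUltrametricDist L] [CompleteSpace L] {π : L}
  {k : Type*} [Field k] [CharP k p] {τ : k →* L}

/-- Dwork's additive character `x ↦ Θ(τ(x))` of the field with `p^e` elements. -/
def dworkChar (p e : ℕ) (π : L) (τ : k →* L) (x : k) : L := ev (τ x) (bigTheta p e π)

theorem dworkChar_pow (hτ : IsTeichmuller τ) (hπ : π ^ (p - 1) = -(p : L)) {e : ℕ} {x : k}
    (hx : x ^ p ^ e = x) : dworkChar p e π τ x ^ p = 1 :=
  ev_bigTheta_pow hπ (hτ.norm_le_one x) (by rw [← map_pow, hx])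

theorem norm_dworkChar_sub (h5 : 5 ≤ p) (hτ : IsTeichmuller τ) (hπ : π ^ (p - 1) = -(p : L)) (e : ℕ)
    (x : k) : ‖dworkChar p e π τ x - (1 + π * τ (∑ i ∈ Finset.range e, x ^ p ^ i))‖ < radius p := by
  have h1 := norm_ev_bigTheta_sub h5 hπ (hτ.norm_le_one x) e
  have h2 := hτ.norm_sum_sub (Finset.range e) fun i => x ^ p ^ i
  simp only [map_pow] at h2
  rw [dworkChar, show ev (τ x) (bigTheta p e π) - (1 + π * τ (∑ i ∈ Finset.range e, x ^ p ^ i)) =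
    (ev (τ x) (bigTheta p e π) - (1 + π * ∑ i ∈ Finset.range e, τ x ^ p ^ i)) -
      π * (τ (∑ i ∈ Finset.range e, x ^ p ^ i) - ∑ i ∈ Finset.range e, τ x ^ p ^ i) by ring]
  refine (norm_sub_le_max' _ _).trans_lt (max_lt h1 ?_)
  rw [norm_mul, norm_pi p hπ]
  exact mul_lt_of_lt_one_right (radius_pos p) h2

/-- Both values are p-th roots of unity with the same first approximation 1 + π τ(trace), and p-th
roots of unity at distance less than |π| coincide. -/
theorem dworkChar_eq (h5 : 5 ≤ p) (hτ : IsTeichmuller τ) (hπ : π ^ (p - 1) = -(p : L)) {e e' : ℕ}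
    {x y : k} (hx : x ^ p ^ e = x) (hy : y ^ p ^ e' = y)
    (h : ∑ i ∈ Finset.range e, x ^ p ^ i = ∑ i ∈ Finset.range e', y ^ p ^ i) :
    dworkChar p e π τ x = dworkChar p e' π τ y := by
  refine eq_of_pow_prime_eq_one (dworkChar_pow hτ hπ hx) (dworkChar_pow hτ hπ hy) ?_
  have h1 := norm_dworkChar_sub h5 hτ hπ e x
  have h2 := norm_dworkChar_sub h5 hτ hπ e' y
  rw [← h] at h2
  rw [← sub_sub_sub_cancel_right _ _ (1 + π * τ (∑ i ∈ Finset.range e, x ^ p ^ i))]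
  exact (norm_sub_le_max' _ _).trans_lt (max_lt h1 h2)

theorem dworkChar_add (h5 : 5 ≤ p) (hτ : IsTeichmuller τ) (hπ : π ^ (p - 1) = -(p : L)) {e : ℕ}
    {x y : k} (hx : x ^ p ^ e = x) (hy : y ^ p ^ e = y) :
    dworkChar p e π τ (x + y) = dworkChar p e π τ x * dworkChar p e π τ y := by
  have hr := radius_pos p
  have hr1 := radius_lt_one p
  have hxy : (x + y) ^ p ^ e = x + y := by rw [add_pow_char_pow, hx, hy]
  refine eq_of_pow_prime_eq_one (dworkChar_pow hτ hπ hxy) (by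
    rw [mul_pow, dworkChar_pow hτ hπ hx, dworkChar_pow hτ hπ hy, one_mul]) ?_
  have h1 := norm_dworkChar_sub h5 hτ hπ e x
  have h2 := norm_dworkChar_sub h5 hτ hπ e y
  have h3 := norm_dworkChar_sub h5 hτ hπ e (x + y)
  have h4 : ∑ i ∈ Finset.range e, (x + y) ^ p ^ i =
      ∑ i ∈ Finset.range e, x ^ p ^ i + ∑ i ∈ Finset.range e, y ^ p ^ i := by
    rw [← Finset.sum_add_distrib]
    exact Finset.sum_congr rfl fun i _ => add_pow_char_pow ..
  rw [h4] at h3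
  set u := ∑ i ∈ Finset.range e, x ^ p ^ i
  set v := ∑ i ∈ Finset.range e, y ^ p ^ i
  have h6 := hτ.norm_add_sub u v
  have hnx : ‖dworkChar p e π τ x‖ = 1 := by
    have := congrArg norm (dworkChar_pow hτ hπ hx)
    rw [norm_pow, norm_one] at this
    exact (pow_eq_one_iff_of_nonneg (norm_nonneg _) hp.out.ne_zero).1 this
  have hv : ‖1 + π * τ v‖ ≤ 1 := by
    refine norm_add_le_of_le (by rw [norm_one]) ?_
    rw [norm_mul, norm_pi p hπ]
    exact mul_le_one₀ hr1.le (norm_nonneg _) (hτ.norm_le_one v)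
  rw [show dworkChar p e π τ (x + y) - dworkChar p e π τ x * dworkChar p e π τ y =
    (dworkChar p e π τ (x + y) - (1 + π * τ (u + v))) +
    ((π * (τ (u + v) - (τ u + τ v)) - π * τ u * (π * τ v)) -
     ((dworkChar p e π τ x - (1 + π * τ u)) * (1 + π * τ v) +
      dworkChar p e π τ x * (dworkChar p e π τ y - (1 + π * τ v)))) by ring]
  refine (IsUltrametricDist.norm_add_le_max _ _).trans_lt (max_lt h3 ?_)
  refine (norm_sub_le_max' _ _).trans_lt (max_lt ?_ ?_)
  · refine (norm_sub_le_max' _ _).trans_lt (max_lt ?_ ?_)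
    · rw [norm_mul, norm_pi p hπ]
      exact mul_lt_of_lt_one_right hr h6
    · rw [norm_mul, norm_mul, norm_mul, norm_pi p hπ]
      have := hτ.norm_le_one u
      have := hτ.norm_le_one v
      calc radius p * ‖τ u‖ * (radius p * ‖τ v‖) ≤ radius p * 1 * (radius p * 1) := by gcongr
        _ < radius p := by nlinarith
  · refine (IsUltrametricDist.norm_add_le_max _ _).trans_lt (max_lt ?_ ?_)
    · rw [norm_mul]
      exact (mul_le_of_le_one_right (norm_nonneg _) hv).trans_lt h1
    · rw [norm_mul, hnx, one_mul]
      exact h2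

theorem dworkChar_zero (hτ : IsTeichmuller τ) (e : ℕ) : dworkChar p e π τ 0 = 1 := by
  rw [dworkChar, hτ.map_zero, ev, tsum_eq_single 0]
  · rw [coeff_zero_eq_constantCoeff_apply, constantCoeff_bigTheta, pow_zero, mul_one]
  · intro n hn
    rw [zero_pow hn, mul_zero]

/-- The absolute trace from degree ar factors through the trace to degree a, and the character
depends on the absolute trace only. -/
theorem dworkChar_trace (h5 : 5 ≤ p) (hτ : IsTeichmuller τ) (hπ : π ^ (p - 1) = -(p : L)) {a r : ℕ}
    {x : k} (hx : x ^ p ^ (a * r) = x) :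
    dworkChar p (a * r) π τ x = dworkChar p a π τ (∑ i ∈ Finset.range r, x ^ (p ^ a) ^ i) := by
  have hfix : (∑ i ∈ Finset.range r, x ^ (p ^ a) ^ i) ^ p ^ a = ∑ i ∈ Finset.range r, x ^ (p ^ a) ^ i := by
    rw [sum_pow_char_pow]
    have h1 := Finset.sum_range_succ (fun i => x ^ (p ^ a) ^ i) r
    have h2 := Finset.sum_range_succ' (fun i => x ^ (p ^ a) ^ i) r
    rw [← pow_mul, hx] at h1
    rw [pow_zero, pow_one] at h2
    rw [h1] at h2
    have h3 := add_right_cancel h2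
    rw [h3]
    refine Finset.sum_congr rfl fun i _ => ?_
    rw [← pow_mul, ← pow_succ]
  refine dworkChar_eq h5 hτ hπ hx hfix ?_
  have h1 : ∀ r, ∑ i ∈ Finset.range (a * r), x ^ p ^ i =
      ∑ j ∈ Finset.range r, ∑ i ∈ Finset.range a, x ^ p ^ (a * j + i) := by
    intro r
    induction r with
    | zero => simp
    | succ r ih => rw [Nat.mul_succ, Finset.sum_range_add, Finset.sum_range_succ, ih]
  rw [h1, Finset.sum_comm]
  refine Finset.sum_congr rfl fun i _ => ?_
  rw [sum_pow_char_pow]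
  refine Finset.sum_congr rfl fun j _ => ?_
  rw [← pow_mul, pow_add, pow_mul p]

section FiniteField

variable {F : Type*} [Field F] [Fintype F]

theorem pow_card_eq {e : ℕ} (hF : Fintype.card F = p ^ e) (ι : F →+* k) (x : F) :
    ι x ^ p ^ e = ι x := by
  rw [← map_pow, ← hF, FiniteField.pow_card]

/-- Dwork's character of a finite field embedded in `k`. -/
def dworkAddChar (h5 : 5 ≤ p) (hτ : IsTeichmuller τ) (hπ : π ^ (p - 1) = -(p : L)) {e : ℕ}
    (hF : Fintype.card F = p ^ e) (ι : F →+* k) : AddChar F L where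
  toFun x := dworkChar p e π τ (ι x)
  map_zero_eq_one' := by rw [map_zero, dworkChar_zero hτ]
  map_add_eq_mul' x y := by
    rw [map_add, dworkChar_add h5 hτ hπ (pow_card_eq hF ι x) (pow_card_eq hF ι y)]

theorem dworkAddChar_ne_one (h5 : 5 ≤ p) (hτ : IsTeichmuller τ) (hπ : π ^ (p - 1) = -(p : L)) {e : ℕ}
    (hF : Fintype.card F = p ^ e) (ι : F →+* k) : dworkAddChar h5 hτ hπ hF ι ≠ 1 := by
  intro h
  have he : e ≠ 0 := by
    rintro rfl
    rw [pow_zero] at hF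
    have := Fintype.one_lt_card (α := F)
    omega
  have hzero : ∀ x : F, ∑ i ∈ Finset.range e, x ^ p ^ i = 0 := by
    intro x
    have h1 := norm_dworkChar_sub h5 hτ hπ e (ι x)
    have h2 : dworkChar p e π τ (ι x) = 1 := congrArg (fun φ : AddChar F L => φ x) h
    rw [h2, sub_add_cancel_left, norm_neg, norm_mul, norm_pi p hπ] at h1
    have h3 := lt_of_mul_lt_mul_left (h1.trans_eq (mul_one _).symm) (radius_pos p).le
    by_contra hne
    rw [hτ.norm_eq_one] at h3
    · exact lt_irrefl _ h3
    · simp only [← map_pow, ← map_sum]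
      exact fun h0 => hne ((map_eq_zero ι).1 h0)
  -- If the character were trivial, the absolute trace would vanish identically; but the trace
  -- polynomial is nonzero and has degree less than the cardinality of the field.
  set f : Polynomial F := ∑ i ∈ Finset.range e, Polynomial.X ^ p ^ i with hf
  obtain ⟨e, rfl⟩ := Nat.exists_eq_succ_of_ne_zero he
  have hcoef : f.coeff 1 = 1 := by
    rw [hf, Polynomial.finsetSum_coeff, Finset.sum_eq_single 0]
    · simp
    · intro i _ hi
      rw [Polynomial.coeff_X_pow, if_neg]
      exact (Nat.one_lt_pow hi hp.out.one_lt).ne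
    · simp
  have hf0 : f ≠ 0 := by
    intro h0
    rw [h0, Polynomial.coeff_zero] at hcoef
    exact zero_ne_one hcoef
  have hdeg : f.natDegree ≤ p ^ e := by
    rw [hf]
    refine Polynomial.natDegree_sum_le_of_forall_le _ _ fun i hi => ?_
    rw [Polynomial.natDegree_X_pow]
    exact Nat.pow_le_pow_right hp.out.pos (Nat.lt_succ_iff.1 (Finset.mem_range.1 hi))
  have hcard : Fintype.card F ≤ f.natDegree := by
    rw [← Finset.card_univ]
    refine Polynomial.card_le_degree_of_subset_roots fun x _ => ?_
    rw [Polynomial.mem_roots hf0, Polynomial.IsRoot, hf, Polynomial.eval_finsetSum]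
    simpa using hzero x
  rw [hF] at hcard
  have := Nat.pow_lt_pow_right hp.out.one_lt (Nat.lt_succ_self e)
  omega

/-- Otherwise ψ would be orthogonal to every x ↦ χ(cx), including c = 0. Summing these relations
over c yields the cardinality of F, by orthogonality in c, instead of 0. -/
theorem exists_eq_mulShift {χ ψ : AddChar F L} (hχ : χ ≠ 1) (hψ : ψ ≠ 1) :
    ∃ c : F, c ≠ 0 ∧ ∀ x, ψ x = χ (c * x) := by
  classical
  have hprim : χ.IsPrimitive := AddChar.IsPrimitive.of_ne_one hχ
  by_contra hcon
  push Not at hcon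
  have h1 : ∀ c : F, ∑ x : F, ψ x * χ (-(c * x)) = 0 := by
    intro c
    have : ψ * (χ.mulShift (-c)) ≠ 1 := by
      intro h
      have h' : ∀ x, ψ x = χ (c * x) := by
        intro x
        have := congrArg (fun φ : AddChar F L => φ x) h
        simp only [AddChar.mul_apply, AddChar.mulShift_apply, AddChar.one_apply, neg_mul] at this
        have h3 : χ (-(c * x)) * χ (c * x) = 1 := by
          rw [← AddChar.map_add_eq_mul, neg_add_cancel, AddChar.map_zero_eq_one]
        linear_combination χ (c * x) * this - ψ x * h3
      by_cases hc : c = 0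
      · refine hψ ?_
        ext x
        rw [h' x, hc, zero_mul, AddChar.map_zero_eq_one, AddChar.one_apply]
      · obtain ⟨x, hx⟩ := hcon c hc
        exact hx (h' x)
    have h2 := AddChar.sum_eq_zero_of_ne_one this
    simpa [AddChar.mul_apply, AddChar.mulShift_apply] using h2
  have h2 : ∑ c : F, ∑ x : F, ψ x * χ (-(c * x)) = Fintype.card F := by
    rw [Finset.sum_comm]
    have h3 : ∀ x : F, ∑ c : F, ψ x * χ (-(c * x)) = if x = 0 then (Fintype.card F : L) else 0 := by
      intro x
      have := AddChar.sum_mulShift (-x) hprim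
      simp only [mul_neg] at this
      rw [← Finset.mul_sum, this]
      by_cases hx : x = 0
      · simp [hx]
      · simp [hx]
    rw [Finset.sum_congr rfl fun x _ => h3 x, Finset.sum_ite_eq' Finset.univ]
    simp
  rw [Finset.sum_congr rfl fun c _ => h1 c, Finset.sum_const_zero] at h2
  exact Fintype.card_ne_zero (α := F) (by exact_mod_cast h2.symm)

end FiniteField

end DworkCharacter


/-! ### Kloosterman sums as traces -/

section KloostermanTrace

variable {p : ℕ} [hp : Fact p.Prime] {L : Type*} [NormedField L] [NormedAlgebra ℚ_[p] L]
  [CharZero L] [IsUltrametricDist L] [CompleteSpace L] {π t : L}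

theorem hasSum_zcoeff_bigTheta (hπ : π ^ (p - 1) = -(p : L)) (e : ℕ) {x : L} (hx : ‖x‖ ≤ 1) :
    HasSum (fun n : ℤ => zcoeff (bigTheta p e π) n * x ^ n) (ev x (bigTheta p e π)) := by
  have hinj : Function.Injective fun j : ℕ => (j : ℤ) := Nat.cast_injective
  rw [← hinj.hasSum_iff]
  · refine hasSum_of_eq ((wiener_bigTheta hπ e).hasSum_ev hx) (fun n => ?_) rfl
    simp [zcoeff_natCast]
  · intro n hn
    rw [zcoeff_of_neg, zero_mul]
    by_contra h
    exact hn ⟨n.toNat, by simp; omega⟩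

/-- The shear `(n, N) ↦ (N + n, N)`. -/
def shearTwo : ℤ × ℤ ≃ ℤ × ℤ where
  toFun x := (x.2 + x.1, x.2)
  invFun x := (x.1 - x.2, x.2)
  left_inv x := by ext <;> simp
  right_inv x := by ext <;> simp

theorem hasSum_kernelG_mul_zpow (hπ : π ^ (p - 1) = -(p : L)) (ht : ‖t‖ = 1) (e : ℕ) {x : L}
    (hx : ‖x‖ = 1) :
    HasSum (fun n : ℤ => kernelG p e π t n * x ^ n)
      (ev x (bigTheta p e π) * ev (t / x) (bigTheta p e π)) := by
  have hx0 : x ≠ 0 := by rintro rfl; simp at hx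
  have htx : ‖t / x‖ = 1 := by rw [norm_div, ht, hx, div_one]
  have h1 := hasSum_zcoeff_bigTheta hπ e hx.le
  have h2 := hasSum_zcoeff_bigTheta hπ e htx.le
  have hsum : Summable fun i : ℤ × ℤ => zcoeff (bigTheta p e π) i.1 * x ^ i.1 *
      (zcoeff (bigTheta p e π) i.2 * (t / x) ^ i.2) := by
    refine Summable.of_norm_bounded (summable_pow_mul_pow (rate_pos p e).le (rate_lt_one p e)
      (rate_pos p e).le (rate_lt_one p e)) (fun i => ?_)
    simp only [norm_mul, norm_zpow, hx, htx, one_zpow, mul_one]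
    exact mul_le_mul (norm_zcoeff_bigTheta_le hπ e _) (norm_zcoeff_bigTheta_le hπ e _)
      (norm_nonneg _) (pow_nonneg (rate_pos p e).le _)
  have h3 := h1.mul h2 hsum
  rw [← shearTwo.hasSum_iff] at h3
  refine h3.prod_fiberwise fun n => ?_
  refine hasSum_of_eq ((hasSum_kernelG hπ ht e n).mul_right (x ^ n)) (fun N => ?_) rfl
  simp only [Function.comp_apply, shearTwo, Equiv.coe_fn_mk, kernelTerm]
  rw [zpow_add₀ hx0, div_zpow]
  field_simp

variable {k : Type*} [Field k] [CharP k p] {τ : k →* L} {E : Type*} [Field E] [Fintype E] [Fintype Eˣ]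

theorem sum_teichmuller_zpow (hτ : IsTeichmuller τ) (ι : E →+* k) (n : ℤ) :
    ∑ x : Eˣ, τ (ι x) ^ n = if ((Fintype.card E - 1 : ℕ) : ℤ) ∣ n then ((Fintype.card E - 1 : ℕ) : L) else 0 := by
  classical
  set g : Eˣ →* Lˣ := Units.map (τ.comp (ι : E →* k)) with hg
  have hginj : Function.Injective g := by
    intro x y h
    have h1 := congrArg Units.val h
    simp only [hg, Units.coe_map, MonoidHom.comp_apply] at h1
    exact Units.ext (ι.injective (hτ.injective h1))
  set f : Eˣ →* L := (Units.coeHom L).comp ((zpowGroupHom n).comp g) with hf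
  have hfx : ∀ x : Eˣ, f x = τ (ι x) ^ n := by
    intro x
    simp [hf, hg]
  rw [← Finset.sum_congr rfl fun x _ => hfx x, sum_hom_units]
  have hcard : Fintype.card Eˣ = Fintype.card E - 1 := by
    rw [← Nat.card_eq_fintype_card, ← Nat.card_eq_fintype_card, Nat.card_units]
  have hiff : f = 1 ↔ ((Fintype.card E - 1 : ℕ) : ℤ) ∣ n := by
    obtain ⟨x, hx⟩ := IsCyclic.exists_generator (α := Eˣ)
    have hord := orderOf_eq_card_of_forall_mem_zpowers hx
    rw [Nat.card_eq_fintype_card, hcard] at hord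
    rw [← hord, orderOf_dvd_iff_zpow_eq_one]
    constructor
    · intro h
      have h1 : ((g x ^ n : Lˣ) : L) = 1 := congrArg (fun φ : Eˣ →* L => φ x) h
      apply hginj
      rw [map_zpow, map_one]
      exact Units.ext h1
    · intro h
      ext y
      obtain ⟨m, rfl⟩ := hx y
      change ((g (x ^ m) ^ n : Lˣ) : L) = 1
      rw [← map_zpow, ← zpow_mul, mul_comm, zpow_mul, h, one_zpow, map_one, Units.val_one]
  simp only [hiff, hcard]
  split_ifs <;> simp

/-- Expand the summand as ∑ G_n τ(x)^n. The sum over x keeps the n divisible by p^e - 1 and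
multiplies them by p^e - 1. Since G at (p^e - 1)u is the diagonal entry `fibreX u u`, the result is
(p^e - 1) tr X. -/
theorem sum_dworkChar_eq_neg_trace (h5 : 5 ≤ p) (hτ : IsTeichmuller τ) (hπ : π ^ (p - 1) = -(p : L))
    {e : ℕ} (hE : Fintype.card E = p ^ e) (ι : E →+* k) (s : Eˣ) :
    ∑ x : Eˣ, dworkChar p e π τ (ι (x + s / x)) = -(fibreM p e π (τ (ι s))).trace := by
  have he : e ≠ 0 := by
    rintro rfl
    rw [pow_zero] at hE
    have := Fintype.one_lt_card (α := E)
    omega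
  have hne : ∀ x : Eˣ, ι x ≠ 0 := fun x => (map_ne_zero ι).2 x.ne_zero
  have hs1 : ‖τ (ι s)‖ = 1 := hτ.norm_eq_one _ (hne s)
  have h1 : ∀ x : Eˣ, HasSum (fun n : ℤ => kernelG p e π (τ (ι s)) n * τ (ι x) ^ n)
      (dworkChar p e π τ (ι (x + s / x))) := by
    intro x
    have := hasSum_kernelG_mul_zpow hπ hs1 e (hτ.norm_eq_one _ (hne x))
    rw [map_add, dworkChar_add h5 hτ hπ (pow_card_eq hE ι _) (pow_card_eq hE ι _)]
    refine hasSum_of_eq this (fun n => rfl) ?_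
    rw [dworkChar, dworkChar, map_div₀]
    congr 2
    have h2 := map_mul τ (ι s / ι x) (ι x)
    rw [div_mul_cancel₀ _ (hne x)] at h2
    rw [h2, mul_div_cancel_right₀ _ (hτ.ne_zero (hne x))]
  have h2 := hasSum_sum fun x (_ : x ∈ Finset.univ) => h1 x
  simp only [← Finset.mul_sum, sum_teichmuller_zpow hτ ι] at h2
  have hfix : τ (ι s) ^ p ^ e = τ (ι s) := by rw [← map_pow, pow_card_eq hE]
  have h3 := fibreM_trace h5 hπ hs1 he hfix
  have hq : 1 < p ^ e := Nat.one_lt_pow he hp.out.one_lt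
  have hinj : Function.Injective fun u : ℤ => ((Fintype.card E - 1 : ℕ) : ℤ) * u := by
    intro u v h
    have : ((Fintype.card E - 1 : ℕ) : ℤ) ≠ 0 := by
      rw [hE]
      omega
    exact mul_left_cancel₀ this h
  rw [← hinj.hasSum_iff] at h2
  · refine h2.unique (hasSum_of_eq h3.neg (fun u => ?_) rfl)
    simp only [Function.comp_apply, dvd_mul_right, if_true, fibreX]
    rw [hE, Nat.cast_sub hq.le, Nat.cast_pow, Nat.cast_one, Nat.cast_sub hq.le, Nat.cast_one, sub_mul,
      one_mul]
    push_cast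
    ring
  · intro n hn
    rw [if_neg, mul_zero]
    rintro ⟨u, rfl⟩
    exact hn ⟨u, rfl⟩

end KloostermanTrace

/-! ### Finite subfields of the algebraic closure -/

section Subfields

variable {F : Type*} [Field F] [Finite F]

theorem mem_subExt_iff {n : ℕ} {x : AlgebraicClosure F} :
    x ∈ subExt F n ↔ x ^ (Nat.card F ^ n) = x := by
  have := Fintype.ofFinite F
  set p := ringChar F with hpdef
  have : CharP F p := ringChar.charP F
  obtain ⟨m, hprime, hcard⟩ := FiniteField.card F p
  have hfact : Fact p.Prime := ⟨hprime⟩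
  have : CharP (AlgebraicClosure F) p := charP_of_injective_algebraMap
    (algebraMap F (AlgebraicClosure F)).injective p
  have hq : Nat.card F ^ n = p ^ (m * n : ℕ) := by rw [Nat.card_eq_fintype_card, hcard, pow_mul]
  refine ⟨fun hx => ?_, fun hx => IntermediateField.subset_adjoin F _ hx⟩
  rw [hq]
  refine IntermediateField.adjoin_induction F (p := fun x _ => x ^ p ^ (m * n : ℕ) = x) ?_ ?_ ?_ ?_ ?_ hx
  · intro y hy
    rw [← hq]
    exact hy
  · intro y
    rw [← hq, ← map_pow, Nat.card_eq_fintype_card, FiniteField.pow_card_pow]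
  · intro y z _ _ hy hz
    rw [add_pow_char_pow, hy, hz]
  · intro y _ hy
    rw [inv_pow, hy]
  · intro y z _ _ hy hz
    rw [mul_pow, hy, hz]

theorem one_lt_natCard : 1 < Nat.card F := Finite.one_lt_card

theorem natCard_subExt {n : ℕ} (hn : n ≠ 0) : Nat.card (subExt F n) = Nat.card F ^ n := by
  have := Fintype.ofFinite F
  set p := ringChar F with hpdef
  have : CharP F p := ringChar.charP F
  obtain ⟨m, hprime, hcard⟩ := FiniteField.card F p
  have hdvd : p ∣ Nat.card F ^ n := by
    rw [Nat.card_eq_fintype_card, hcard]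
    exact dvd_pow (dvd_pow_self p m.ne_zero) hn
  have h1 := Polynomial.card_rootSet_eq_natDegree (K := AlgebraicClosure F)
    (galois_poly_separable (K := F) p _ hdvd) (IsAlgClosed.splits _)
  rw [FiniteField.X_pow_card_pow_sub_X_natDegree_eq _ hn one_lt_natCard] at h1
  rw [← h1, ← Nat.card_eq_fintype_card]
  refine Nat.card_congr (Equiv.subtypeEquivRight fun x => ?_)
  rw [mem_subExt_iff, Polynomial.mem_rootSet_of_ne
    (FiniteField.X_pow_card_pow_sub_X_ne_zero _ hn one_lt_natCard)]
  simp [sub_eq_zero]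

theorem finite_subExt {n : ℕ} (hn : n ≠ 0) : Finite (subExt F n) := by
  apply Nat.finite_of_card_ne_zero
  rw [natCard_subExt hn]
  exact pow_ne_zero _ (by have := one_lt_natCard (F := F); omega)

theorem finrank_subExt {n : ℕ} (hn : n ≠ 0) : Module.finrank F (subExt F n) = n := by
  have := finite_subExt (F := F) hn
  have h1 := Module.natCard_eq_pow_finrank (K := F) (V := subExt F n)
  rw [natCard_subExt hn] at h1
  exact (Nat.pow_right_injective one_lt_natCard h1).symm

theorem algebraMap_trace_subExt {n : ℕ} (hn : n ≠ 0) (x : subExt F n) :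
    algebraMap F (AlgebraicClosure F) (Algebra.trace F (subExt F n) x) =
      ∑ i ∈ Finset.range n, (x : AlgebraicClosure F) ^ Nat.card F ^ i := by
  have := finite_subExt (F := F) hn
  rw [IsScalarTower.algebraMap_apply F (subExt F n), FiniteField.algebraMap_trace_eq_sum_pow,
    finrank_subExt hn]
  simp

end Subfields


/-! ### The unit root of the fibre Frobenius -/

section UnitRoot

variable {L : Type*} [NormedField L] [IsUltrametricDist L]

/-- Matrices which reduce to `!![1, *; 0, 0]` modulo the maximal ideal. -/
structure IsUnitRoot (M : Matrix (Fin 2) (Fin 2) L) : Prop where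
  zero_zero : ‖M 0 0 - 1‖ < 1
  zero_one : ‖M 0 1‖ ≤ 1
  one_zero : ‖M 1 0‖ < 1
  one_one : ‖M 1 1‖ < 1

theorem norm_eq_one_of_sub {x : L} (h : ‖x - 1‖ < 1) : ‖x‖ = 1 := by
  have := IsUltrametricDist.norm_add_eq_max_of_norm_ne_norm (x := x - 1) (y := 1)
    (by rw [norm_one]; exact h.ne)
  rw [sub_add_cancel, norm_one, max_eq_right h.le] at this
  exact this

theorem norm_add_lt {x y : L} {r : ℝ} (hx : ‖x‖ < r) (hy : ‖y‖ < r) : ‖x + y‖ < r :=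
  (IsUltrametricDist.norm_add_le_max _ _).trans_lt (max_lt hx hy)

theorem norm_sub_lt {x y : L} {r : ℝ} (hx : ‖x‖ < r) (hy : ‖y‖ < r) : ‖x - y‖ < r :=
  (norm_sub_le_max' _ _).trans_lt (max_lt hx hy)

theorem norm_mul_lt_one {x y : L} (hx : ‖x‖ < 1) (hy : ‖y‖ ≤ 1) : ‖x * y‖ < 1 := by
  rw [norm_mul]
  exact (mul_le_of_le_one_right (norm_nonneg _) hy).trans_lt hx

theorem norm_mul_lt_one' {x y : L} (hx : ‖x‖ ≤ 1) (hy : ‖y‖ < 1) : ‖x * y‖ < 1 := by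
  rw [mul_comm]
  exact norm_mul_lt_one hy hx

theorem norm_mul_sub_one_lt {x y : L} (hx : ‖x - 1‖ < 1) (hy : ‖y - 1‖ < 1) : ‖x * y - 1‖ < 1 := by
  rw [show x * y - 1 = x * (y - 1) + (x - 1) by ring]
  exact norm_add_lt (norm_mul_lt_one' (norm_eq_one_of_sub hx).le hy) hx

theorem IsUnitRoot.mul {M N : Matrix (Fin 2) (Fin 2) L} (hM : IsUnitRoot M) (hN : IsUnitRoot N) :
    IsUnitRoot (M * N) := by
  have m0 := norm_eq_one_of_sub hM.zero_zero
  have n0 := norm_eq_one_of_sub hN.zero_zero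
  constructor
  · rw [Matrix.mul_apply, Fin.sum_univ_two, add_sub_right_comm]
    exact norm_add_lt (norm_mul_sub_one_lt hM.zero_zero hN.zero_zero)
      (norm_mul_lt_one' hM.zero_one hN.one_zero)
  · rw [Matrix.mul_apply, Fin.sum_univ_two]
    refine norm_add_le_of_le ?_ (norm_mul_lt_one' hM.zero_one hN.one_one).le
    rw [norm_mul, m0, one_mul]
    exact hN.zero_one
  · rw [Matrix.mul_apply, Fin.sum_univ_two]
    exact norm_add_lt (norm_mul_lt_one hM.one_zero n0.le) (norm_mul_lt_one hM.one_one hN.one_zero.le)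
  · rw [Matrix.mul_apply, Fin.sum_univ_two]
    exact norm_add_lt (norm_mul_lt_one hM.one_zero hN.zero_one) (norm_mul_lt_one hM.one_one hN.one_one.le)

theorem IsUnitRoot.trace {M : Matrix (Fin 2) (Fin 2) L} (hM : IsUnitRoot M) : ‖M.trace - 1‖ < 1 := by
  rw [Matrix.trace_fin_two, add_sub_right_comm]
  exact norm_add_lt hM.zero_zero hM.one_one

theorem IsUnitRoot.det {M : Matrix (Fin 2) (Fin 2) L} (hM : IsUnitRoot M) : ‖M.det‖ < 1 := by
  rw [Matrix.det_fin_two]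
  exact norm_sub_lt (norm_mul_lt_one' (norm_eq_one_of_sub hM.zero_zero).le hM.one_one)
    (norm_mul_lt_one' hM.zero_one hM.one_zero)

variable {p : ℕ} [hp : Fact p.Prime] {K : Type*} [NormedField K]
  [NormedAlgebra ℚ_[p] K] [NormedAlgebra ℚ_[p] L] [CharZero K] [CharZero L]
  [IsUltrametricDist K] [CompleteSpace K] [CompleteSpace L]
  {a : ℕ} {b b' : ℝ} {π : K} {z : L} {j : K →+* L}

/-- The second row carries the factor p^(-b), and A_1 has constant term 1 and all other coefficients
bounded by `decay` < 1. -/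
theorem isUnitRoot_fibreM (hj : ∀ x, ‖j x‖ = ‖x‖) (H : Params p a π b b') (hz : ‖z‖ = 1) :
    IsUnitRoot (fibreM p a (j π) z) := by
  have hd0 : 0 < decay p a b' := decay_pos
  have hd1 := decay_lt_one H
  have hpb : ((p : ℝ) ^ b)⁻¹ < 1 := by
    apply inv_lt_one_of_one_lt₀
    apply Real.one_lt_rpow (one_lt_cast p)
    have : 0 < 1 / ((p : ℝ) - 1) := one_div_pos.2 (by linarith [one_lt_cast p])
    linarith [H.lt_b]
  have hpb0 : 0 ≤ ((p : ℝ) ^ b)⁻¹ := by positivity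
  have hrow1 : ∀ k, ‖fibreM p a (j π) z 1 k‖ < 1 := by
    intro k
    rw [fibreM_eq_ev j hj H hz]
    refine lt_of_le_of_lt (norm_tsum_le_of_le hpb0 fun n => ?_) hpb
    obtain ⟨-, -, h2, -⟩ := frobColumn_spec H k
    rw [norm_mul, norm_pow, hz, one_pow, mul_one, coeff_map, hj]
    exact (h2 n).trans (mul_le_of_le_one_right hpb0 (pow_le_one₀ hd0.le hd1.le))
  have hrow0 : ‖fibreM p a (j π) z 0 1‖ ≤ 1 := by
    rw [fibreM_eq_ev j hj H hz]
    refine norm_tsum_le_of_le zero_le_one fun n => ?_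
    obtain ⟨-, h1, -, -⟩ := frobColumn_spec H 1
    rw [norm_mul, norm_pow, hz, one_pow, mul_one, coeff_map, hj]
    exact (h1 n).trans (pow_le_one₀ hd0.le hd1.le)
  refine ⟨?_, hrow0, hrow1 0, hrow1 1⟩
  obtain ⟨-, h1, -, h3⟩ := frobColumn_spec H 0
  rw [fibreM_eq_ev j hj H hz]
  have hs := ((wiener_frobM j hj H 0 0).hasSum_ev hz.le).summable
  rw [ev, hs.tsum_eq_zero_add, pow_zero, mul_one]
  have h0 : coeff 0 (PowerSeries.map j (frobM p a b' b π 0 0)) = 1 := by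
    rw [coeff_map]
    change j (coeff 0 (frobColumn p a b' b π 0).1) = 1
    rw [coeff_zero_eq_constantCoeff_apply, h3, if_pos rfl, map_one]
  rw [h0, add_sub_cancel_left]
  refine lt_of_le_of_lt (norm_tsum_le_of_le hd0.le fun n => ?_) hd1
  rw [norm_mul, norm_pow, hz, one_pow, mul_one, coeff_map, hj]
  exact (h1 _).trans ((pow_le_pow_of_le_one hd0.le hd1.le (Nat.succ_le_succ (Nat.zero_le n))).trans_eq
    (pow_one _))

theorem isUnitRoot_fibreM_mul (hj : ∀ x, ‖j x‖ = ‖x‖) (H : Params p a π b b') (hz : ‖z‖ = 1) {r : ℕ}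
    (hr : r ≠ 0) : IsUnitRoot (fibreM p (a * r) (j π) z) := by
  obtain ⟨r, rfl⟩ := Nat.exists_eq_succ_of_ne_zero hr
  clear hr
  induction r with
  | zero => simpa using isUnitRoot_fibreM hj H hz
  | succ r ih =>
    rw [Nat.mul_succ, fibreM_add H.five_le (H.map j) hz _ H.a_ne]
    refine (isUnitRoot_fibreM hj H ?_).mul ih
    rw [norm_pow, hz, one_pow]

/-- At a point fixed by the d-th iterate of Frobenius all factors of the cocycle are equal. -/
theorem fibreM_pow (H : Params p a π b b') (hz : ‖z‖ = 1) {d m : ℕ} (hd : d ≠ 0) (hm : m ≠ 0)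
    (hzd : z ^ p ^ (a * d) = z) : fibreM p (a * (d * m)) (j π) z = fibreM p (a * d) (j π) z ^ m := by
  obtain ⟨m, rfl⟩ := Nat.exists_eq_succ_of_ne_zero hm
  clear hm
  induction m with
  | zero => simp
  | succ m ih =>
    rw [Nat.mul_succ d, Nat.mul_add a, add_comm (a * (d * (m + 1))), fibreM_add H.five_le (H.map j) hz _
      (mul_ne_zero H.a_ne (mul_ne_zero hd m.succ_ne_zero)), hzd, ih]
    exact (pow_succ _ _).symm

end UnitRoot

/-! ### Kloosterman sums of an arbitrary nontrivial character -/

section KloostermanSums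

variable {p : ℕ} [hp : Fact p.Prime] {K L : Type*} [NormedField K] [NormedField L]
  [NormedAlgebra ℚ_[p] K] [NormedAlgebra ℚ_[p] L] [CharZero K] [CharZero L]
  [IsUltrametricDist K] [IsUltrametricDist L] [CompleteSpace K] [CompleteSpace L]
  {a : ℕ} {π : K} {j : K →+* L} {F : Type*} [Field F] [Finite F]
  [CharP (AlgebraicClosure F) p] {τ : AlgebraicClosure F →* L}

theorem deg_ne_zero {F : Type*} [Field F] (t : (AlgebraicClosure F)ˣ) : deg F t ≠ 0 := by
  have hint : IsIntegral F (t : AlgebraicClosure F) := Algebra.IsIntegral.isIntegral _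
  have : FiniteDimensional F F⟮(t : AlgebraicClosure F)⟯ :=
    IntermediateField.adjoin.finiteDimensional hint
  exact Module.finrank_pos.ne'

/-- The substitution y = cx turns c(x + t/x) into y + c²t/y; this is the reason for the parameter
c²t. -/
theorem kloosterman_sum_eq (h5 : 5 ≤ p) (hτ : IsTeichmuller τ) (hπ : (j π) ^ (p - 1) = -(p : L))
    (hF : Nat.card F = p ^ a) {ψ : AddChar F K} {c : F} (hc : c ≠ 0)
    (hψ : ∀ x, j (ψ x) = dworkChar p a (j π) τ (algebraMap F (AlgebraicClosure F) (c * x)))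
    {n : ℕ} (hn : n ≠ 0) (t : (AlgebraicClosure F)ˣ) (ht : (t : AlgebraicClosure F) ∈ subExt F n) :
    j (∑ᶠ x : (subExt F n)ˣ, ψ (Algebra.trace F (subExt F n) (x + ⟨t, ht⟩ / x))) =
      -(fibreM p (a * n) (j π) (τ (algebraMap F _ c ^ 2 * t))).trace := by
  classical
  have := finite_subExt (F := F) hn
  have := Fintype.ofFinite (subExt F n)
  have := Fintype.ofFinite (subExt F n)ˣ
  have hcard : Fintype.card (subExt F n) = p ^ (a * n) := by
    rw [← Nat.card_eq_fintype_card, natCard_subExt hn, hF, pow_mul]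
  set ι : subExt F n →+* AlgebraicClosure F := (subExt F n).val.toRingHom with hι
  set t' : subExt F n := ⟨t, ht⟩ with ht'
  set c' : subExt F n := algebraMap F _ c with hc'
  have hc0 : c' ≠ 0 := by
    rw [hc']
    exact (map_ne_zero _).2 hc
  have ht0 : t' ≠ 0 := fun h => t.ne_zero (congrArg Subtype.val h)
  have h1 := sum_dworkChar_eq_neg_trace h5 hτ hπ hcard ι (Units.mk0 (c' ^ 2 * t')
    (mul_ne_zero (pow_ne_zero _ hc0) ht0))
  have h2 : ι (Units.mk0 (c' ^ 2 * t') (mul_ne_zero (pow_ne_zero _ hc0) ht0)) =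
      algebraMap F (AlgebraicClosure F) c ^ 2 * t := rfl
  rw [h2] at h1
  rw [← h1, finsum_eq_sum_of_fintype, map_sum]
  refine Fintype.sum_equiv (Equiv.mulLeft (Units.mk0 c' hc0)) _ _ fun x => ?_
  rw [hψ, ← smul_eq_mul, ← map_smul, algebraMap_trace_subExt hn, hF]
  have h3 : ∀ y : subExt F n, (y : AlgebraicClosure F) ^ p ^ (a * n) = y := by
    intro y
    have := mem_subExt_iff.1 y.2
    rwa [hF, ← pow_mul] at this
  rw [← dworkChar_trace h5 hτ hπ (h3 _)]
  congr 1
  have hval : ∀ y : subExt F n, (y : AlgebraicClosure F) = ι y := fun y => rfl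
  rw [hval]
  congr 1
  have hx : (x : subExt F n) ≠ 0 := x.ne_zero
  rw [Algebra.smul_def]
  simp only [Equiv.coe_mulLeft, Units.val_mul, Units.val_mk0]
  rw [← hc']
  field_simp

theorem exists_teichmuller_char [IsAlgClosed L] (h5 : 5 ≤ p) (hπ : (j π) ^ (p - 1) = -(p : L))
    (hF : Nat.card F = p ^ a) {ψ : AddChar F K} (hψ : ψ ≠ 1) :
    ∃ τ : AlgebraicClosure F →* L, IsTeichmuller τ ∧ ∃ c : F, c ≠ 0 ∧
      ∀ x, j (ψ x) = dworkChar p a (j π) τ (algebraMap F (AlgebraicClosure F) (c * x)) := by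
  have := Fintype.ofFinite F
  have ha : a ≠ 0 := by
    rintro rfl
    rw [pow_zero] at hF
    have := one_lt_natCard (F := F)
    omega
  obtain ⟨τ, hτ⟩ := exists_isTeichmuller (L := L) (p := p) (k := AlgebraicClosure F) (by
    intro x
    by_cases hx : x = 0
    · exact ⟨1, one_ne_zero, by rw [hx, pow_one, zero_pow hp.out.ne_zero]⟩
    · have h1 := mem_subExt_iff.1 (mem_subExt F (Units.mk0 x hx) 1)
      rw [hF, ← pow_mul] at h1
      refine ⟨a * (deg F (Units.mk0 x hx) * 1), ?_, h1⟩
      exact mul_ne_zero ha (mul_ne_zero (deg_ne_zero _) one_ne_zero))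
  refine ⟨τ, hτ, ?_⟩
  have hF' : Fintype.card F = p ^ a := by rw [← Nat.card_eq_fintype_card, hF]
  have hψ' : j.toMonoidHom.compAddChar ψ ≠ 1 := by
    intro h
    apply hψ
    ext x
    have := congrArg (fun φ : AddChar F L => φ x) h
    exact j.injective (this.trans (map_one j).symm)
  obtain ⟨c, hc, h⟩ := exists_eq_mulShift
    (dworkAddChar_ne_one h5 hτ hπ hF' (algebraMap F (AlgebraicClosure F))) hψ'
  exact ⟨c, hc, h⟩

end KloostermanSums


/-! ### The reciprocal roots `π₀(t)` and `π₁(t)` -/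

section QuadraticFactor

theorem sq_fin_two {R : Type*} [CommRing R] (N : Matrix (Fin 2) (Fin 2) R) :
    N ^ 2 = N.trace • N - N.det • 1 := by
  ext i k
  rw [pow_two, Matrix.mul_apply, Fin.sum_univ_two, Matrix.trace_fin_two, Matrix.det_fin_two]
  fin_cases i <;> fin_cases k <;> simp <;> ring

theorem trace_pow_add_two {R : Type*} [CommRing R] (N : Matrix (Fin 2) (Fin 2) R) (m : ℕ) :
    (N ^ (m + 2)).trace = N.trace * (N ^ (m + 1)).trace - N.det * (N ^ m).trace := by
  rw [pow_add N m 2, sq_fin_two, mul_sub, mul_smul_comm, mul_smul_comm, mul_one, Matrix.trace_sub,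
    Matrix.trace_smul, Matrix.trace_smul, smul_eq_mul, smul_eq_mul, ← pow_succ]

/-- This is exp(-∑ tr(N^m) T^m / m) = det(1 - TN); the logarithmic derivative reduces it to the
Cayley–Hamilton recursion for the traces. -/
theorem exp_trace_pow {L : Type*} [Field L] [CharZero L] (N : Matrix (Fin 2) (Fin 2) L) :
    (exp L).subst (PowerSeries.mk fun m => if m = 0 then 0 else -(N ^ m).trace / (m : L)) =
      1 - C N.trace * X + C N.det * X ^ 2 := by
  symm
  apply eq_exp_subst
  · rw [← coeff_zero_eq_constantCoeff_apply, coeff_mk, if_pos rfl]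
  · simp
  set h : L⟦X⟧ := PowerSeries.mk fun n => (N ^ (n + 1)).trace with hh
  have hd : derivative L (PowerSeries.mk fun m => if m = 0 then 0 else -(N ^ m).trace / (m : L)) = -h := by
    ext n
    have : (n : L) + 1 ≠ 0 := by exact_mod_cast n.succ_ne_zero
    rw [coeff_derivative, coeff_mk, if_neg n.succ_ne_zero, map_neg, hh, coeff_mk]
    push_cast
    field_simp
  have hf : derivative L (1 - C N.trace * X + C N.det * X ^ 2) = -C N.trace + C (2 * N.det) * X := by
    ext n
    rw [coeff_derivative]
    rcases n with - | - | n
    · simp [coeff_one, coeff_X_pow]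
    · simp [coeff_one, coeff_X_pow]
      ring
    · simp [coeff_one, coeff_X_pow]
  rw [hd, hf]
  have e : (1 - C N.trace * X + C N.det * X ^ 2) * -h =
      -(h - C N.trace * (X * h) + C N.det * (X ^ 2 * h)) := by ring
  rw [e]
  ext n
  rcases n with - | - | n
  · simp [hh]
  · have := trace_pow_add_two N 0
    simp [hh, coeff_X_pow_mul', coeff_succ_X_mul] at this ⊢
    rw [this]
    ring
  · have := trace_pow_add_two N (n + 1)
    simp [hh, coeff_X_pow_mul', coeff_succ_X_mul] at this ⊢
    rw [show n + 1 + 1 + 1 = n + 1 + 2 by rfl, this]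
    ring

theorem coeff_one_quadratic {L : Type*} [CommRing L] (x y : L) :
    coeff 1 (1 - C x * X + C y * X ^ 2 : L⟦X⟧) = -x := by
  simp [coeff_one, coeff_X_pow]

theorem coeff_two_quadratic {L : Type*} [CommRing L] (x y : L) :
    coeff 2 (1 - C x * X + C y * X ^ 2 : L⟦X⟧) = y := by
  simp [coeff_one, coeff_X_pow, coeff_X]

/-- The map x ↦ e₁ - e₂ / x preserves a small closed ball around 1 and contracts it, because |e₂| <
1 and |x| = 1 there. The argument stays in K, so no extension of the coefficient field is needed. -/
theorem exists_unit_root {K : Type*} [NormedField K] [IsUltrametricDist K] [CompleteSpace K]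
    {e₁ e₂ : K} (h₁ : ‖e₁ - 1‖ < 1) (h₂ : ‖e₂‖ < 1) :
    ∃ x, ‖x - 1‖ < 1 ∧ x * x - e₁ * x + e₂ = 0 := by
  set r := max ‖e₁ - 1‖ ‖e₂‖ with hr
  have hr0 : 0 ≤ r := le_max_of_le_left (norm_nonneg _)
  have hr1 : r < 1 := max_lt h₁ h₂
  set f : K → K := fun x => e₁ - e₂ / x with hf
  have hone : ∀ {x : K}, x ∈ Metric.closedBall (1 : K) r → ‖x‖ = 1 := by
    intro x hx
    rw [mem_closedBall_iff_norm] at hx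
    exact norm_eq_one_of_sub (hx.trans_lt hr1)
  have hmaps : Set.MapsTo f (Metric.closedBall 1 r) (Metric.closedBall 1 r) := by
    intro x hx
    have hx1 := hone hx
    rw [mem_closedBall_iff_norm]
    rw [hf, sub_right_comm]
    refine (norm_sub_le_max' _ _).trans ?_
    rw [norm_div, hx1, div_one]
  have hcomp : IsComplete (Metric.closedBall (1 : K) r) := Metric.isClosed_closedBall.isComplete
  have hcontr : ContractingWith ⟨r, hr0⟩ (hmaps.restrict f _ _) := by
    refine ⟨hr1, LipschitzWith.of_dist_le_mul fun x y => ?_⟩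
    rw [Subtype.dist_eq, Subtype.dist_eq, Set.MapsTo.val_restrict_apply,
      Set.MapsTo.val_restrict_apply, dist_eq_norm, dist_eq_norm]
    have hx := hone x.2
    have hy := hone y.2
    have hx0 : (x : K) ≠ 0 := by rw [← norm_ne_zero_iff, hx]; exact one_ne_zero
    have hy0 : (y : K) ≠ 0 := by rw [← norm_ne_zero_iff, hy]; exact one_ne_zero
    rw [show f x - f y = e₂ * ((x : K) - y) / (x * y) by rw [hf]; field_simp; ring, norm_div, norm_mul,
      norm_mul, hx, hy, mul_one, div_one]
    exact mul_le_mul_of_nonneg_right (le_max_right _ _) (norm_nonneg _)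
  obtain ⟨x, hx, hfix, -⟩ := hcontr.exists_fixedPoint' hcomp hmaps
    (Metric.mem_closedBall_self hr0) (edist_ne_top _ _)
  refine ⟨x, ?_, ?_⟩
  · rw [mem_closedBall_iff_norm] at hx
    exact hx.trans_lt hr1
  · have hx1 := hone hx
    have hx0 : x ≠ 0 := by rw [← norm_ne_zero_iff, hx1]; exact one_ne_zero
    have h : e₁ - e₂ / x = x := hfix
    field_simp at h
    linear_combination -h

end QuadraticFactor

/-! ### Existence, uniqueness and conjugation invariance of the pair of reciprocal roots -/

section Roots

variable {p : ℕ} [hp : Fact p.Prime] {K L : Type*} [NormedField K] [NormedField L]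
  [NormedAlgebra ℚ_[p] K] [NormedAlgebra ℚ_[p] L] [CharZero K] [CharZero L]
  [IsUltrametricDist K] [IsUltrametricDist L] [CompleteSpace K] [CompleteSpace L]
  {a : ℕ} {π : K} {b b' : ℝ} {j : K →+* L} {F : Type*} [Field F] [Finite F]
  [CharP (AlgebraicClosure F) p] {τ : AlgebraicClosure F →* L} {ψ : AddChar F K} {c : F}

/-- An isometric embedding of coefficient fields, a Teichmüller lift, and a presentation of `ψ` through
Dwork's character. -/
structure KlData (p : ℕ) [Fact p.Prime] {K L : Type*} [NormedField K] [NormedField L]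
    [NormedAlgebra ℚ_[p] K] [NormedAlgebra ℚ_[p] L] [CharZero K] [CharZero L]
    [IsUltrametricDist L] (a : ℕ) (π : K) (b b' : ℝ) (j : K →+* L) {F : Type*} [Field F] [Finite F]
    (τ : AlgebraicClosure F →* L) (ψ : AddChar F K) (c : F) : Prop where
  params : Params p a π b b'
  isometry : ∀ x, ‖j x‖ = ‖x‖
  teich : IsTeichmuller τ
  card : Nat.card F = p ^ a
  c_ne : c ≠ 0
  char_eq : ∀ x, j (ψ x) = dworkChar p a (j π) τ (algebraMap F (AlgebraicClosure F) (c * x))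

/-- The Frobenius at the Teichmüller point above `c² t`, iterated `n` times. -/
def klM (p a : ℕ) (π : K) (j : K →+* L) (τ : AlgebraicClosure F →* L) (c : F) (n : ℕ)
    (t : (AlgebraicClosure F)ˣ) : Matrix (Fin 2) (Fin 2) L :=
  fibreM p (a * n) (j π) (τ (algebraMap F _ c ^ 2 * t))

theorem kloosterman_sum_conj {K : Type*} [NormedField K] (ψ : AddChar F K) {n : ℕ} (hn : n ≠ 0)
    {t t' : (AlgebraicClosure F)ˣ} (σ : AlgebraicClosure F ≃ₐ[F] AlgebraicClosure F)
    (hσ : (t' : AlgebraicClosure F) = σ t) (ht : (t : AlgebraicClosure F) ∈ subExt F n)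
    (ht' : (t' : AlgebraicClosure F) ∈ subExt F n) :
    ∑ᶠ x : (subExt F n)ˣ, ψ (Algebra.trace F (subExt F n) (x + ⟨t, ht⟩ / x)) =
      ∑ᶠ x : (subExt F n)ˣ, ψ (Algebra.trace F (subExt F n) (x + ⟨t', ht'⟩ / x)) := by
  have := finite_subExt (F := F) hn
  set ρ : subExt F n →* subExt F n :=
    ⟨⟨fun y => ⟨σ y, mem_subExt_iff.2 (by rw [← map_pow, mem_subExt_iff.1 y.2])⟩,
      Subtype.ext (map_one σ)⟩, fun x y => Subtype.ext (map_mul σ _ _)⟩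
  have hinj : Function.Injective (Units.map ρ) := Units.map_injective fun x y h =>
    Subtype.ext (σ.injective (congrArg Subtype.val h))
  refine finsum_eq_of_bijective _ (Finite.injective_iff_bijective.1 hinj) fun x => ?_
  congr 1
  apply (algebraMap F (AlgebraicClosure F)).injective
  rw [← σ.commutes, algebraMap_trace_subExt hn, algebraMap_trace_subExt hn, map_sum]
  refine Finset.sum_congr rfl fun i _ => ?_
  rw [map_pow]
  congr 1
  change σ (x + t / x) = σ x + t' / σ x
  rw [map_add, map_div₀, hσ]

theorem klSum_conj {K : Type*} [NormedField K] (ψ : AddChar F K) {t t' : (AlgebraicClosure F)ˣ}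
    (h : minpoly F (t : AlgebraicClosure F) = minpoly F (t' : AlgebraicClosure F)) {m : ℕ}
    (hm : m ≠ 0) : klSum ψ t m = klSum ψ t' m := by
  obtain ⟨σ, hσ⟩ := isConjRoot_iff_exists_algEquiv.1 (show IsConjRoot F _ _ from h.symm)
  have hdeg : deg F t * m = deg F t' * m := by
    rw [deg, deg, IntermediateField.adjoin.finrank (Algebra.IsIntegral.isIntegral _),
      IntermediateField.adjoin.finrank (Algebra.IsIntegral.isIntegral _), h]
  -- The degrees of conjugate points are equal but not definitionally so; the sum is transported
  -- along this equality.
  have key : ∀ {n n' : ℕ} (_ : n = n') (ht : (t' : AlgebraicClosure F) ∈ subExt F n)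
      (ht' : (t' : AlgebraicClosure F) ∈ subExt F n'),
      ∑ᶠ x : (subExt F n)ˣ, ψ (Algebra.trace F (subExt F n) (x + ⟨t', ht⟩ / x)) =
      ∑ᶠ x : (subExt F n')ˣ, ψ (Algebra.trace F (subExt F n') (x + ⟨t', ht'⟩ / x)) := by
    rintro n _ rfl ht ht'
    rfl
  have ht' : (t' : AlgebraicClosure F) ∈ subExt F (deg F t * m) := by
    rw [hdeg]
    exact mem_subExt F t' m
  exact (kloosterman_sum_conj ψ (mul_ne_zero (deg_ne_zero t) hm) σ hσ.symm (mem_subExt F t m) ht').trans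
    (key hdeg ht' (mem_subExt F t' m))

/-- The Euler product chooses one representative of each closed point, while the trace formula sums
over all geometric points; this allows the comparison. -/
theorem klRoots_conj {K : Type*} [NormedField K] [CharZero K] (ψ : AddChar F K)
    {t t' : (AlgebraicClosure F)ˣ}
    (h : minpoly F (t : AlgebraicClosure F) = minpoly F (t' : AlgebraicClosure F)) :
    klRoots ψ t = klRoots ψ t' := by
  have hL : klL ψ t = klL ψ t' := by
    rw [klL, klL]
    congr 2
    funext m
    split_ifs with hm
    · rfl
    · rw [klSum_conj ψ h hm]
  have hI : IsKlRoots ψ t = IsKlRoots ψ t' := by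
    funext r
    rw [IsKlRoots, IsKlRoots, hL]
  rw [klRoots, klRoots, hI]

namespace KlData

theorem norm_point (D : KlData p a π b b' j τ ψ c) (t : (AlgebraicClosure F)ˣ) : ‖τ (algebraMap F _ c ^ 2 * t)‖ = 1 :=
  D.teich.norm_eq_one _ (mul_ne_zero (pow_ne_zero _ ((map_ne_zero _).2 D.c_ne)) t.ne_zero)

theorem point_pow (D : KlData p a π b b' j τ ψ c) {t : (AlgebraicClosure F)ˣ} {n : ℕ}
    (ht : (t : AlgebraicClosure F) ∈ subExt F n) :
    τ (algebraMap F _ c ^ 2 * t) ^ p ^ (a * n) = τ (algebraMap F _ c ^ 2 * t) := by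
  have h1 := mem_subExt_iff.1 ht
  have h2 := mem_subExt_iff.1 ((subExt F n).algebraMap_mem c)
  rw [D.card, ← pow_mul] at h1 h2
  rw [← map_pow, mul_pow, h1, ← pow_mul, mul_comm 2, pow_mul, h2]

theorem klM_mul (D : KlData p a π b b' j τ ψ c) {t : (AlgebraicClosure F)ˣ} {d m : ℕ} (hd : d ≠ 0)
    (hm : m ≠ 0) (ht : (t : AlgebraicClosure F) ∈ subExt F d) :
    klM p a π j τ c (d * m) t = klM p a π j τ c d t ^ m :=
  fibreM_pow D.params (D.norm_point t) hd hm (D.point_pow ht)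

theorem mem_subExt_deg (t : (AlgebraicClosure F)ˣ) : (t : AlgebraicClosure F) ∈ subExt F (deg F t) := by
  simpa using mem_subExt F t 1

theorem klSum_eq (D : KlData p a π b b' j τ ψ c) (t : (AlgebraicClosure F)ˣ) {m : ℕ} (hm : m ≠ 0) :
    j (klSum ψ t m) = -(klM p a π j τ c (deg F t) t ^ m).trace := by
  rw [← D.klM_mul (deg_ne_zero t) hm (mem_subExt_deg t)]
  exact kloosterman_sum_eq D.params.five_le D.teich (D.params.map j) D.card D.c_ne D.char_eq
    (mul_ne_zero (deg_ne_zero t) hm) t (mem_subExt F t m)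

theorem isUnitRoot_klM (D : KlData p a π b b' j τ ψ c) (t : (AlgebraicClosure F)ˣ) {n : ℕ}
    (hn : n ≠ 0) : IsUnitRoot (klM p a π j τ c n t) :=
  isUnitRoot_fibreM_mul D.isometry D.params (D.norm_point t) hn

theorem map_klL (D : KlData p a π b b' j τ ψ c) (t : (AlgebraicClosure F)ˣ) :
    PowerSeries.map j (klL ψ t) = 1 - C (klM p a π j τ c (deg F t) t).trace * X +
      C (klM p a π j τ c (deg F t) t).det * X ^ 2 := by
  rw [klL, map_exp_subst, ← exp_trace_pow]
  · congr 1
    ext m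
    rw [coeff_map, coeff_mk, coeff_mk]
    split_ifs with hm
    · rw [map_zero]
    · rw [map_div₀, map_natCast, D.klSum_eq t hm]
  · rw [← coeff_zero_eq_constantCoeff_apply, coeff_mk, if_pos rfl]

theorem isKlRoots_iff (D : KlData p a π b b' j τ ψ c) (t : (AlgebraicClosure F)ˣ) (r : K × K) :
    IsKlRoots ψ t r ↔ j (r.1 + r.2) = (klM p a π j τ c (deg F t) t).trace ∧
      j (r.1 * r.2) = (klM p a π j τ c (deg F t) t).det ∧ ‖1 - r.1‖ < 1 := by
  have hmap : Function.Injective (PowerSeries.map j) := PowerSeries.map_injective _ j.injective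
  have e : PowerSeries.map j ((1 - C r.1 * X) * (1 - C r.2 * X)) =
      1 - C (j (r.1 + r.2)) * X + C (j (r.1 * r.2)) * X ^ 2 := by
    rw [map_mul, map_sub, map_sub, map_one, map_mul, map_mul, map_C, map_C, map_X, map_add, map_add,
      map_mul j, map_mul]
    ring
  rw [IsKlRoots, ← hmap.eq_iff, D.map_klL t, e, ← and_assoc]
  refine and_congr_left fun _ => ⟨fun h => ?_, fun h => by rw [h.1, h.2]⟩
  have h1 := congrArg (coeff 1) h
  have h2 := congrArg (coeff 2) h
  rw [coeff_one_quadratic, coeff_one_quadratic, neg_inj] at h1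
  rw [coeff_two_quadratic, coeff_two_quadratic] at h2
  exact ⟨h1.symm, h2.symm⟩

/-- Trace and determinant of the Frobenius matrix lie in L, but up to sign they are images of
coefficients of `klL`; the quadratic equation can hence be solved in K. -/
theorem exists_isKlRoots (D : KlData p a π b b' j τ ψ c) (t : (AlgebraicClosure F)ˣ) :
    ∃ r, IsKlRoots ψ t r := by
  have hU := D.isUnitRoot_klM t (deg_ne_zero t)
  have hmap := D.map_klL t
  have h1 := congrArg (coeff 1) hmap
  have h2 := congrArg (coeff 2) hmap
  rw [coeff_map, coeff_one_quadratic] at h1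
  rw [coeff_map, coeff_two_quadratic] at h2
  obtain ⟨x, hx, hroot⟩ := exists_unit_root (e₁ := -coeff 1 (klL ψ t)) (e₂ := coeff 2 (klL ψ t))
    (by
      rw [← D.isometry, map_sub, map_neg, h1, neg_neg, map_one]
      exact hU.trace)
    (by
      rw [← D.isometry, h2]
      exact hU.det)
  refine ⟨(x, -coeff 1 (klL ψ t) - x), (D.isKlRoots_iff t _).2 ⟨?_, ?_, ?_⟩⟩
  · rw [add_sub_cancel, map_neg, h1, neg_neg]
  · rw [← h2]
    congr 1
    linear_combination -hroot
  · rw [norm_sub_rev]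
    exact hx

theorem norm_root_lt (D : KlData p a π b b' j τ ψ c) {t : (AlgebraicClosure F)ˣ} {r : K × K}
    (h : IsKlRoots ψ t r) : ‖r.1‖ = 1 ∧ ‖r.2‖ < 1 := by
  obtain ⟨-, h2, h3⟩ := (D.isKlRoots_iff t r).1 h
  have h4 : ‖r.1‖ = 1 := norm_eq_one_of_sub (by rwa [norm_sub_rev])
  refine ⟨h4, ?_⟩
  have h5 := (D.isUnitRoot_klM t (deg_ne_zero t)).det
  rwa [← h2, D.isometry, norm_mul, h4, one_mul] at h5

/-- The two roots are distinguished by their norms, 1 and less than 1. -/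
theorem isKlRoots_unique (D : KlData p a π b b' j τ ψ c) {t : (AlgebraicClosure F)ˣ} {r s : K × K}
    (hr : IsKlRoots ψ t r) (hs : IsKlRoots ψ t s) : r = s := by
  obtain ⟨r1, r2⟩ := D.norm_root_lt hr
  obtain ⟨s1, s2⟩ := D.norm_root_lt hs
  obtain ⟨h1, h2, -⟩ := (D.isKlRoots_iff t r).1 hr
  obtain ⟨h1', h2', -⟩ := (D.isKlRoots_iff t s).1 hs
  have hadd := j.injective (h1.trans h1'.symm)
  have hmul := j.injective (h2.trans h2'.symm)
  have h3 : (s.1 - r.1) * (s.1 - r.2) = 0 := by linear_combination -s.1 * hadd + hmul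
  rcases mul_eq_zero.1 h3 with h | h
  · have e1 := sub_eq_zero.1 h
    refine Prod.ext e1.symm ?_
    rw [e1] at hadd
    exact add_left_cancel hadd
  · rw [sub_eq_zero.1 h] at s1
    exact absurd s1 r2.ne

theorem existsUnique_isKlRoots (D : KlData p a π b b' j τ ψ c) (t : (AlgebraicClosure F)ˣ) :
    ∃! r, IsKlRoots ψ t r := by
  obtain ⟨r, hr⟩ := D.exists_isKlRoots t
  exact ⟨r, hr, fun s hs => D.isKlRoots_unique hs hr⟩

theorem isKlRoots_klRoots (D : KlData p a π b b' j τ ψ c) (t : (AlgebraicClosure F)ˣ) :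
    IsKlRoots ψ t (klRoots ψ t) := Classical.epsilon_spec (D.exists_isKlRoots t)

end KlData

end Roots

/-! ### Entries of the infinite symmetric power -/

section SymEntries

variable (p : ℕ) [hp : Fact p.Prime] {K : Type*} [NormedField K] [IsUltrametricDist K]
  [NormedAlgebra ℚ_[p] K]

theorem norm_binom_le_one (τ : ℤ_[p]) (k : ℕ) : ‖binom p K τ k‖ ≤ 1 := by
  rw [binom, norm_algebraMap']
  exact PadicInt.norm_le_one _

theorem factorial_mul_choose (τ : ℤ_[p]) (s : ℕ) :
    (s.factorial : ℤ_[p]) * Ring.choose τ s = ∏ i ∈ Finset.range s, (τ - (i : ℤ_[p])) := by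
  induction s with
  | zero => simp
  | succ s ih =>
    have h := Ring.choose_smul_choose τ (Nat.le_succ s)
    rw [Nat.succ_eq_add_one, Nat.choose_succ_self_right, Nat.add_sub_cancel_left,
      Ring.choose_one_right, nsmul_eq_mul] at h
    rw [Finset.prod_range_succ, ← ih, Nat.factorial_succ]
    push_cast at h ⊢
    linear_combination (s.factorial : ℤ_[p]) * h

theorem choose_mul_binom (τ : ℤ_[p]) {k s : ℕ} (h : s ≤ k) :
    (k.choose s : K) * binom p K τ k = binom p K τ s * binom p K (τ - (s : ℤ_[p])) (k - s) := by
  have h1 := Ring.choose_smul_choose τ h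
  rw [nsmul_eq_mul] at h1
  have h2 := congrArg (fun x : ℤ_[p] => algebraMap ℚ_[p] K x) h1
  simpa [binom] using h2

open scoped Classical in
theorem fall_ne_zero (κ : ℤ_[p]) (m : ℕ) : fall p K κ m ≠ 0 := by
  rw [fall, map_ne_zero]
  have : (∏ i ∈ Finset.range m, if κ - (i : ℤ_[p]) = 0 then 1 else κ - (i : ℤ_[p])) ≠ 0 := by
    refine Finset.prod_ne_zero_iff.2 fun i _ => ?_
    split_ifs with h
    · exact one_ne_zero
    · exact h
  exact fun h => this (Subtype.ext h)

theorem norm_fall_anti (κ : ℤ_[p]) {j m : ℕ} (h : j ≤ m) :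
    ‖fall p K κ m‖ ≤ ‖fall p K κ j‖ := by
  obtain ⟨d, rfl⟩ := Nat.exists_eq_add_of_le h
  rw [fall, fall, norm_algebraMap', norm_algebraMap', Finset.prod_range_add, PadicInt.coe_mul,
    norm_mul]
  exact mul_le_of_le_one_right (norm_nonneg _) (PadicInt.norm_le_one _)

/-- The product s! binom(κ - m, s) continues the falling factorial of length m to length m + s. If a
factor vanishes, the binomial side is 0, while the modified factorial just omits it. Legendre's
bound trades s! for `radius p ^ s`. -/
theorem norm_fall_mul_binom_le (κ : ℤ_[p]) {j m s : ℕ} (h : j ≤ m + s) :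
    ‖fall p K κ m * binom p K (κ - (m : ℤ_[p])) s‖ * radius p ^ s ≤ ‖fall p K κ j‖ := by
  have h1 : ‖fall p K κ m * binom p K (κ - (m : ℤ_[p])) s‖ * ‖((s.factorial : ℕ) : K)‖ ≤
      ‖fall p K κ (m + s)‖ := by
    have e : ((s.factorial : ℕ) : K) =
        algebraMap ℚ_[p] K (((s.factorial : ℕ) : ℤ_[p]) : ℚ_[p]) := by simp
    rw [← norm_mul, mul_assoc, binom, fall, e, ← map_mul, ← PadicInt.coe_mul, ← map_mul,
      ← PadicInt.coe_mul, mul_comm (Ring.choose _ _), factorial_mul_choose, fall,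
      Finset.prod_range_add]
    simp only [norm_algebraMap', PadicInt.padic_norm_e_of_padicInt, norm_mul]
    gcongr
    rw [norm_prod, norm_prod]
    refine Finset.prod_le_prod (fun _ _ => norm_nonneg _) fun i _ => ?_
    split_ifs with h0
    · have : κ - (m : ℤ_[p]) - (i : ℤ_[p]) = 0 := by rw [← h0]; push_cast; ring
      rw [this]
      simp
    · apply le_of_eq
      congr 1
      push_cast
      ring
  refine le_trans ?_ (h1.trans (norm_fall_anti p κ h))
  gcongr
  exact radius_pow_le_norm_factorial p s

variable (M : Matrix (Fin 2) (Fin 2) K⟦X⟧)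

/-- The coefficient of `t^n w^j` in `(A₁ + A₃ w)^(κ - m) (A₂ + A₄ w)^m`. -/
def symEntry (κ : ℤ_[p]) (n m j : ℕ) : K :=
  coeff n (coeff j (serUnitPow p (C (M 0 0) + C (M 1 0) * X) (κ - (m : ℤ_[p])) *
    (C (M 0 1) + C (M 1 1) * X) ^ m))

/-- Coefficient bounds for the matrix of the relative Frobenius. -/
structure FrobBound (δ β : ℝ) : Prop where
  pos : 0 < δ
  bot_pos : 0 < β
  top : ∀ k d, ‖coeff d (M 0 k)‖ ≤ δ ^ d
  bot : ∀ k d, ‖coeff d (M 1 k)‖ ≤ β * δ ^ d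
  one : constantCoeff (M 0 0) = 1

/-- The power series `G` in `w` with `‖G(n, j)‖ ≤ δ^n β^j`. -/
def BoundTW (δ β : ℝ) (G : K⟦X⟧⟦X⟧) : Prop := ∀ j n, ‖coeff n (coeff j G)‖ ≤ β ^ j * δ ^ n

variable {δ β : ℝ} {M}

theorem BoundTW.one (hδ : 0 ≤ δ) (hβ : 0 ≤ β) : BoundTW δ β (1 : K⟦X⟧⟦X⟧) := by
  intro j n
  rw [coeff_one]
  split_ifs with h
  · simpa [h] using norm_coeff_one_le (K := K) hδ n
  · rw [map_zero, norm_zero]; positivity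

theorem BoundTW.mul (hδ : 0 ≤ δ) (hβ : 0 ≤ β) {G G' : K⟦X⟧⟦X⟧} (h : BoundTW δ β G)
    (h' : BoundTW δ β G') : BoundTW δ β (G * G') := by
  intro j n
  rw [coeff_mul, map_sum]
  refine norm_sum_le_of_le _ _ (by positivity) fun i hi => ?_
  rw [← mem_antidiagonal.1 hi, pow_add]
  exact norm_coeff_mul_le (by positivity) (by positivity) hδ (h i.1) (h' i.2) n

theorem BoundTW.pow (hδ : 0 ≤ δ) (hβ : 0 ≤ β) {G : K⟦X⟧⟦X⟧} (h : BoundTW δ β G) (k : ℕ) :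
    BoundTW δ β (G ^ k) := by
  induction k with
  | zero => simpa using BoundTW.one hδ hβ
  | succ k ih => rw [pow_succ]; exact ih.mul hδ hβ h

theorem coeff_linear (A B : K⟦X⟧) (j : ℕ) :
    coeff j (C A + C B * X) = if j = 0 then A else if j = 1 then B else 0 := by
  rcases j with _ | _ | j <;> simp [coeff_C]

theorem coeff_linear_pow (A B : K⟦X⟧) (k s : ℕ) :
    coeff s ((C A + C B * X) ^ k) = (k.choose s : K⟦X⟧) * (B ^ s * A ^ (k - s)) := by
  rw [add_comm, add_pow, map_sum]
  have h : ∀ i ∈ Finset.range (k + 1),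
      coeff s ((C B * X) ^ i * C A ^ (k - i) * (k.choose i : K⟦X⟧⟦X⟧)) =
        if s = i then (k.choose i : K⟦X⟧) * (B ^ i * A ^ (k - i)) else 0 := by
    intro i _
    rw [mul_pow, show (C B ^ i * X ^ i * C A ^ (k - i) * (k.choose i : K⟦X⟧⟦X⟧)) =
      C ((k.choose i : K⟦X⟧) * (B ^ i * A ^ (k - i))) * X ^ i by
        rw [map_mul, map_mul, map_pow, map_pow, map_natCast]; ring, coeff_C_mul_X_pow]
  rw [Finset.sum_congr rfl h, Finset.sum_ite_eq]
  split_ifs with hs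
  · rfl
  · rw [Nat.choose_eq_zero_of_lt (by simpa using hs), Nat.cast_zero, zero_mul]

theorem FrobBound.boundTW (H : FrobBound M δ β) (k : Fin 2) :
    BoundTW δ β (C (M 0 k) + C (M 1 k) * X) := by
  intro j n
  have hδ := H.pos.le
  have hβ := H.bot_pos.le
  rw [coeff_linear]
  split_ifs with h0 h1
  · simpa [h0] using H.top k n
  · simpa [h1] using H.bot k n
  · rw [map_zero, norm_zero]; positivity

theorem FrobBound.linear_sub_one :
    (C (M 0 0) + C (M 1 0) * X : K⟦X⟧⟦X⟧) - 1 = C (M 0 0 - 1) + C (M 1 0) * X := by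
  rw [map_sub, map_one]; ring

theorem FrobBound.norm_sub_one_le (H : FrobBound M δ β) (d : ℕ) :
    ‖coeff d (M 0 0 - 1)‖ ≤ 1 * δ ^ d := by
  rw [map_sub]
  exact norm_sub_le_of_le (by simpa using H.top 0 d) (norm_coeff_one_le H.pos.le d)

/-- The identity binom(k, s) binom(τ, k) = binom(τ, s) binom(τ - s, k - s) extracts the factor
binom(τ, s) common to all terms contributing to w^s. Keeping it is essential for the bounds in the
basis w^(m). -/
theorem FrobBound.norm_serUnitPow_le (H : FrobBound M δ β) (τ : ℤ_[p]) (s n : ℕ) :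
    ‖coeff n (coeff s (serUnitPow p (C (M 0 0) + C (M 1 0) * X) τ))‖ ≤
      ‖binom p K τ s‖ * β ^ s * δ ^ n := by
  have hδ := H.pos.le
  have hβ := H.bot_pos.le
  rw [serUnitPow, coeff_mk, coeff_mk, linear_sub_one]
  refine norm_sum_le_of_le _ _ (by positivity) fun k _ => ?_
  rw [coeff_linear_pow]
  rcases lt_or_ge k s with h | h
  · rw [Nat.choose_eq_zero_of_lt h, Nat.cast_zero, zero_mul, map_zero, mul_zero, norm_zero]
    positivity
  · rw [← map_natCast (C (R := K)), coeff_C_mul, ← mul_assoc, mul_comm (binom p K τ k),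
      choose_mul_binom p τ h, norm_mul, norm_mul, mul_assoc, mul_assoc]
    refine mul_le_mul_of_nonneg_left ?_ (norm_nonneg _)
    refine (mul_le_of_le_one_left (norm_nonneg _) (norm_binom_le_one p _ _)).trans ?_
    have := norm_coeff_mul_le (pow_nonneg hβ s) (pow_nonneg zero_le_one (k - s)) hδ
      (norm_coeff_pow_le hβ hδ (H.bot 0) s)
      (norm_coeff_pow_le zero_le_one hδ H.norm_sub_one_le (k - s)) n
    rwa [one_pow, mul_one] at this

theorem FrobBound.boundTW_serUnitPow (H : FrobBound M δ β) (τ : ℤ_[p]) :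
    BoundTW δ β (serUnitPow p (C (M 0 0) + C (M 1 0) * X) τ) := by
  intro s n
  have hδ := H.pos.le
  have hβ := H.bot_pos.le
  refine (H.norm_serUnitPow_le p τ s n).trans ?_
  rw [mul_assoc]
  exact mul_le_of_le_one_left (by positivity) (norm_binom_le_one p _ _)

theorem FrobBound.norm_symEntry_le (H : FrobBound M δ β) (κ : ℤ_[p]) (n m j : ℕ) :
    ‖symEntry p M κ n m j‖ ≤ β ^ j * δ ^ n :=
  BoundTW.mul H.pos.le H.bot_pos.le (H.boundTW_serUnitPow p _)
    ((H.boundTW 1).pow H.pos.le H.bot_pos.le m) j n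

/-- The change of basis divides by the falling factorial of length j. Of the j factors β, those
coming from the binomial series are split as |π| γ, and |π| pays for the denominators. The other
factor has degree at most m in w, which gives j ≤ m + i.1. -/
theorem FrobBound.norm_fall_mul_symEntry_le (H : FrobBound M δ β) {γ : ℝ}
    (hγ : β = radius p * γ) (κ : ℤ_[p]) (n m j : ℕ) :
    ‖fall p K κ m * symEntry p M κ n m j‖ ≤ ‖fall p K κ j‖ * (γ ^ j * δ ^ n) := by
  have hδ := H.pos.le
  have hβ := H.bot_pos.le
  have hr := radius_pos p
  have hγ0 : 0 < γ := by
    have := H.bot_pos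
    rw [hγ] at this
    exact (mul_pos_iff_of_pos_left hr).1 this
  rw [symEntry, coeff_mul, map_sum, Finset.mul_sum]
  refine norm_sum_le_of_le _ _ (by positivity) fun i hi => ?_
  have hi := mem_antidiagonal.1 hi
  have hU := (H.boundTW 1).pow hδ hβ m i.2
  have hz : m < i.2 → coeff i.2 ((C (M 0 1) + C (M 1 1) * X) ^ m) = 0 := fun h => by
    rw [coeff_linear_pow, Nat.choose_eq_zero_of_lt h, Nat.cast_zero, zero_mul]
  rcases lt_or_ge m i.2 with h | h
  · rw [hz h, mul_zero, map_zero, mul_zero, norm_zero]; positivity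
  have h1 := norm_coeff_mul_le (by positivity) (pow_nonneg hβ i.2) hδ
    (H.norm_serUnitPow_le p (κ - (m : ℤ_[p])) i.1) hU n
  have h2 := norm_fall_mul_binom_le p (K := K) κ (show j ≤ m + i.1 by omega)
  rw [norm_mul] at h2 ⊢
  have hγβ : β ≤ γ := by
    rw [hγ]
    exact mul_le_of_le_one_left hγ0.le (radius_lt_one p).le
  calc _ ≤ ‖fall p K κ m‖ * (‖binom p K (κ - (m : ℤ_[p])) i.1‖ * β ^ i.1 * β ^ i.2 * δ ^ n) := by
        gcongr
    _ = (‖fall p K κ m‖ * ‖binom p K (κ - (m : ℤ_[p])) i.1‖ * radius p ^ i.1) *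
          (γ ^ i.1 * β ^ i.2 * δ ^ n) := by
        have : β ^ i.1 = radius p ^ i.1 * γ ^ i.1 := by rw [hγ, mul_pow]
        rw [this]; ring
    _ ≤ ‖fall p K κ j‖ * (γ ^ i.1 * γ ^ i.2 * δ ^ n) := by gcongr
    _ = _ := by rw [← pow_add, hi]

/-- For fixed indices an entry is a finite sum of binomial coefficients in κ times constants. -/
theorem tendsto_symEntry {κ : ℤ_[p]} {k : ℕ → ℤ_[p]} (hk : Filter.Tendsto k .atTop (nhds κ))
    (n m j : ℕ) : Filter.Tendsto (fun i => symEntry p M (k i) n m j) .atTop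
      (nhds (symEntry p M κ n m j)) := by
  simp only [symEntry, coeff_mul, map_sum, serUnitPow, coeff_mk]
  refine tendsto_finsetSum _ fun _ _ => tendsto_finsetSum _ fun _ _ =>
    (tendsto_finsetSum _ fun l _ => ?_).mul_const _
  refine Filter.Tendsto.mul_const _ ?_
  have h1 : Continuous fun x : ℤ_[p] => binom p K x l := by
    unfold binom
    exact (continuous_algebraMap ℚ_[p] K).comp
      (continuous_subtype_val.comp (PadicInt.continuous_choose l))
  exact (h1.tendsto _).comp (hk.sub_const _)

theorem serUnitPow_natCast (G : K⟦X⟧⟦X⟧) (hG : constantCoeff (constantCoeff G) = 1) (k : ℕ) :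
    serUnitPow p G (k : ℤ_[p]) = G ^ k := by
  have hb : ∀ l, binom p K (k : ℤ_[p]) l = (k.choose l : K) := fun l => by
    rw [binom, Ring.choose_natCast]; simp
  have hvan : ∀ l j n, n + j < l → coeff n (coeff j ((G - 1) ^ l)) = 0 := by
    intro l
    induction l with
    | zero => intro j n h; omega
    | succ l ih =>
      intro j n h
      rw [pow_succ, coeff_mul, map_sum]
      refine Finset.sum_eq_zero fun i hi => ?_
      rw [coeff_mul]
      refine Finset.sum_eq_zero fun i' hi' => ?_
      have hi := mem_antidiagonal.1 hi
      have hi' := mem_antidiagonal.1 hi'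
      by_cases h0 : i.2 = 0 ∧ i'.2 = 0
      · have : coeff i'.2 (coeff i.2 (G - 1)) = 0 := by
          rw [h0.1, h0.2, coeff_zero_eq_constantCoeff_apply, coeff_zero_eq_constantCoeff_apply,
            map_sub, map_sub, hG]
          simp
        rw [this, mul_zero]
      · rw [ih _ _ (by omega), zero_mul]
  ext j n
  rw [serUnitPow, coeff_mk, coeff_mk]
  conv_rhs => rw [show G = (G - 1) + 1 by ring, add_pow]
  simp only [one_pow, mul_one, map_sum]
  have h2 : ∀ l, coeff n (coeff j ((G - 1) ^ l * (k.choose l : K⟦X⟧⟦X⟧))) =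
      binom p K (k : ℤ_[p]) l * coeff n (coeff j ((G - 1) ^ l)) := by
    intro l
    rw [hb, mul_comm, ← map_natCast (C (R := K⟦X⟧)), coeff_C_mul, ← map_natCast (C (R := K)),
      coeff_C_mul]
  simp only [h2]
  rcases le_total (n + j + 1) (k + 1) with h | h
  · refine Finset.sum_subset (Finset.range_subset_range.2 h) fun l _ hl => ?_
    rw [hvan l j n (by simpa using hl), mul_zero]
  · refine (Finset.sum_subset (Finset.range_subset_range.2 h) fun l _ hl => ?_).symm
    rw [hb, Nat.choose_eq_zero_of_lt (by simpa using hl), Nat.cast_zero, zero_mul]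

theorem symEntry_natCast (h1 : constantCoeff (M 0 0) = 1) {k m : ℕ} (h : m ≤ k) (n j : ℕ) :
    symEntry p M k n m j = coeff n (coeff j ((C (M 0 0) + C (M 1 0) * X) ^ (k - m) *
      (C (M 0 1) + C (M 1 1) * X) ^ m)) := by
  rw [symEntry, ← Nat.cast_sub h, serUnitPow_natCast p _ (by simp [h1])]

end SymEntries

/-! ### The operator `β_κ` -/

section SymOperator

variable {p : ℕ} [hp : Fact p.Prime] {K : Type*} [NormedField K] [IsUltrametricDist K]
  [NormedAlgebra ℚ_[p] K] [CompleteSpace K] [CharZero K] {a : ℕ} {b b' ε : ℝ} {π : K}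

theorem decay_eq_pow : decay p 0 b' = decay p a b' ^ p ^ a := by
  have : (p : ℝ) ^ a ≠ 0 := pow_ne_zero _ (by exact_mod_cast hp.out.ne_zero)
  rw [decay_pow, decay]
  congr 1
  push_cast
  field_simp

theorem memSρ_iff {ρ : ℝ} {A : ℕ × ℕ → K} : MemSρ p b' ε ρ A ↔
    ∀ i : ℕ × ℕ, ‖A i‖ ≤ (p : ℝ) ^ (-ρ) * (decay p 0 b' ^ i.1 * ((p : ℝ) ^ (-ε)) ^ i.2) := by
  have h0 : (0 : ℝ) < p := by linarith [one_lt_cast p]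
  refine forall_congr' fun i => ?_
  rw [OrdGE, decay_pow, ← Real.rpow_natCast (_ ^ _), ← Real.rpow_mul h0.le, ← Real.rpow_add h0,
    ← Real.rpow_add h0]
  rw [show -ρ + (-(2 * (b' / (p : ℝ) ^ 0) * i.1) + -ε * i.2) = -(2 * b' * i.1 + ε * i.2 + ρ) by
    rw [pow_zero, div_one]; ring]

theorem Params.frobBound (H : Params p a π b b') :
    FrobBound (frobM p a b' b π) (decay p a b') ((p : ℝ) ^ b)⁻¹ where
  pos := decay_pos
  bot_pos := inv_pos.2 (Real.rpow_pos_of_pos (by linarith [one_lt_cast p]) _)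
  top k d := (frobColumn_spec H k).2.1 d
  bot k d := (frobColumn_spec H k).2.2.1 d
  one := (frobColumn_spec H 0).2.2.2

theorem symFrobCoeff_eq (κ : ℤ_[p]) (n m j : ℕ) : symFrobCoeff p a b' b π κ n m j =
    fall p K κ m * symEntry p (frobM p a b' b π) κ n m j / fall p K κ j := by
  rw [symFrobCoeff, symFrobBasis, mul_assoc, coeff_C_mul, coeff_C_mul, serOne_eq, serPiTX_eq]
  rfl

theorem norm_symFrobCoeff_le (H : Params p a π b b') (hε : ε = b - 1 / ((p : ℝ) - 1))
    (κ : ℤ_[p]) (n m j : ℕ) :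
    ‖symFrobCoeff p a b' b π κ n m j‖ ≤ ((p : ℝ) ^ (-ε)) ^ j * decay p a b' ^ n := by
  have h0 : (0 : ℝ) < p := by linarith [one_lt_cast p]
  rw [symFrobCoeff_eq, norm_div, div_le_iff₀ (norm_pos_iff.2 (fall_ne_zero p κ j))]
  refine (H.frobBound.norm_fall_mul_symEntry_le p ?_ κ n m j).trans (mul_comm _ _).le
  rw [radius, ← Real.rpow_neg h0.le, ← Real.rpow_add h0, hε]
  congr 1
  ring

/-- The coefficient of `t^N w^(j)` in `ξ_m(t) [ᾱ_a]_κ(w^(m))`. -/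
def symTerm (p : ℕ) [Fact p.Prime] {K : Type*} [NormedField K] [NormedAlgebra ℚ_[p] K] [CharZero K]
    (a : ℕ) (b' b : ℝ) (π : K) (κ : ℤ_[p]) (ξ : ℕ × ℕ → K) (N j m : ℕ) : K :=
  ∑ i ∈ antidiagonal N, ξ (i.1, m) * symFrobCoeff p a b' b π κ i.2 m j

theorem norm_symTerm_le (H : Params p a π b b') (hε : ε = b - 1 / ((p : ℝ) - 1)) (κ : ℤ_[p])
    {ξ : ℕ × ℕ → K} {D : ℝ} {m : ℕ} (hξ : ∀ n, ‖ξ (n, m)‖ ≤ D * decay p a b' ^ n) (N j : ℕ) :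
    ‖symTerm p a b' b π κ ξ N j m‖ ≤ D * (decay p a b' ^ N * ((p : ℝ) ^ (-ε)) ^ j) := by
  have hδ := decay_pos (p := p) (a := a) (b' := b')
  have hD : 0 ≤ D := by simpa using (norm_nonneg _).trans (hξ 0)
  refine norm_sum_le_of_le _ _ (by positivity) fun i hi => ?_
  rw [norm_mul, ← mem_antidiagonal.1 hi]
  calc _ ≤ (D * decay p a b' ^ i.1) * (((p : ℝ) ^ (-ε)) ^ j * decay p a b' ^ i.2) :=
        mul_le_mul (hξ _) (norm_symFrobCoeff_le H hε κ _ _ _) (norm_nonneg _) (by positivity)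
    _ = _ := by rw [pow_add]; ring

theorem gamma_lt_one (H : Params p a π b b') (hε : ε = b - 1 / ((p : ℝ) - 1)) :
    (p : ℝ) ^ (-ε) < 1 :=
  Real.rpow_lt_one_of_one_lt_of_neg (one_lt_cast p) (by linarith [H.lt_b])

/-- This ratio is the gain in t produced by ψ_t^a, together with p^(-ε) in w the source of
compactness. -/
theorem decay_ratio_lt_one (H : Params p a π b b') : decay p 0 b' / decay p a b' < 1 := by
  have hδ := decay_pos (p := p) (a := a) (b' := b')
  rw [div_lt_one hδ, decay_eq_pow (a := a)]
  exact pow_lt_self_of_lt_one₀ hδ (decay_lt_one H) (Nat.one_lt_pow H.a_ne hp.out.one_lt)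

theorem exists_bound_of_mem (ξ : S p K b' ε) : ∃ D : ℝ, 0 ≤ D ∧ ∀ i : ℕ × ℕ,
    ‖ξ.1 i‖ ≤ D * (decay p 0 b' ^ i.1 * ((p : ℝ) ^ (-ε)) ^ i.2) := by
  obtain ⟨ρ, h⟩ := ξ.2
  exact ⟨(p : ℝ) ^ (-ρ), by positivity, memSρ_iff.1 h⟩

theorem le_of_decay (H : Params p a π b b') {x D g : ℝ} (hD : 0 ≤ D) (hg : 0 ≤ g) (n : ℕ)
    (h : x ≤ D * (decay p 0 b' ^ n * g)) : x ≤ D * g * decay p a b' ^ n := by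
  refine h.trans ?_
  rw [mul_comm _ g, ← mul_assoc]
  have h0 := decay_pos (p := p) (a := 0) (b' := b')
  have := decay_ratio_lt_one H
  rw [div_lt_one decay_pos] at this
  gcongr

theorem summable_symTerm (H : Params p a π b b') (hε : ε = b - 1 / ((p : ℝ) - 1)) (κ : ℤ_[p])
    (ξ : S p K b' ε) (N j : ℕ) : Summable (symTerm p a b' b π κ ξ.1 N j) := by
  obtain ⟨D, hD, h⟩ := exists_bound_of_mem ξ
  have hγ : (0 : ℝ) ≤ (p : ℝ) ^ (-ε) := by positivity
  refine Summable.of_norm_bounded (((summable_geometric_of_lt_one hγ (gamma_lt_one H hε)).mul_left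
    D).mul_right (decay p a b' ^ N * ((p : ℝ) ^ (-ε)) ^ j)) fun m => ?_
  exact norm_symTerm_le H hε κ (fun n => le_of_decay H hD (pow_nonneg hγ m) n (h (n, m))) N j

theorem norm_tsum_symTerm_le (H : Params p a π b b') (hε : ε = b - 1 / ((p : ℝ) - 1)) (κ : ℤ_[p])
    {ξ : ℕ × ℕ → K} {D : ℝ} (hξ : ∀ i : ℕ × ℕ, ‖ξ i‖ ≤ D * decay p a b' ^ i.1) (N j : ℕ) :
    ‖∑' m, symTerm p a b' b π κ ξ N j m‖ ≤ D * (decay p a b' ^ N * ((p : ℝ) ^ (-ε)) ^ j) := by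
  have hδ := decay_pos (p := p) (a := a) (b' := b')
  have hD : 0 ≤ D := by simpa using (norm_nonneg _).trans (hξ 0)
  exact norm_tsum_le_of_le (by positivity)
    fun m => norm_symTerm_le H hε κ (fun n => hξ (n, m)) N j

/-- The operator `[ᾱ_a]_κ`. -/
def symFrob (H : Params p a π b b') (hε : ε = b - 1 / ((p : ℝ) - 1)) (κ : ℤ_[p]) :
    S p K b' ε →ₗ[K] S p K (b' / (p : ℝ) ^ a) ε where
  toFun ξ := ⟨fun i => ∑' m, symTerm p a b' b π κ ξ.1 i.1 i.2 m, by
    obtain ⟨D, hD, h⟩ := exists_bound_of_mem ξ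
    refine (exists_memSρ_iff p _ _ _).2 ⟨D, fun i => ?_⟩
    have hγ : (0 : ℝ) ≤ (p : ℝ) ^ (-ε) := by positivity
    refine (norm_tsum_symTerm_le H hε κ (D := D) (fun i => ?_) i.1 i.2).trans (le_of_eq ?_)
    · have h1 := le_of_decay H hD (pow_nonneg hγ i.2) i.1 (h i)
      refine h1.trans ?_
      have hδ := decay_pos (p := p) (a := a) (b' := b')
      gcongr
      exact mul_le_of_le_one_right hD (pow_le_one₀ hγ (gamma_lt_one H hε).le)
    · have h0 : (0 : ℝ) < p := by linarith [one_lt_cast p]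
      rw [decay_pow, ← Real.rpow_natCast (_ ^ _), ← Real.rpow_mul h0.le, ← Real.rpow_add h0]
      congr 2
      ring⟩
  map_add' ξ η := by
    ext i
    change ∑' m, symTerm p a b' b π κ (ξ.1 + η.1) i.1 i.2 m = ∑' m, _ + ∑' m, _
    rw [← (summable_symTerm H hε κ ξ i.1 i.2).tsum_add (summable_symTerm H hε κ η i.1 i.2)]
    refine tsum_congr fun m => ?_
    simp only [symTerm, Pi.add_apply, add_mul, Finset.sum_add_distrib]
  map_smul' c ξ := by
    ext i
    change ∑' m, symTerm p a b' b π κ (c • ξ.1) i.1 i.2 m = c * ∑' m, _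
    rw [← tsum_mul_left]
    refine tsum_congr fun m => ?_
    simp only [symTerm, Pi.smul_apply, smul_eq_mul, mul_assoc, Finset.mul_sum]

theorem isSymFrob_symFrob (H : Params p a π b b') (hε : ε = b - 1 / ((p : ℝ) - 1)) (κ : ℤ_[p]) :
    IsSymFrob p a b' b ε π κ (symFrob H hε κ) :=
  fun ξ N j => (summable_symTerm H hε κ ξ N j).hasSum

/-- The hypothesis is much weaker than membership in the ball of index ρ: only the slower rate in t
is required, and nothing in w. -/
theorem memSρ_psiT_symFrob (H : Params p a π b b') (hε : ε = b - 1 / ((p : ℝ) - 1)) (κ : ℤ_[p])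
    {ξ : S p K b' ε} {ρ : ℝ} (hξ : ∀ i : ℕ × ℕ, ‖ξ.1 i‖ ≤ (p : ℝ) ^ (-ρ) * decay p a b' ^ i.1) :
    MemSρ p b' ε ρ ((psiT p a b' ε ∘ₗ symFrob H hε κ) ξ).1 := by
  refine memSρ_iff.2 fun i => ?_
  rw [decay_eq_pow (a := a), ← pow_mul]
  exact norm_tsum_symTerm_le H hε κ hξ _ _

/-- The operator is approximated by its composite with truncation to a finite box of indices.
Outside the box an element of a ball satisfies the weak bounds of `memSρ_psiT_symFrob` with an
additional factor p^(-c). -/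
theorem isCompletelyContinuous_symFrob (H : Params p a π b b')
    (hε : ε = b - 1 / ((p : ℝ) - 1)) (κ : ℤ_[p]) :
    IsCompletelyContinuous p (psiT p a b' ε ∘ₗ symFrob H hε κ) := by
  intro c
  have h0 : (0 : ℝ) < p := by linarith [one_lt_cast p]
  set γ := (p : ℝ) ^ (-ε) with hγ
  have hγ0 : 0 < γ := by positivity
  have hγ1 : γ < 1 := gamma_lt_one H hε
  have hδ := decay_pos (p := p) (a := a) (b' := b')
  have hΔ := decay_pos (p := p) (a := 0) (b' := b')
  set r := decay p 0 b' / decay p a b' with hr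
  have hr0 : 0 < r := by positivity
  have hr1 : r < 1 := decay_ratio_lt_one H
  -- The sides of the box: beyond M₁ in w the factor γ^m, and beyond M₂ in t the factor r^n, is
  -- below p^(-c).
  obtain ⟨M₁, hM₁⟩ := exists_pow_lt_of_lt_one (show 0 < (p : ℝ) ^ (-c) by positivity) hγ1
  obtain ⟨M₂, hM₂⟩ := exists_pow_lt_of_lt_one (show 0 < (p : ℝ) ^ (-c) by positivity) hr1
  have hprod : ∀ n : ℕ, decay p 0 b' ^ n = r ^ n * decay p a b' ^ n := fun n => by
    rw [← mul_pow, hr, div_mul_cancel₀ _ hδ.ne']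
  let s : Finset (ℕ × ℕ) := Finset.range M₂ ×ˢ Finset.range M₁
  let P : S p K b' ε →ₗ[K] (s → K) := LinearMap.pi fun i =>
    LinearMap.proj (i : ℕ × ℕ) ∘ₗ Submodule.subtype _
  let E : (s → K) →ₗ[K] S p K b' ε := Fintype.linearCombination K fun i : s => basisVec p b' ε i.1
  have hT : ∀ (ξ : S p K b' ε) (i : ℕ × ℕ), (E (P ξ)).1 i = if i ∈ s then ξ.1 i else 0 := by
    intro ξ i
    have h1 : (E (P ξ)).1 i = ∑ k : s, ξ.1 k * Pi.single (M := fun _ => K) (k : ℕ × ℕ) 1 i := by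
      simp only [E, Fintype.linearCombination_apply, P]
      rw [← Submodule.subtype_apply, map_sum, Finset.sum_apply]
      rfl
    rw [h1, Finset.sum_coe_sort s fun k => ξ.1 k * Pi.single (M := fun _ => K) k 1 i]
    simp only [Pi.single_apply, mul_ite, mul_one, mul_zero, Finset.sum_ite_eq]
  refine ⟨(psiT p a b' ε ∘ₗ symFrob H hε κ) ∘ₗ E ∘ₗ P, ?_, ⟨0, fun ρ ξ hξ => ?_⟩, fun ρ ξ hξ => ?_⟩
  · rw [← LinearMap.comp_assoc]
    exact Submodule.finiteDimensional_of_le (LinearMap.range_comp_le_range _ _)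
  · rw [add_zero]
    refine memSρ_psiT_symFrob H hε κ fun i => ?_
    change ‖(E (P ξ)).1 i‖ ≤ _
    rw [hT]
    split_ifs
    · refine (memSρ_iff.1 hξ i).trans ?_
      rw [hprod]
      gcongr
      calc _ = r ^ i.1 * γ ^ i.2 * decay p a b' ^ i.1 := by ring
        _ ≤ 1 * decay p a b' ^ i.1 := by
          gcongr
          exact mul_le_one₀ (pow_le_one₀ hr0.le hr1.le) (by positivity) (pow_le_one₀ hγ0.le hγ1.le)
        _ = _ := one_mul _
    · rw [norm_zero]; positivity
  · have : (psiT p a b' ε ∘ₗ symFrob H hε κ) ξ - ((psiT p a b' ε ∘ₗ symFrob H hε κ) ∘ₗ E ∘ₗ P) ξ =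
        (psiT p a b' ε ∘ₗ symFrob H hε κ) (ξ - E (P ξ)) := by rw [map_sub]; rfl
    rw [this]
    refine memSρ_psiT_symFrob H hε κ fun i => ?_
    change ‖ξ.1 i - (E (P ξ)).1 i‖ ≤ _
    rw [hT]
    split_ifs with hi
    · rw [sub_self, norm_zero]; positivity
    · rw [sub_zero]
      refine (memSρ_iff.1 hξ i).trans ?_
      rw [hprod, neg_add, Real.rpow_add h0, mul_assoc ((p : ℝ) ^ (-ρ)) ((p : ℝ) ^ (-c))]
      refine mul_le_mul_of_nonneg_left ?_ (by positivity)
      calc _ = r ^ i.1 * γ ^ i.2 * decay p a b' ^ i.1 := by ring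
        _ ≤ _ := by
          gcongr
          rw [Finset.mem_product, Finset.mem_range, Finset.mem_range, not_and_or, not_lt,
            not_lt] at hi
          rcases hi with hi | hi
          · exact (mul_le_of_le_one_right (by positivity) (pow_le_one₀ hγ0.le hγ1.le)).trans
              ((pow_le_pow_of_le_one hr0.le hr1.le hi).trans hM₂.le)
          · exact (mul_le_of_le_one_left (by positivity) (pow_le_one₀ hr0.le hr1.le)).trans
              ((pow_le_pow_of_le_one hγ0.le hγ1.le hi).trans hM₁.le)

/-- The matrix of `ψ_t^a ∘ [ᾱ_a]_κ` with respect to the `t^n w^m`. -/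
def symMatrix (p : ℕ) [Fact p.Prime] {K : Type*} [NormedField K] [NormedAlgebra ℚ_[p] K]
    (q : ℕ) (M : Matrix (Fin 2) (Fin 2) K⟦X⟧) (κ : ℤ_[p]) (x y : ℕ × ℕ) : K :=
  if y.1 ≤ q * x.1 then symEntry p M κ (q * x.1 - y.1) y.2 x.2 else 0

theorem psiT_symFrob_basisVec (H : Params p a π b b') (hε : ε = b - 1 / ((p : ℝ) - 1))
    (κ : ℤ_[p]) (x y : ℕ × ℕ) :
    ((psiT p a b' ε ∘ₗ symFrob H hε κ) (basisVec p b' ε y)).1 x =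
      fall p K κ y.2 * symMatrix p (p ^ a) (frobM p a b' b π) κ x y / fall p K κ x.2 := by
  change ∑' m, symTerm p a b' b π κ (Pi.single y 1) (p ^ a * x.1) x.2 m = _
  have h : ∀ m, symTerm p a b' b π κ (Pi.single y 1) (p ^ a * x.1) x.2 m = if m = y.2 then
      (if y.1 ≤ p ^ a * x.1 then symFrobCoeff p a b' b π κ (p ^ a * x.1 - y.1) m x.2 else 0)
      else 0 := by
    intro m
    rw [symTerm, Finset.Nat.sum_antidiagonal_eq_sum_range_succ (fun i k =>
      Pi.single (M := fun _ => K) y 1 (i, m) * symFrobCoeff p a b' b π κ k m x.2)]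
    simp only [Pi.single_apply, Prod.ext_iff, ite_mul, one_mul, zero_mul]
    split_ifs with hm hy
    · simp only [hm, and_true]
      rw [Finset.sum_ite_eq', if_pos (by simpa [Nat.lt_succ_iff] using hy)]
    · simp only [hm, and_true]
      rw [Finset.sum_ite_eq', if_neg (by simpa [Nat.lt_succ_iff] using hy)]
    · simp [hm]
  rw [tsum_congr h, tsum_ite_eq, symMatrix]
  split_ifs
  · rw [symFrobCoeff_eq]
  · simp

end SymOperator

/-! ### Traces and Fredholm determinants of nuclear matrices -/

section FiniteNewton

variable {n R : Type*} [Fintype n] [DecidableEq n] [CommRing R]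

/-- Jacobi's formula: the Leibniz rule replaces one column at a time by its derivative, and the
resulting determinants are diagonal entries of adjugate times derivative. -/
theorem derivative_det (A : Matrix n n (Polynomial R)) :
    Polynomial.derivative A.det = (A.adjugate * A.map Polynomial.derivative).trace := by
  have h1 : ∀ i, (A.adjugate * A.map Polynomial.derivative) i i =
      (A.updateCol i fun k => Polynomial.derivative (A k i)).det := fun i => by
    rw [← Matrix.cramer_apply, Matrix.cramer_eq_adjugate_mulVec]
    rfl
  rw [Matrix.trace]
  simp only [Matrix.diag_apply, h1, Matrix.det_apply]
  rw [Finset.sum_comm, map_sum]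
  refine Finset.sum_congr rfl fun σ _ => ?_
  rw [← Finset.smul_sum]
  have h2 : Polynomial.derivative (Equiv.Perm.sign σ • ∏ i, A (σ i) i) =
      Equiv.Perm.sign σ • Polynomial.derivative (∏ i, A (σ i) i) := by
    rcases Int.units_eq_one_or (Equiv.Perm.sign σ) with h | h <;> simp [h]
  rw [h2, Polynomial.derivative_prod_finset]
  congr 1
  refine Finset.sum_congr rfl fun i _ => ?_
  rw [← Finset.mul_prod_erase _ _ (Finset.mem_univ i), Matrix.updateCol_self, mul_comm]
  congr 1
  refine Finset.prod_congr rfl fun k hk => ?_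
  rw [Matrix.updateCol_ne (Finset.ne_of_mem_erase hk)]

/-- Newton's identities for the coefficients of `det (1 - T M)`. -/
theorem newton_det (M : Matrix n n R) (k : ℕ) :
    (k + 1 : R) * (Matrix.det (1 + (Polynomial.X : Polynomial R) • (-M).map Polynomial.C)).coeff
      (k + 1) = -∑ i ∈ antidiagonal k,
        (Matrix.det (1 + (Polynomial.X : Polynomial R) • (-M).map Polynomial.C)).coeff i.1 *
          (M ^ (i.2 + 1)).trace := by
  set A : Matrix n n (Polynomial R) := 1 + (Polynomial.X : Polynomial R) • (-M).map Polynomial.C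
    with hA
  have hA' : A.map Polynomial.derivative = (-M).map Polynomial.C := by
    ext i j
    by_cases h : i = j <;> simp [hA, h]
  let B : ℕ → Matrix n n R := fun k => A.adjugate.map fun f => f.coeff k
  have hmul : ∀ (N : Matrix n n R) k,
      (A.adjugate * N.map Polynomial.C).map (fun f => f.coeff k) = B k * N := by
    intro N k
    ext i j
    simp [Matrix.mul_apply, B, Polynomial.finsetSum_coeff]
  have hrec : A.adjugate + (Polynomial.X : Polynomial R) • (A.adjugate * (-M).map Polynomial.C) =
      A.det • (1 : Matrix n n (Polynomial R)) := by
    rw [← Matrix.adjugate_mul, hA, mul_add, mul_one, Matrix.mul_smul]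
  have hone : ∀ k, (A.det • (1 : Matrix n n (Polynomial R))).map (fun f => f.coeff k) =
      A.det.coeff k • (1 : Matrix n n R) := by
    intro k
    ext i j
    by_cases h : i = j <;> simp [h]
  -- Comparing coefficients in adj(A) A = det(A), A = 1 - XM, determines the coefficients of the
  -- adjugate recursively as partial sums of det(A) (1 - XM)⁻¹.
  have hB : ∀ k, B k = ∑ i ∈ antidiagonal k, A.det.coeff i.1 • M ^ i.2 := by
    intro k
    induction k with
    | zero =>
      have h := congrArg (fun N => Matrix.map N fun f : Polynomial R => f.coeff 0) hrec
      simp only [hone] at h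
      have h' : B 0 = A.det.coeff 0 • (1 : Matrix n n R) := by
        rw [← h]
        ext i j
        simp [B]
      simp [h']
    | succ k ih =>
      have h := congrArg (fun N => Matrix.map N fun f : Polynomial R => f.coeff (k + 1)) hrec
      simp only [hone] at h
      have h' : B (k + 1) + B k * (-M) = A.det.coeff (k + 1) • (1 : Matrix n n R) := by
        rw [← h, ← hmul]
        ext i j
        simp [B]
      rw [Finset.Nat.antidiagonal_succ', Finset.sum_cons, Finset.sum_map]
      have h3 : B (k + 1) = A.det.coeff (k + 1) • (1 : Matrix n n R) + B k * M := by
        rw [← h']; simp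
      rw [h3, ih, Finset.sum_mul]
      simp [pow_succ]
  have h := congrArg (fun f : Polynomial R => f.coeff k) (derivative_det A)
  simp only [Polynomial.coeff_derivative, hA'] at h
  have htr : (A.adjugate * (-M).map Polynomial.C).trace.coeff k = (B k * (-M)).trace := by
    rw [← hmul]
    simp [Matrix.trace, Polynomial.finsetSum_coeff]
  rw [mul_comm, h, htr, hB, mul_neg, Matrix.trace_neg, Finset.sum_mul, Matrix.trace_sum]
  simp [pow_succ]

end FiniteNewton

/-! ### Infinite matrices dominated by a rank one matrix of finite trace -/

section Nuclear

variable {ι K : Type*} [DecidableEq ι] [NormedField K] [CompleteSpace K]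

/-- A matrix dominated by a matrix of rank one with finite trace. -/
structure Nuclear (u w : ι → ℝ) (X : ι → ι → K) : Prop where
  left : ∀ i, 0 ≤ u i
  right : ∀ i, 0 ≤ w i
  summable : Summable fun i => u i * w i
  bound : ∀ i k, ‖X i k‖ ≤ u i * w k

/-- The power `X^(r + 1)` of a matrix. -/
def matPow (X : ι → ι → K) : ℕ → ι → ι → K
  | 0 => X
  | r + 1 => fun i k => ∑' l, matPow X r i l * X l k

/-- The trace of `X^(r + 1)`. -/
def matTr (X : ι → ι → K) (r : ℕ) : K := ∑' i, matPow X r i i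

/-- The Fredholm determinant `det(1 - T X)`. -/
def fredholmSeries (X : ι → ι → K) : K⟦X⟧ := PowerSeries.mk fun k =>
  (-1) ^ k * ∑' I : {I : Finset ι // I.card = k}, (Matrix.of fun i j : I.1 => X i j).det

variable {u w : ι → ℝ} {X : ι → ι → K}

namespace Nuclear

theorem trace_nonneg (H : Nuclear u w X) : 0 ≤ ∑' i, u i * w i :=
  tsum_nonneg fun i => mul_nonneg (H.left i) (H.right i)

theorem norm_mul_le_of (H : Nuclear u w X) {r : ℕ}
    (h : ∀ i k, ‖matPow X r i k‖ ≤ (∑' i, u i * w i) ^ r * (u i * w k)) (i k l : ι) :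
    ‖matPow X r i l * X l k‖ ≤ (∑' i, u i * w i) ^ r * (u i * w k) * (u l * w l) := by
  rw [norm_mul]
  refine (mul_le_mul (h i l) (H.bound l k) (norm_nonneg _)
    (mul_nonneg (pow_nonneg H.trace_nonneg _) (mul_nonneg (H.left _) (H.right _)))).trans
    (le_of_eq (by ring))

theorem norm_matPow_le (H : Nuclear u w X) (r : ℕ) (i k : ι) :
    ‖matPow X r i k‖ ≤ (∑' i, u i * w i) ^ r * (u i * w k) := by
  induction r generalizing i k with
  | zero => simpa [matPow] using H.bound i k
  | succ r ih =>
    refine (tsum_of_norm_bounded (H.summable.hasSum.mul_left _)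
      (H.norm_mul_le_of ih i k)).trans (le_of_eq (by ring))

theorem norm_mul_le (H : Nuclear u w X) (r : ℕ) (i k l : ι) :
    ‖matPow X r i l * X l k‖ ≤ (∑' i, u i * w i) ^ r * (u i * w k) * (u l * w l) :=
  H.norm_mul_le_of (H.norm_matPow_le r) i k l

variable {α : Type*} {f : Filter α} {Y : α → ι → ι → K}

/-- The majorants u and w do not depend on the parameter, so dominated convergence applies. It
serves both for finite truncations and for limits in the weight κ. -/
theorem tendsto_matPow (H : Nuclear u w X) (hY : ∀ x, Nuclear u w (Y x))
    (h : ∀ i k, f.Tendsto (fun x => Y x i k) (nhds (X i k))) (r : ℕ) (i k : ι) :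
    f.Tendsto (fun x => matPow (Y x) r i k) (nhds (matPow X r i k)) := by
  induction r generalizing i k with
  | zero => exact h i k
  | succ r ih =>
    exact tendsto_tsum_of_dominated_convergence
      (H.summable.mul_left ((∑' i, u i * w i) ^ r * (u i * w k)))
      (fun l => (ih i l).mul (h l k)) (.of_forall fun x l => (hY x).norm_mul_le r i k l)

theorem tendsto_matTr (H : Nuclear u w X) (hY : ∀ x, Nuclear u w (Y x))
    (h : ∀ i k, f.Tendsto (fun x => Y x i k) (nhds (X i k))) (r : ℕ) :
    f.Tendsto (fun x => matTr (Y x) r) (nhds (matTr X r)) :=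
  tendsto_tsum_of_dominated_convergence (H.summable.mul_left ((∑' i, u i * w i) ^ r))
    (fun i => H.tendsto_matPow hY h r i i) (.of_forall fun x i => (hY x).norm_matPow_le r i i)

variable [IsUltrametricDist K]

/-- In every term of the Leibniz expansion the permutation only rearranges the factors u, so all
terms have the same majorant. -/
theorem norm_det_le (H : Nuclear u w X) (I : Finset ι) :
    ‖(Matrix.of fun i j : I => X i j).det‖ ≤ ∏ i ∈ I, u i * w i := by
  rw [Matrix.det_apply]
  have h0 : 0 ≤ ∏ i ∈ I, u i * w i :=
    Finset.prod_nonneg fun i _ => mul_nonneg (H.left i) (H.right i)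
  refine norm_sum_le_of_le _ _ h0 fun σ _ => ?_
  have h1 : ‖Equiv.Perm.sign σ • ∏ i : I, Matrix.of (fun i j : I => X i j) (σ i) i‖ =
      ‖∏ i : I, X (σ i) i‖ := by
    rcases Int.units_eq_one_or (Equiv.Perm.sign σ) with h | h <;> simp [h]
  rw [h1, norm_prod]
  refine (Finset.prod_le_prod (fun _ _ => norm_nonneg _) fun i _ => H.bound _ _).trans
    (le_of_eq ?_)
  rw [Finset.prod_mul_distrib, Equiv.prod_comp σ (fun i : I => u i), ← Finset.prod_mul_distrib,
    Finset.prod_coe_sort I (fun i => u i * w i)]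

theorem summable_prod (H : Nuclear u w X) (k : ℕ) :
    Summable fun I : {I : Finset ι // I.card = k} => ∏ i ∈ I.1, u i * w i :=
  (summable_finsetProd_of_summable_nonneg (fun i => mul_nonneg (H.left i) (H.right i))
    H.summable).subtype _

theorem summable_det (H : Nuclear u w X) (k : ℕ) :
    Summable fun I : {I : Finset ι // I.card = k} => (Matrix.of fun i j : I.1 => X i j).det :=
  Summable.of_norm_bounded (H.summable_prod k) fun I => H.norm_det_le I.1

theorem tendsto_coeff_fredholmSeries (H : Nuclear u w X) (hY : ∀ x, Nuclear u w (Y x))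
    (h : ∀ i k, f.Tendsto (fun x => Y x i k) (nhds (X i k))) (k : ℕ) :
    f.Tendsto (fun x => coeff k (fredholmSeries (Y x))) (nhds (coeff k (fredholmSeries X))) := by
  simp only [fredholmSeries, coeff_mk]
  refine (tendsto_tsum_of_dominated_convergence (H.summable_prod k) (fun I => ?_)
    (.of_forall fun x I => (hY x).norm_det_le I.1)).const_mul _
  simp only [Matrix.det_apply, Matrix.of_apply]
  exact tendsto_finsetSum _ fun σ _ => (tendsto_finsetProd _ fun i _ => h _ _).const_smul _

/-- Restriction of a matrix to the indices in a finite set. -/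
def trunc (X : ι → ι → K) (J : Finset ι) : ι → ι → K := fun i k =>
  if i ∈ J ∧ k ∈ J then X i k else 0

theorem nuclear_trunc (H : Nuclear u w X) (J : Finset ι) : Nuclear u w (trunc X J) where
  left := H.left
  right := H.right
  summable := H.summable
  bound i k := by
    rw [trunc]
    split_ifs
    · exact H.bound i k
    · rw [norm_zero]; exact mul_nonneg (H.left i) (H.right k)

theorem tendsto_trunc (X : ι → ι → K) (i k : ι) :
    Filter.Tendsto (fun J => trunc X J i k) Filter.atTop (nhds (X i k)) := by
  refine tendsto_const_nhds.congr' ?_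
  filter_upwards [Filter.eventually_ge_atTop {i, k}] with J hJ
  rw [trunc, if_pos ⟨hJ (by simp), hJ (by simp)⟩]

theorem matPow_trunc (X : ι → ι → K) (J : Finset ι) (r : ℕ) (i k : ι) :
    matPow (trunc X J) r i k = if h : i ∈ J ∧ k ∈ J then
      ((Matrix.of fun i k : J => X i k) ^ (r + 1)) ⟨i, h.1⟩ ⟨k, h.2⟩ else 0 := by
  induction r generalizing i k with
  | zero =>
    rw [matPow, trunc]
    split_ifs <;> simp
  | succ r ih =>
    change ∑' l, matPow (trunc X J) r i l * trunc X J l k = _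
    split_ifs with h
    · rw [tsum_eq_sum (s := J), ← Finset.sum_coe_sort, pow_succ, Matrix.mul_apply]
      · refine Finset.sum_congr rfl fun l _ => ?_
        rw [ih, dif_pos ⟨h.1, l.2⟩, trunc, if_pos ⟨l.2, h.2⟩]
        rfl
      · intro l hl
        rw [trunc, if_neg (fun h => hl h.1), mul_zero]
    · have h0 : ∀ l, matPow (trunc X J) r i l * trunc X J l k = 0 := fun l => by
        rw [ih, trunc]
        split_ifs with h1 h2 <;> simp
        exact absurd ⟨h1.1, h2.2⟩ h
      simp [h0]

theorem matTr_trunc (X : ι → ι → K) (J : Finset ι) (r : ℕ) :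
    matTr (trunc X J) r = ((Matrix.of fun i k : J => X i k) ^ (r + 1)).trace := by
  rw [matTr, tsum_eq_sum (s := J), ← Finset.sum_coe_sort]
  · refine Finset.sum_congr rfl fun i _ => ?_
    rw [matPow_trunc, dif_pos ⟨i.2, i.2⟩]
    rfl
  · intro i hi
    rw [matPow_trunc, dif_neg (fun h => hi h.1)]

theorem coeff_fredholmSeries_trunc (X : ι → ι → K) (J : Finset ι) (k : ℕ) :
    coeff k (fredholmSeries (trunc X J)) = (Matrix.det (1 + (Polynomial.X : Polynomial K) •
      (-(Matrix.of fun i k : J => X i k)).map Polynomial.C)).coeff k := by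
  rw [Matrix.coeff_det_one_add_X_smul_eq_sum_minors, fredholmSeries, coeff_mk]
  let e : {s : Finset J // s.card = k} → {I : Finset ι // I.card = k} := fun s =>
    ⟨s.1.map (Function.Embedding.subtype _), by rw [Finset.card_map, s.2]⟩
  have he : Function.Injective e := fun s s' h =>
    Subtype.ext (Finset.map_injective _ (congrArg Subtype.val h))
  rw [← he.tsum_eq, tsum_fintype, Finset.mul_sum,
    Finset.sum_subtype (Finset.univ.powersetCard k) (p := fun s => s.card = k)
      fun s => by rw [Finset.mem_powersetCard_univ]]
  · refine Finset.sum_congr rfl fun s _ => ?_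
    have hs := s.2
    rw [Matrix.submatrix_neg, Pi.neg_apply, Pi.neg_apply, Matrix.det_neg, Fintype.card_coe, hs]
    congr 1
    let g : s.1 ≃ (e s).1 := Equiv.ofBijective (fun i => ⟨i.1.1, by simp [e]⟩)
      ⟨fun i i' h => Subtype.ext (Subtype.ext (Subtype.mk.inj h)), fun i => by
        obtain ⟨x, hx, h⟩ := Finset.mem_map.1 i.2
        exact ⟨⟨x, hx⟩, Subtype.ext h⟩⟩
    rw [← Matrix.det_submatrix_equiv_self g]
    congr 1
    ext i i'
    change trunc X J i.1.1 i'.1.1 = X i.1.1 i'.1.1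
    rw [trunc, if_pos ⟨i.1.2, i'.1.2⟩]
  · intro I hI
    by_contra hne
    refine hI ?_
    -- An index set not coming from J contains a zero row of the truncated matrix, and its minor
    -- vanishes.
    have : ∃ x ∈ I.1, x ∉ J := by
      by_contra! hall
      refine hne ⟨⟨I.1.subtype (· ∈ J), ?_⟩, Subtype.ext ?_⟩
      · rw [Finset.card_subtype, Finset.filter_true_of_mem hall, I.2]
      · exact Finset.subtype_map_of_mem hall
    obtain ⟨x, hx, hxJ⟩ := this
    refine Matrix.det_eq_zero_of_row_eq_zero ⟨x, hx⟩ fun i => ?_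
    rw [Matrix.of_apply, trunc, if_neg fun h => hxJ h.1]

/-- Newton's identities: the logarithmic derivative of the Fredholm determinant. -/
theorem derivative_fredholmSeries (H : Nuclear u w X) :
    derivative K (fredholmSeries X) = -(fredholmSeries X * PowerSeries.mk (matTr X)) := by
  ext k
  rw [coeff_derivative, map_neg, coeff_mul]
  simp only [coeff_mk]
  have hg := fun k => H.tendsto_coeff_fredholmSeries H.nuclear_trunc (tendsto_trunc X) k
  have hT := fun r => H.tendsto_matTr H.nuclear_trunc (tendsto_trunc X) r
  -- Newton's identities hold for every finite block, and both sides converge along the finite sets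
  -- of indices.
  refine tendsto_nhds_unique ((hg (k + 1)).mul_const _)
    (Filter.Tendsto.congr (fun J => ?_)
      (tendsto_finsetSum (antidiagonal k) fun i _ => (hg i.1).mul (hT i.2)).neg)
  rw [mul_comm]
  simp only [coeff_fredholmSeries_trunc, matTr_trunc]
  rw [newton_det]

theorem constantCoeff_fredholmSeries (X : ι → ι → K) : constantCoeff (fredholmSeries X) = 1 := by
  rw [← coeff_zero_eq_constantCoeff_apply, fredholmSeries, coeff_mk,
    tsum_eq_single ⟨∅, Finset.card_empty⟩]
  · simp
  · rintro ⟨I, hI⟩ h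
    exact absurd (Subtype.ext (Finset.card_eq_zero.1 hI)) h

end Nuclear

end Nuclear

/-! ### Nuclearity and the Fredholm determinant of β_κ -/

section SymNuclear

variable {p : ℕ} [hp : Fact p.Prime] {K : Type*} [NormedField K] [IsUltrametricDist K]
  [NormedAlgebra ℚ_[p] K]

/-- An entry is at most β^(x.2) δ^(q x.1 - y.1), which splits into a function of the row and one of
the column; the diagonal products are summable since q > 1. In the basis t^n w^m the majorant does
not involve κ, which permits p-adic interpolation of the weight. -/
theorem FrobBound.nuclear_symMatrix {M : Matrix (Fin 2) (Fin 2) K⟦X⟧} {δ β : ℝ}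
    (H : FrobBound M δ β) (hδ : δ < 1) (hβ : β < 1) {q : ℕ} (hq : 1 < q) (κ : ℤ_[p]) :
    Nuclear (fun x : ℕ × ℕ => (δ ^ q) ^ x.1 * β ^ x.2) (fun y => (δ⁻¹) ^ y.1)
      (symMatrix p q M κ) where
  left x := by have := H.pos; have := H.bot_pos; positivity
  right x := by have := H.pos; positivity
  summable := by
    have h1 : δ ^ q * δ⁻¹ < 1 := by
      rw [← div_eq_mul_inv, div_lt_one H.pos]
      exact pow_lt_self_of_lt_one₀ H.pos hδ hq
    have h0 := H.pos
    refine ((summable_geometric_of_lt_one (by positivity) h1).mul_of_nonneg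
      (summable_geometric_of_lt_one H.bot_pos.le hβ) (fun n => by positivity)
      (fun n => pow_nonneg H.bot_pos.le n)).congr fun x => ?_
    rw [mul_pow]; ring
  bound x y := by
    have h0 := H.pos
    have h1 := H.bot_pos
    rw [symMatrix]
    split_ifs with h
    · refine (H.norm_symEntry_le p κ _ _ _).trans (le_of_eq ?_)
      rw [← pow_mul, pow_sub₀ _ h0.ne' h, inv_pow]
      ring
    · rw [norm_zero]; positivity

variable [CompleteSpace K] [CharZero K] {a : ℕ} {b b' ε : ℝ} {π : K}

theorem Params.nuclear (H : Params p a π b b') (κ : ℤ_[p]) :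
    Nuclear (fun x : ℕ × ℕ => (decay p a b' ^ p ^ a) ^ x.1 * (((p : ℝ) ^ b)⁻¹) ^ x.2)
      (fun y => ((decay p a b')⁻¹) ^ y.1) (symMatrix p (p ^ a) (frobM p a b' b π) κ) := by
  refine H.frobBound.nuclear_symMatrix (decay_lt_one H) ?_ (Nat.one_lt_pow H.a_ne hp.out.one_lt) κ
  refine inv_lt_one_of_one_lt₀ (Real.one_lt_rpow (one_lt_cast p) (lt_trans ?_ H.lt_b))
  exact one_div_pos.2 (by linarith [one_lt_cast p])

/-- Passing from w^(m) to w^m conjugates the matrix by an invertible diagonal matrix, and principal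
minors do not change. -/
theorem det_symFrob (H : Params p a π b b') (hε : ε = b - 1 / ((p : ℝ) - 1)) (κ : ℤ_[p])
    (I : Finset (ℕ × ℕ)) :
    (Matrix.of fun i j : I =>
      ((psiT p a b' ε ∘ₗ symFrob H hε κ) (basisVec p b' ε j)).1 i).det =
    (Matrix.of fun i j : I => symMatrix p (p ^ a) (frobM p a b' b π) κ i j).det := by
  let v : I → K := fun i => fall p K κ i.1.2
  have hv : ∏ i, v i ≠ 0 := Finset.prod_ne_zero_iff.2 fun i _ => fall_ne_zero p κ _
  have h1 := Matrix.det_mul_row v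
    (Matrix.of fun i j : I => symMatrix p (p ^ a) (frobM p a b' b π) κ i j)
  have h2 := Matrix.det_mul_column v (Matrix.of fun i j : I =>
      ((psiT p a b' ε ∘ₗ symFrob H hε κ) (basisVec p b' ε j)).1 i)
  refine mul_left_cancel₀ hv (h2.symm.trans (Eq.trans ?_ h1))
  congr 1
  ext i j
  simp only [Matrix.of_apply]
  rw [psiT_symFrob_basisVec, mul_div_cancel₀ _ (fall_ne_zero p κ _)]

theorem hasFredholmDet_symFrob (H : Params p a π b b') (hε : ε = b - 1 / ((p : ℝ) - 1))
    (κ : ℤ_[p]) : HasFredholmDet p (psiT p a b' ε ∘ₗ symFrob H hε κ) := by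
  intro k
  simp only [det_symFrob H hε κ]
  exact (H.nuclear κ).summable_det k

theorem fredholmDet_symFrob (H : Params p a π b b') (hε : ε = b - 1 / ((p : ℝ) - 1))
    (κ : ℤ_[p]) : fredholmDet p (psiT p a b' ε ∘ₗ symFrob H hε κ) =
      fredholmSeries (symMatrix p (p ^ a) (frobM p a b' b π) κ) := by
  rw [fredholmDet, fredholmSeries]
  simp only [det_symFrob H hε κ]

end SymNuclear

/-! ### Symmetric powers of a matrix of size two -/

section SymPower

variable {R R' : Type*} [CommRing R] [CommRing R']

/-- The linear polynomial `M₀ᵢ + M₁ᵢ w`. -/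
def colPoly (M : Matrix (Fin 2) (Fin 2) R) (i : Fin 2) : Polynomial R :=
  Polynomial.C (M 0 i) + Polynomial.C (M 1 i) * Polynomial.X

/-- The matrix of the `k`-th symmetric power. -/
def symPower (k : ℕ) (M : Matrix (Fin 2) (Fin 2) R) : Matrix (Fin (k + 1)) (Fin (k + 1)) R :=
  Matrix.of fun j m => (colPoly M 0 ^ (k - m : ℕ) * colPoly M 1 ^ (m : ℕ)).coeff j

theorem natDegree_colPoly_le (M : Matrix (Fin 2) (Fin 2) R) (i : Fin 2) :
    (colPoly M i).natDegree ≤ 1 := by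
  rw [colPoly, add_comm]
  exact Polynomial.natDegree_linear_le

theorem natDegree_symColumn_le (M : Matrix (Fin 2) (Fin 2) R) (k m : ℕ) :
    (colPoly M 0 ^ k * colPoly M 1 ^ m).natDegree ≤ k + m := by
  refine Polynomial.natDegree_mul_le_of_le ?_ ?_
  · simpa using Polynomial.natDegree_pow_le_of_le k (natDegree_colPoly_le M 0)
  · simpa using Polynomial.natDegree_pow_le_of_le m (natDegree_colPoly_le M 1)

/-- The homogenisation of degree `n` of `P`, at `(Y, Z)`. -/
def homog (Y Z : Polynomial R) (n : ℕ) (P : Polynomial R) : Polynomial R :=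
  ∑ l ∈ Finset.range (n + 1), Polynomial.C (P.coeff l) * (Y ^ (n - l) * Z ^ l)

theorem homog_colPoly_mul (Y Z : Polynomial R) (M : Matrix (Fin 2) (Fin 2) R) (i : Fin 2) {n : ℕ}
    {P : Polynomial R} (hP : P.natDegree ≤ n) :
    homog Y Z (n + 1) (colPoly M i * P) =
      (Polynomial.C (M 0 i) * Y + Polynomial.C (M 1 i) * Z) * homog Y Z n P := by
  have e : colPoly M i * P =
      Polynomial.C (M 0 i) * P + Polynomial.C (M 1 i) * (P * Polynomial.X) := by
    rw [colPoly]; ring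
  have h1 : homog Y Z (n + 1) P = Y * homog Y Z n P := by
    rw [homog, Finset.sum_range_succ, Polynomial.coeff_eq_zero_of_natDegree_lt (by omega), homog,
      Finset.mul_sum]
    simp only [map_zero, zero_mul, add_zero]
    refine Finset.sum_congr rfl fun l hl => ?_
    have hl := Finset.mem_range.1 hl
    rw [show n + 1 - l = n - l + 1 by omega]
    ring
  have h2 : homog Y Z (n + 1) (P * Polynomial.X) = Z * homog Y Z n P := by
    rw [homog, Finset.sum_range_succ', Polynomial.coeff_mul_X_zero, homog, Finset.mul_sum]
    simp only [map_zero, zero_mul, add_zero]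
    refine Finset.sum_congr rfl fun l hl => ?_
    rw [Polynomial.coeff_mul_X, show n + 1 - (l + 1) = n - l by omega]
    ring
  rw [add_mul, mul_assoc, mul_assoc, ← h1, ← h2, e]
  simp only [homog, Finset.mul_sum, ← Finset.sum_add_distrib]
  refine Finset.sum_congr rfl fun l _ => ?_
  rw [Polynomial.coeff_add, Polynomial.coeff_C_mul, Polynomial.coeff_C_mul, map_add, map_mul,
    map_mul]
  ring

theorem homog_symColumn (Y Z : Polynomial R) (M : Matrix (Fin 2) (Fin 2) R) (k m : ℕ) :
    homog Y Z (k + m) (colPoly M 0 ^ k * colPoly M 1 ^ m) =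
      (Polynomial.C (M 0 0) * Y + Polynomial.C (M 1 0) * Z) ^ k *
        (Polynomial.C (M 0 1) * Y + Polynomial.C (M 1 1) * Z) ^ m := by
  induction k with
  | zero =>
    induction m with
    | zero => simp [homog]
    | succ m ih =>
      have := homog_colPoly_mul Y Z M 1 (natDegree_symColumn_le M 0 m)
      rw [ih] at this
      rw [pow_zero, one_mul, pow_succ', show 0 + (m + 1) = 0 + m + 1 by ring]
      rw [pow_zero, one_mul] at this
      rw [this]
      ring
  | succ k ih =>
    rw [pow_succ', mul_assoc, show k + 1 + m = k + m + 1 by ring,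
      homog_colPoly_mul Y Z M 0 (natDegree_symColumn_le M k m), ih]
    ring

/-- Columns of Sym^k are homogeneous forms of degree k, and homogenisation is compatible with linear
substitution: the columns for MN arise by substituting those of M into the forms of N. -/
theorem symPower_mul (k : ℕ) (M N : Matrix (Fin 2) (Fin 2) R) :
    symPower k (M * N) = symPower k M * symPower k N := by
  have hcol : ∀ i, colPoly (M * N) i =
      Polynomial.C (N 0 i) * colPoly M 0 + Polynomial.C (N 1 i) * colPoly M 1 := fun i => by
    simp only [colPoly, Matrix.mul_apply, Fin.sum_univ_two, map_add, map_mul]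
    ring
  ext j m
  have hm : k - m + m = k := Nat.sub_add_cancel (Nat.lt_succ_iff.1 m.2)
  have h := homog_symColumn (colPoly M 0) (colPoly M 1) N (k - m) m
  rw [hm] at h
  rw [symPower, Matrix.of_apply, hcol, hcol, ← h, homog, Polynomial.finsetSum_coeff,
    Finset.sum_range, Matrix.mul_apply]
  refine Finset.sum_congr rfl fun l _ => ?_
  rw [Polynomial.coeff_C_mul, mul_comm]
  rfl

theorem symPower_one (k : ℕ) : symPower k (1 : Matrix (Fin 2) (Fin 2) R) = 1 := by
  ext j m
  simp [symPower, colPoly, Polynomial.coeff_X_pow, Matrix.one_apply, Fin.ext_iff]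

theorem symPower_map (φ : R →+* R') (k : ℕ) (M : Matrix (Fin 2) (Fin 2) R) :
    symPower k (M.map φ) = (symPower k M).map φ := by
  have hcol : ∀ i, colPoly (M.map φ) i = (colPoly M i).map φ := fun i => by simp [colPoly]
  ext j m
  rw [symPower, Matrix.of_apply, hcol, hcol, ← Polynomial.map_pow, ← Polynomial.map_pow,
    ← Polynomial.map_mul, Polynomial.coeff_map]
  rfl

/-- The vector (1, z) is an eigenvector for x, so a unipotent change of basis makes N triangular
with diagonal x, y. Then Sym^k is triangular with the monomials of degree k on its diagonal. -/
theorem trace_symPower {K : Type*} [Field K] (k : ℕ) (N : Matrix (Fin 2) (Fin 2) K) {x y : K}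
    (htr : N.trace = x + y) (hdet : N.det = x * y) (hne : x ≠ N 1 1) :
    (symPower k N).trace = ∑ m ∈ Finset.range (k + 1), x ^ (k - m) * y ^ m := by
  have hne' : x - N 1 1 ≠ 0 := sub_ne_zero.2 hne
  set z := N 1 0 / (x - N 1 1) with hz
  rw [Matrix.trace_fin_two] at htr
  rw [Matrix.det_fin_two] at hdet
  let P : Matrix (Fin 2) (Fin 2) K := !![1, 0; z, 1]
  let P' : Matrix (Fin 2) (Fin 2) K := !![1, 0; -z, 1]
  have hzc : z * (x - N 1 1) = N 1 0 := div_mul_cancel₀ _ hne'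
  have hPP : P' * P = 1 := by
    ext i j
    fin_cases i <;> fin_cases j <;> simp [P, P', Matrix.mul_apply, Fin.sum_univ_two]
  have hb : N 0 0 + N 0 1 * z = x := by
    refine mul_right_cancel₀ hne' ?_
    linear_combination N 0 1 * hzc - hdet + x * htr
  have hNP : N * P = P * !![x, N 0 1; 0, y] := by
    ext i j
    fin_cases i <;> fin_cases j <;> simp [P, Matrix.mul_apply, Fin.sum_univ_two]
    · exact hb
    · linear_combination -hzc
    · linear_combination htr - hb
  have hN : (symPower k N).trace = (symPower k !![x, N 0 1; 0, y]).trace := by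
    have h1 : N = P * !![x, N 0 1; 0, y] * P' := by
      rw [← hNP, mul_assoc, (mul_eq_one_comm.1 hPP), mul_one]
    conv_lhs => rw [h1]
    rw [symPower_mul, symPower_mul, Matrix.trace_mul_comm, ← mul_assoc, ← symPower_mul, hPP,
      symPower_one, one_mul]
  rw [hN, Matrix.trace, Finset.sum_range]
  refine Finset.sum_congr rfl fun m _ => ?_
  have h2 : colPoly !![x, N 0 1; 0, y] 0 = Polynomial.C x := by simp [colPoly]
  have h3 : (colPoly !![x, N 0 1; 0, y] 1 ^ (m : ℕ)).coeff m = y ^ (m : ℕ) := by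
    have := Polynomial.coeff_pow_of_natDegree_le
      (natDegree_colPoly_le !![x, N 0 1; 0, y] 1) (m := m)
    rw [mul_one] at this
    simpa [colPoly] using this
  rw [Matrix.diag_apply, symPower, Matrix.of_apply, h2, ← map_pow, Polynomial.coeff_C_mul, h3]

end SymPower

/-! ### Traces at natural weights -/

section NaturalWeight

variable {p : ℕ} [hp : Fact p.Prime] {K : Type*} [NormedField K] [IsUltrametricDist K]
  [NormedAlgebra ℚ_[p] K]

/-- `M(t^(q^r)) ⋯ M(t^q) M(t)`. -/
def frobIter (q : ℕ) (hq : q ≠ 0) (M : Matrix (Fin 2) (Fin 2) K⟦X⟧) :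
    ℕ → Matrix (Fin 2) (Fin 2) K⟦X⟧
  | 0 => M
  | r + 1 => (frobIter q hq M r).map (PowerSeries.expand q hq) * M

/-- This is Dwork's rule f ∘ ψ_q = ψ_q ∘ f(t^q) on coefficients; it collects a composite of
operators ψ_q ∘ f into a single one. -/
theorem sum_coeff_mul_coeff {q : ℕ} (hq : q ≠ 0) (f g : K⟦X⟧) (A n : ℕ) :
    (∑ i ∈ Finset.range (A + 1), coeff (A - i) f *
      if n ≤ q * i then coeff (q * i - n) g else 0) =
    if n ≤ q * A then coeff (q * A - n) (PowerSeries.expand q hq f * g) else 0 := by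
  have hmono : ∀ i ≤ A, q * i ≤ q * A := fun i hi => Nat.mul_le_mul_left q hi
  split_ifs with h
  · rw [coeff_mul]
    simp only [mul_ite, mul_zero]
    rw [← Finset.sum_filter]
    refine Finset.sum_of_injOn (fun i => (q * (A - i), q * i - n)) ?_ ?_ ?_ ?_
    · intro i hi i' hi' h
      simp only [Finset.coe_filter, Finset.mem_range, Set.mem_ofPred_eq, Prod.mk.injEq] at hi hi' h
      have := Nat.eq_of_mul_eq_mul_left (Nat.pos_of_ne_zero hq) h.1
      omega
    · intro i hi
      simp only [Finset.coe_filter, Finset.mem_range, Set.mem_ofPred_eq] at hi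
      have := hmono i (by omega)
      simp only [Finset.mem_coe, mem_antidiagonal, Nat.mul_sub]
      omega
    · rintro ⟨x, y⟩ hx hne
      have hx := mem_antidiagonal.1 hx
      rw [coeff_expand]
      split_ifs with hd
      · obtain ⟨i, rfl⟩ := hd
        have hi : i ≤ A := Nat.le_of_mul_le_mul_left (show q * i ≤ q * A by simp at hx; omega)
          (Nat.pos_of_ne_zero hq)
        have := hmono i hi
        refine absurd ⟨A - i, ?_, ?_⟩ hne
        · simp only [Finset.coe_filter, Finset.mem_range, Set.mem_ofPred_eq, Nat.mul_sub]
          simp at hx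
          omega
        · simp only [Nat.sub_sub_self hi, Prod.mk.injEq, true_and, Nat.mul_sub]
          simp at hx
          omega
      · rw [zero_mul]
    · intro i _
      rw [coeff_expand_mul]
  · refine Finset.sum_eq_zero fun i hi => ?_
    rw [if_neg, mul_zero]
    have := hmono i (by simpa [Nat.lt_succ_iff] using hi)
    omega

variable {M : Matrix (Fin 2) (Fin 2) K⟦X⟧} {q : ℕ}

theorem symEntry_eq_coeff (h1 : constantCoeff (M 0 0) = 1) {k m : ℕ} (h : m ≤ k) (n j : ℕ) :
    symEntry p M k n m j = coeff n ((colPoly M 0 ^ (k - m) * colPoly M 1 ^ m).coeff j) := by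
  rw [symEntry_natCast p h1 h, ← Polynomial.coeff_coe]
  simp [colPoly]

theorem symMatrix_natCast (h1 : constantCoeff (M 0 0) = 1) {k : ℕ} (N n : ℕ)
    (j m : Fin (k + 1)) : symMatrix p q M k (N, j) (n, m) =
      if n ≤ q * N then coeff (q * N - n) (symPower k M j m) else 0 := by
  rw [symMatrix, symEntry_eq_coeff h1 (Nat.lt_succ_iff.1 m.2)]
  rfl

/-- At the weight k the columns with m ≤ k are polynomials in w of degree at most k, so their span
is stable. -/
theorem symMatrix_eq_zero (h1 : constantCoeff (M 0 0) = 1) {k m j : ℕ} (hm : m ≤ k) (hj : k < j)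
    (N n : ℕ) : symMatrix p q M k (N, j) (n, m) = 0 := by
  rw [symMatrix, symEntry_eq_coeff h1 hm, Polynomial.coeff_eq_zero_of_natDegree_lt]
  · simp
  · have := natDegree_symColumn_le M (k - m) m
    rw [Nat.sub_add_cancel hm] at this
    exact this.trans_lt hj

variable [CompleteSpace K]

theorem matPow_symMatrix (h1 : constantCoeff (M 0 0) = 1) (hq : q ≠ 0) {k : ℕ} (r N n : ℕ)
    (j m : Fin (k + 1)) : matPow (symMatrix p q M k) r (N, j) (n, m) =
      if n ≤ q ^ (r + 1) * N then
        coeff (q ^ (r + 1) * N - n) (symPower k (frobIter q hq M r) j m) else 0 := by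
  induction r generalizing n m with
  | zero => rw [zero_add, pow_one]; exact symMatrix_natCast h1 N n j m
  | succ r ih =>
    change ∑' y : ℕ × ℕ, matPow (symMatrix p q M k) r (N, j) y * symMatrix p q M k y (n, m) = _
    have hm : (m : ℕ) ≤ k := Nat.lt_succ_iff.1 m.2
    rw [tsum_eq_sum (s := Finset.range (q ^ (r + 1) * N + 1) ×ˢ Finset.range (k + 1)),
      Finset.sum_product_right, Finset.sum_range]
    · have hM : symPower k (frobIter q hq M (r + 1)) =
          (symPower k (frobIter q hq M r)).map (PowerSeries.expand q hq) * symPower k M := by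
        rw [frobIter, symPower_mul]
        congr 1
        exact symPower_map (PowerSeries.expand q hq : K⟦X⟧ →ₐ[K] K⟦X⟧).toRingHom k _
      have e : q ^ (r + 1 + 1) * N = q * (q ^ (r + 1) * N) := by rw [pow_succ']; ring
      rw [hM, Matrix.mul_apply, e, map_sum]
      have hs : ∀ l : Fin (k + 1), ∑ x ∈ Finset.range (q ^ (r + 1) * N + 1),
          matPow (symMatrix p q M k) r (N, j) (x, l) * symMatrix p q M k (x, l) (n, m) =
          if n ≤ q * (q ^ (r + 1) * N) then coeff (q * (q ^ (r + 1) * N) - n)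
            ((symPower k (frobIter q hq M r)).map (PowerSeries.expand q hq) j l * symPower k M l m)
            else 0 := by
        intro l
        rw [Matrix.map_apply, ← sum_coeff_mul_coeff hq]
        refine Finset.sum_congr rfl fun x hx => ?_
        rw [ih, symMatrix_natCast h1, if_pos (by simpa [Nat.lt_succ_iff] using hx)]
      rw [Finset.sum_congr rfl fun l _ => hs l]
      split_ifs <;> simp
    · rintro ⟨x, l⟩ hx
      rw [Finset.mem_product, Finset.mem_range, Finset.mem_range, not_and_or, not_lt, not_lt] at hx
      rcases le_or_gt l k with hl | hl
      · have hx' : ¬ x ≤ q ^ (r + 1) * N := by omega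
        have := ih x ⟨l, Nat.lt_succ_iff.2 hl⟩
        rw [if_neg hx'] at this
        rw [this, zero_mul]
      · rw [symMatrix_eq_zero h1 hm hl, mul_zero]

/-- The diagonal entries with w-index at most k form the trace on Sym^k. The others contain at least
k + 1 factors β, and their sum tends to 0 as k grows. -/
theorem FrobBound.norm_matTr_sub_le {δ β : ℝ} (H : FrobBound M δ β) (hδ : δ < 1) (hβ : β < 1)
    (hq : 1 < q) (hq0 : q ≠ 0) (r k : ℕ) :
    ‖matTr (symMatrix p q M k) r -
      ∑' N, coeff ((q ^ (r + 1) - 1) * N) (symPower k (frobIter q hq0 M r)).trace‖ ≤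
        (∑' x : ℕ × ℕ, (δ ^ q) ^ x.1 * β ^ x.2 * (δ⁻¹) ^ x.1) ^ r * β ^ (k + 1) := by
  have hN := H.nuclear_symMatrix (p := p) hδ hβ hq (k : ℤ_[p])
  have h0 := H.pos
  have h0' := H.bot_pos
  set S := ∑' x : ℕ × ℕ, (δ ^ q) ^ x.1 * β ^ x.2 * (δ⁻¹) ^ x.1
  have hS : 0 ≤ S ^ r := pow_nonneg hN.trace_nonneg r
  have hb := fun x : ℕ × ℕ => hN.norm_matPow_le r x x
  have hd : Summable fun x : ℕ × ℕ => matPow (symMatrix p q M k) r x x :=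
    Summable.of_norm_bounded (hN.summable.mul_left (S ^ r)) hb
  have hd1 : Summable fun x : ℕ × ℕ =>
      if x.2 < k + 1 then matPow (symMatrix p q M k) r x x else 0 := by
    refine Summable.of_norm_bounded (hN.summable.mul_left (S ^ r)) fun x => ?_
    split_ifs
    · exact hb x
    · rw [norm_zero]
      exact mul_nonneg hS (mul_nonneg (hN.left x) (hN.right x))
  have h1 : ∑' N, coeff ((q ^ (r + 1) - 1) * N) (symPower k (frobIter q hq0 M r)).trace =
      ∑' x : ℕ × ℕ, if x.2 < k + 1 then matPow (symMatrix p q M k) r x x else 0 := by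
    rw [hd1.tsum_prod]
    refine tsum_congr fun N => ?_
    rw [tsum_eq_sum (s := Finset.range (k + 1))]
    · rw [Matrix.trace, map_sum, Finset.sum_range]
      refine Finset.sum_congr rfl fun j _ => ?_
      -- On the diagonal the index q^(r+1) N - n has n = N, whence the step q^(r+1) - 1.
      rw [if_pos j.2, matPow_symMatrix H.one hq0, if_pos (Nat.le_mul_of_pos_left _ (by positivity)),
        Nat.sub_mul, one_mul]
      rfl
    · intro j hj
      exact if_neg (by simpa using hj)
  rw [matTr, h1, ← hd.tsum_sub hd1]
  refine norm_tsum_le_of_le (by positivity) fun x => ?_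
  split_ifs with hx
  · rw [sub_self, norm_zero]; positivity
  · rw [sub_zero]
    refine (hb x).trans ?_
    gcongr
    rw [mul_right_comm, ← mul_pow]
    have h2 : δ ^ q * δ⁻¹ ≤ 1 := by
      rw [← div_eq_mul_inv, div_le_one H.pos]
      exact (pow_lt_self_of_lt_one₀ H.pos hδ hq).le
    exact (mul_le_of_le_one_left (by positivity) (pow_le_one₀ (by positivity) h2)).trans
      (pow_le_pow_of_le_one H.bot_pos.le hβ.le (not_lt.1 hx))

end NaturalWeight

/-! ### Evaluation at Teichmüller points -/

section TeichmullerSums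

variable {L : Type*} [NormedField L] [CompleteSpace L] {t : L}

/-- The ring of series with absolutely summable coefficients. -/
def wienerSubring (L : Type*) [NormedField L] [CompleteSpace L] : Subring L⟦X⟧ where
  carrier := {f | Wiener f}
  mul_mem' := Wiener.mul
  one_mem' := Wiener.one
  add_mem' := Wiener.add
  zero_mem' := by simpa using Wiener.C (0 : L)
  neg_mem' h := by simpa using (Wiener.C (-1 : L)).mul h

/-- Evaluation at `t` as a ring homomorphism. -/
def evHom (ht : ‖t‖ ≤ 1) : wienerSubring L →+* L where
  toFun f := ev t f.1
  map_zero' := by simpa using ev_C (t := t) (0 : L)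
  map_one' := ev_one
  map_add' f g := ev_add f.2 g.2 ht
  map_mul' f g := ev_mul f.2 g.2 ht

theorem ev_trace_symPower (ht : ‖t‖ ≤ 1) {N : Matrix (Fin 2) (Fin 2) L⟦X⟧}
    (hN : ∀ i k, Wiener (N i k)) (k : ℕ) : Wiener (symPower k N).trace ∧
      ev t (symPower k N).trace = (symPower k (N.map (ev t))).trace := by
  let N' : Matrix (Fin 2) (Fin 2) (wienerSubring L) := Matrix.of fun i k => ⟨N i k, hN i k⟩
  have h1 : (symPower k N).trace = ((symPower k N').trace : wienerSubring L).1 := by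
    have : N = N'.map (wienerSubring L).subtype := rfl
    rw [this, symPower_map]
    exact (AddMonoidHom.map_trace (wienerSubring L).subtype.toAddMonoidHom _).symm
  have h2 : N.map (ev t) = N'.map (evHom ht) := rfl
  rw [h1, h2, symPower_map]
  refine ⟨(symPower k N').trace.2, ?_⟩
  exact AddMonoidHom.map_trace (evHom ht).toAddMonoidHom (symPower k N')

variable {p : ℕ} [hp : Fact p.Prime] [IsUltrametricDist L] [NormedAlgebra ℚ_[p] L]
  [CharZero L] {k : Type*} [Field k] [CharP k p] {τ : k →* L} {E : Type*} [Field E] [Fintype E] [Fintype Eˣ]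

/-- Summing t^n over the Teichmüller lifts of a cyclic group of order |E| - 1 isolates the exponents
divisible by this order. -/
theorem sum_ev_teichmuller (hτ : IsTeichmuller τ) (ι : E →+* k) {f : L⟦X⟧} (hf : Wiener f) :
    ∑ x : Eˣ, ev (τ (ι x)) f =
      ((Fintype.card E - 1 : ℕ) : L) * ∑' N, coeff ((Fintype.card E - 1) * N) f := by
  have hE : Fintype.card E - 1 ≠ 0 := by have := Fintype.one_lt_card (α := E); omega
  have h1 := (hasSum_sum fun (x : Eˣ) (_ : x ∈ Finset.univ) =>
    hf.hasSum_ev (hτ.norm_le_one (ι x))).tsum_eq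
  rw [← h1, ← tsum_mul_left]
  have hinj : Function.Injective fun N : ℕ => (Fintype.card E - 1) * N := fun i i' h =>
    Nat.eq_of_mul_eq_mul_left (Nat.pos_of_ne_zero hE) h
  have h2 : ∀ n : ℕ, ∑ x : Eˣ, coeff n f * τ (ι x) ^ n =
      if (Fintype.card E - 1) ∣ n then ((Fintype.card E - 1 : ℕ) : L) * coeff n f else 0 := by
    intro n
    have := sum_teichmuller_zpow hτ ι (n : ℤ)
    simp only [zpow_natCast, Int.natCast_dvd_natCast] at this
    rw [← Finset.mul_sum, this]
    split_ifs
    · ring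
    · rw [mul_zero]
  rw [tsum_congr h2, ← hinj.tsum_eq]
  · refine tsum_congr fun N => ?_
    rw [if_pos (dvd_mul_right _ _)]
  · intro n hn
    by_contra h
    refine hn (if_neg ?_)
    rintro ⟨i, rfl⟩
    exact h ⟨i, rfl⟩

end TeichmullerSums

/-! ### Powers of `1`-units -/

section UnitPowers

variable {p : ℕ} [hp : Fact p.Prime] {K : Type*} [NormedField K] [IsUltrametricDist K]
  [NormedAlgebra ℚ_[p] K] [CompleteSpace K] {x y : K}

theorem exists_natCast_tendsto (κ : ℤ_[p]) : ∃ k : ℕ → ℕ,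
    Filter.Tendsto (fun i => (k i : ℤ_[p])) .atTop (nhds κ) ∧ Filter.Tendsto k .atTop .atTop := by
  -- Adding p^i does not disturb the p-adic approximation and forces the sequence to infinity.
  refine ⟨fun i => κ.appr i + p ^ i, ?_, ?_⟩
  · rw [tendsto_iff_norm_sub_tendsto_zero]
    refine squeeze_zero (fun _ => norm_nonneg _) (fun i => ?_)
      (tendsto_pow_atTop_nhds_zero_of_lt_one (r := (p : ℝ)⁻¹) (by positivity)
        (inv_lt_one_of_one_lt₀ (one_lt_cast p)))
    obtain ⟨y, hy⟩ := Ideal.mem_span_singleton'.1 (PadicInt.appr_spec i κ)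
    have : ((κ.appr i + p ^ i : ℕ) : ℤ_[p]) - κ = (p : ℤ_[p]) ^ i * (1 - y) := by
      push_cast
      linear_combination hy
    rw [this, norm_mul, norm_pow, PadicInt.norm_p]
    exact mul_le_of_le_one_right (by positivity) (PadicInt.norm_le_one _)
  · exact Filter.tendsto_atTop_mono (fun i => Nat.le_add_left _ _)
      (tendsto_pow_atTop_atTop_of_one_lt hp.out.one_lt)

theorem unitPow_natCast (x : K) (n : ℕ) : unitPow p x (n : ℤ_[p]) = x ^ n := by
  have hb : ∀ l, binom p K (n : ℤ_[p]) l = (n.choose l : K) := fun l => by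
    rw [binom, Ring.choose_natCast]; simp
  rw [unitPow, tsum_eq_sum (s := Finset.range (n + 1))]
  · conv_rhs => rw [show x = (x - 1) + 1 by ring, add_pow]
    refine Finset.sum_congr rfl fun l _ => ?_
    rw [hb, one_pow, mul_one, mul_comm]
  · intro l hl
    rw [hb, Nat.choose_eq_zero_of_lt (by simpa using hl), Nat.cast_zero, zero_mul]

theorem norm_unitPow_le (hx : ‖x - 1‖ < 1) (τ : ℤ_[p]) : ‖unitPow p x τ‖ ≤ 1 := by
  refine norm_tsum_le_of_le zero_le_one fun k => ?_
  rw [norm_mul, norm_pow]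
  exact mul_le_one₀ (norm_binom_le_one p _ _) (by positivity) (pow_le_one₀ (norm_nonneg _) hx.le)

theorem continuous_unitPow (hx : ‖x - 1‖ < 1) : Continuous (unitPow p x) := by
  have h1 : ∀ l, Continuous fun x : ℤ_[p] => binom p K x l := fun l =>
    (continuous_algebraMap ℚ_[p] K).comp
      (continuous_subtype_val.comp (PadicInt.continuous_choose l))
  refine continuous_tsum (fun l => (h1 l).mul continuous_const)
    (summable_geometric_of_lt_one (norm_nonneg (x - 1)) hx) fun l τ => ?_
  rw [norm_mul, norm_pow]
  exact mul_le_of_le_one_left (by positivity) (norm_binom_le_one p _ _)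

theorem norm_pow_sub_one_lt (hx : ‖x - 1‖ < 1) (m : ℕ) : ‖x ^ m - 1‖ < 1 := by
  induction m with
  | zero => simp
  | succ m ih => rw [pow_succ]; exact norm_mul_sub_one_lt ih hx

theorem unitPow_pow (hx : ‖x - 1‖ < 1) (m : ℕ) (τ : ℤ_[p]) :
    unitPow p (x ^ m) τ = unitPow p x τ ^ m := by
  refine DenseRange.induction_on PadicInt.denseRange_natCast τ
    (isClosed_eq (continuous_unitPow (norm_pow_sub_one_lt hx m))
      ((continuous_unitPow hx).pow m)) fun n => ?_
  rw [unitPow_natCast, unitPow_natCast, ← pow_mul, ← pow_mul, mul_comm]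

/-- As |x| = 1, the terms are dominated by |y|^m. Each of them is eventually `unitPow` at the
natural exponent k - m, which converges by continuity in the exponent. -/
theorem tendsto_sum_pow_mul_pow (hx : ‖x - 1‖ < 1) (hy : ‖y‖ < 1) {κ : ℤ_[p]} {k : ℕ → ℕ}
    (hk : Filter.Tendsto (fun i => (k i : ℤ_[p])) .atTop (nhds κ))
    (hk' : Filter.Tendsto k .atTop .atTop) :
    Filter.Tendsto (fun i => ∑ m ∈ Finset.range (k i + 1), x ^ (k i - m) * y ^ m) .atTop
      (nhds (∑' m : ℕ, unitPow p x (κ - (m : ℤ_[p])) * y ^ m)) := by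
  have hx1 := norm_eq_one_of_sub hx
  have h := tendsto_tsum_of_dominated_convergence (𝓕 := Filter.atTop)
    (f := fun i m => if m ∈ Finset.range (k i + 1) then x ^ (k i - m) * y ^ m else 0)
    (g := fun m => unitPow p x (κ - (m : ℤ_[p])) * y ^ m)
    (summable_geometric_of_lt_one (norm_nonneg y) hy) (fun m => ?_) (.of_forall fun i m => ?_)
  · refine h.congr fun i => ?_
    rw [tsum_eq_sum (s := Finset.range (k i + 1)) fun m hm => if_neg hm]
    exact Finset.sum_congr rfl fun m hm => if_pos hm
  · refine Filter.Tendsto.congr' ?_ ((((continuous_unitPow hx).tendsto _).comp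
      (hk.sub_const (m : ℤ_[p]))).mul_const (y ^ m))
    filter_upwards [hk'.eventually_ge_atTop m] with i hi
    rw [if_pos (by simpa [Nat.lt_succ_iff] using hi), Function.comp_apply, ← Nat.cast_sub hi,
      unitPow_natCast]
  · split_ifs
    · rw [norm_mul, norm_pow, norm_pow, hx1, one_pow, one_mul]
    · rw [norm_zero]; positivity

end UnitPowers

/-! ### The trace formula -/

section TraceFormula

theorem trace_pow_fin_two {R : Type*} [CommRing R] {N : Matrix (Fin 2) (Fin 2) R} {x y : R}
    (ht : N.trace = x + y) (hd : N.det = x * y) (m : ℕ) : (N ^ m).trace = x ^ m + y ^ m := by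
  induction m using Nat.twoStepInduction with
  | zero => simp; norm_num
  | one => simpa using ht
  | more m h1 h2 =>
    rw [trace_pow_add_two, h1, h2, ht, hd]
    ring

variable {F : Type*} [Field F] [Finite F]

theorem deg_dvd {n : ℕ} (hn : n ≠ 0) {t : (AlgebraicClosure F)ˣ}
    (ht : (t : AlgebraicClosure F) ∈ subExt F n) : deg F t ∣ n := by
  have h := IntermediateField.finrank_dvd_of_le_right
    (IntermediateField.adjoin_simple_le_iff.2 ht)
  rwa [finrank_subExt hn] at h

variable (F) in
/-- The points of `𝔾_m` over the extension of degree `n`. -/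
def points (n : ℕ) : Finset (AlgebraicClosure F)ˣ :=
  Set.Finite.toFinset (s := {t | n ≠ 0 ∧ (t : AlgebraicClosure F) ∈ subExt F n}) <| by
    rcases eq_or_ne n 0 with rfl | hn
    · simp
    · have := finite_subExt (F := F) hn
      refine Set.Finite.of_injOn (f := fun t : (AlgebraicClosure F)ˣ => (t : AlgebraicClosure F))
        (t := (subExt F n : Set (AlgebraicClosure F))) (fun t ht => ht.2)
        (fun t _ t' _ h => Units.ext h) (Set.toFinite _)

theorem mem_points {n : ℕ} (hn : n ≠ 0) {t : (AlgebraicClosure F)ˣ} :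
    t ∈ points F n ↔ (t : AlgebraicClosure F) ∈ subExt F n := by
  simp [points, hn]

variable {p : ℕ} [hp : Fact p.Prime] {K L : Type*} [NormedField K] [NormedField L]
  [NormedAlgebra ℚ_[p] K] [NormedAlgebra ℚ_[p] L] [CharZero K] [CharZero L]
  [IsUltrametricDist K] [IsUltrametricDist L] [CompleteSpace K] [CompleteSpace L]
  {a : ℕ} {π : K} {b b' : ℝ} {j : K →+* L}
  [CharP (AlgebraicClosure F) p] {τ : AlgebraicClosure F →* L} {ψ : AddChar F K} {c : F}

theorem ev_frobIter (hj : ∀ x, ‖j x‖ = ‖x‖) (H : Params p a π b b') (hq : p ^ a ≠ 0) (r : ℕ) {t : L}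
    (ht : ‖t‖ = 1) (i k : Fin 2) :
    Wiener (PowerSeries.map j (frobIter (p ^ a) hq (frobM p a b' b π) r i k)) ∧
      ev t (PowerSeries.map j (frobIter (p ^ a) hq (frobM p a b' b π) r i k)) =
        fibreM p (a * (r + 1)) (j π) t i k := by
  induction r generalizing t i k with
  | zero =>
    rw [zero_add, mul_one]
    exact ⟨wiener_frobM j hj H i k, (fibreM_eq_ev j hj H ht i k).symm⟩
  | succ r ih =>
    have hW := fun l => (ih ht i l).1.expand hq
    have ht' : ‖t ^ p ^ a‖ = 1 := by rw [norm_pow, ht, one_pow]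
    have e : PowerSeries.map j (frobIter (p ^ a) hq (frobM p a b' b π) (r + 1) i k) =
        ∑ l, PowerSeries.expand (p ^ a) hq
          (PowerSeries.map j (frobIter (p ^ a) hq (frobM p a b' b π) r i l)) *
          PowerSeries.map j (frobM p a b' b π l k) := by
      rw [frobIter, Matrix.mul_apply, map_sum]
      refine Finset.sum_congr rfl fun l _ => ?_
      rw [map_mul, Matrix.map_apply, PowerSeries.map_expand]
    have hprod := fun l => (hW l).mul (wiener_frobM j hj H l k)
    rw [e]
    refine ⟨Wiener.sum fun l _ => hprod l, ?_⟩
    rw [ev_sum (fun l _ => hprod l) ht.le, show a * (r + 1 + 1) = a + a * (r + 1) by ring,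
      fibreM_add H.five_le (H.map j) ht _ (mul_ne_zero H.a_ne r.succ_ne_zero), Matrix.mul_apply]
    refine Finset.sum_congr rfl fun l _ => ?_
    rw [ev_mul (hW l) (wiener_frobM j hj H l k) ht.le, ev_expand, (ih ht' i l).2,
      fibreM_eq_ev j hj H ht]

namespace KlData

theorem norm_klRoots_sub_one (D : KlData p a π b b' j τ ψ c) (t : (AlgebraicClosure F)ˣ) :
    ‖(klRoots ψ t).1 - 1‖ < 1 := by
  rw [norm_sub_rev]
  exact (D.isKlRoots_klRoots t).2

theorem trace_symPower_klM (D : KlData p a π b b' j τ ψ c) {n : ℕ} (hn : n ≠ 0)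
    {t : (AlgebraicClosure F)ˣ} (ht : (t : AlgebraicClosure F) ∈ subExt F n) (k : ℕ) :
    (symPower k (klM p a π j τ c n t)).trace =
      j (∑ m ∈ Finset.range (k + 1), ((klRoots ψ t).1 ^ (n / deg F t)) ^ (k - m) *
        ((klRoots ψ t).2 ^ (n / deg F t)) ^ m) := by
  have hr := D.isKlRoots_klRoots t
  obtain ⟨h1, h2, h3⟩ := (D.isKlRoots_iff t _).1 hr
  obtain ⟨h4, -⟩ := D.norm_root_lt hr
  have hd := deg_ne_zero t
  obtain ⟨m, rfl⟩ := deg_dvd hn ht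
  have hm : m ≠ 0 := by rintro rfl; simp at hn
  rw [Nat.mul_div_cancel_left _ (Nat.pos_of_ne_zero hd)]
  rw [map_add] at h1
  rw [map_mul] at h2
  have hU := D.isUnitRoot_klM t hn
  rw [D.klM_mul hd hm (mem_subExt_deg t)] at hU ⊢
  rw [trace_symPower k _ (trace_pow_fin_two h1.symm h2.symm m)
    (by rw [Matrix.det_pow, ← h2, mul_pow]), map_sum]
  · simp only [map_mul, map_pow]
  · intro h
    have := hU.one_one
    rw [← h, norm_pow, D.isometry, h4, one_pow] at this
    exact lt_irrefl _ this

theorem sum_points_ev (D : KlData p a π b b' j τ ψ c) {n : ℕ} (hn : n ≠ 0) {f : L⟦X⟧}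
    (hf : Wiener f) : ∑ t ∈ points F n, ev (τ (algebraMap F _ c ^ 2 * t)) f =
      (((p ^ a) ^ n - 1 : ℕ) : L) * ∑' N, coeff (((p ^ a) ^ n - 1) * N) f := by
  have := finite_subExt (F := F) hn
  have := Fintype.ofFinite (subExt F n)
  have := Fintype.ofFinite (subExt F n)ˣ
  have hcard : Fintype.card (subExt F n) = (p ^ a) ^ n := by
    rw [← Nat.card_eq_fintype_card, natCard_subExt hn, D.card]
  have h := sum_ev_teichmuller D.teich (algebraMap (subExt F n) (AlgebraicClosure F)) hf
  rw [hcard] at h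
  rw [← h]
  -- Multiplication by c² permutes the points over the extension of degree n, so the twist by c
  -- disappears from the sum.
  let cu : (subExt F n)ˣ := Units.mk0 (algebraMap F _ c ^ 2)
    (pow_ne_zero _ ((map_ne_zero _).2 D.c_ne))
  have hmem : ∀ t ∈ points F n, (t : AlgebraicClosure F) ∈ subExt F n := fun t ht =>
    (mem_points hn).1 ht
  refine Finset.sum_bij (fun t ht => cu * Units.mk0 (⟨t, hmem t ht⟩ : subExt F n) fun h0 =>
    t.ne_zero (congrArg Subtype.val h0)) (fun t ht => Finset.mem_univ _) ?_ ?_ ?_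
  · intro t ht t' ht' h
    have h1 := congrArg Units.val (mul_left_cancel h)
    exact Units.ext (congrArg Subtype.val h1)
  · intro x _
    let t : (AlgebraicClosure F)ˣ := Units.map
      (algebraMap (subExt F n) (AlgebraicClosure F)).toMonoidHom (cu⁻¹ * x)
    have ht : t ∈ points F n := (mem_points hn).2 ((cu⁻¹ * x : (subExt F n)ˣ) : subExt F n).2
    refine ⟨t, ht, ?_⟩
    have : Units.mk0 (⟨t, hmem t ht⟩ : subExt F n) (fun h0 =>
        t.ne_zero (congrArg Subtype.val h0)) = cu⁻¹ * x := Units.ext (Subtype.ext rfl)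
    rw [this, mul_inv_cancel_left]
  · intro t ht
    rfl

/-- The trace formula at a natural weight. -/
theorem tsum_coeff_trace (D : KlData p a π b b' j τ ψ c) (hq : p ^ a ≠ 0) (r k : ℕ) :
    (((p ^ a) ^ (r + 1) - 1 : ℕ) : K) * ∑' N, coeff (((p ^ a) ^ (r + 1) - 1) * N)
      (symPower k (frobIter (p ^ a) hq (frobM p a b' b π) r)).trace =
    ∑ t ∈ points F (r + 1), ∑ m ∈ Finset.range (k + 1),
      ((klRoots ψ t).1 ^ ((r + 1) / deg F t)) ^ (k - m) *
        ((klRoots ψ t).2 ^ ((r + 1) / deg F t)) ^ m := by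
  set N := frobIter (p ^ a) hq (frobM p a b' b π) r with hN
  have hW : ∀ i k, Wiener ((N.map (PowerSeries.map j)) i k) := fun i k =>
    (ev_frobIter D.isometry D.params hq r norm_one i k).1
  have htr : PowerSeries.map j (symPower k N).trace =
      (symPower k (N.map (PowerSeries.map j))).trace := by
    rw [symPower_map]
    exact AddMonoidHom.map_trace (PowerSeries.map j).toAddMonoidHom _
  have hf := (ev_trace_symPower (t := (1 : L)) norm_one.le hW k).1
  have h := D.sum_points_ev r.succ_ne_zero hf
  apply j.injective
  rw [map_mul, map_natCast, map_sum]
  have hcont : Continuous j := (AddMonoidHomClass.isometry_of_norm j D.isometry).continuous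
  have hsum : Summable fun n => coeff (((p ^ a) ^ (r + 1) - 1) * n) (symPower k N).trace := by
    have h1 : Summable fun n => coeff n (symPower k N).trace := by
      refine Summable.of_norm (hf.congr fun n => ?_)
      rw [← htr, coeff_map, D.isometry]
    refine h1.comp_injective fun i i' h => Nat.eq_of_mul_eq_mul_left ?_ h
    have := Nat.one_lt_pow (show r + 1 ≠ 0 by omega) (Nat.one_lt_pow D.params.a_ne hp.out.one_lt)
    omega
  have hj : j (∑' n, coeff (((p ^ a) ^ (r + 1) - 1) * n) (symPower k N).trace) =
      ∑' n, coeff (((p ^ a) ^ (r + 1) - 1) * n) (symPower k (N.map (PowerSeries.map j))).trace := by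
    rw [← (hsum.hasSum.map j hcont).tsum_eq, ← htr]
    rfl
  rw [hj, ← h]
  refine Finset.sum_congr rfl fun t ht => ?_
  have hz := D.norm_point t
  rw [← D.trace_symPower_klM r.succ_ne_zero ((mem_points r.succ_ne_zero).1 ht),
    (ev_trace_symPower hz.le hW k).2]
  congr 2
  ext i l
  exact (ev_frobIter D.isometry D.params hq r hz i l).2

/-- The trace formula. -/
theorem matTr_symMatrix (D : KlData p a π b b' j τ ψ c) (κ : ℤ_[p]) (r : ℕ) :
    (((p ^ a) ^ (r + 1) - 1 : ℕ) : K) * matTr (symMatrix p (p ^ a) (frobM p a b' b π) κ) r =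
    ∑ t ∈ points F (r + 1), ∑' m : ℕ, (unitPow p (klRoots ψ t).1 (κ - (m : ℤ_[p])) *
      (klRoots ψ t).2 ^ m) ^ ((r + 1) / deg F t) := by
  have H := D.params
  have hq : p ^ a ≠ 0 := pow_ne_zero _ hp.out.ne_zero
  -- Natural weights tending to κ in ℤ_p and to infinity in ℕ: the first makes the operators
  -- converge, the second removes the error outside Sym^k.
  obtain ⟨k, hk, hk'⟩ := exists_natCast_tendsto κ
  have hβ : ((p : ℝ) ^ b)⁻¹ < 1 :=
    inv_lt_one_of_one_lt₀ (Real.one_lt_rpow (one_lt_cast p)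
      (lt_trans (one_div_pos.2 (by linarith [one_lt_cast p])) H.lt_b))
  have h1 := (H.nuclear κ).tendsto_matTr (f := Filter.atTop) (fun i => H.nuclear (k i))
    (fun x y => by
      simp only [symMatrix]
      split_ifs
      · exact tendsto_symEntry p hk _ _ _
      · exact tendsto_const_nhds) r
  have h2 : Filter.Tendsto (fun i => ∑' N, coeff (((p ^ a) ^ (r + 1) - 1) * N)
      (symPower (k i) (frobIter (p ^ a) hq (frobM p a b' b π) r)).trace) .atTop
      (nhds (matTr (symMatrix p (p ^ a) (frobM p a b' b π) κ) r)) := by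
    refine Filter.Tendsto.congr_dist h1 (squeeze_zero
      (g := fun i => (∑' x : ℕ × ℕ, (decay p a b' ^ p ^ a) ^ x.1 * (((p : ℝ) ^ b)⁻¹) ^ x.2 *
        ((decay p a b')⁻¹) ^ x.1) ^ r * (((p : ℝ) ^ b)⁻¹) ^ (k i + 1))
      (fun _ => dist_nonneg) (fun i => ?_) ?_)
    · rw [dist_eq_norm]
      exact H.frobBound.norm_matTr_sub_le (decay_lt_one H) hβ
        (Nat.one_lt_pow H.a_ne hp.out.one_lt) hq r (k i)
    · have := ((tendsto_pow_atTop_nhds_zero_of_lt_one (by positivity) hβ).comp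
        ((Filter.tendsto_add_atTop_nat 1).comp hk')).const_mul ((∑' x : ℕ × ℕ,
          (decay p a b' ^ p ^ a) ^ x.1 * (((p : ℝ) ^ b)⁻¹) ^ x.2 * ((decay p a b')⁻¹) ^ x.1) ^ r)
      rwa [mul_zero] at this
  refine tendsto_nhds_unique (h2.const_mul _) (Filter.Tendsto.congr
    (fun i => (D.tsum_coeff_trace hq r (k i)).symm) (tendsto_finsetSum _ fun t ht => ?_))
  have hd : (r + 1) / deg F t ≠ 0 := by
    have h := deg_dvd r.succ_ne_zero ((mem_points r.succ_ne_zero).1 ht)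
    exact (Nat.div_pos (Nat.le_of_dvd r.succ_pos h) (Nat.pos_of_ne_zero (deg_ne_zero t))).ne'
  have hx := D.norm_klRoots_sub_one t
  have hy := (D.norm_root_lt (D.isKlRoots_klRoots t)).2
  have h3 := tendsto_sum_pow_mul_pow (norm_pow_sub_one_lt hx ((r + 1) / deg F t))
    (show ‖(klRoots ψ t).2 ^ ((r + 1) / deg F t)‖ < 1 by
      rw [norm_pow]; exact pow_lt_one₀ (norm_nonneg _) hy hd) hk hk'
  -- Raising to the power (r + 1) / deg commutes with the p-adic exponent, which identifies the
  -- limit with powers of the reciprocal Euler roots.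
  have h4 : ∀ m : ℕ, (unitPow p (klRoots ψ t).1 (κ - (m : ℤ_[p])) *
      (klRoots ψ t).2 ^ m) ^ ((r + 1) / deg F t) =
      unitPow p ((klRoots ψ t).1 ^ ((r + 1) / deg F t)) (κ - (m : ℤ_[p])) *
        ((klRoots ψ t).2 ^ ((r + 1) / deg F t)) ^ m := fun m => by
    rw [mul_pow, unitPow_pow hx, ← pow_mul, ← pow_mul, mul_comm m]
  simpa only [h4] using h3

end KlData

end TraceFormula

/-! ### Infinite products through logarithms -/

section LogProducts

variable {K : Type*} [Field K] [CharZero K]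

/-- `-log (1 - c T^d)`. -/
def logFactor (c : K) (d : ℕ) : K⟦X⟧ := PowerSeries.mk fun n =>
  if n ≠ 0 ∧ d ∣ n then (d : K) * c ^ (n / d) / (n : K) else 0

theorem constantCoeff_logFactor (c : K) (d : ℕ) : constantCoeff (logFactor c d) = 0 := by
  rw [← coeff_zero_eq_constantCoeff_apply, logFactor, coeff_mk, if_neg (by simp)]

theorem exp_neg_logFactor (c : K) {d : ℕ} (hd : d ≠ 0) :
    (exp K).subst (-logFactor c d) = 1 - C c * X ^ d := by
  symm
  apply eq_exp_subst
  · rw [map_neg, constantCoeff_logFactor, neg_zero]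
  · simp [hd]
  have hl : ∀ n, coeff n (derivative K (logFactor c d)) =
      if d ∣ n + 1 then (d : K) * c ^ ((n + 1) / d) else 0 := by
    intro n
    have : (n : K) + 1 ≠ 0 := by exact_mod_cast n.succ_ne_zero
    rw [coeff_derivative, logFactor, coeff_mk]
    by_cases h : d ∣ n + 1
    · rw [if_pos h, if_pos ⟨n.succ_ne_zero, h⟩]
      push_cast
      field_simp
    · rw [if_neg h, if_neg (fun h' => h h'.2), zero_mul]
  ext n
  have e : (1 - C c * X ^ d) * derivative K (-logFactor c d) =
      C c * (X ^ d * derivative K (logFactor c d)) - derivative K (logFactor c d) := by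
    rw [map_neg]; ring
  rw [e, coeff_derivative, map_sub (coeff (n + 1)), map_sub (coeff n), coeff_C_mul, coeff_C_mul,
    coeff_X_pow_mul', hl, hl, coeff_one, coeff_X_pow, if_neg n.succ_ne_zero]
  by_cases h1 : d ≤ n
  · have h2 : n - d + 1 = n + 1 - d := by omega
    rw [if_pos h1, h2, if_neg (by omega)]
    by_cases h3 : d ∣ n + 1
    · obtain ⟨m, hm⟩ := h3
      obtain ⟨m, rfl⟩ : ∃ m', m = m' + 1 := ⟨m - 1, by
        rcases m with _ | m
        · simp at hm
        · omega⟩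
      have h4 : n + 1 - d = d * m := by rw [hm, Nat.mul_succ]; omega
      rw [h4, hm, if_pos (dvd_mul_right _ _), if_pos (dvd_mul_right _ _),
        Nat.mul_div_cancel_left _ (Nat.pos_of_ne_zero hd),
        Nat.mul_div_cancel_left _ (Nat.pos_of_ne_zero hd)]
      ring
    · rw [if_neg h3, if_neg]
      · ring
      · intro h
        refine h3 ?_
        have := (Nat.dvd_add_iff_left (dvd_refl d)).1 h
        rwa [Nat.sub_add_cancel (by omega)] at this
  · rw [if_neg h1]
    by_cases h3 : n + 1 = d
    · rw [if_pos h3, if_pos (by rw [h3]), h3, Nat.div_self (Nat.pos_of_ne_zero hd), ← h3]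
      push_cast
      ring
    · rw [if_neg h3, if_neg fun h => h3 (le_antisymm (by omega) (Nat.le_of_dvd n.succ_pos h))]
      ring

theorem exp_logFactor (c : K) {d : ℕ} (hd : d ≠ 0) :
    (exp K).subst (logFactor c d) = (1 - C c * X ^ d)⁻¹ := by
  rw [PowerSeries.eq_inv_iff_mul_eq_one (by simp [hd]), ← exp_neg_logFactor c hd,
    ← exp_subst_add (constantCoeff_logFactor c d)
      (by rw [map_neg, constantCoeff_logFactor, neg_zero]), add_neg_cancel, exp_subst_zero]

theorem exp_subst_sum {ι : Type*} (s : Finset ι) {f : ι → K⟦X⟧}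
    (hf : ∀ i, constantCoeff (f i) = 0) :
    (exp K).subst (∑ i ∈ s, f i) = ∏ i ∈ s, (exp K).subst (f i) := by
  classical
  induction s using Finset.induction_on with
  | empty => simpa using exp_subst_zero
  | insert i s hi ih =>
    rw [Finset.sum_insert hi, Finset.prod_insert hi, exp_subst_add (hf i)
      (by rw [map_sum]; exact Finset.sum_eq_zero fun i _ => hf i), ih]

end LogProducts

/-! ### Convergent products as exponentials of convergent sums -/

section HasProdExp

variable {K : Type*} [NormedField K] [CharZero K]

theorem coeff_exp_subst {g : K⟦X⟧} (hg : constantCoeff g = 0) (n : ℕ) :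
    coeff n ((exp K).subst g) = ∑ d ∈ Finset.range (n + 1), coeff d (exp K) * coeff n (g ^ d) := by
  rw [coeff_subst' (HasSubst.of_constantCoeff_zero' hg), finsum_eq_sum_of_support_subset]
  · rfl
  · intro d hd
    by_contra h
    refine hd ?_
    have : coeff n (g ^ d) = 0 := coeff_of_lt_order _ <| lt_of_lt_of_le (by
      have : n < d := by simpa using h
      exact_mod_cast this) (le_order_pow_of_constantCoeff_eq_zero d hg)
    simp [this]

/-- A fixed coefficient of exp(g) is a polynomial in finitely many coefficients of g, so
coefficientwise convergence of the sum of logarithms passes to the product. -/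
theorem hasProd_exp_subst {ι : Type*} {f : ι → K⟦X⟧} {g : K⟦X⟧}
    (hf : ∀ i, constantCoeff (f i) = 0) (hg : HasSum f g) :
    HasProd (fun i => (exp K).subst (f i)) ((exp K).subst g) := by
  have hg0 : constantCoeff g = 0 := by
    have := (WithPiTopology.hasSum_iff_hasSum_coeff K).1 hg 0
    simp only [coeff_zero_eq_constantCoeff_apply, hf] at this
    exact this.unique hasSum_zero
  rw [HasProd, WithPiTopology.tendsto_iff_coeff_tendsto]
  intro n
  simp only [← exp_subst_sum _ hf]
  have h0 : ∀ s : Finset ι, constantCoeff (∑ i ∈ s, f i) = 0 := fun s => by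
    rw [map_sum]; exact Finset.sum_eq_zero fun i _ => hf i
  simp only [coeff_exp_subst (h0 _), coeff_exp_subst hg0]
  refine tendsto_finsetSum _ fun d _ => Filter.Tendsto.const_mul _ ?_
  exact ((WithPiTopology.continuous_coeff K n).tendsto _).comp (hg.pow d)

end HasProdExp

/-! ### The `L`-function -/

section EulerProduct

variable {F : Type*} [Field F] [Finite F]

theorem deg_eq_of_minpoly {t t' : (AlgebraicClosure F)ˣ}
    (h : minpoly F (t : AlgebraicClosure F) = minpoly F (t' : AlgebraicClosure F)) :
    deg F t = deg F t' := by
  rw [deg, deg, IntermediateField.adjoin.finrank (Algebra.IsIntegral.isIntegral _),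
    IntermediateField.adjoin.finrank (Algebra.IsIntegral.isIntegral _), h]

theorem mem_points_iff_deg_dvd {n : ℕ} (hn : n ≠ 0) {t : (AlgebraicClosure F)ˣ} :
    t ∈ points F n ↔ deg F t ∣ n := by
  refine ⟨fun h => deg_dvd hn ((mem_points hn).1 h), ?_⟩
  rintro ⟨m, rfl⟩
  exact (mem_points hn).2 (mem_subExt F t m)

theorem minpoly_out (t : (AlgebraicClosure F)ˣ) :
    minpoly F ((⟦t⟧ : ClosedPoint F).out : AlgebraicClosure F) =
      minpoly F (t : AlgebraicClosure F) :=
  Quotient.mk_out (s := Setoid.ker fun t : (AlgebraicClosure F)ˣ =>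
    minpoly F (t : AlgebraicClosure F)) t

open scoped Classical in
-- The geometric points above a closed point are the roots of its minimal polynomial, which is
-- separable over a finite field and has degree `deg`.
theorem card_points_fibre {n : ℕ} (hn : n ≠ 0) (P : ClosedPoint F) (hP : deg F P.out ∣ n) :
    ((points F n).filter fun t => (⟦t⟧ : ClosedPoint F) = P).card = deg F P.out := by
  set f := minpoly F (P.out : AlgebraicClosure F) with hf
  have hint : IsIntegral F (P.out : AlgebraicClosure F) := Algebra.IsIntegral.isIntegral _
  have hcard : (f.rootSet (AlgebraicClosure F)).toFinset.card = deg F P.out := by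
    rw [Set.toFinset_card, Polynomial.card_rootSet_eq_natDegree
      (Algebra.IsSeparable.isSeparable F (P.out : AlgebraicClosure F))
      (IsAlgClosed.splits _), deg, IntermediateField.adjoin.finrank hint]
  rw [← hcard, ← Finset.card_map ⟨fun t : (AlgebraicClosure F)ˣ => (t : AlgebraicClosure F),
    Units.val_injective⟩]
  congr 1
  ext x
  have hPeq : ∀ t : (AlgebraicClosure F)ˣ, (⟦t⟧ : ClosedPoint F) = P ↔
      minpoly F (t : AlgebraicClosure F) = f := fun t => by
    constructor
    · rintro rfl
      exact (minpoly_out t).symm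
    · intro h
      rw [← Quotient.out_eq P]
      exact Quotient.sound h
  rw [Finset.mem_map, Set.mem_toFinset, Polynomial.mem_rootSet]
  constructor
  · rintro ⟨t, ht, rfl⟩
    have h := (hPeq t).1 (Finset.mem_filter.1 ht).2
    refine ⟨minpoly.ne_zero hint, ?_⟩
    rw [← h]
    exact minpoly.aeval F _
  · rintro ⟨-, hx⟩
    have hmin : f = minpoly F x :=
      minpoly.eq_of_irreducible_of_monic (minpoly.irreducible hint) hx (minpoly.monic hint)
    have hx0 : x ≠ 0 := by
      rintro rfl
      rw [minpoly.zero] at hmin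
      have := minpoly.aeval F (P.out : AlgebraicClosure F)
      rw [← hf, hmin, Polynomial.aeval_X] at this
      exact P.out.ne_zero this
    refine ⟨Units.mk0 x hx0, Finset.mem_filter.2 ⟨?_, (hPeq _).2 hmin.symm⟩, rfl⟩
    rw [mem_points_iff_deg_dvd hn]
    rwa [deg_eq_of_minpoly (t := Units.mk0 x hx0) (t' := P.out) hmin.symm]

/-- Sums over points as sums over closed points. -/
theorem sum_points {K : Type*} [Field K] {n : ℕ} (hn : n ≠ 0) {G : (AlgebraicClosure F)ˣ → K}
    (hG : ∀ t t' : (AlgebraicClosure F)ˣ,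
      minpoly F (t : AlgebraicClosure F) = minpoly F (t' : AlgebraicClosure F) → G t = G t') :
    ∃ s : Finset (ClosedPoint F), (∀ P, P ∈ s ↔ deg F P.out ∣ n) ∧
      ∑ t ∈ points F n, G t = ∑ P ∈ s, (deg F P.out : K) * G P.out := by
  classical
  let s : Finset (ClosedPoint F) := (points F n).image fun t => ⟦t⟧
  have hs : ∀ P, P ∈ s ↔ deg F P.out ∣ n := by
    intro P
    rw [Finset.mem_image]
    constructor
    · rintro ⟨t, ht, rfl⟩
      rw [deg_eq_of_minpoly (minpoly_out t)]
      exact (mem_points_iff_deg_dvd hn).1 ht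
    · exact fun h => ⟨P.out, (mem_points_iff_deg_dvd hn).2 h, Quotient.out_eq P⟩
  refine ⟨s, hs, ?_⟩
  rw [← Finset.sum_fiberwise_of_maps_to (t := s) (g := fun t => (⟦t⟧ : ClosedPoint F))
    fun t ht => Finset.mem_image_of_mem _ ht]
  refine Finset.sum_congr rfl fun P hP => ?_
  rw [← card_points_fibre hn P ((hs P).1 hP), ← nsmul_eq_mul]
  refine Finset.sum_eq_card_nsmul fun t ht => hG _ _ ?_
  rw [← (Finset.mem_filter.1 ht).2, minpoly_out]

variable {p : ℕ} [hp : Fact p.Prime] {K L : Type*} [NormedField K] [NormedField L]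
  [NormedAlgebra ℚ_[p] K] [NormedAlgebra ℚ_[p] L] [CharZero K] [CharZero L]
  [IsUltrametricDist K] [IsUltrametricDist L] [CompleteSpace K] [CompleteSpace L]
  {a : ℕ} {π : K} {b b' : ℝ} {j : K →+* L}
  [CharP (AlgebraicClosure F) p] {τ : AlgebraicClosure F →* L} {ψ : AddChar F K} {c : F}

/-- The inverse root `π₀(t)^(κ - m) π₁(t)^m`. -/
def symRoot (p : ℕ) [Fact p.Prime] {K : Type*} [NormedField K] [NormedAlgebra ℚ_[p] K] [CharZero K]
    (ψ : AddChar F K) (κ : ℤ_[p]) (t : (AlgebraicClosure F)ˣ) (m : ℕ) : K :=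
  unitPow p (klRoots ψ t).1 (κ - (m : ℤ_[p])) * (klRoots ψ t).2 ^ m

namespace KlData

theorem summable_symRoot (D : KlData p a π b b' j τ ψ c) (κ : ℤ_[p]) (t : (AlgebraicClosure F)ˣ)
    {e : ℕ} (he : e ≠ 0) : Summable fun m => ‖symRoot p ψ κ t m ^ e‖ := by
  have hy := (D.norm_root_lt (D.isKlRoots_klRoots t)).2
  refine Summable.of_nonneg_of_le (fun _ => norm_nonneg _) (fun m => ?_)
    (summable_geometric_of_lt_one (norm_nonneg (klRoots ψ t).2) hy)
  have h1 : ‖symRoot p ψ κ t m‖ ≤ ‖(klRoots ψ t).2‖ ^ m := by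
    rw [symRoot, norm_mul, norm_pow]
    exact mul_le_of_le_one_left (by positivity) (norm_unitPow_le (D.norm_klRoots_sub_one t) _)
  rw [norm_pow]
  exact (pow_le_of_le_one (norm_nonneg _) (h1.trans (pow_le_one₀ (norm_nonneg _) hy.le)) he).trans h1

/-- The logarithm of the `L`-function. -/
theorem hasSum_logFactor (D : KlData p a π b b' j τ ψ c) (κ : ℤ_[p]) :
    HasSum (fun i : ClosedPoint F × ℕ => logFactor (symRoot p ψ κ i.1.out i.2) (deg F i.1.out))
      (PowerSeries.mk fun n => if n = 0 then 0 else
        (∑ t ∈ points F n, ∑' m, symRoot p ψ κ t m ^ (n / deg F t)) / (n : K)) := by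
  rw [WithPiTopology.hasSum_iff_hasSum_coeff]
  intro n
  simp only [logFactor, coeff_mk]
  rcases eq_or_ne n 0 with rfl | hn
  · simp
  simp only [hn, ne_eq, not_false_eq_true, true_and, if_false]
  obtain ⟨s, hs, hsum⟩ := sum_points (F := F) (K := K) hn
    (G := fun t => ∑' m, symRoot p ψ κ t m ^ (n / deg F t)) fun t t' h => by
      simp only [symRoot, klRoots_conj ψ h, deg_eq_of_minpoly h]
  have he : ∀ P : ClosedPoint F, deg F P.out ∣ n → n / deg F P.out ≠ 0 := fun P h =>
    (Nat.div_pos (Nat.le_of_dvd (Nat.pos_of_ne_zero hn) h)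
      (Nat.pos_of_ne_zero (deg_ne_zero P.out))).ne'
  set f : ClosedPoint F × ℕ → K := fun i => if deg F i.1.out ∣ n then
    (deg F i.1.out : K) * symRoot p ψ κ i.1.out i.2 ^ (n / deg F i.1.out) / (n : K) else 0 with hf
  have hfib : ∀ P, Summable fun m => ‖f (P, m)‖ := by
    intro P
    simp only [hf]
    split_ifs with h
    · refine ((D.summable_symRoot κ P.out (he P h)).mul_left
        (‖(deg F P.out : K)‖ / ‖(n : K)‖)).congr fun m => ?_
      rw [norm_div, norm_mul]
      ring
    · simp
  -- At a fixed power T^n only the finitely many closed points of degree dividing n matter, and over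
  -- each of them the terms decay geometrically in m.
  have hsumm : Summable f := by
    refine Summable.of_norm ((summable_prod_of_nonneg fun _ => norm_nonneg _).2 ⟨hfib, ?_⟩)
    refine summable_of_ne_finset_zero (s := s) fun P hP => ?_
    have : ¬ deg F P.out ∣ n := fun h => hP ((hs P).2 h)
    simp [hf, this]
  have := hsumm.hasSum
  rwa [hsumm.tsum_prod, tsum_eq_sum (s := s), show ∑ P ∈ s, ∑' m, f (P, m) =
    (∑ t ∈ points F n, ∑' m, symRoot p ψ κ t m ^ (n / deg F t)) / (n : K) from ?_] at this
  · rw [hsum, Finset.sum_div]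
    refine Finset.sum_congr rfl fun P hP => ?_
    simp only [hf, (hs P).1 hP, if_true]
    rw [tsum_div_const, tsum_mul_left]
  · intro P hP
    have : ¬ deg F P.out ∣ n := fun h => hP ((hs P).2 h)
    simp [hf, this]

theorem hasProd_eulerFactor (D : KlData p a π b b' j τ ψ c) (κ : ℤ_[p]) :
    HasProd (eulerFactor p ψ κ) ((exp K).subst (PowerSeries.mk fun n => if n = 0 then 0 else
        (∑ t ∈ points F n, ∑' m, symRoot p ψ κ t m ^ (n / deg F t)) / (n : K) : K⟦X⟧)) := by
  have h := hasProd_exp_subst (fun i => constantCoeff_logFactor _ _) (D.hasSum_logFactor κ)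
  convert h using 1
  funext i
  rw [exp_logFactor _ (deg_ne_zero _)]
  rfl

/-- `L(Sym^{∞,κ} Kl, T) = g(T) / g(qT)`. -/
theorem symL_eq (D : KlData p a π b b' j τ ψ c) (κ : ℤ_[p]) :
    symL p ψ κ = fredholmSeries (symMatrix p (p ^ a) (frobM p a b' b π) κ) *
      (PowerSeries.rescale ((p : K) ^ a)
        (fredholmSeries (symMatrix p (p ^ a) (frobM p a b' b π) κ)))⁻¹ := by
  set g := fredholmSeries (symMatrix p (p ^ a) (frobM p a b' b π) κ) with hg
  set T := matTr (symMatrix p (p ^ a) (frobM p a b' b π) κ) with hT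
  have hcg : constantCoeff g = 1 := Nuclear.constantCoeff_fredholmSeries _
  set h : K⟦X⟧ := PowerSeries.mk fun n => if n = 0 then 0 else -T (n - 1) / (n : K) with hh
  have h0 : constantCoeff h = 0 := by
    rw [← coeff_zero_eq_constantCoeff_apply, hh, coeff_mk, if_pos rfl]
  have hgh : g = (exp K).subst h := by
    refine eq_exp_subst h0 hcg ?_
    rw [hg, (D.params.nuclear κ).derivative_fredholmSeries, ← mul_neg]
    congr 1
    ext n
    have : (n : K) + 1 ≠ 0 := by exact_mod_cast n.succ_ne_zero
    rw [map_neg, coeff_mk, coeff_derivative, hh, coeff_mk, if_neg n.succ_ne_zero,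
      Nat.add_sub_cancel, ← hT]
    push_cast
    field_simp
  have hres : PowerSeries.rescale ((p : K) ^ a) g =
      (exp K).subst (PowerSeries.rescale ((p : K) ^ a) h) := by
    rw [hgh, rescale_exp_subst h0]
  rw [PowerSeries.eq_mul_inv_iff_mul_eq (by
    rw [← coeff_zero_eq_constantCoeff_apply, coeff_rescale, pow_zero, one_mul,
      coeff_zero_eq_constantCoeff_apply, hcg]
    exact one_ne_zero), symL, (D.hasProd_eulerFactor κ).tprod_eq, hres, hgh, ← exp_subst_add]
  · congr 1
    ext n
    rw [map_add, coeff_rescale, coeff_mk, hh, coeff_mk]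
    rcases n with _ | n
    · simp
    · have hn : ((n + 1 : ℕ) : K) ≠ 0 := by exact_mod_cast n.succ_ne_zero
      -- At T^n, with the index shifted by one since `matTr` starts at the first power, the trace
      -- formula supplies q^n - 1. The summand -1 matches g(T) and q^n matches g(qT).
      have ht := D.matTr_symMatrix κ n
      rw [if_neg n.succ_ne_zero, if_neg n.succ_ne_zero, Nat.add_sub_cancel]
      simp only [symRoot]
      rw [← ht, Nat.cast_sub (Nat.one_le_pow _ _ (Nat.pos_of_ne_zero
        (pow_ne_zero _ hp.out.ne_zero)))]
      push_cast at hn ⊢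
      field_simp
      ring
  · rw [← coeff_zero_eq_constantCoeff_apply, coeff_mk, if_pos rfl]
  · rw [← coeff_zero_eq_constantCoeff_apply, coeff_rescale, coeff_zero_eq_constantCoeff_apply, h0,
      mul_zero]

end KlData

end EulerProduct

end KloostermanSym

end

/-! ### The theorem -/

theorem theoremT
    (p : ℕ) [Fact p.Prime] (hp : 5 ≤ p)
    (π : PadicAlgCl p) (hπ : π ^ (p - 1) = -(p : PadicAlgCl p))
    (F : Type*) [Field F] [Finite F] (a : ℕ) (hF : Nat.card F = p ^ a)
    (ψ : AddChar F (KloostermanSym.Omega p π)) (hψ : ψ ≠ 1)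
    (b b' ε : ℝ)
    (hb : 1 / ((p : ℝ) - 1) < b)
    (hb₁ : b ≤ ((p : ℝ) - 1) / p - 1 / ((p : ℝ) - 1))
    (hb' : 0 < b') (hb'b : b' ≤ b)
    (hε : ε = b - 1 / ((p : ℝ) - 1))
    (κ : ℤ_[p]) :
    -- the roots `π₀(t)`, `π₁(t)` are well defined, and the Euler product converges
    (∀ t : (AlgebraicClosure F)ˣ, ∃! r, KloostermanSym.IsKlRoots ψ t r) ∧
    Multipliable (KloostermanSym.eulerFactor p ψ κ) ∧
    -- the relative Frobenius is well defined in the bases `1, π t / x` and `1, π t^q / x`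
    (∃! c, KloostermanSym.IsFrobCoords p a b' b (KloostermanSym.piOmega p π)
      KloostermanSym.serOne c) ∧
    (∃! c, KloostermanSym.IsFrobCoords p a b' b (KloostermanSym.piOmega p π)
      (KloostermanSym.serPiTX (KloostermanSym.piOmega p π)) c) ∧
    -- its infinite symmetric power `A` exists, `β = ψ_t^a ∘ A` is completely continuous, and
    -- `L(Sym^{∞,κ} Kl, T) = g(T) / g(qT)` for its Fredholm determinant `g`
    ∃ A : KloostermanSym.S p (KloostermanSym.Omega p π) b' ε →ₗ[KloostermanSym.Omega p π]
        KloostermanSym.S p (KloostermanSym.Omega p π) (b' / (p : ℝ) ^ a) ε,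
      KloostermanSym.IsSymFrob p a b' b ε (KloostermanSym.piOmega p π) κ A ∧
      KloostermanSym.IsCompletelyContinuous p (KloostermanSym.psiT p a b' ε ∘ₗ A) ∧
      KloostermanSym.HasFredholmDet p (KloostermanSym.psiT p a b' ε ∘ₗ A) ∧
      KloostermanSym.symL p ψ κ =
        KloostermanSym.fredholmDet p (KloostermanSym.psiT p a b' ε ∘ₗ A) *
          (PowerSeries.rescale ((p : KloostermanSym.Omega p π) ^ a)
            (KloostermanSym.fredholmDet p (KloostermanSym.psiT p a b' ε ∘ₗ A)))⁻¹ := by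
  have hK : CompleteSpace (KloostermanSym.Omega p π) := by
    have : FiniteDimensional ℚ_[p] (KloostermanSym.Omega p π) :=
      IntermediateField.adjoin.finiteDimensional (Algebra.IsIntegral.isIntegral π)
    exact FiniteDimensional.complete ℚ_[p] _
  have ha : a ≠ 0 := by
    rintro rfl
    have := KloostermanSym.one_lt_natCard (F := F)
    rw [hF, pow_zero] at this
    exact lt_irrefl _ this
  have hchar : CharP F p := by
    have := Fintype.ofFinite F
    obtain ⟨n, hr, hc⟩ := FiniteField.card F (ringChar F)
    rw [← Nat.card_eq_fintype_card, hF] at hc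
    have : ringChar F = p := by
      have h1 : ringChar F ∣ p ^ a := hc ▸ dvd_pow_self _ n.ne_zero
      exact (Nat.prime_dvd_prime_iff_eq hr Fact.out).1 (hr.dvd_of_dvd_pow h1)
    rw [← this]
    exact ringChar.charP F
  have hcharA : CharP (AlgebraicClosure F) p := charP_of_injective_algebraMap
    (algebraMap F (AlgebraicClosure F)).injective p
  have H : KloostermanSym.Params p a (KloostermanSym.piOmega p π) b b' :=
    { five_le := hp
      pi_pow := Subtype.ext hπ
      a_ne := ha
      lt_b := hb
      b_le := hb₁
      b'_pos := hb'
      b'_le := hb'b }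
  -- Teichmüller lifts of the whole algebraic closure of F require an algebraically closed field,
  -- and evaluation of series requires a complete one. The embedding is isometric, so bounds and
  -- identities descend to Ω.
  let j : KloostermanSym.Omega p π →+* ℂ_[p] :=
    (algebraMap (PadicAlgCl p) ℂ_[p]).comp (algebraMap (KloostermanSym.Omega p π) (PadicAlgCl p))
  have hj : ∀ x, ‖j x‖ = ‖x‖ := fun x => PadicComplex.norm_extends p x
  obtain ⟨τ, hτ, c, hc, hψc⟩ := KloostermanSym.exists_teichmuller_char (j := j) hp (H.map j) hF hψ
  have D : KloostermanSym.KlData p a (KloostermanSym.piOmega p π) b b' j τ ψ c :=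
    ⟨H, hj, hτ, hF, hc, hψc⟩
  refine ⟨D.existsUnique_isKlRoots, (D.hasProd_eulerFactor κ).multipliable, ?_, ?_,
    KloostermanSym.symFrob H hε κ, KloostermanSym.isSymFrob_symFrob H hε κ,
    KloostermanSym.isCompletelyContinuous_symFrob H hε κ,
    KloostermanSym.hasFredholmDet_symFrob H hε κ, ?_⟩
  · rw [KloostermanSym.serOne_eq]
    exact ⟨_, (KloostermanSym.frobColumn_spec H 0).1,
      fun c hc => KloostermanSym.isFrobCoords_unique H hc (KloostermanSym.frobColumn_spec H 0).1⟩
  · rw [KloostermanSym.serPiTX_eq]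
    exact ⟨_, (KloostermanSym.frobColumn_spec H 1).1,
      fun c hc => KloostermanSym.isFrobCoords_unique H hc (KloostermanSym.frobColumn_spec H 1).1⟩
  · rw [KloostermanSym.fredholmDet_symFrob]
    exact D.symL_eq κ
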